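/- Let $m\ge 0$ be an integer and let $Q:\mathbb R\to\mathbb C^{m\times m}$ be measurable, with $Q(x)=Q(x)^*$ for almost every $x$ and $\int_{-\infty}^{\infty}(1+|x|)\,\|Q(x)\|\,dx<\infty$. Consider the equation $$-Y''+Q(x)Y=\rho^2Y,\qquad x\in\mathbb R, \tag{1}$$ whose solutions are differentiable functions $Y$ with locally absolutely continuous $Y'$ satisfying (1) almost everywhere. Write $I$ for the unit matrix. *Jost solutions.* For $\operatorname{Im}\rho\ge0$, (1) has unique matrix solutions $F_\pm(x,\rho)$ with $e^{\mp i\rho x}F_\pm(x,\rho)\to I$ as $x\to\pm\infty$. *Scattering matrices.* For real $\rho\ne0$ there are unique matrices $A(\rho),B(\rho),C(\rho),D(\rho)$ such that for all $x$ $$F_+(x,\rho)=F_-(x,-\rho)A(\rho)+F_-(x,\rho)B(\rho),\qquad F_-(x,\rho)=F_+(x,\rho)C(\rho)+F_+(x,-\rho)D(\rho),$$ and $A(\rho)$, $D(\rho)$ are invertible. Put $S_-(\rho)=B(\rho)A(\rho)^{-1}$ and $S_+(\rho)=C(\rho)D(\rho)^{-1}$. The formulas $$A(\rho)=-\frac1{2i\rho}\Big(\tfrac{d}{dx}\bar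 F_-(x,\rho)\,F_+(x,\rho)-\bar F_-(x,\rho)\,\tfrac{d}{dx}F_+(x,\rho)\Big)\Big|_{x=0},\quad \bar F_-(x,\rho)=F_-(x,-\bar\rho)^*,\qquad D(\rho)=A(-\bar\rho)^*$$ extend $A$ and $D$ to functions that are continuous for $\operatorname{Im}\rho\ge0$, $\rho\neq0$, and analytic for $\operatorname{Im}\rho>0$. *Fourier transforms.* $S_\pm\in L_2(\mathbb R;\mathbb C^{m\times m})$, and the functions $$R_\pm(x)=\frac1{2\pi}\int_{-\infty}^{\infty}S_\pm(\rho)e^{\pm i\rho x}\,d\rho\in L_2(\mathbb R;\mathbb C^{m\times m})$$ (the integral being the limit in $L_2$ of the integrals over $(-T,T)$ as $T\to\infty$) have unique continuous representatives, again denoted by $R_\pm$. *Eigenvalues and weight matrices.* A number $\lambda=\rho^2\in\mathbb C$ is an eigenvalue if (1) has a nonzero vector solution in $L_2(\mathbb R;\mathbb C^m)$. The set of eigenvalues is finite, of the form $\{\rho_k^2\}_{k=1}^N$ with $\rho_k=i\tau_k$ and distinct $\tau_k>0$. The limits $R_k^-=\lim_{\rho\to\rho_k}(\rho-\rho_k)A(\rho)^{-1}$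 and $R_k^+=\lim_{\rho\to\rho_k}(\rho-\rho_k)D(\rho)^{-1}$ exist, and there are unique matrices $N_k^\pm$ with $$F_+(x,\rho_k)R_k^-=iF_-(x,\rho_k)N_k^-,\qquad F_-(x,\rho_k)R_k^+=iF_+(x,\rho_k)N_k^+\qquad\text{for all }x.$$ *Transformation operators.* There are kernels $K_+(x,t)$, continuous on $\{t\ge x\}$ with $K_+(x,\cdot)$ integrable on $(x,\infty)$ for every $x$, and $K_-(x,t)$, continuous on $\{t\le x\}$ with $K_-(x,\cdot)$ integrable on $(-\infty,x)$ for every $x$, such that for all $x\in\mathbb R$ and $\operatorname{Im}\rho\ge0$ $$F_+(x,\rho)=e^{i\rho x}I+\int_x^\infty K_+(x,t)e^{i\rho t}\,dt,\qquad F_-(x,\rho)=e^{-i\rho x}I+\int_{-\infty}^xK_-(x,t)e^{-i\rho t}\,dt. \tag{2}$$ **Theorem.** All objects above exist and are well defined as described. Let $$M_\pm(x)=R_\pm(x)+\sum_{k=1}^N N_k^\pm e^{\mp\tau_kx}.$$ Then any kernels $K_\pm$ as in (2) satisfy the Gelfand–Levitan–Marchenko equations: for every $x\in\mathbb R$, $$M_+(x+y)+K_+(x,y)+\int_x^\infty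 K_+(x,t)M_+(t+y)\,dt=0,\qquad y>x,$$ $$M_-(x+y)+K_-(x,y)+\int_{-\infty}^xK_-(x,t)M_-(t+y)\,dt=0,\qquad y<x,$$ the integrals being absolutely convergent. -/

import Mathlib

open scoped Matrix Matrix.Norms.L2Operator Topology
open MeasureTheory Filter Set

namespace MatrixScattering

noncomputable section

/-- Complex `m × m` matrices, with the operator norm induced by the Euclidean norm of `ℂ^m`. -/
abbrev Mat (m : ℕ) : Type := Matrix (Fin m) (Fin m) ℂ

/-- `y` is a (Carathéodory) solution of `-y'' + Q y = lam y` on the whole line: `y` is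
differentiable and `y'` is locally absolutely continuous with `y'' = Q y - lam y` almost
everywhere, i.e. `y'` is an indefinite integral of the (locally integrable) right-hand side. -/
def IsSolution {m : ℕ} (Q : ℝ → Mat m) (lam : ℂ) (y : ℝ → Fin m → ℂ) : Prop :=
  Differentiable ℝ y ∧
    ∀ a b : ℝ, deriv y b - deriv y a = ∫ t in a..b, (Q t *ᵥ y t - lam • y t)

/-- A matrix solution is a matrix function whose columns are solutions. -/
def IsMatrixSolution {m : ℕ} (Q : ℝ → Mat m) (lam : ℂ) (F : ℝ → Mat m) : Prop :=
  ∀ j : Fin m, IsSolution Q lam (fun x i => F x i j)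

/-- `F` is the Jost solution at `+∞`: a solution for `lam = ρ²` with
`exp(-iρx) F(x) → I` as `x → +∞`. -/
def IsJostPlus {m : ℕ} (Q : ℝ → Mat m) (ρ : ℂ) (F : ℝ → Mat m) : Prop :=
  IsMatrixSolution Q (ρ ^ 2) F ∧
    Tendsto (fun x : ℝ => Complex.exp (-(Complex.I * ρ * x)) • F x) atTop (𝓝 1)

/-- `F` is the Jost solution at `-∞`: a solution for `lam = ρ²` with
`exp(iρx) F(x) → I` as `x → -∞`. -/
def IsJostMinus {m : ℕ} (Q : ℝ → Mat m) (ρ : ℂ) (F : ℝ → Mat m) : Prop :=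
  IsMatrixSolution Q (ρ ^ 2) F ∧
    Tendsto (fun x : ℝ => Complex.exp (Complex.I * ρ * x) • F x) atBot (𝓝 1)

/-- The Jost solution `F₊(·, ρ)`, meaningful for `Im ρ ≥ 0`. -/
def jostPlus {m : ℕ} (Q : ℝ → Mat m) (ρ : ℂ) : ℝ → Mat m :=
  Classical.epsilon (IsJostPlus Q ρ)

/-- The Jost solution `F₋(·, ρ)`, meaningful for `Im ρ ≥ 0`. -/
def jostMinus {m : ℕ} (Q : ℝ → Mat m) (ρ : ℂ) : ℝ → Mat m :=
  Classical.epsilon (IsJostMinus Q ρ)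

/-- `P = (A, B)` satisfies `F₊(x,ρ) = F₋(x,-ρ) A + F₋(x,ρ) B` for all `x`. -/
def IsCoeffAB {m : ℕ} (Q : ℝ → Mat m) (ρ : ℝ) (P : Mat m × Mat m) : Prop :=
  ∀ x : ℝ, jostPlus Q ρ x = jostMinus Q (-ρ) x * P.1 + jostMinus Q ρ x * P.2

/-- `P = (C, D)` satisfies `F₋(x,ρ) = F₊(x,ρ) C + F₊(x,-ρ) D` for all `x`. -/
def IsCoeffCD {m : ℕ} (Q : ℝ → Mat m) (ρ : ℝ) (P : Mat m × Mat m) : Prop :=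
  ∀ x : ℝ, jostMinus Q ρ x = jostPlus Q ρ x * P.1 + jostPlus Q (-ρ) x * P.2

/-- The pair `(A(ρ), B(ρ))` for real `ρ ≠ 0`. -/
def coeffAB {m : ℕ} (Q : ℝ → Mat m) (ρ : ℝ) : Mat m × Mat m :=
  Classical.epsilon (IsCoeffAB Q ρ)

/-- The pair `(C(ρ), D(ρ))` for real `ρ ≠ 0`. -/
def coeffCD {m : ℕ} (Q : ℝ → Mat m) (ρ : ℝ) : Mat m × Mat m :=
  Classical.epsilon (IsCoeffCD Q ρ)

/-- The left scattering matrix `S₋(ρ) = B(ρ) A(ρ)⁻¹`, for real `ρ ≠ 0`. -/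
def scatMinus {m : ℕ} (Q : ℝ → Mat m) (ρ : ℝ) : Mat m :=
  (coeffAB Q ρ).2 * (coeffAB Q ρ).1⁻¹

/-- The right scattering matrix `S₊(ρ) = C(ρ) D(ρ)⁻¹`, for real `ρ ≠ 0`. -/
def scatPlus {m : ℕ} (Q : ℝ → Mat m) (ρ : ℝ) : Mat m :=
  (coeffCD Q ρ).1 * (coeffCD Q ρ).2⁻¹

/-- The matrix Wronskian `⟨Z, Y⟩ = Z' Y - Z Y'`. -/
def wronskian {m : ℕ} (Z Y : ℝ → Mat m) (x : ℝ) : Mat m :=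
  deriv Z x * Y x - Z x * deriv Y x

/-- The Jost solution `F₋(x, -ρ̄)^*` of the adjoint equation `-Z'' + Z Q = ρ² Z`. -/
def barJostMinus {m : ℕ} (Q : ℝ → Mat m) (ρ : ℂ) (x : ℝ) : Mat m :=
  (jostMinus Q (-(starRingEnd ℂ ρ)) x)ᴴ

/-- The continuation of `A` to `Im ρ ≥ 0`, `ρ ≠ 0`, by the formula
`A(ρ) = -(2iρ)⁻¹ ⟨F̄₋(x,ρ), F₊(x,ρ)⟩`; the Wronskian does not depend on the point `x`,
and is evaluated at `x = 0`. -/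
def contA {m : ℕ} (Q : ℝ → Mat m) (ρ : ℂ) : Mat m :=
  (-(1 / (2 * Complex.I * ρ))) • wronskian (barJostMinus Q ρ) (jostPlus Q ρ) 0

/-- The continuation of `D` to `Im ρ ≥ 0`, `ρ ≠ 0`: `D(ρ) = A(-ρ̄)^*`. -/
def contD {m : ℕ} (Q : ℝ → Mat m) (ρ : ℂ) : Mat m :=
  (contA Q (-(starRingEnd ℂ ρ)))ᴴ

/-- `lam` is an eigenvalue: there is a nonzero square-integrable vector solution. -/
def IsEigenvalue {m : ℕ} (Q : ℝ → Mat m) (lam : ℂ) : Prop :=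
  ∃ y : ℝ → Fin m → ℂ, IsSolution Q lam y ∧ y ≠ 0 ∧ MemLp y 2 volume

/-- `τ₁, …, τ_N > 0` are distinct and `ρ_k² = (iτ_k)² = -τ_k²` are exactly the eigenvalues. -/
def IsEigenvalueEnumeration {m : ℕ} (Q : ℝ → Mat m) {N : ℕ} (τ : Fin N → ℝ) : Prop :=
  Function.Injective τ ∧ (∀ k, 0 < τ k) ∧
    {lam : ℂ | IsEigenvalue Q lam} = range (fun k => (Complex.I * (τ k : ℂ)) ^ 2)

/-- `W` is the right weight matrix at `ρ₀ = iτ`: `F₋(x,ρ₀) Res = i F₊(x,ρ₀) W`, where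
`Res = lim (ρ - ρ₀) D(ρ)⁻¹` as `ρ → ρ₀`. -/
def IsWeightPlus {m : ℕ} (Q : ℝ → Mat m) (τ : ℝ) (W : Mat m) : Prop :=
  ∃ Res : Mat m,
    Tendsto (fun ρ : ℂ => (ρ - Complex.I * τ) • (contD Q ρ)⁻¹) (𝓝[≠] (Complex.I * τ)) (𝓝 Res) ∧
    ∀ x : ℝ, jostMinus Q (Complex.I * τ) x * Res =
      Complex.I • (jostPlus Q (Complex.I * τ) x * W)

/-- `W` is the left weight matrix at `ρ₀ = iτ`: `F₊(x,ρ₀) Res = i F₋(x,ρ₀) W`, where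
`Res = lim (ρ - ρ₀) A(ρ)⁻¹` as `ρ → ρ₀`. -/
def IsWeightMinus {m : ℕ} (Q : ℝ → Mat m) (τ : ℝ) (W : Mat m) : Prop :=
  ∃ Res : Mat m,
    Tendsto (fun ρ : ℂ => (ρ - Complex.I * τ) • (contA Q ρ)⁻¹) (𝓝[≠] (Complex.I * τ)) (𝓝 Res) ∧
    ∀ x : ℝ, jostPlus Q (Complex.I * τ) x * Res =
      Complex.I • (jostMinus Q (Complex.I * τ) x * W)

/-- The right weight matrix at `ρ₀ = iτ`. -/
def weightPlus {m : ℕ} (Q : ℝ → Mat m) (τ : ℝ) : Mat m :=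
  Classical.epsilon (IsWeightPlus Q τ)

/-- The left weight matrix at `ρ₀ = iτ`. -/
def weightMinus {m : ℕ} (Q : ℝ → Mat m) (τ : ℝ) : Mat m :=
  Classical.epsilon (IsWeightMinus Q τ)

/-- `R(x) = (2π)⁻¹ ∫ S(ρ) exp(iσρx) dρ` in the sense of `L²`: `S` and `R` are square integrable
and the integrals over `(-T, T)` converge to `R` in the norm of `L²` as `T → ∞`. -/
def IsL2Fourier {m : ℕ} (σ : ℝ) (S R : ℝ → Mat m) : Prop :=
  MemLp S 2 volume ∧ MemLp R 2 volume ∧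
    Tendsto (fun T : ℝ => eLpNorm (fun x : ℝ => R x - (1 / (2 * Real.pi) : ℂ) •
        ∫ ρ in (-T)..T, Complex.exp (Complex.I * σ * ρ * x) • S ρ) 2 volume)
      atTop (𝓝 0)

/-- `R` is the continuous representative of `R₊(x) = (2π)⁻¹ ∫ S₊(ρ) exp(iρx) dρ`. -/
def IsRPlus {m : ℕ} (Q : ℝ → Mat m) (R : ℝ → Mat m) : Prop :=
  Continuous R ∧ IsL2Fourier 1 (scatPlus Q) R

/-- `R` is the continuous representative of `R₋(x) = (2π)⁻¹ ∫ S₋(ρ) exp(-iρx) dρ`. -/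
def IsRMinus {m : ℕ} (Q : ℝ → Mat m) (R : ℝ → Mat m) : Prop :=
  Continuous R ∧ IsL2Fourier (-1) (scatMinus Q) R

/-- The function `R₊`. -/
def RPlus {m : ℕ} (Q : ℝ → Mat m) : ℝ → Mat m :=
  Classical.epsilon (IsRPlus Q)

/-- The function `R₋`. -/
def RMinus {m : ℕ} (Q : ℝ → Mat m) : ℝ → Mat m :=
  Classical.epsilon (IsRMinus Q)

/-- `M₊(x) = R₊(x) + ∑ₖ exp(-τₖ x) Nₖ⁺`. -/
def MPlus {m : ℕ} (Q : ℝ → Mat m) {N : ℕ} (τ : Fin N → ℝ) (x : ℝ) : Mat m :=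
  RPlus Q x + ∑ k, Real.exp (-(τ k * x)) • weightPlus Q (τ k)

/-- `M₋(x) = R₋(x) + ∑ₖ exp(τₖ x) Nₖ⁻`. -/
def MMinus {m : ℕ} (Q : ℝ → Mat m) {N : ℕ} (τ : Fin N → ℝ) (x : ℝ) : Mat m :=
  RMinus Q x + ∑ k, Real.exp (τ k * x) • weightMinus Q (τ k)

/-- `K` is the kernel (on `x ≤ t`) of the transformation operator of `F₊`: it is continuous,
integrable in `t`, and `F₊(x,ρ) = exp(iρx) I + ∫_x^∞ K(x,t) exp(iρt) dt` for `Im ρ ≥ 0`. -/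
def IsKernelPlus {m : ℕ} (Q : ℝ → Mat m) (K : ℝ → ℝ → Mat m) : Prop :=
  ContinuousOn (fun p : ℝ × ℝ => K p.1 p.2) {p | p.1 ≤ p.2} ∧
  (∀ x : ℝ, IntegrableOn (K x) (Ioi x)) ∧
  ∀ ρ : ℂ, 0 ≤ ρ.im → ∀ x : ℝ, jostPlus Q ρ x =
    Complex.exp (Complex.I * ρ * x) • (1 : Mat m) +
      ∫ t in Ioi x, Complex.exp (Complex.I * ρ * t) • K x t

/-- `K` is the kernel (on `t ≤ x`) of the transformation operator of `F₋`: it is continuous,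
integrable in `t`, and `F₋(x,ρ) = exp(-iρx) I + ∫_{-∞}^x K(x,t) exp(-iρt) dt` for `Im ρ ≥ 0`. -/
def IsKernelMinus {m : ℕ} (Q : ℝ → Mat m) (K : ℝ → ℝ → Mat m) : Prop :=
  ContinuousOn (fun p : ℝ × ℝ => K p.1 p.2) {p | p.2 ≤ p.1} ∧
  (∀ x : ℝ, IntegrableOn (K x) (Iio x)) ∧
  ∀ ρ : ℂ, 0 ≤ ρ.im → ∀ x : ℝ, jostMinus Q ρ x =
    Complex.exp (-(Complex.I * ρ * x)) • (1 : Mat m) +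
      ∫ t in Iio x, Complex.exp (-(Complex.I * ρ * t)) • K x t

end

end MatrixScattering

set_option linter.unusedSectionVars false

/-! Reflection `x ↦ -x` exchanges the two ends of the line, `A` with `D` and `S₋` with `S₊`, so only
`F₊`, `D`, `S₊` need be studied. In the variable `z = (t - x)/2` the transformation kernel satisfies
a Volterra equation without `ρ`, solved by contraction in a weighted sup norm
(`Majorant.exists_kernel`). Its Fourier transform is an integral equation for `e^{-iρx} F₊`
(`IsJostKernel.jostF_eq`), which yields the Jost solution for all `Im ρ ≥ 0`, its holomorphy in `ρ`
and the `1/ρ` asymptotics. Solutions are identified through the Wronskian with `F₊(x,-ρ̄)^*`: it is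
constant because `Q` is selfadjoint, and when it vanishes the solution is `F₊ a`
(`IsJostKernel.eq_mul_of_wr_eq_zero`).

The function `W(ρ) = 2iρ D(ρ)` is `jostWr`. On the real line `D^*D = I + C^*C` makes `D⁻¹` and `S₊`
contractions. Off the axes a flux argument gives `|Re ρ| ‖v‖ ≤ K ‖W(ρ)v‖` on bounded sets
(`Pot.exists_jostWr_lower`), so `W` is singular only on the imaginary axis, exactly where `ρ²` is an
eigenvalue. A maximum principle argument improves `|Re ρ|` to the distance from a point
(`norm_mul_le_of_re_mul_norm_le`). Hence the poles of `D⁻¹` are simple and `D⁻¹` is bounded near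
`0`, once it is known that eigenvalues do not accumulate there; that follows from orthogonality of
eigenfunctions and compactness (`Pot.exists_isUnit_near_zero`).

For the integral equation, write `F₋(x,ρ) D(ρ)⁻¹ = F₊(x,ρ) S₊(ρ) + F₊(x,-ρ)` for real `ρ ≠ 0`. After
multiplication by `e^{iρx}` and subtraction of `I` and of the poles, the left side extends
holomorphically to the upper half-plane, is bounded near `0` and is `O(1/ρ)`, so by Jordan's lemma
its inverse Fourier integral at `y - x > 0` vanishes. On the right, inserting the kernel
representation of `F₊` produces `R₊(x+y)`, the integral of `K₊` against `R₊`, `K₊(x,y)` and the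
contribution of the poles, which is the sum over the weight matrices. At first `R₊` is only an `L²`
limit and the equation holds almost everywhere (`Pot.ae_glm`). All its other terms are continuous in
`y`, so the equation itself supplies the continuous representative of `R₊` and then holds for all `y
> x`. -/

namespace MatrixScattering

noncomputable section

/-! ### Tail integrals of functions with finite first moment -/

section

section Tail

/-- The tail integral `∫_x^∞ p`. -/
def tail (p : ℝ → ℝ) (x : ℝ) : ℝ := ∫ t in Ioi x, p t

variable {p : ℝ → ℝ}

lemma continuous_integral_Ioi {E : Type*} [NormedAddCommGroup E] [NormedSpace ℝ E] {q : ℝ → E}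
    (hq : ∀ x, IntegrableOn q (Ioi x)) : Continuous fun x => ∫ t in Ioi x, q t := by
  have hloc : ∀ a b, IntervalIntegrable q volume a b := fun a b => by
    rw [intervalIntegrable_iff]
    exact (hq (min a b)).mono_set fun t ht => ht.1
  have : (fun x => ∫ t in Ioi x, q t) = fun x => (∫ t in Ioi 0, q t) - ∫ t in (0:ℝ)..x, q t := by
    ext x
    rw [← intervalIntegral.integral_Ioi_sub_Ioi' (hq 0) (hq x)]
    abel
  rw [this]
  exact continuous_const.sub (intervalIntegral.continuous_primitive hloc 0)

lemma tendsto_integral_Ioi_atTop {E : Type*} [NormedAddCommGroup E] [NormedSpace ℝ E] {q : ℝ → E}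
    : Tendsto (fun x => ∫ t in Ioi x, q t) atTop (𝓝 0) := by
  exact tendsto_integral_Ioi_zero (μ := volume) tendsto_id

lemma tail_antitone (hp : ∀ x, IntegrableOn p (Ioi x)) (h0 : ∀ t, 0 ≤ p t) : Antitone (tail p) := by
  intro a b hab
  exact setIntegral_mono_set (hp a) (ae_of_all _ h0) (Ioi_subset_Ioi hab).eventuallyLE

lemma tail_nonneg (h0 : ∀ t, 0 ≤ p t) (x : ℝ) : 0 ≤ tail p x :=
  integral_nonneg h0

lemma tail_pos (hp : ∀ x, IntegrableOn p (Ioi x)) (h0 : ∀ t, 0 < p t) (x : ℝ) : 0 < tail p x := by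
  rw [tail, setIntegral_pos_iff_support_of_nonneg_ae (ae_of_all _ fun t => (h0 t).le) (hp x)]
  have : Function.support p = univ := by ext t; simp [(h0 t).ne']
  simp [this]

/-- Fubini: the double integral of `p` over `x < s < t` equals `∫ (t - x)⁺ p(t) dt`, which is where
the first moment is needed. -/
lemma integrableOn_tail (hp : Integrable p) (hp1 : Integrable fun t => |t| * p t)
    (x : ℝ) : IntegrableOn (tail p) (Ioi x) := by
  have hmeas : AEStronglyMeasurable (fun z : ℝ × ℝ => (Ioi z.1).indicator p z.2)
      ((volume.restrict (Ioi x)).prod volume) := by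
    have : (fun z : ℝ × ℝ => (Ioi z.1).indicator p z.2) =
        {z : ℝ × ℝ | z.1 < z.2}.indicator fun z => p z.2 := by
      ext z; simp [indicator]
    rw [this]
    exact hp.aestronglyMeasurable.comp_snd.indicator (measurableSet_lt measurable_fst measurable_snd)
  have key : Integrable (fun z : ℝ × ℝ => (Ioi z.1).indicator p z.2)
      ((volume.restrict (Ioi x)).prod volume) := by
    rw [integrable_prod_iff' hmeas]
    have hint : ∀ t : ℝ, (fun s : ℝ => (Ioi s).indicator p t) = (Iio t).indicator fun _ => p t := by
      intro t; ext s; simp [indicator]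
    refine ⟨ae_of_all _ fun t => ?_, ?_⟩
    · simp only [hint]
      rw [integrable_indicator_iff measurableSet_Iio]
      refine integrableOn_const (by
        rw [Measure.restrict_apply measurableSet_Iio, Iio_inter_Ioi]
        simp) 
    · have : ∀ t : ℝ, ∫ s in Ioi x, ‖(Ioi s).indicator p t‖ = (max (t - x) 0) * ‖p t‖ := by
        intro t
        have h2 : (fun s : ℝ => ‖(Ioi s).indicator p t‖) = (Iio t).indicator fun _ => ‖p t‖ := by
          ext s; by_cases h : s < t <;> simp [indicator, h]
        simp only [h2]
        rw [integral_indicator measurableSet_Iio, Measure.restrict_restrict measurableSet_Iio,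
          Iio_inter_Ioi]
        simp [Measure.real, ENNReal.toReal_ofReal']
      simp only [this]
      refine Integrable.mono' (g := fun t => |t| * ‖p t‖ + |x| * ‖p t‖) ?_ ?_ (ae_of_all _ fun t => ?_)
      · refine Integrable.add ?_ (hp.norm.const_mul _)
        refine hp1.norm.congr (ae_of_all _ fun t => ?_)
        simp
      · exact ((measurable_id.sub_const x).max measurable_const).aestronglyMeasurable.mul
          hp.aestronglyMeasurable.norm
      · rw [norm_mul, norm_norm, ← add_mul]
        gcongr
        rw [Real.norm_eq_abs, abs_of_nonneg (le_max_right _ _)]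
        refine max_le ?_ (by positivity)
        have := neg_abs_le x
        have := le_abs_self t
        linarith
  have h3 := key.integral_prod_left
  refine h3.congr (ae_of_all _ fun s => ?_)
  simp only [tail]
  rw [integral_indicator measurableSet_Ioi]

end Tail

end

/-! ### The transformation kernel as a fixed point -/

section

section Kernel

variable {E : Type*} [NormedRing E] [NormedAlgebra ℂ E]

/-- A strictly positive majorant of the potential with finite first moment. -/
structure Majorant (Q : ℝ → E) (p : ℝ → ℝ) : Prop where
  meas : AEStronglyMeasurable Q volume
  pos : ∀ t, 0 < p t
  le : ∀ t, ‖Q t‖ ≤ p t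
  int : Integrable p
  int1 : Integrable fun t => |t| * p t

lemma aestronglyMeasurable_of_weighted {Q : ℝ → E}
    (hQ : Integrable fun x : ℝ => (1 + |x|) • Q x) : AEStronglyMeasurable Q volume := by
  have h1 : AEStronglyMeasurable (fun x : ℝ => (1 + |x|)⁻¹) volume :=
    ((measurable_const.add measurable_abs).inv).aestronglyMeasurable
  refine (h1.smul hQ.aestronglyMeasurable).congr (ae_of_all _ fun x => ?_)
  have : (1 + |x|) ≠ 0 := by positivity
  simp only [smul_smul, Pi.smul_apply']
  rw [inv_mul_cancel₀ this, one_smul]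

lemma exists_majorant {Q : ℝ → E} (hQ : Integrable fun x : ℝ => (1 + |x|) • Q x) :
    ∃ p, Majorant Q p := by
  have hm := aestronglyMeasurable_of_weighted hQ
  have e : Integrable fun t : ℝ => Real.exp (-1 * t ^ 2) := integrable_exp_neg_mul_sq one_pos
  have e1 : Integrable fun t : ℝ => t * Real.exp (-1 * t ^ 2) := integrable_mul_exp_neg_mul_sq one_pos
  have hnorm : ∀ x : ℝ, ‖(1 + |x|) • Q x‖ = (1 + |x|) * ‖Q x‖ := fun x => by
    rw [norm_smul, Real.norm_eq_abs, abs_of_pos (by positivity)]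
  -- The Gaussian keeps the majorant strictly positive where `Q` vanishes, so that the tail, and
  -- with it the kernel weight, may be divided by.
  refine ⟨fun t => ‖Q t‖ + Real.exp (-1 * t ^ 2), hm, fun t => by positivity, fun t => ?_, ?_, ?_⟩
  · have := Real.exp_pos (-1 * t ^ 2); linarith
  · refine Integrable.add (hQ.norm.mono' hm.norm (ae_of_all _ fun t => ?_)) e
    rw [hnorm, norm_norm]
    nlinarith [abs_nonneg t, norm_nonneg (Q t)]
  · simp only [mul_add]
    refine Integrable.add (hQ.norm.mono' ?_ (ae_of_all _ fun t => ?_)) ?_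
    · exact measurable_abs.aestronglyMeasurable.mul hm.norm
    · rw [hnorm, norm_mul, norm_norm, Real.norm_eq_abs, abs_abs]
      nlinarith [abs_nonneg t, norm_nonneg (Q t)]
    · refine e1.norm.congr (ae_of_all _ fun t => ?_)
      simp

/-- The exponential weight `exp (2 ∫_x^∞ ∫_s^∞ p)`. -/
def expWeight (p : ℝ → ℝ) (x : ℝ) : ℝ := Real.exp (2 * tail (tail p) x)

/-- The weight bounding the transformation kernel. -/
def kernelWeight (p : ℝ → ℝ) (x z : ℝ) : ℝ := tail p (x + max z 0) * expWeight p x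

namespace Majorant

variable {Q : ℝ → E} {p : ℝ → ℝ} (h : Majorant Q p)
include h

lemma integrableOn (x : ℝ) : IntegrableOn p (Ioi x) := h.int.integrableOn

lemma integrableQ : Integrable Q := h.int.mono' h.meas (ae_of_all _ h.le)

lemma tail_pos (x : ℝ) : 0 < tail p x := MatrixScattering.tail_pos h.integrableOn h.pos x

lemma tail_antitone : Antitone (tail p) :=
  MatrixScattering.tail_antitone h.integrableOn fun t => (h.pos t).le

lemma continuous_tail : Continuous (tail p) := continuous_integral_Ioi h.integrableOn

lemma integrableOn_tail (x : ℝ) : IntegrableOn (tail p) (Ioi x) :=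
  MatrixScattering.integrableOn_tail h.int h.int1 x

lemma tail2_nonneg (x : ℝ) : 0 ≤ tail (tail p) x := tail_nonneg (fun t => (h.tail_pos t).le) x

lemma tail2_antitone : Antitone (tail (tail p)) :=
  MatrixScattering.tail_antitone h.integrableOn_tail fun t => (h.tail_pos t).le

lemma hasDerivAt_tail2 (x : ℝ) : HasDerivAt (tail (tail p)) (-tail p x) x := by
  have : tail (tail p) = fun x => tail (tail p) 0 - ∫ t in (0:ℝ)..x, tail p t := by
    ext x
    rw [tail, tail, ← intervalIntegral.integral_Ioi_sub_Ioi' (h.integrableOn_tail 0)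
      (h.integrableOn_tail x)]
    abel
  rw [this]
  exact (intervalIntegral.integral_hasDerivAt_right (h.continuous_tail.intervalIntegrable _ _)
    (h.continuous_tail.stronglyMeasurableAtFilter _ _) h.continuous_tail.continuousAt).const_sub _

lemma hasDerivAt_expWeight (x : ℝ) :
    HasDerivAt (expWeight p) (-2 * (tail p x * expWeight p x)) x := by
  refine ((h.hasDerivAt_tail2 x).const_mul 2).exp.congr_deriv ?_
  simp only [expWeight]; ring

lemma continuous_expWeight : Continuous (expWeight p) :=
  continuous_iff_continuousAt.2 fun x => (h.hasDerivAt_expWeight x).continuousAt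

lemma expWeight_antitone : Antitone (expWeight p) := fun a b hab => by
  have := h.tail2_antitone hab
  unfold expWeight; gcongr

lemma one_le_expWeight (x : ℝ) : 1 ≤ expWeight p x :=
  Real.one_le_exp (by have := h.tail2_nonneg x; positivity)

/-- The integrand is the exact derivative of `-expWeight p / 2`. The factor 2 in the exponent of the
weight is thus the source of the contraction constant 1/2. -/
lemma integral_tail_mul_expWeight_le (x y : ℝ) :
    ∫ t in x..y, tail p t * expWeight p t ≤ expWeight p x / 2 := by
  have hc : Continuous fun t => tail p t * expWeight p t := h.continuous_tail.mul h.continuous_expWeight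
  have h1 : ∫ t in x..y, tail p t * expWeight p t =
      (-1 / 2) * expWeight p y - (-1 / 2) * expWeight p x := by
    refine intervalIntegral.integral_eq_sub_of_hasDerivAt (f := fun t => (-1 / 2) * expWeight p t)
      (fun t _ => ?_) (hc.intervalIntegrable _ _)
    exact ((h.hasDerivAt_expWeight t).const_mul (-1 / 2)).congr_deriv (by ring)
  have := h.one_le_expWeight y
  rw [h1]; linarith

lemma kernelWeight_pos (x z : ℝ) : 0 < kernelWeight p x z :=
  mul_pos (h.tail_pos _) (Real.exp_pos _)

lemma continuous_kernelWeight : Continuous fun q : ℝ × ℝ => kernelWeight p q.1 q.2 :=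
  (h.continuous_tail.comp (continuous_fst.add (continuous_snd.max continuous_const))).mul
    (h.continuous_expWeight.comp continuous_fst)

end Majorant

/-- The inner integral `∫_r^∞ Q(t) β(t,w) dt` of the kernel equation. -/
def innerInt (Q : ℝ → E) (β : ℝ × ℝ → E) (r w : ℝ) : E := ∫ t in Ioi r, Q t * β (t, w)

/-- The Volterra operator of the kernel equation. -/
def volterra (Q : ℝ → E) (β : ℝ × ℝ → E) (q : ℝ × ℝ) : E :=
  ∫ w in (0:ℝ)..max q.2 0, innerInt Q β (q.1 + max q.2 0 - w) w

variable {Q : ℝ → E} {p : ℝ → ℝ} (h : Majorant Q p) {β : ℝ × ℝ → E} {C : ℝ}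

/-- For fixed `w` the weight is antitone in its first argument, so its value at the end `r` controls
the whole ray. -/
lemma Majorant.norm_mul_le (h : Majorant Q p) (hC : 0 ≤ C)
    (hβC : ∀ x z, ‖β (x, z)‖ ≤ C * kernelWeight p x z) {r t : ℝ} (w : ℝ) (hrt : r ≤ t) :
    ‖Q t * β (t, w)‖ ≤ p t * (C * kernelWeight p r w) := by
  refine (_root_.norm_mul_le _ _).trans
    (mul_le_mul (h.le t) ((hβC t w).trans ?_) (norm_nonneg _) (h.pos t).le)
  refine mul_le_mul_of_nonneg_left ?_ hC
  exact mul_le_mul (h.tail_antitone (by linarith)) (h.expWeight_antitone hrt)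
    (Real.exp_pos _).le (h.tail_pos _).le

lemma Majorant.integrableOn_mul (h : Majorant Q p) (hC : 0 ≤ C) (hβ : Continuous β)
    (hβC : ∀ x z, ‖β (x, z)‖ ≤ C * kernelWeight p x z) (r w : ℝ) :
    IntegrableOn (fun t => Q t * β (t, w)) (Ioi r) := by
  refine Integrable.mono' ((h.integrableOn r).mul_const (C * kernelWeight p r w)) ?_ ?_
  · exact (h.meas.mul (hβ.comp (by fun_prop)).aestronglyMeasurable).restrict
  · filter_upwards [ae_restrict_mem measurableSet_Ioi] with t ht
    exact h.norm_mul_le hC hβC w (le_of_lt ht)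

lemma Majorant.norm_innerInt_le (h : Majorant Q p) (hC : 0 ≤ C)
    (hβC : ∀ x z, ‖β (x, z)‖ ≤ C * kernelWeight p x z) (r w : ℝ) :
    ‖innerInt Q β r w‖ ≤ tail p r * (C * kernelWeight p r w) := by
  rw [innerInt, tail, ← integral_mul_const]
  refine norm_integral_le_of_norm_le ((h.integrableOn r).mul_const _) ?_
  filter_upwards [ae_restrict_mem measurableSet_Ioi] with t ht
  exact h.norm_mul_le hC hβC w (le_of_lt ht)

/-- Dominated convergence: the indicator of the moving ray is discontinuous in `r` only at `t = r`,
a null set. -/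
lemma Majorant.continuous_innerInt (h : Majorant Q p) (hC : 0 ≤ C) (hβ : Continuous β)
    (hβC : ∀ x z, ‖β (x, z)‖ ≤ C * kernelWeight p x z) :
    Continuous (Function.uncurry (innerInt Q β)) := by
  have heq : Function.uncurry (innerInt Q β) =
      fun q : ℝ × ℝ => ∫ t, (Ioi q.1).indicator (fun t => Q t * β (t, q.2)) t := by
    ext q; rw [integral_indicator measurableSet_Ioi]; rfl
  rw [heq, continuous_iff_continuousAt]
  rintro ⟨r, w⟩
  have hK : ∀ᶠ q : ℝ × ℝ in 𝓝 (r, w), kernelWeight p (r - 1) q.2 < kernelWeight p (r - 1) w + 1 :=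
    ((h.continuous_kernelWeight.comp
      (continuous_const.prodMk continuous_snd)).tendsto (r, w)).eventually
      (gt_mem_nhds (by simp))
  have hr : ∀ᶠ q : ℝ × ℝ in 𝓝 (r, w), r - 1 < q.1 :=
    (continuous_fst.tendsto (r, w)).eventually (lt_mem_nhds (by simp))
  refine continuousAt_of_dominated
    (bound := fun t => p t * (C * (kernelWeight p (r - 1) w + 1))) ?_ ?_ ?_ ?_
  · exact Eventually.of_forall fun q =>
      (h.meas.mul (hβ.comp (by fun_prop)).aestronglyMeasurable).indicator measurableSet_Ioi
  · filter_upwards [hK, hr] with q hq1 hq2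
    refine ae_of_all _ fun t => ?_
    have hnn : 0 ≤ p t * (C * (kernelWeight p (r - 1) w + 1)) :=
      mul_nonneg (h.pos t).le (mul_nonneg hC (by have := h.kernelWeight_pos (r - 1) w; linarith))
    by_cases ht : t ∈ Ioi q.1
    · rw [indicator_of_mem ht]
      refine (h.norm_mul_le hC hβC q.2 (hq2.le.trans (le_of_lt ht))).trans ?_
      exact mul_le_mul_of_nonneg_left (mul_le_mul_of_nonneg_left hq1.le hC) (h.pos t).le
    · rw [indicator_of_notMem ht, norm_zero]; exact hnn
  · exact h.int.mul_const _
  · have : ∀ᵐ t : ℝ, t ≠ r := by simp [ae_iff]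
    filter_upwards [this] with t ht
    rcases lt_or_gt_of_ne ht with hlt | hgt
    · have : (fun q : ℝ × ℝ => (Ioi q.1).indicator (fun t => Q t * β (t, q.2)) t)
          =ᶠ[𝓝 (r, w)] fun _ => 0 := by
        filter_upwards [(continuous_fst.tendsto (r, w)).eventually (lt_mem_nhds hlt)] with q hq
        exact indicator_of_notMem (by simpa using hq.le) _
      exact continuousAt_const.congr this.symm
    · have : (fun q : ℝ × ℝ => (Ioi q.1).indicator (fun t => Q t * β (t, q.2)) t)
          =ᶠ[𝓝 (r, w)] fun q => Q t * β (t, q.2) := by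
        filter_upwards [(continuous_fst.tendsto (r, w)).eventually (gt_mem_nhds hgt)] with q hq
        exact indicator_of_mem (by simpa using hq) _
      refine ContinuousAt.congr ?_ this.symm
      fun_prop

lemma Majorant.continuous_volterra (h : Majorant Q p) (hC : 0 ≤ C) (hβ : Continuous β)
    (hβC : ∀ x z, ‖β (x, z)‖ ≤ C * kernelWeight p x z) : Continuous (volterra Q β) := by
  have hc := h.continuous_innerInt hC hβ hβC
  refine intervalIntegral.continuous_parametric_intervalIntegral_of_continuous
    (f := fun (q : ℝ × ℝ) w => innerInt Q β (q.1 + max q.2 0 - w) w) ?_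
    (continuous_snd.max continuous_const)
  exact hc.comp (f := fun r : (ℝ × ℝ) × ℝ => (r.1.1 + max r.1.2 0 - r.2, r.2)) (by fun_prop)

/-- On the inner ray starting at `r = x + z - w` one has `r + w = x + z`, so the factor `tail p (x +
z)` does not depend on `w` and comes out; what remains is the exact derivative integrated above. -/
lemma Majorant.norm_volterra_le (h : Majorant Q p) (hC : 0 ≤ C)
    (hβC : ∀ x z, ‖β (x, z)‖ ≤ C * kernelWeight p x z) (x z : ℝ) :
    ‖volterra Q β (x, z)‖ ≤ (C / 2) * kernelWeight p x z := by
  set y := max z 0 with hy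
  have hy0 : 0 ≤ y := le_max_right _ _
  have hcont : Continuous fun t => tail p t * expWeight p t :=
    h.continuous_tail.mul h.continuous_expWeight
  have h1 : ‖volterra Q β (x, z)‖ ≤
      ∫ w in (0:ℝ)..y, C * tail p (x + y) * (tail p (x + y - w) * expWeight p (x + y - w)) := by
    refine intervalIntegral.norm_integral_le_of_norm_le hy0 (ae_of_all _ fun w hw => ?_) ?_
    · refine (h.norm_innerInt_le hC hβC _ _).trans (le_of_eq ?_)
      rw [kernelWeight, max_eq_left hw.1.le]
      simp only [← hy]
      rw [show x + y - w + w = x + y by ring]; ring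
    · exact (continuous_const.mul (hcont.comp (by fun_prop))).intervalIntegrable _ _
  refine h1.trans ?_
  rw [intervalIntegral.integral_const_mul, intervalIntegral.integral_comp_sub_left
    (fun t => tail p t * expWeight p t) (x + y), kernelWeight, ← hy]
  have := h.integral_tail_mul_expWeight_le (x + y - y) (x + y - 0)
  rw [show x + y - y = x by ring, sub_zero] at this ⊢
  have h3 : 0 ≤ C * tail p (x + y) := mul_nonneg hC (h.tail_pos _).le
  calc _ ≤ C * tail p (x + y) * (expWeight p x / 2) := mul_le_mul_of_nonneg_left this h3
    _ = _ := by ring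

lemma Majorant.volterra_sub (h : Majorant Q p) {β' : ℝ × ℝ → E} (hC : 0 ≤ C) (hβ : Continuous β)
    (hβC : ∀ x z, ‖β (x, z)‖ ≤ C * kernelWeight p x z) (hβ' : Continuous β')
    (hβC' : ∀ x z, ‖β' (x, z)‖ ≤ C * kernelWeight p x z) (q : ℝ × ℝ) :
    volterra Q (fun q => β q - β' q) q = volterra Q β q - volterra Q β' q := by
  have hc := h.continuous_innerInt hC hβ hβC
  have hc' := h.continuous_innerInt hC hβ' hβC'
  rw [volterra, volterra, volterra, ← intervalIntegral.integral_sub]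
  · congr 1; ext w
    simp only [innerInt]
    rw [← integral_sub (h.integrableOn_mul hC hβ hβC _ _) (h.integrableOn_mul hC hβ' hβC' _ _)]
    simp only [mul_sub]
  · exact (hc.comp (f := fun w : ℝ => (q.1 + max q.2 0 - w, w)) (by fun_prop)).intervalIntegrable _ _
  · exact (hc'.comp (f := fun w : ℝ => (q.1 + max q.2 0 - w, w)) (by fun_prop)).intervalIntegrable _ _

open BoundedContinuousFunction in
/-- Existence of the transformation kernel in the variables `x`, `z = (t - x) / 2`. -/
theorem Majorant.exists_kernel [CompleteSpace E] (h : Majorant Q p) :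
    ∃ (B : ℝ × ℝ → E) (C : ℝ), 0 ≤ C ∧ Continuous B ∧
      (∀ x z, ‖B (x, z)‖ ≤ C * kernelWeight p x z) ∧
      ∀ x z, 0 ≤ z → B (x, z) = (∫ t in Ioi (x + z), Q t) +
        ∫ w in (0:ℝ)..z, innerInt Q B (x + z - w) w := by
  let ω : ℝ × ℝ → ℝ := fun q => kernelWeight p q.1 q.2
  have hω : Continuous ω := h.continuous_kernelWeight
  have hω0 : ∀ q, 0 < ω q := fun q => h.kernelWeight_pos _ _
  -- Replacing `z` by `max z 0` here, in the weight and in the operator makes the whole plane the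
  -- domain; the equation is only claimed for `0 ≤ z`.
  let G : ℝ × ℝ → E := fun q => ∫ t in Ioi (q.1 + max q.2 0), Q t
  have hG : Continuous G := (continuous_integral_Ioi fun x => h.integrableQ.integrableOn).comp
    (continuous_fst.add (continuous_snd.max continuous_const))
  have hGb : ∀ q, ‖G q‖ ≤ ω q := fun q => by
    have h1 : ‖G q‖ ≤ tail p (q.1 + max q.2 0) :=
      norm_integral_le_of_norm_le (h.integrableOn _) (ae_of_all _ h.le)
    exact h1.trans (le_mul_of_one_le_right (h.tail_pos _).le (h.one_le_expWeight _))
  have hb : ∀ b : ℝ × ℝ →ᵇ E, ∀ x z, ‖ω (x, z) • b (x, z)‖ ≤ ‖b‖ * kernelWeight p x z := by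
    intro b x z
    rw [norm_smul, Real.norm_of_nonneg (hω0 _).le, mul_comm]
    exact mul_le_mul_of_nonneg_right (b.norm_coe_le_norm _) (hω0 _).le
  have hbc : ∀ b : ℝ × ℝ →ᵇ E, Continuous fun q => ω q • b q := fun b => hω.smul b.continuous
  -- The kernel is sought as `ω b` with `b` bounded and continuous; division by `ω` turns the
  -- Volterra operator into a contraction with constant 1/2.
  let V : (ℝ × ℝ →ᵇ E) → ℝ × ℝ → E := fun b q => (ω q)⁻¹ • (G q + volterra Q (fun q => ω q • b q) q)
  have hVc : ∀ b, Continuous (V b) := fun b =>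
    (hω.inv₀ fun q => (hω0 q).ne').smul
      (hG.add (h.continuous_volterra (norm_nonneg b) (hbc b) (hb b)))
  have hVb : ∀ b q, ‖V b q‖ ≤ 1 + ‖b‖ / 2 := by
    rintro b ⟨x, z⟩
    rw [norm_smul, norm_inv, Real.norm_of_nonneg (hω0 _).le, inv_mul_le_iff₀ (hω0 _)]
    refine (norm_add_le _ _).trans ((add_le_add (hGb _)
      (h.norm_volterra_le (norm_nonneg b) (hb b) x z)).trans (le_of_eq ?_))
    simp only [ω]; ring
  let S : (ℝ × ℝ →ᵇ E) → (ℝ × ℝ →ᵇ E) := fun b => ofNormedAddCommGroup (V b) (hVc b) _ (hVb b)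
  have hS : ContractingWith (1 / 2) S := by
    refine ⟨by rw [← NNReal.coe_lt_coe]; norm_num, LipschitzWith.of_dist_le_mul fun b b' => ?_⟩
    rw [dist_le (by positivity)]
    rintro ⟨x, z⟩
    have hm : ∀ x z, ‖ω (x, z) • b (x, z)‖ ≤ (max ‖b‖ ‖b'‖) * kernelWeight p x z := fun x z =>
      (hb b x z).trans (mul_le_mul_of_nonneg_right (le_max_left _ _) (hω0 (x, z)).le)
    have hm' : ∀ x z, ‖ω (x, z) • b' (x, z)‖ ≤ (max ‖b‖ ‖b'‖) * kernelWeight p x z := fun x z =>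
      (hb b' x z).trans (mul_le_mul_of_nonneg_right (le_max_right _ _) (hω0 (x, z)).le)
    have hsub : V b (x, z) - V b' (x, z) =
        (ω (x, z))⁻¹ • volterra Q (fun q => ω q • (b - b') q) (x, z) := by
      simp only [V, ← smul_sub]
      congr 1
      rw [add_sub_add_left_eq_sub, ← h.volterra_sub (le_max_of_le_left (norm_nonneg b)) (hbc b) hm
        (hbc b') hm']
      congr 1
      ext q
      simp [smul_sub]
    change dist (V b (x, z)) (V b' (x, z)) ≤ _
    rw [dist_eq_norm, hsub, norm_smul, norm_inv, Real.norm_of_nonneg (hω0 _).le,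
      inv_mul_le_iff₀ (hω0 _), dist_eq_norm]
    refine (h.norm_volterra_le (norm_nonneg _) (hb (b - b')) x z).trans (le_of_eq ?_)
    simp only [ω]; push_cast; ring
  obtain ⟨b, hfix, -⟩ := hS.exists_fixedPoint 0 (edist_ne_top _ _)
  refine ⟨fun q => ω q • b q, ‖b‖, norm_nonneg _, hbc b, hb b, fun x z hz => ?_⟩
  have h1 : V b (x, z) = b (x, z) := congrArg (fun c : ℝ × ℝ →ᵇ E => c (x, z)) hfix
  change ω (x, z) • b (x, z) = _
  rw [← h1]
  simp only [V]
  rw [smul_smul, mul_inv_cancel₀ (hω0 _).ne', one_smul]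
  simp only [G, volterra, max_eq_left hz]

end Kernel

end

/-! ### The Jost function as Fourier transform of the kernel -/

section

lemma integral_Ioi_zero_comp_add {E : Type*} [NormedAddCommGroup E] [NormedSpace ℝ E]
    (k : ℝ → E) (x : ℝ) : ∫ u in Ioi 0, k (x + u) = ∫ s in Ioi x, k s := by
  have := (measurePreserving_add_left (volume : Measure ℝ) x).setIntegral_preimage_emb
    (measurableEmbedding_addLeft x) k (Ioi x)
  simpa using this

lemma integrableOn_Ioi_zero_comp_add {E : Type*} [NormedAddCommGroup E] {k : ℝ → E} {x : ℝ}
    (hk : IntegrableOn k (Ioi x)) : IntegrableOn (fun u => k (x + u)) (Ioi 0) := by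
  have := (measurePreserving_add_left (volume : Measure ℝ) x).integrableOn_comp_preimage
    (measurableEmbedding_addLeft x) (f := k) (s := Ioi x)
  simpa [Function.comp_def] using this.2 hk

/-- Fubini together with the invariance of planar Lebesgue measure under the shear `(z, w) ↦ (z - w,
w)`. -/
lemma integral_integral_shear {E : Type*} [NormedAddCommGroup E] [NormedSpace ℝ E]
    {G : ℝ × ℝ → E} (hG : Integrable G) :
    ∫ z, ∫ w, G (z - w, w) = ∫ u, ∫ w, G (u, w) := by
  have hmp := measurePreserving_sub_prod (volume : Measure ℝ) (volume : Measure ℝ)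
  have hint : Integrable (fun q : ℝ × ℝ => G (q.1 - q.2, q.2)) :=
    hmp.integrable_comp_of_integrable hG
  have h1 : ∫ q : ℝ × ℝ, G (q.1 - q.2, q.2) = ∫ q, G q :=
    hmp.integral_comp (MeasurableEquiv.measurableEmbedding
      { toFun := fun q : ℝ × ℝ => (q.1 - q.2, q.2), invFun := fun q => (q.1 + q.2, q.2)
        left_inv := fun q => by simp
        right_inv := fun q => by simp
        measurable_toFun := (measurable_fst.sub measurable_snd).prodMk measurable_snd
        measurable_invFun := (measurable_fst.add measurable_snd).prodMk measurable_snd }) G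
  rw [Measure.volume_eq_prod] at h1 hint hG
  rw [integral_prod _ hint, integral_prod _ hG] at h1
  exact h1

section Jost

variable {E : Type*} [NormedRing E] [NormedAlgebra ℂ E]

/-- The modulated Jost function `exp (-iρx) F₊(x, ρ)` built from a kernel. -/
def jostF (B : ℝ × ℝ → E) (ρ : ℂ) (x : ℝ) : E :=
  1 + ∫ z in Ioi (0 : ℝ), Complex.exp (2 * Complex.I * ρ * z) • B (x, z)

/-- The tail `∫_x^∞ Q f`. -/
def jostH (Q : ℝ → E) (B : ℝ × ℝ → E) (ρ : ℂ) (x : ℝ) : E :=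
  ∫ t in Ioi x, Q t * jostF B ρ t

/-- `B` solves the kernel equation with the standard bound. -/
structure IsJostKernel (Q : ℝ → E) (p : ℝ → ℝ) (B : ℝ × ℝ → E) (C : ℝ) : Prop where
  maj : Majorant Q p
  nonneg : 0 ≤ C
  cont : Continuous B
  bound : ∀ x z, ‖B (x, z)‖ ≤ C * kernelWeight p x z
  eqn : ∀ x z, 0 ≤ z → B (x, z) = (∫ t in Ioi (x + z), Q t) +
        ∫ w in (0:ℝ)..z, innerInt Q B (x + z - w) w

/-- Bound for `∫_0^∞ ‖B(x,z)‖ dz`. -/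
def kernelMass (p : ℝ → ℝ) (C x : ℝ) : ℝ := C * (expWeight p x * tail (tail p) x)

lemma norm_exp_two_I_mul_le {ρ : ℂ} (hρ : 0 ≤ ρ.im) {z : ℝ} (hz : 0 ≤ z) :
    ‖Complex.exp (2 * Complex.I * ρ * z)‖ ≤ 1 := by
  rw [Complex.norm_exp, Real.exp_le_one_iff]
  have : (2 * Complex.I * ρ * z).re = -(2 * ρ.im * z) := by simp
  rw [this]
  have := mul_nonneg (mul_nonneg zero_le_two hρ) hz
  linarith

namespace IsJostKernel

variable {Q : ℝ → E} {p : ℝ → ℝ} {B : ℝ × ℝ → E} {C : ℝ} (h : IsJostKernel Q p B C)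
include h

lemma continuous_left (x : ℝ) : Continuous fun z => B (x, z) := h.cont.comp (by fun_prop)

lemma integrableOn_weight (x : ℝ) : IntegrableOn (fun z => kernelWeight p x z) (Ioi 0) := by
  refine IntegrableOn.congr_fun ((integrableOn_Ioi_zero_comp_add
    (h.maj.integrableOn_tail x)).mul_const (expWeight p x)) (fun z hz => ?_) measurableSet_Ioi
  rw [kernelWeight, max_eq_left (le_of_lt hz)]

lemma integral_weight (x : ℝ) :
    ∫ z in Ioi (0 : ℝ), C * kernelWeight p x z = kernelMass p C x := by
  rw [kernelMass, integral_const_mul, tail, mul_comm (expWeight p x), ← integral_mul_const,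
    ← integral_Ioi_zero_comp_add _ x]
  refine congrArg (C * ·) (setIntegral_congr_fun measurableSet_Ioi fun z hz => ?_)
  simp only [kernelWeight, max_eq_left (le_of_lt (mem_Ioi.1 hz))]

lemma kernelMass_antitone : Antitone (kernelMass p C) := fun a b hab => by
  have h1 := h.maj.expWeight_antitone hab
  have h2 := h.maj.tail2_antitone hab
  have h3 := h.maj.tail2_nonneg b
  have h4 : 0 ≤ expWeight p a := (Real.exp_pos _).le
  have := h.nonneg
  unfold kernelMass; gcongr

lemma kernelMass_nonneg (x : ℝ) : 0 ≤ kernelMass p C x :=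
  mul_nonneg h.nonneg (mul_nonneg (Real.exp_pos _).le (h.maj.tail2_nonneg x))

lemma tendsto_kernelMass : Tendsto (kernelMass p C) atTop (𝓝 0) := by
  have h1 : Tendsto (tail (tail p)) atTop (𝓝 0) := tendsto_integral_Ioi_atTop
  have h2 : Tendsto (expWeight p) atTop (𝓝 (Real.exp (2 * 0))) :=
    (Real.continuous_exp.tendsto _).comp (h1.const_mul 2)
  have := (h2.mul h1).const_mul C
  rw [mul_zero, mul_zero] at this
  exact this

lemma integrableOn (x : ℝ) : IntegrableOn (fun z => B (x, z)) (Ioi 0) :=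
  ((h.integrableOn_weight x).const_mul C).mono' (h.continuous_left x).aestronglyMeasurable
    (ae_of_all _ fun z => h.bound x z)

lemma integral_norm_le (x : ℝ) : ∫ z in Ioi (0 : ℝ), ‖B (x, z)‖ ≤ kernelMass p C x := by
  rw [← h.integral_weight]
  exact integral_mono (h.integrableOn x).norm ((h.integrableOn_weight x).const_mul C) (h.bound x)

lemma norm_le (x z : ℝ) : ‖B (x, z)‖ ≤ C * (tail p x * expWeight p x) :=
  (h.bound x z).trans (mul_le_mul_of_nonneg_left (mul_le_mul_of_nonneg_right
    (h.maj.tail_antitone (by simp)) (Real.exp_pos _).le) h.nonneg)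

variable {ρ : ℂ} (hρ : 0 ≤ ρ.im)
include hρ

lemma integrableOn_exp_smul (x : ℝ) :
    IntegrableOn (fun z : ℝ => Complex.exp (2 * Complex.I * ρ * z) • B (x, z)) (Ioi 0) := by
  refine (h.integrableOn x).norm.mono' ?_ ?_
  · exact (Continuous.smul (by fun_prop) (h.continuous_left x)).aestronglyMeasurable
  · filter_upwards [ae_restrict_mem measurableSet_Ioi] with z hz
    rw [norm_smul]
    exact mul_le_of_le_one_left (norm_nonneg _) (norm_exp_two_I_mul_le hρ (le_of_lt hz))

lemma norm_jostF_sub_one_le (x : ℝ) : ‖jostF B ρ x - 1‖ ≤ kernelMass p C x := by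
  rw [jostF, add_sub_cancel_left]
  refine (norm_integral_le_of_norm_le (h.integrableOn x).norm ?_).trans (h.integral_norm_le x)
  filter_upwards [ae_restrict_mem measurableSet_Ioi] with z hz
  rw [norm_smul]
  exact mul_le_of_le_one_left (norm_nonneg _) (norm_exp_two_I_mul_le hρ (le_of_lt hz))

lemma norm_jostF_le (x : ℝ) : ‖jostF B ρ x‖ ≤ ‖(1 : E)‖ + kernelMass p C x := by
  have := h.norm_jostF_sub_one_le hρ x
  calc ‖jostF B ρ x‖ = ‖1 + (jostF B ρ x - 1)‖ := by rw [add_sub_cancel]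
    _ ≤ _ := (norm_add_le _ _).trans (by gcongr)

lemma continuous_jostF : Continuous (jostF B ρ) := by
  refine continuous_const.add (continuous_iff_continuousAt.2 fun x => ?_)
  have hx : ∀ᶠ y in 𝓝 x, x - 1 < y := lt_mem_nhds (by linarith)
  refine continuousAt_of_dominated (bound := fun z => C * kernelWeight p (x - 1) z) ?_ ?_ ?_ ?_
  · exact Eventually.of_forall fun y => (h.integrableOn_exp_smul hρ y).aestronglyMeasurable
  · filter_upwards [hx] with y hy
    filter_upwards [ae_restrict_mem measurableSet_Ioi] with z hz
    rw [norm_smul]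
    refine (mul_le_of_le_one_left (norm_nonneg _) (norm_exp_two_I_mul_le hρ (le_of_lt hz))).trans
      ((h.bound y z).trans (mul_le_mul_of_nonneg_left ?_ h.nonneg))
    exact mul_le_mul (h.maj.tail_antitone (by linarith)) (h.maj.expWeight_antitone hy.le)
      (Real.exp_pos _).le (h.maj.tail_pos _).le
  · exact (h.integrableOn_weight _).const_mul C
  · refine ae_of_all _ fun z => ContinuousAt.const_smul ?_ _
    exact (h.cont.comp (by fun_prop : Continuous fun y : ℝ => (y, z))).continuousAt

lemma integrableOn_mul_jostF (x : ℝ) : IntegrableOn (fun t => Q t * jostF B ρ t) (Ioi x) := by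
  refine Integrable.mono' ((h.maj.integrableOn x).mul_const (‖(1 : E)‖ + kernelMass p C x)) ?_ ?_
  · exact (h.maj.meas.mul (h.continuous_jostF hρ).aestronglyMeasurable).restrict
  · filter_upwards [ae_restrict_mem measurableSet_Ioi] with t ht
    refine (norm_mul_le _ _).trans (mul_le_mul (h.maj.le t) ((h.norm_jostF_le hρ t).trans ?_)
      (norm_nonneg _) (h.maj.pos t).le)
    gcongr
    exact h.kernelMass_antitone (le_of_lt ht)

lemma norm_jostH_le (x : ℝ) :
    ‖jostH Q B ρ x‖ ≤ tail p x * (‖(1 : E)‖ + kernelMass p C x) := by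
  rw [jostH, tail, ← integral_mul_const]
  refine norm_integral_le_of_norm_le ((h.maj.integrableOn x).mul_const _) ?_
  filter_upwards [ae_restrict_mem measurableSet_Ioi] with t ht
  refine (norm_mul_le _ _).trans (mul_le_mul (h.maj.le t) ((h.norm_jostF_le hρ t).trans ?_)
    (norm_nonneg _) (h.maj.pos t).le)
  gcongr
  exact h.kernelMass_antitone (le_of_lt ht)

lemma continuous_jostH : Continuous (jostH Q B ρ) :=
  continuous_integral_Ioi (h.integrableOn_mul_jostF hρ)

lemma integrableOn_jostH (x : ℝ) : IntegrableOn (jostH Q B ρ) (Ioi x) := by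
  refine Integrable.mono' ((h.maj.integrableOn_tail x).mul_const (‖(1 : E)‖ + kernelMass p C x))
    (h.continuous_jostH hρ).aestronglyMeasurable ?_
  filter_upwards [ae_restrict_mem measurableSet_Ioi] with t ht
  refine (h.norm_jostH_le hρ t).trans (mul_le_mul_of_nonneg_left ?_ (h.maj.tail_pos t).le)
  gcongr
  exact h.kernelMass_antitone (le_of_lt ht)

variable [CompleteSpace E]

/-- Fubini carries the Fourier integral of the kernel outside the integral against `Q`, which leaves
the inner integral of the kernel equation. -/
lemma jostH_eq (s : ℝ) : jostH Q B ρ s = (∫ t in Ioi s, Q t) +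
    ∫ w in Ioi (0 : ℝ), Complex.exp (2 * Complex.I * ρ * w) • innerInt Q B s w := by
  have hprod : Integrable (Function.uncurry fun (t w : ℝ) =>
      Complex.exp (2 * Complex.I * ρ * w) • (Q t * B (t, w)))
      ((volume.restrict (Ioi s)).prod (volume.restrict (Ioi (0 : ℝ)))) := by
    refine Integrable.mono' ((h.maj.integrableOn s).mul_prod
      ((h.integrableOn_weight s).const_mul C)) ?_ ?_
    · refine AEStronglyMeasurable.smul (by fun_prop) (AEStronglyMeasurable.mul ?_ ?_)
      · exact h.maj.meas.restrict.comp_fst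
      · exact h.cont.aestronglyMeasurable
    · rw [Measure.prod_restrict]
      filter_upwards [ae_restrict_mem (measurableSet_Ioi.prod measurableSet_Ioi)] with q hq
      simp only [Function.uncurry]
      rw [norm_smul]
      exact (mul_le_of_le_one_left (norm_nonneg _) (norm_exp_two_I_mul_le hρ (le_of_lt hq.2))).trans
        (h.maj.norm_mul_le h.nonneg h.bound _ (le_of_lt hq.1))
  have h1 : ∀ t, Q t * jostF B ρ t =
      Q t + ∫ w in Ioi (0 : ℝ), Complex.exp (2 * Complex.I * ρ * w) • (Q t * B (t, w)) := fun t => by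
    rw [jostF, mul_add, mul_one]
    congr 1
    rw [← integral_const_mul_of_integrable (h.integrableOn_exp_smul hρ t)]
    simp only [mul_smul_comm]
  simp only [jostH, h1]
  rw [integral_add h.maj.integrableQ.integrableOn
    (by simpa only [Function.uncurry] using hprod.integral_prod_left),
    integral_integral_swap hprod]
  congr 1
  refine setIntegral_congr_fun measurableSet_Ioi fun w _ => ?_
  simp only [innerInt]
  rw [integral_smul]

/-- The substitution `u = z - w` maps the sector `0 < w < z` to the quadrant `u, w > 0`, and the
phase splits as `e^{2iρu} e^{2iρw}`. -/
lemma integral_exp_smul_innerInt (x : ℝ) :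
    ∫ z in Ioi (0 : ℝ), Complex.exp (2 * Complex.I * ρ * z) •
      ∫ w in (0:ℝ)..z, innerInt Q B (x + z - w) w =
    ∫ u in Ioi (0 : ℝ), ∫ w in Ioi (0 : ℝ),
      Complex.exp (2 * Complex.I * ρ * (u + w)) • innerInt Q B (x + u) w := by
  have hc := h.maj.continuous_innerInt h.nonneg h.cont h.bound
  let G : ℝ × ℝ → E := (Ioi (0 : ℝ) ×ˢ Ioi (0 : ℝ)).indicator fun q =>
    Complex.exp (2 * Complex.I * ρ * (q.1 + q.2)) • innerInt Q B (x + q.1) q.2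
  have hGint : Integrable G := by
    rw [integrable_indicator_iff (measurableSet_Ioi.prod measurableSet_Ioi), IntegrableOn,
      Measure.volume_eq_prod, ← Measure.prod_restrict]
    refine Integrable.mono' ((integrableOn_Ioi_zero_comp_add (h.maj.integrableOn_tail x)).mul_prod
      ((h.integrableOn_weight x).const_mul C)) ?_ ?_
    · exact (Continuous.smul (by fun_prop) (hc.comp (f := fun q : ℝ × ℝ => (x + q.1, q.2))
        (by fun_prop))).aestronglyMeasurable
    · rw [Measure.prod_restrict]
      filter_upwards [ae_restrict_mem (measurableSet_Ioi.prod measurableSet_Ioi)] with q hq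
      have hq1 : 0 < q.1 := hq.1
      have hq2 : 0 < q.2 := hq.2
      rw [norm_smul, ← Complex.ofReal_add]
      refine (mul_le_of_le_one_left (norm_nonneg _)
        (norm_exp_two_I_mul_le hρ (by positivity))).trans
        ((h.maj.norm_innerInt_le h.nonneg h.bound _ _).trans
        (mul_le_mul_of_nonneg_left (mul_le_mul_of_nonneg_left ?_ h.nonneg) (h.maj.tail_pos _).le))
      exact mul_le_mul (h.maj.tail_antitone (by linarith)) (h.maj.expWeight_antitone (by linarith))
        (Real.exp_pos _).le (h.maj.tail_pos _).le
  have hshear := integral_integral_shear hGint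
  have hL : ∀ z, ∫ w, G (z - w, w) = (Ioi (0 : ℝ)).indicator (fun z : ℝ =>
      Complex.exp (2 * Complex.I * ρ * z) • ∫ w in (0:ℝ)..z, innerInt Q B (x + z - w) w) z := by
    intro z
    have h1 : (fun w => G (z - w, w)) = (Ioo 0 z).indicator fun w =>
        Complex.exp (2 * Complex.I * ρ * z) • innerInt Q B (x + z - w) w := by
      ext w
      by_cases hw : w ∈ Ioo 0 z
      · rw [indicator_of_mem hw]
        have : (z - w, w) ∈ Ioi (0 : ℝ) ×ˢ Ioi (0 : ℝ) := ⟨by simpa using hw.2, hw.1⟩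
        simp only [G]
        rw [indicator_of_mem this]
        simp only
        rw [show ((z - w : ℝ) : ℂ) + (w : ℂ) = z by push_cast; ring,
          show x + (z - w) = x + z - w by ring]
      · rw [indicator_of_notMem hw]
        have : (z - w, w) ∉ Ioi (0 : ℝ) ×ˢ Ioi (0 : ℝ) := fun hh => hw ⟨hh.2, by simpa using hh.1⟩
        simp only [G]
        rw [indicator_of_notMem this]
    rw [h1, integral_indicator measurableSet_Ioo, integral_smul]
    by_cases hz : 0 < z
    · rw [indicator_of_mem (by exact hz), intervalIntegral.integral_of_le hz.le,
        integral_Ioc_eq_integral_Ioo]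
    · rw [indicator_of_notMem (by exact hz), Ioo_eq_empty hz]
      simp
  have hR : ∀ u, ∫ w, G (u, w) = (Ioi (0 : ℝ)).indicator (fun u : ℝ => ∫ w in Ioi (0 : ℝ),
      Complex.exp (2 * Complex.I * ρ * (u + w)) • innerInt Q B (x + u) w) u := by
    intro u
    by_cases hu : u ∈ Ioi (0 : ℝ)
    · rw [indicator_of_mem hu, ← integral_indicator measurableSet_Ioi]
      congr 1; ext w
      by_cases hw : w ∈ Ioi (0 : ℝ)
      · simp only [G]
        rw [indicator_of_mem hw, indicator_of_mem (mk_mem_prod hu hw)]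
      · simp only [G]
        rw [indicator_of_notMem hw, indicator_of_notMem fun hh => hw hh.2]
    · rw [indicator_of_notMem hu]
      have : (fun w => G (u, w)) = fun _ => 0 := by
        ext w
        exact indicator_of_notMem (fun hh => hu hh.1) _
      rw [this, integral_zero]
  simp only [hL, hR] at hshear
  rwa [integral_indicator measurableSet_Ioi, integral_indicator measurableSet_Ioi] at hshear

/-- The Fourier transform in `z` of the kernel equation. In contrast to the usual form with kernel
`(e^{2iρ(t-x)} - 1)/(2iρ)`, nothing is divided by `ρ`, so `ρ = 0` needs no separate treatment. -/
lemma jostF_eq (x : ℝ) : jostF B ρ x =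
    1 + ∫ s in Ioi x, Complex.exp (2 * Complex.I * ρ * (s - x)) • jostH Q B ρ s := by
  have hcT := continuous_integral_Ioi fun x => h.maj.integrableQ.integrableOn (s := Ioi x)
  have hTi : IntegrableOn (fun u : ℝ => Complex.exp (2 * Complex.I * ρ * u) • ∫ t in Ioi (x + u), Q t)
      (Ioi (0 : ℝ)) := by
    refine Integrable.mono' (integrableOn_Ioi_zero_comp_add (h.maj.integrableOn_tail x)) ?_ ?_
    · exact (Continuous.smul (by fun_prop)
        (hcT.comp (by fun_prop : Continuous fun u => x + u))).aestronglyMeasurable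
    · filter_upwards [ae_restrict_mem measurableSet_Ioi] with z hz
      rw [norm_smul]
      exact (mul_le_of_le_one_left (norm_nonneg _) (norm_exp_two_I_mul_le hρ (le_of_lt hz))).trans
        (norm_integral_le_of_norm_le (h.maj.integrableOn _) (ae_of_all _ h.maj.le))
  have hHi : IntegrableOn (fun u : ℝ => Complex.exp (2 * Complex.I * ρ * u) • jostH Q B ρ (x + u))
      (Ioi (0 : ℝ)) := by
    refine Integrable.mono' (integrableOn_Ioi_zero_comp_add (h.integrableOn_jostH hρ x)).norm ?_ ?_
    · exact (Continuous.smul (by fun_prop)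
        ((h.continuous_jostH hρ).comp (by fun_prop : Continuous fun u => x + u))).aestronglyMeasurable
    · filter_upwards [ae_restrict_mem measurableSet_Ioi] with z hz
      rw [norm_smul]
      exact mul_le_of_le_one_left (norm_nonneg _) (norm_exp_two_I_mul_le hρ (le_of_lt hz))
  rw [← integral_Ioi_zero_comp_add, jostF]
  congr 1
  have e1 : ∀ u : ℝ, ((x + u : ℝ) : ℂ) - x = u := fun u => by push_cast; ring
  simp only [e1]
  have hB : ∀ z ∈ Ioi (0 : ℝ), Complex.exp (2 * Complex.I * ρ * z) • B (x, z) =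
      Complex.exp (2 * Complex.I * ρ * z) • (∫ t in Ioi (x + z), Q t) +
      Complex.exp (2 * Complex.I * ρ * z) • ∫ w in (0:ℝ)..z, innerInt Q B (x + z - w) w := by
    intro z hz
    rw [h.eqn x z (le_of_lt hz), smul_add]
  have hVi : IntegrableOn (fun z : ℝ => Complex.exp (2 * Complex.I * ρ * z) •
      ∫ w in (0:ℝ)..z, innerInt Q B (x + z - w) w) (Ioi 0) := by
    refine ((h.integrableOn_exp_smul hρ x).sub hTi).congr ?_
    filter_upwards [ae_restrict_mem measurableSet_Ioi] with z hz
    simp only [Pi.sub_apply]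
    rw [hB z hz, add_sub_cancel_left]
  rw [setIntegral_congr_fun measurableSet_Ioi hB, integral_add hTi hVi,
    h.integral_exp_smul_innerInt hρ x]
  have hH : ∀ u : ℝ, ∫ w in Ioi (0 : ℝ),
      Complex.exp (2 * Complex.I * ρ * (u + w)) • innerInt Q B (x + u) w =
      Complex.exp (2 * Complex.I * ρ * u) • jostH Q B ρ (x + u) -
      Complex.exp (2 * Complex.I * ρ * u) • ∫ t in Ioi (x + u), Q t := by
    intro u
    rw [h.jostH_eq hρ, smul_add, add_sub_cancel_left, ← integral_smul]
    congr 1; ext w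
    rw [smul_smul, ← Complex.exp_add]
    congr 2; ring
  simp only [hH]
  rw [integral_sub hHi hTi]
  abel

end IsJostKernel

end Jost

end

/-! ### Product rule for indefinite integrals; initial values of solutions -/

section

section ProductRule

variable {E : Type*} [NormedRing E] [NormedAlgebra ℝ E] [CompleteSpace E]

/-- The integral of `p(t) r(s)` over the square is split along the diagonal; the order of the
factors is kept throughout because the ring need not be commutative. -/
lemma integral_mul_primitive_add {p r : ℝ → E} {a b : ℝ} (hab : a ≤ b)
    (hp : IntervalIntegrable p volume a b) (hr : IntervalIntegrable r volume a b) :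
    (∫ t in a..b, p t * ∫ s in a..t, r s) + (∫ t in a..b, (∫ s in a..t, p s) * r t) =
      (∫ t in a..b, p t) * ∫ t in a..b, r t := by
  rw [intervalIntegrable_iff_integrableOn_Ioc_of_le hab] at hp hr
  set μ := volume.restrict (Ioc a b) with hμ
  have hG : Integrable (fun q : ℝ × ℝ => p q.1 * r q.2) (μ.prod μ) := hp.mul_prod hr
  have hS : MeasurableSet {q : ℝ × ℝ | q.2 ≤ q.1} := measurableSet_le measurable_snd measurable_fst
  have h1 : ∫ t in a..b, p t * ∫ s in a..t, r s =
      ∫ q, {q : ℝ × ℝ | q.2 ≤ q.1}.indicator (fun q => p q.1 * r q.2) q ∂(μ.prod μ) := by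
    rw [integral_prod _ (hG.indicator hS), intervalIntegral.integral_of_le hab]
    refine setIntegral_congr_fun measurableSet_Ioc fun t ht => ?_
    have : (fun s => {q : ℝ × ℝ | q.2 ≤ q.1}.indicator (fun q => p q.1 * r q.2) (t, s)) =
        (Iic t).indicator fun s => p t * r s := by
      ext s; simp [indicator]
    simp only [this]
    rw [integral_indicator measurableSet_Iic, hμ, Measure.restrict_restrict measurableSet_Iic,
      inter_comm, Ioc_inter_Iic, min_eq_right ht.2, integral_const_mul_of_integrable
      (hr.mono_set (Ioc_subset_Ioc_right ht.2)), intervalIntegral.integral_of_le ht.1.le]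
  have h2 : ∫ t in a..b, (∫ s in a..t, p s) * r t =
      ∫ q, {q : ℝ × ℝ | q.2 ≤ q.1}ᶜ.indicator (fun q => p q.1 * r q.2) q ∂(μ.prod μ) := by
    rw [integral_prod_symm _ (hG.indicator hS.compl), intervalIntegral.integral_of_le hab]
    refine setIntegral_congr_fun measurableSet_Ioc fun t ht => ?_
    have : (fun s => {q : ℝ × ℝ | q.2 ≤ q.1}ᶜ.indicator (fun q => p q.1 * r q.2) (s, t)) =
        (Iio t).indicator fun s => p s * r t := by
      ext s; simp [indicator]
    simp only [this]
    rw [integral_indicator measurableSet_Iio, hμ, Measure.restrict_restrict measurableSet_Iio,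
      show Iio t ∩ Ioc a b = Ioo a t by
        ext s; exact ⟨fun hs => ⟨hs.2.1, hs.1⟩, fun hs => ⟨hs.2, hs.1, hs.2.le.trans ht.2⟩⟩,
      integral_mul_const_of_integrable
      (hp.mono_set (Ioo_subset_Ioc_self.trans (Ioc_subset_Ioc_right ht.2))),
      intervalIntegral.integral_of_le ht.1.le, integral_Ioc_eq_integral_Ioo]
  rw [h1, h2, integral_indicator hS, integral_indicator hS.compl, integral_add_compl hS hG,
    integral_prod _ hG, intervalIntegral.integral_of_le hab, intervalIntegral.integral_of_le hab]
  have h3 : ∀ t, ∫ s, p t * r s ∂μ = p t * ∫ s, r s ∂μ := fun t =>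
    integral_const_mul_of_integrable hr
  simp only [h3]
  exact integral_mul_const_of_integrable hp

/-- The product rule for indefinite integrals. -/
lemma mul_sub_mul_eq_integral {P R p r : ℝ → E} (hp : ∀ a b, IntervalIntegrable p volume a b)
    (hr : ∀ a b, IntervalIntegrable r volume a b) (hP : ∀ a b, P b - P a = ∫ t in a..b, p t)
    (hR : ∀ a b, R b - R a = ∫ t in a..b, r t) (a b : ℝ) :
    P b * R b - P a * R a = ∫ t in a..b, (p t * R t + P t * r t) := by
  wlog hab : a ≤ b
  · rw [intervalIntegral.integral_symm, ← this hp hr hP hR b a (le_of_not_ge hab), neg_sub]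
  have hPc : Continuous P := by
    have : P = fun x => P a + ∫ t in a..x, p t := by ext x; rw [← hP]; abel
    rw [this]; exact continuous_const.add (intervalIntegral.continuous_primitive hp a)
  have hRc : Continuous R := by
    have : R = fun x => R a + ∫ t in a..x, r t := by ext x; rw [← hR]; abel
    rw [this]; exact continuous_const.add (intervalIntegral.continuous_primitive hr a)
  have key := integral_mul_primitive_add hab (hp a b) (hr a b)
  simp only [← hP, ← hR, mul_sub, sub_mul] at key
  have i1 : IntervalIntegrable (fun t => p t * R t) volume a b :=
    (hp a b).mul_continuousOn hRc.continuousOn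
  have i2 : IntervalIntegrable (fun t => P t * r t) volume a b :=
    (hr a b).continuousOn_mul hPc.continuousOn
  have i3 : IntervalIntegrable (fun t => p t * R a) volume a b :=
    (hp a b).mul_continuousOn continuousOn_const
  have i4 : IntervalIntegrable (fun t => P a * r t) volume a b :=
    (hr a b).continuousOn_mul continuousOn_const
  have e3 : ∫ t in a..b, p t * R a = (P b - P a) * R a := by
    rw [hP, intervalIntegral.integral_of_le hab, intervalIntegral.integral_of_le hab]
    exact integral_mul_const_of_integrable ((intervalIntegrable_iff_integrableOn_Ioc_of_le hab).1 (hp a b))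
  have e4 : ∫ t in a..b, P a * r t = P a * (R b - R a) := by
    rw [hR, intervalIntegral.integral_of_le hab, intervalIntegral.integral_of_le hab]
    exact integral_const_mul_of_integrable ((intervalIntegrable_iff_integrableOn_Ioc_of_le hab).1 (hr a b))
  rw [intervalIntegral.integral_sub i1 i3, intervalIntegral.integral_sub i2 i4, e3, e4] at key
  rw [intervalIntegral.integral_add i1 i2]
  have : (∫ t in a..b, p t * R t) + ∫ t in a..b, P t * r t =
      P b * R b - P a * R b - (P b * R a - P a * R a) + (P b - P a) * R a + P a * (R b - R a) := by
    rw [← key]; abel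
  rw [this]; noncomm_ring

end ProductRule

section Solutions

variable {E : Type*} [NormedRing E] [NormedAlgebra ℂ E] [CompleteSpace E]

/-- `Y` is a solution of `-Y'' + Q Y = lam Y` with derivative `Y'`. -/
structure Sol (Q : ℝ → E) (lam : ℂ) (Y Y' : ℝ → E) : Prop where
  hasDerivAt : ∀ x, HasDerivAt Y (Y' x) x
  sub_eq : ∀ a b : ℝ, Y' b - Y' a = ∫ t in a..b, (Q t * Y t - lam • Y t)

namespace Sol

variable {Q : ℝ → E} {lam : ℂ} {Y Y' Z Z' : ℝ → E}

lemma continuous (h : Sol Q lam Y Y') : Continuous Y :=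
  continuous_iff_continuousAt.2 fun x => (h.hasDerivAt x).continuousAt

lemma intervalIntegrable (h : Sol Q lam Y Y') (hQ : Integrable Q) (a b : ℝ) :
    IntervalIntegrable (fun t => Q t * Y t - lam • Y t) volume a b :=
  (hQ.intervalIntegrable.mul_continuousOn h.continuous.continuousOn).sub
    ((h.continuous.const_smul lam).intervalIntegrable _ _)

lemma continuous_deriv (h : Sol Q lam Y Y') (hQ : Integrable Q) : Continuous Y' := by
  have : Y' = fun x => Y' 0 + ∫ t in (0:ℝ)..x, (Q t * Y t - lam • Y t) := by
    ext x; rw [← h.sub_eq]; abel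
  rw [this]
  exact continuous_const.add (intervalIntegral.continuous_primitive (h.intervalIntegrable hQ) 0)

lemma integral_deriv (h : Sol Q lam Y Y') (hQ : Integrable Q) (a b : ℝ) :
    Y b - Y a = ∫ t in a..b, Y' t :=
  (intervalIntegral.integral_eq_sub_of_hasDerivAt (fun x _ => h.hasDerivAt x)
    ((h.continuous_deriv hQ).intervalIntegrable _ _)).symm

lemma deriv_eq (h : Sol Q lam Y Y') : deriv Y = Y' := funext fun x => (h.hasDerivAt x).deriv

lemma sub (h : Sol Q lam Y Y') (h' : Sol Q lam Z Z') (hQ : Integrable Q) :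
    Sol Q lam (Y - Z) (Y' - Z') := by
  refine ⟨fun x => (h.hasDerivAt x).sub (h'.hasDerivAt x), fun a b => ?_⟩
  have : ∀ t, Q t * (Y - Z) t - lam • (Y - Z) t =
      (Q t * Y t - lam • Y t) - (Q t * Z t - lam • Z t) := fun t => by
    simp only [Pi.sub_apply, mul_sub, smul_sub]; abel
  simp only [this]
  rw [intervalIntegral.integral_sub (h.intervalIntegrable hQ a b) (h'.intervalIntegrable hQ a b),
    ← h.sub_eq, ← h'.sub_eq]
  simp only [Pi.sub_apply]; abel

lemma mul_const (h : Sol Q lam Y Y') (hQ : Integrable Q) (a : E) :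
    Sol Q lam (fun x => Y x * a) (fun x => Y' x * a) := by
  refine ⟨fun x => (h.hasDerivAt x).mul_const a, fun c d => ?_⟩
  have : ∀ t, Q t * (Y t * a) - lam • (Y t * a) = (Q t * Y t - lam • Y t) * a := fun t => by
    rw [sub_mul, mul_assoc, smul_mul_assoc]
  simp only [this]
  rw [← sub_mul, h.sub_eq]
  have i := h.intervalIntegrable hQ c d
  rw [intervalIntegral, intervalIntegral, sub_mul, integral_mul_const_of_integrable i.1,
    integral_mul_const_of_integrable i.2]

/-- Reflection of a solution. -/
lemma comp_neg (h : Sol Q lam Y Y') :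
    Sol (fun x => Q (-x)) lam (fun x => Y (-x)) (fun x => -Y' (-x)) := by
  refine ⟨fun x => ?_, fun a b => ?_⟩
  · simpa [Function.comp_def] using (h.hasDerivAt (-x)).scomp x (hasDerivAt_neg x)
  · rw [intervalIntegral.integral_comp_neg (fun t => Q t * Y t - lam • Y t), ← h.sub_eq]
    abel

/-- Uniqueness for the initial value problem. -/
lemma eq_zero (h : Sol Q lam Y Y') (hQ : Integrable Q) {c : ℝ} (h0 : Y c = 0) (h0' : Y' c = 0)
    (x : ℝ) : Y x = 0 := by
  have hYc := h.continuous
  have hYc' := h.continuous_deriv hQ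
  -- By connectedness it is enough that the set where both initial values vanish is closed and open.
  let A : Set ℝ := {x | Y x = 0 ∧ Y' x = 0}
  have hclosed : IsClosed A :=
    (isClosed_eq hYc continuous_const).inter (isClosed_eq hYc' continuous_const)
  have hopen : IsOpen A := by
    rw [isOpen_iff_mem_nhds]
    rintro c ⟨hc, hc'⟩
    let k : ℝ → ℝ := fun t => ‖Q t‖ + ‖lam‖ + 1
    have hki : ∀ a b, IntervalIntegrable k volume a b := fun a b =>
      ((hQ.norm.intervalIntegrable).add (intervalIntegrable_const)).add intervalIntegrable_const
    have hk0 : ∀ t, 0 ≤ k t := fun t => by positivity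
    have hcont : Continuous fun x => ∫ t in c..x, k t := intervalIntegral.continuous_primitive hki c
    have hδ : ∀ᶠ x in 𝓝 c, |∫ t in c..x, k t| < 1 := by
      have := (hcont.abs.tendsto c)
      simp only [intervalIntegral.integral_same, abs_zero] at this
      exact this.eventually (gt_mem_nhds one_pos)
    obtain ⟨δ, hδ0, hδ⟩ := Metric.eventually_nhds_iff.1 hδ
    refine Metric.mem_nhds_iff.2 ⟨δ, hδ0, fun y hy => ?_⟩
    -- On an interval around `c` over which `∫ k < 1`, the maximum of `‖Y‖ + ‖Y'‖` is bounded by a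
    -- proper fraction of itself and hence is zero.
    obtain ⟨s, hs, hmax⟩ := isCompact_uIcc.exists_isMaxOn (nonempty_uIcc (a := c) (b := y))
      (f := fun x => ‖Y x‖ + ‖Y' x‖) (by fun_prop)
    have hbound : ∀ x ∈ uIcc c y, ‖Y x‖ + ‖Y' x‖ ≤ |∫ t in c..x, k t| * (‖Y s‖ + ‖Y' s‖) := by
      intro x hx
      have hM : ∀ t ∈ uIoc c x, ‖Y t‖ + ‖Y' t‖ ≤ ‖Y s‖ + ‖Y' s‖ := fun t ht =>
        hmax (uIcc_subset_uIcc_left hx (uIoc_subset_uIcc ht))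
      have hx0 : |∫ t in c..x, k t| = ∫ t in uIoc c x, k t := by
        rw [intervalIntegral.abs_integral_eq_abs_integral_uIoc,
          abs_of_nonneg (integral_nonneg fun t => hk0 t)]
      have e1 : ‖Y x‖ ≤ ∫ t in uIoc c x, ‖Y' t‖ := by
        have := h.integral_deriv hQ c x
        rw [hc, sub_zero] at this
        rw [this]
        exact intervalIntegral.norm_integral_le_integral_norm_uIoc
      have e2 : ‖Y' x‖ ≤ ∫ t in uIoc c x, ‖Q t * Y t - lam • Y t‖ := by
        have := h.sub_eq c x
        rw [hc', sub_zero] at this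
        rw [this]
        exact intervalIntegral.norm_integral_le_integral_norm_uIoc
      have i1 : IntegrableOn (fun t => ‖Y' t‖) (uIoc c x) :=
        intervalIntegrable_iff.1 (hYc'.norm.intervalIntegrable _ _)
      have i2 : IntegrableOn (fun t => ‖Q t * Y t - lam • Y t‖) (uIoc c x) :=
        intervalIntegrable_iff.1 (h.intervalIntegrable hQ c x).norm
      refine (add_le_add e1 e2).trans ?_
      rw [← integral_add i1 i2, hx0, ← integral_mul_const]
      refine setIntegral_mono_on (i1.add i2)
        ((intervalIntegrable_iff.1 (hki c x)).mul_const _) measurableSet_uIoc fun t ht => ?_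
      have h1 : ‖Q t * Y t - lam • Y t‖ ≤ (‖Q t‖ + ‖lam‖) * ‖Y t‖ := by
        refine (norm_sub_le _ _).trans ?_
        rw [add_mul, norm_smul]
        gcongr
        exact norm_mul_le _ _
      refine le_trans ?_ (mul_le_mul_of_nonneg_left (hM t ht) (hk0 t))
      simp only [k]
      nlinarith [norm_nonneg (Y t), norm_nonneg (Y' t), norm_nonneg (Q t), norm_nonneg lam,
        mul_nonneg (norm_nonneg (Q t)) (norm_nonneg (Y' t)),
        mul_nonneg (norm_nonneg lam) (norm_nonneg (Y' t))]
    have hs2 := hbound s hs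
    have hlt : |∫ t in c..s, k t| < 1 := hδ (by
      have : |s - c| ≤ |y - c| := abs_sub_left_of_mem_uIcc hs
      rw [Real.dist_eq]
      exact this.trans_lt (by simpa [Real.dist_eq] using hy))
    have hs0 : ‖Y s‖ + ‖Y' s‖ = 0 := by
      have : 0 ≤ ‖Y s‖ + ‖Y' s‖ := by positivity
      nlinarith
    have hy0 : ‖Y y‖ + ‖Y' y‖ ≤ ‖Y s‖ + ‖Y' s‖ := hmax right_mem_uIcc
    rw [hs0] at hy0
    have n1 := norm_nonneg (Y y)
    have n2 := norm_nonneg (Y' y)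
    exact ⟨norm_eq_zero.1 (by linarith), norm_eq_zero.1 (by linarith)⟩
  have : A = univ := IsClopen.eq_univ ⟨hclosed, hopen⟩ ⟨c, h0, h0'⟩
  exact (this ▸ mem_univ x : x ∈ A).1

end Sol

end Solutions

end

/-! ### Green's identity and the Jost solution -/

section

section Green

variable {E : Type*} [CStarAlgebra E]

lemma star_intervalIntegral (f : ℝ → E) (a b : ℝ) :
    star (∫ t in a..b, f t) = ∫ t in a..b, star (f t) := by
  have := (starL' ℝ : E ≃L[ℝ] E).integral_comp_comm (μ := volume.restrict (Ioc a b)) f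
  have h2 := (starL' ℝ : E ≃L[ℝ] E).integral_comp_comm (μ := volume.restrict (Ioc b a)) f
  simp only [starL'_apply] at this h2
  rw [intervalIntegral, intervalIntegral, star_sub, this, h2]

/-- The Wronskian pairing of two solutions. -/
def wr (Z Z' Y Y' : ℝ → E) (x : ℝ) : E := star (Z' x) * Y x - star (Z x) * Y' x

variable {Q : ℝ → E} {lam mu : ℂ} {Y Y' Z Z' : ℝ → E}

/-- Green's identity. -/
lemma Sol.green (hZ : Sol Q mu Z Z') (hY : Sol Q lam Y Y') (hQ : Integrable Q)
    (hs : ∀ᵐ x, IsSelfAdjoint (Q x)) (a b : ℝ) :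
    wr Z Z' Y Y' b - wr Z Z' Y Y' a =
      (lam - starRingEnd ℂ mu) • ∫ t in a..b, star (Z t) * Y t := by
  have iZ := hZ.intervalIntegrable hQ
  have iY := hY.intervalIntegrable hQ
  have iZs : ∀ a b, IntervalIntegrable (fun t => star (Q t * Z t - mu • Z t)) volume a b := by
    intro a b
    have hL := fun (s : Set ℝ) (h : IntegrableOn (fun t => Q t * Z t - mu • Z t) s) =>
      ((starL' ℝ : E ≃L[ℝ] E).toContinuousLinearMap).integrable_comp h
    exact ⟨hL _ (iZ a b).1, hL _ (iZ a b).2⟩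
  have cY' := hY.continuous_deriv hQ
  have cZ' := hZ.continuous_deriv hQ
  have h1 := mul_sub_mul_eq_integral (P := fun t => star (Z' t)) (R := Y) (r := Y')
    iZs (fun a b => cY'.intervalIntegrable _ _)
    (fun a b => by rw [← star_sub, hZ.sub_eq, star_intervalIntegral]) (hY.integral_deriv hQ) a b
  have h2 := mul_sub_mul_eq_integral (P := fun t => star (Z t)) (R := Y') (p := fun t => star (Z' t))
    (fun a b => (continuous_star.comp cZ').intervalIntegrable _ _) iY
    (fun a b => by rw [← star_sub, hZ.integral_deriv hQ, star_intervalIntegral]) hY.sub_eq a b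
  have c1 : ∀ a b, IntervalIntegrable (fun t => star (Q t * Z t - mu • Z t) * Y t) volume a b :=
    fun a b => (iZs a b).mul_continuousOn hY.continuous.continuousOn
  have c2 : ∀ a b, IntervalIntegrable (fun t => star (Z t) * (Q t * Y t - lam • Y t)) volume a b :=
    fun a b => (iY a b).continuousOn_mul (continuous_star.comp hZ.continuous).continuousOn
  have c3 : ∀ a b, IntervalIntegrable (fun t => star (Z' t) * Y' t) volume a b :=
    fun a b => ((continuous_star.comp cZ').mul cY').intervalIntegrable _ _
  have : wr Z Z' Y Y' b - wr Z Z' Y Y' a = (star (Z' b) * Y b - star (Z' a) * Y a) -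
      (star (Z b) * Y' b - star (Z a) * Y' a) := by
    simp only [wr]; abel
  rw [this, h1, h2, ← intervalIntegral.integral_sub ((c1 a b).add (c3 a b)) ((c3 a b).add (c2 a b)),
    ← intervalIntegral.integral_smul]
  refine intervalIntegral.integral_congr_ae ?_
  filter_upwards [hs] with t ht _
  rw [star_sub, star_mul, ht.star_eq, star_smul, sub_mul, mul_sub, smul_mul_assoc,
    mul_smul_comm, mul_assoc, sub_smul]
  simp only [starRingEnd_apply]
  abel

/-- With conjugate spectral parameters the scalar factor in Green's identity is zero. -/
lemma Sol.wr_const (hZ : Sol Q (starRingEnd ℂ lam) Z Z') (hY : Sol Q lam Y Y') (hQ : Integrable Q)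
    (hs : ∀ᵐ x, IsSelfAdjoint (Q x)) (a b : ℝ) : wr Z Z' Y Y' b = wr Z Z' Y Y' a := by
  have := hZ.green hY hQ hs a b
  rwa [starRingEnd_self_apply, sub_self, zero_smul, sub_eq_zero] at this

end Green

section JostSol

variable {E : Type*} [NormedRing E] [NormedAlgebra ℂ E] [CompleteSpace E]

lemma hasDerivAt_integral_Ioi {q : ℝ → E} (hc : Continuous q) (hq : ∀ x, IntegrableOn q (Ioi x))
    (x : ℝ) : HasDerivAt (fun x => ∫ t in Ioi x, q t) (-q x) x := by
  have : (fun x => ∫ t in Ioi x, q t) = fun x => (∫ t in Ioi 0, q t) - ∫ t in (0:ℝ)..x, q t := by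
    ext x
    rw [← intervalIntegral.integral_Ioi_sub_Ioi' (hq 0) (hq x)]
    abel
  rw [this]
  exact (intervalIntegral.integral_hasDerivAt_right (hc.intervalIntegrable _ _)
    (hc.stronglyMeasurableAtFilter _ _) hc.continuousAt).const_sub _

/-- The Jost solution `exp (iρx) f`. -/
def jostSol (B : ℝ × ℝ → E) (ρ : ℂ) (x : ℝ) : E := Complex.exp (Complex.I * ρ * x) • jostF B ρ x

/-- The derivative of the Jost solution. -/
def jostSol' (Q : ℝ → E) (B : ℝ × ℝ → E) (ρ : ℂ) (x : ℝ) : E :=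
  Complex.exp (Complex.I * ρ * x) •
    ((2 * Complex.I * ρ) • (1 : E) - (Complex.I * ρ) • jostF B ρ x - jostH Q B ρ x)

lemma hasDerivAt_cexp_mul (c : ℂ) (x : ℝ) :
    HasDerivAt (fun x : ℝ => Complex.exp (c * x)) (c * Complex.exp (c * x)) x := by
  have h1 : HasDerivAt (fun x : ℝ => c * (x : ℂ)) c x := by
    simpa using (Complex.ofRealCLM.hasDerivAt (x := x)).const_mul c
  exact h1.cexp.congr_deriv (mul_comm _ _)

namespace IsJostKernel

variable {Q : ℝ → E} {p : ℝ → ℝ} {B : ℝ × ℝ → E} {C : ℝ} (h : IsJostKernel Q p B C)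
  {ρ : ℂ} (hρ : 0 ≤ ρ.im)
include h hρ

lemma integrableOn_exp_smul_jostH (a x : ℝ) :
    IntegrableOn (fun s : ℝ => Complex.exp (2 * Complex.I * ρ * (s - a)) • jostH Q B ρ s) (Ioi x) := by
  have h1 : IntegrableOn (fun s : ℝ => Complex.exp (2 * Complex.I * ρ * (s - x)) • jostH Q B ρ s)
      (Ioi x) := by
    refine Integrable.mono' (h.integrableOn_jostH hρ x).norm ?_ ?_
    · exact (Continuous.smul (by fun_prop) (h.continuous_jostH hρ)).aestronglyMeasurable
    · filter_upwards [ae_restrict_mem measurableSet_Ioi] with s hs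
      rw [norm_smul, ← Complex.ofReal_sub]
      exact mul_le_of_le_one_left (norm_nonneg _)
        (norm_exp_two_I_mul_le hρ (sub_nonneg.2 (le_of_lt hs)))
  have := h1.smul (Complex.exp (2 * Complex.I * ρ * (x - a)))
  refine this.congr (ae_of_all _ fun s => ?_)
  simp only [Pi.smul_apply, smul_smul, ← Complex.exp_add]
  congr 2; ring

/-- Pulling `e^{-2iρx}` out of `jostF_eq` leaves an integral over a ray with an integrand free of
`x`, which can be differentiated. -/
lemma hasDerivAt_jostF (x : ℝ) :
    HasDerivAt (jostF B ρ) (-(2 * Complex.I * ρ) • (jostF B ρ x - 1) - jostH Q B ρ x) x := by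
  have hJ := h.integrableOn_exp_smul_jostH hρ 0
  have heq : ∀ x : ℝ, ∫ s : ℝ in Ioi x, Complex.exp (2 * Complex.I * ρ * (s - x)) • jostH Q B ρ s =
      Complex.exp (-(2 * Complex.I * ρ) * x) •
        ∫ s : ℝ in Ioi x, Complex.exp (2 * Complex.I * ρ * (s - (0 : ℝ))) • jostH Q B ρ s := by
    intro x
    rw [← integral_smul]
    congr 1; ext s
    rw [smul_smul, ← Complex.exp_add]
    congr 2; push_cast; ring
  have hf : jostF B ρ = fun x : ℝ => 1 + Complex.exp (-(2 * Complex.I * ρ) * x) •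
        ∫ s : ℝ in Ioi x, Complex.exp (2 * Complex.I * ρ * (s - (0 : ℝ))) • jostH Q B ρ s := by
    ext x; rw [h.jostF_eq hρ, heq]
  have hc : Continuous fun s : ℝ => Complex.exp (2 * Complex.I * ρ * (s - (0 : ℝ))) • jostH Q B ρ s :=
    Continuous.smul (by fun_prop) (h.continuous_jostH hρ)
  have hd := ((hasDerivAt_cexp_mul (-(2 * Complex.I * ρ)) x).smul
    (hasDerivAt_integral_Ioi hc hJ x)).const_add 1
  refine (hd.congr_of_eventuallyEq (f₁ := jostF B ρ)
    (Eventually.of_forall fun y => congrFun hf y)).congr_deriv ?_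
  have hx : jostF B ρ x - 1 = Complex.exp (-(2 * Complex.I * ρ) * x) •
      ∫ s : ℝ in Ioi x, Complex.exp (2 * Complex.I * ρ * (s - (0 : ℝ))) • jostH Q B ρ s := by
    rw [← heq, h.jostF_eq hρ, add_sub_cancel_left]
  rw [hx, smul_neg, smul_smul, ← Complex.exp_add, smul_smul,
    show -(2 * Complex.I * ρ) * (x : ℂ) + 2 * Complex.I * ρ * (x - (0 : ℝ)) = 0 by push_cast; ring,
    Complex.exp_zero, one_smul]
  abel

lemma jostH_sub (a b : ℝ) :
    jostH Q B ρ b - jostH Q B ρ a = ∫ t in a..b, -(Q t * jostF B ρ t) := by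
  rw [intervalIntegral.integral_neg, jostH, jostH, ← intervalIntegral.integral_Ioi_sub_Ioi'
    (h.integrableOn_mul_jostF hρ a) (h.integrableOn_mul_jostF hρ b)]
  abel

lemma hasDerivAt_jostSol (x : ℝ) : HasDerivAt (jostSol B ρ) (jostSol' Q B ρ x) x := by
  refine ((hasDerivAt_cexp_mul (Complex.I * ρ) x).smul (h.hasDerivAt_jostF hρ x)).congr_deriv ?_
  rw [jostSol']
  module

/-- The derivative of the Jost solution is the smooth function `2iρ e^{iρx} - iρ F` minus `e^{iρx}
H`. Since `H` is only an indefinite integral of `-Q f`, the product rule for such functions takes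
the place of a pointwise second derivative. -/
lemma sol_jostSol : Sol Q (ρ ^ 2) (jostSol B ρ) (jostSol' Q B ρ) := by
  have hQ := h.maj.integrableQ
  refine ⟨h.hasDerivAt_jostSol hρ, fun a b => ?_⟩
  set c := Complex.I * ρ with hcdef
  have hcf := h.continuous_jostF hρ
  have hcH := h.continuous_jostH hρ
  have he : ∀ x : ℝ, HasDerivAt (fun x : ℝ => Complex.exp (c * x) • (1 : E))
      ((c * Complex.exp (c * x)) • (1 : E)) x := fun x => (hasDerivAt_cexp_mul c x).smul_const 1
  have hcd : Continuous fun x : ℝ => (c * Complex.exp (c * x)) • (1 : E) := by fun_prop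
  have hP : ∀ a b : ℝ, Complex.exp (c * b) • (1 : E) - Complex.exp (c * a) • (1 : E) =
      ∫ t in a..b, (c * Complex.exp (c * t)) • (1 : E) := fun a b =>
    (intervalIntegral.integral_eq_sub_of_hasDerivAt (fun x _ => he x)
      (hcd.intervalIntegrable _ _)).symm
  have hr : ∀ a b, IntervalIntegrable (fun t => -(Q t * jostF B ρ t)) volume a b := fun a b =>
    (hQ.intervalIntegrable.mul_continuousOn hcf.continuousOn).neg
  have h1 := mul_sub_mul_eq_integral (fun a b => hcd.intervalIntegrable a b) hr hP
    (h.jostH_sub hρ) a b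
  -- the smooth part
  have hcs : Continuous (jostSol B ρ) := Continuous.smul (by fun_prop) hcf
  have hcs' : Continuous (jostSol' Q B ρ) :=
    Continuous.smul (by fun_prop) ((continuous_const.sub (hcf.const_smul _)).sub hcH)
  have hS : ∀ x : ℝ, HasDerivAt (fun x : ℝ => (2 * c) • (Complex.exp (c * x) • (1 : E)) -
      c • jostSol B ρ x) ((2 * c) • ((c * Complex.exp (c * x)) • (1 : E)) - c • jostSol' Q B ρ x) x :=
    fun x => ((he x).const_smul (2 * c)).sub ((h.hasDerivAt_jostSol hρ x).const_smul c)
  have hcS : Continuous fun x : ℝ =>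
      (2 * c) • ((c * Complex.exp (c * x)) • (1 : E)) - c • jostSol' Q B ρ x :=
    (hcd.const_smul _).sub (hcs'.const_smul _)
  have h2 := intervalIntegral.integral_eq_sub_of_hasDerivAt (fun x _ => hS x)
    (hcS.intervalIntegrable a b)
  have hsplit : ∀ x, jostSol' Q B ρ x = ((2 * c) • (Complex.exp (c * x) • (1 : E)) -
      c • jostSol B ρ x) - Complex.exp (c * x) • (1 : E) * jostH Q B ρ x := fun x => by
    rw [jostSol', jostSol, smul_mul_assoc, one_mul]
    simp only [smul_sub, smul_smul, hcdef]
    congr 2 <;> congr 1 <;> ring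
  have i1 : IntervalIntegrable (fun t : ℝ => (c * Complex.exp (c * t)) • (1 : E) * jostH Q B ρ t +
      Complex.exp (c * t) • (1 : E) * -(Q t * jostF B ρ t)) volume a b := by
    refine ((hcd.mul hcH).intervalIntegrable _ _).add ((hr a b).continuousOn_mul ?_)
    exact Continuous.continuousOn (by fun_prop)
  rw [hsplit b, hsplit a, sub_sub_sub_comm, ← h2, h1,
    ← intervalIntegral.integral_sub (hcS.intervalIntegrable a b) i1]
  refine intervalIntegral.integral_congr fun t _ => ?_
  have e1 : Q t * jostSol B ρ t = Complex.exp (c * t) • (Q t * jostF B ρ t) := by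
    rw [jostSol, mul_smul_comm]
  have e2 : ρ ^ 2 = -(c * c) := by
    rw [hcdef]; linear_combination ρ ^ 2 * Complex.I_mul_I
  rw [hsplit t, e1, e2]
  simp only [smul_mul_assoc, one_mul]
  module

end IsJostKernel

end JostSol

end

/-! ### Dependence of the Jost solution on the spectral parameter -/

section

/-- Holomorphic dependence of an integral on a parameter under a uniform integrable bound. -/
lemma differentiableOn_integral_of_bound {E : Type*} [NormedAddCommGroup E] [NormedSpace ℂ E]
    {μ : Measure ℝ} {φ : ℂ → ℝ → E} {bound : ℝ → ℝ} {U : Set ℂ} (hU : IsOpen U)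
    (hm : ∀ z ∈ U, AEStronglyMeasurable (φ z) μ) (hd : ∀ t, DifferentiableOn ℂ (fun z => φ z t) U)
    (hb : ∀ᵐ t ∂μ, ∀ z ∈ U, ‖φ z t‖ ≤ bound t) (hi : Integrable bound μ) :
    DifferentiableOn ℂ (fun z => ∫ t, φ z t ∂μ) U := by
  intro z₀ hz₀
  obtain ⟨r, hr, hball⟩ := Metric.isOpen_iff.1 hU z₀ hz₀
  have hsub : ∀ z ∈ Metric.ball z₀ (r / 2), Metric.closedBall z (r / 4) ⊆ U := fun z hz w hw =>
    hball (by
      rw [Metric.mem_ball] at hz ⊢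
      rw [Metric.mem_closedBall] at hw
      linarith [dist_triangle w z z₀])
  have hdiff : ∀ t, ∀ z ∈ U, HasDerivAt (fun z => φ z t) (deriv (fun z => φ z t) z) z :=
    fun t z hz => ((hd t).differentiableAt (hU.mem_nhds hz)).hasDerivAt
  -- The complex derivative is a pointwise limit of difference quotients along `z₀ + 1/(n+1)`; the
  -- shift by `n₀` keeps these points in `U`.
  have hmeas' : AEStronglyMeasurable (fun t => deriv (fun z => φ z t) z₀) μ := by
    have hseq : Tendsto (fun n : ℕ => z₀ + ((1 / ((n : ℝ) + 1) : ℝ) : ℂ)) atTop (𝓝[≠] z₀) := by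
      rw [tendsto_nhdsWithin_iff]
      constructor
      · have := (Complex.continuous_ofReal.tendsto 0).comp tendsto_one_div_add_atTop_nhds_zero_nat
        simpa [Function.comp_def] using this.const_add z₀
      · refine Eventually.of_forall fun n => ?_
        have : (1 / ((n : ℝ) + 1) : ℝ) ≠ 0 := by positivity
        simpa using Complex.ofReal_ne_zero.2 this
    have hev : ∀ᶠ n : ℕ in atTop, z₀ + ((1 / ((n : ℝ) + 1) : ℝ) : ℂ) ∈ U :=
      (tendsto_nhds_of_tendsto_nhdsWithin hseq).eventually (hU.mem_nhds hz₀)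
    obtain ⟨n₀, hn₀⟩ := eventually_atTop.1 hev
    refine aestronglyMeasurable_of_tendsto_ae (u := atTop)
      (f := fun n t => slope (fun z => φ z t) z₀ (z₀ + ((1 / (((n + n₀ : ℕ) : ℝ) + 1) : ℝ) : ℂ)))
      (fun n => ?_) (ae_of_all _ fun t => ?_)
    · simp only [slope, vsub_eq_sub]
      exact ((hm _ (hn₀ _ (by omega))).sub (hm _ hz₀)).const_smul _
    · exact ((hasDerivAt_iff_tendsto_slope.1 (hdiff t z₀ hz₀)).comp hseq).comp
        (tendsto_add_atTop_nat n₀)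
  have hint : Integrable (φ z₀) μ := hi.mono' (hm z₀ hz₀) (hb.mono fun t ht => ht z₀ hz₀)
  refine (hasDerivAt_integral_of_dominated_loc_of_deriv_le (s := Metric.ball z₀ (r / 2))
    (F' := fun z t => deriv (fun z => φ z t) z) (bound := fun t => bound t / (r / 4))
    (Metric.ball_mem_nhds _ (by positivity)) ?_ hint hmeas' ?_ (hi.div_const _) ?_).2
    |>.differentiableAt.differentiableWithinAt
  · filter_upwards [hU.mem_nhds hz₀] with z hz using hm z hz
  · filter_upwards [hb] with t ht z hz
    -- Cauchy's estimate on circles of radius `r/4` turns the bound on `φ` into a bound on its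
    -- derivative.
    refine Complex.norm_deriv_le_of_forall_mem_sphere_norm_le (by positivity) ?_ fun w hw =>
      ht w (hsub z hz (Metric.sphere_subset_closedBall hw))
    exact ((hd t).mono (hsub z hz)).diffContOnCl_ball Subset.rfl
  · exact ae_of_all _ fun t z hz => hdiff t z
      (hsub z hz (Metric.mem_closedBall_self (by positivity)))

lemma isOpen_upper : IsOpen {ρ : ℂ | 0 < ρ.im} := isOpen_lt continuous_const Complex.continuous_im

section Dependence

variable {E : Type*} [NormedRing E] [NormedAlgebra ℂ E]

/-- The modulated derivative `exp (-iρx) F₊'`. -/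
def jostG (Q : ℝ → E) (B : ℝ × ℝ → E) (ρ : ℂ) (x : ℝ) : E :=
  (2 * Complex.I * ρ) • (1 : E) - (Complex.I * ρ) • jostF B ρ x - jostH Q B ρ x

lemma jostSol'_eq (Q : ℝ → E) (B : ℝ × ℝ → E) (ρ : ℂ) (x : ℝ) :
    jostSol' Q B ρ x = Complex.exp (Complex.I * ρ * x) • jostG Q B ρ x := rfl

/-- The uniform bound for the tail integral `jostH`. -/
def tailMass (p : ℝ → ℝ) (c C x : ℝ) : ℝ := tail p x * (c + kernelMass p C x)

namespace IsJostKernel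

variable {Q : ℝ → E} {p : ℝ → ℝ} {B : ℝ × ℝ → E} {C : ℝ} (h : IsJostKernel Q p B C)
include h

lemma continuousOn_jostF_param (x : ℝ) :
    ContinuousOn (fun ρ => jostF B ρ x) {ρ : ℂ | 0 ≤ ρ.im} := by
  refine continuousOn_const.add (continuousOn_of_dominated (bound := fun z => ‖B (x, z)‖) ?_ ?_
    (h.integrableOn x).norm (ae_of_all _ fun z => Continuous.continuousOn (by fun_prop)))
  · exact fun ρ hρ => (h.integrableOn_exp_smul hρ x).aestronglyMeasurable
  · intro ρ hρ
    filter_upwards [ae_restrict_mem measurableSet_Ioi] with z hz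
    rw [norm_smul]
    exact mul_le_of_le_one_left (norm_nonneg _) (norm_exp_two_I_mul_le hρ (le_of_lt hz))

lemma differentiableOn_jostF_param (x : ℝ) :
    DifferentiableOn ℂ (fun ρ => jostF B ρ x) {ρ : ℂ | 0 < ρ.im} := by
  refine (differentiableOn_const _).add (differentiableOn_integral_of_bound
    (bound := fun z => ‖B (x, z)‖) isOpen_upper ?_ ?_ ?_ (h.integrableOn x).norm)
  · exact fun ρ hρ => (h.integrableOn_exp_smul (le_of_lt hρ) x).aestronglyMeasurable
  · exact fun t => Differentiable.differentiableOn (by fun_prop)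
  · filter_upwards [ae_restrict_mem measurableSet_Ioi] with z hz ρ hρ
    rw [norm_smul]
    exact mul_le_of_le_one_left (norm_nonneg _)
      (norm_exp_two_I_mul_le (le_of_lt hρ) (le_of_lt hz))

lemma norm_mul_jostF_le {ρ : ℂ} (hρ : 0 ≤ ρ.im) {x t : ℝ} (hxt : x ≤ t) :
    ‖Q t * jostF B ρ t‖ ≤ p t * (‖(1 : E)‖ + kernelMass p C x) := by
  refine (norm_mul_le _ _).trans (mul_le_mul (h.maj.le t) ((h.norm_jostF_le hρ t).trans ?_)
    (norm_nonneg _) (h.maj.pos t).le)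
  gcongr
  exact h.kernelMass_antitone hxt

lemma continuousOn_jostH_param (x : ℝ) :
    ContinuousOn (fun ρ => jostH Q B ρ x) {ρ : ℂ | 0 ≤ ρ.im} := by
  refine continuousOn_of_dominated (bound := fun t => p t * (‖(1 : E)‖ + kernelMass p C x)) ?_ ?_
    ((h.maj.integrableOn x).mul_const _) (ae_of_all _ fun t =>
      continuousOn_const.mul (h.continuousOn_jostF_param t))
  · exact fun ρ hρ => (h.integrableOn_mul_jostF hρ x).aestronglyMeasurable
  · intro ρ hρ
    filter_upwards [ae_restrict_mem measurableSet_Ioi] with t ht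
    exact h.norm_mul_jostF_le hρ (le_of_lt ht)

lemma differentiableOn_jostH_param (x : ℝ) :
    DifferentiableOn ℂ (fun ρ => jostH Q B ρ x) {ρ : ℂ | 0 < ρ.im} := by
  refine differentiableOn_integral_of_bound
    (bound := fun t => p t * (‖(1 : E)‖ + kernelMass p C x)) isOpen_upper ?_ ?_ ?_
    ((h.maj.integrableOn x).mul_const _)
  · exact fun ρ hρ => (h.integrableOn_mul_jostF (le_of_lt hρ) x).aestronglyMeasurable
  · exact fun t => (differentiableOn_const _).mul (h.differentiableOn_jostF_param t)
  · filter_upwards [ae_restrict_mem measurableSet_Ioi] with t ht ρ hρ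
    exact h.norm_mul_jostF_le (le_of_lt hρ) (le_of_lt ht)

lemma tailMass_antitone : Antitone (tailMass p ‖(1 : E)‖ C) := fun a b hab => by
  have h1 := h.maj.tail_antitone hab
  have h2 := h.kernelMass_antitone hab
  have h3 := h.kernelMass_nonneg b
  have h4 := (h.maj.tail_pos a).le
  unfold tailMass; gcongr

lemma tailMass_nonneg (x : ℝ) : 0 ≤ tailMass p ‖(1 : E)‖ C x :=
  mul_nonneg (h.maj.tail_pos x).le (add_nonneg (norm_nonneg _) (h.kernelMass_nonneg x))

lemma tendsto_tailMass : Tendsto (tailMass p ‖(1 : E)‖ C) atTop (𝓝 0) := by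
  have h1 : Tendsto (tail p) atTop (𝓝 0) := tendsto_integral_Ioi_atTop
  have := h1.mul (h.tendsto_kernelMass.const_add ‖(1 : E)‖)
  rwa [zero_mul] at this

lemma tendsto_jostF {ρ : ℂ} (hρ : 0 ≤ ρ.im) : Tendsto (jostF B ρ) atTop (𝓝 1) := by
  rw [tendsto_iff_norm_sub_tendsto_zero]
  exact squeeze_zero (fun _ => norm_nonneg _) (h.norm_jostF_sub_one_le hρ) h.tendsto_kernelMass

lemma tendsto_jostH {ρ : ℂ} (hρ : 0 ≤ ρ.im) : Tendsto (jostH Q B ρ) atTop (𝓝 0) :=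
  squeeze_zero_norm (h.norm_jostH_le hρ) h.tendsto_tailMass

lemma tendsto_jostG {ρ : ℂ} (hρ : 0 ≤ ρ.im) :
    Tendsto (jostG Q B ρ) atTop (𝓝 ((Complex.I * ρ) • (1 : E))) := by
  have := (((h.tendsto_jostF hρ).const_smul (Complex.I * ρ)).const_sub
    ((2 * Complex.I * ρ) • (1 : E))).sub (h.tendsto_jostH hρ)
  have e : (2 * Complex.I * ρ) • (1 : E) - (Complex.I * ρ) • (1 : E) - 0 =
    (Complex.I * ρ) • (1 : E) := by module
  rwa [e] at this

/-- Integration by parts in `jostF_eq`: the two boundary terms and the remaining integral against `Q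
f` are each at most `tailMass`, whence `2|ρ| ‖f - 1‖ ≤ 3 tailMass`. This is the `1/ρ` decay that
Jordan's lemma will need. -/
lemma norm_jostF_sub_one_le_div [CompleteSpace E] {ρ : ℂ} (hρ : 0 ≤ ρ.im) (x : ℝ) :
    ‖ρ‖ * ‖jostF B ρ x - 1‖ ≤ 2 * tailMass p ‖(1 : E)‖ C x := by
  set c := 2 * Complex.I * ρ with hc
  have hH := h.continuous_jostH hρ
  have hint : IntegrableOn (fun s : ℝ => Complex.exp (c * (s - x)) • jostH Q B ρ s) (Ioi x) :=
    h.integrableOn_exp_smul_jostH hρ x x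
  have hlim := (intervalIntegral_tendsto_integral_Ioi x hint tendsto_id).const_smul c
  have hval : ∫ s in Ioi x, Complex.exp (c * (s - x)) • jostH Q B ρ s = jostF B ρ x - 1 := by
    rw [h.jostF_eq hρ, add_sub_cancel_left]
  rw [hval] at hlim
  have hle : ‖c • (jostF B ρ x - 1)‖ ≤ 3 * tailMass p ‖(1 : E)‖ C x := by
    refine le_of_tendsto hlim.norm ?_
    filter_upwards [eventually_ge_atTop x] with b hb
    have he : ∀ s : ℝ, HasDerivAt (fun s : ℝ => Complex.exp (c * (s - x)) • (1 : E))
        ((c * Complex.exp (c * (s - x))) • (1 : E)) s := fun s => by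
      have := (hasDerivAt_cexp_mul c (s - x)).comp_sub_const s x
      push_cast at this
      exact this.smul_const 1
    have hcd : Continuous fun s : ℝ => (c * Complex.exp (c * (s - x))) • (1 : E) := by fun_prop
    have hr : ∀ a b, IntervalIntegrable (fun t => -(Q t * jostF B ρ t)) volume a b := fun a b =>
      (h.maj.integrableQ.intervalIntegrable.mul_continuousOn (h.continuous_jostF hρ).continuousOn).neg
    have h1 := mul_sub_mul_eq_integral (fun a b => hcd.intervalIntegrable a b) hr
      (fun a b => (intervalIntegral.integral_eq_sub_of_hasDerivAt (fun x _ => he x)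
        (hcd.intervalIntegrable _ _)).symm) (h.jostH_sub hρ) x b
    have i1 : IntervalIntegrable (fun s : ℝ => (c * Complex.exp (c * (s - x))) • (1 : E) *
        jostH Q B ρ s) volume x b := (hcd.mul hH).intervalIntegrable _ _
    have i2 : IntervalIntegrable (fun s : ℝ => Complex.exp (c * (s - x)) • (1 : E) *
        -(Q s * jostF B ρ s)) volume x b :=
      (hr x b).continuousOn_mul (Continuous.continuousOn (by fun_prop))
    rw [intervalIntegral.integral_add i1 i2] at h1
    have h2 : c • ∫ s in x..b, Complex.exp (c * (s - x)) • jostH Q B ρ s =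
        Complex.exp (c * (b - x)) • jostH Q B ρ b - jostH Q B ρ x +
        ∫ s in x..b, Complex.exp (c * (s - x)) • (Q s * jostF B ρ s) := by
      rw [← intervalIntegral.integral_smul]
      simp only [smul_mul_assoc, one_mul, mul_neg, sub_self, mul_zero, Complex.exp_zero,
        one_smul, intervalIntegral.integral_neg] at h1
      rw [h1]
      simp only [smul_smul]
      abel
    have hexp : ∀ s, x ≤ s → ‖Complex.exp (c * (s - x))‖ ≤ 1 := fun s hs => by
      rw [← Complex.ofReal_sub]
      exact norm_exp_two_I_mul_le hρ (sub_nonneg.2 hs)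
    have b1 : ‖Complex.exp (c * (b - x)) • jostH Q B ρ b‖ ≤ tailMass p ‖(1 : E)‖ C x := by
      rw [norm_smul]
      exact (mul_le_of_le_one_left (norm_nonneg _) (hexp b hb)).trans
        ((h.norm_jostH_le hρ b).trans (h.tailMass_antitone hb))
    have b2 : ‖jostH Q B ρ x‖ ≤ tailMass p ‖(1 : E)‖ C x := h.norm_jostH_le hρ x
    have b3 : ‖∫ s in x..b, Complex.exp (c * (s - x)) • (Q s * jostF B ρ s)‖ ≤
        tailMass p ‖(1 : E)‖ C x := by
      have hpi : IntegrableOn (fun s => p s * (‖(1 : E)‖ + kernelMass p C x)) (Ioi x) :=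
        (h.maj.integrableOn x).mul_const _
      rw [intervalIntegral.integral_of_le hb, tailMass, tail, ← integral_mul_const]
      refine (norm_integral_le_of_norm_le (hpi.mono_set Ioc_subset_Ioi_self) ?_).trans
        (setIntegral_mono_set hpi (ae_of_all _ fun s => mul_nonneg (h.maj.pos s).le
          (add_nonneg (norm_nonneg _) (h.kernelMass_nonneg x))) Ioc_subset_Ioi_self.eventuallyLE)
      filter_upwards [ae_restrict_mem measurableSet_Ioc] with s hs
      rw [norm_smul]
      exact (mul_le_of_le_one_left (norm_nonneg _) (hexp s hs.1.le)).trans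
        (h.norm_mul_jostF_le hρ hs.1.le)
    simp only [id]
    rw [h2]
    calc _ ≤ _ := norm_add_le _ _
      _ ≤ _ := add_le_add (norm_sub_le _ _) le_rfl
      _ ≤ _ := by linarith
  have hcn : ‖c‖ = 2 * ‖ρ‖ := by simp [hc]
  rw [norm_smul, hcn] at hle
  have := h.tailMass_nonneg x
  linarith

end IsJostKernel

end Dependence

/-! ### Wronskian characterisation and uniqueness of the Jost solution -/

section Kernel

variable {E : Type*} [CStarAlgebra E] {Q : ℝ → E} {p : ℝ → ℝ} {B : ℝ × ℝ → E} {C : ℝ}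

lemma neg_conj_im (ρ : ℂ) : (-(starRingEnd ℂ ρ)).im = ρ.im := by simp

lemma neg_conj_sq (ρ : ℂ) : (-(starRingEnd ℂ ρ)) ^ 2 = starRingEnd ℂ (ρ ^ 2) := by simp

lemma star_exp_neg_conj (ρ : ℂ) (x : ℝ) :
    star (Complex.exp (Complex.I * (-(starRingEnd ℂ ρ)) * x)) = Complex.exp (Complex.I * ρ * x) := by
  rw [Complex.star_def, ← Complex.exp_conj]
  simp

lemma norm_exp_I_mul_le {ρ : ℂ} (hρ : 0 ≤ ρ.im) {x : ℝ} (hx : 0 ≤ x) :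
    ‖Complex.exp (Complex.I * ρ * x)‖ ≤ 1 := by
  rw [Complex.norm_exp, Real.exp_le_one_iff]
  have : (Complex.I * ρ * x).re = -(ρ.im * x) := by simp
  rw [this]
  have := mul_nonneg hρ hx
  linarith

namespace IsJostKernel

variable (h : IsJostKernel Q p B C)
include h

lemma sol_neg_conj {ρ : ℂ} (hρ : 0 ≤ ρ.im) : Sol Q (starRingEnd ℂ (ρ ^ 2))
    (jostSol B (-(starRingEnd ℂ ρ))) (jostSol' Q B (-(starRingEnd ℂ ρ))) := by
  rw [← neg_conj_sq]
  exact h.sol_jostSol (by rwa [neg_conj_im])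

/-- The Wronskian of the Jost solution with its adjoint partner vanishes. -/
lemma wr_self (hs : ∀ᵐ x, IsSelfAdjoint (Q x)) {ρ : ℂ} (hρ : 0 ≤ ρ.im) (x : ℝ) :
    wr (jostSol B (-(starRingEnd ℂ ρ))) (jostSol' Q B (-(starRingEnd ℂ ρ)))
      (jostSol B ρ) (jostSol' Q B ρ) x = 0 := by
  have hρ' : 0 ≤ (-(starRingEnd ℂ ρ)).im := by rwa [neg_conj_im]
  set σ := -(starRingEnd ℂ ρ) with hσ
  set W := wr (jostSol B σ) (jostSol' Q B σ) (jostSol B ρ) (jostSol' Q B ρ) with hW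
  have hconst : ∀ y, W y = W x := fun y =>
    (h.sol_neg_conj hρ).wr_const (h.sol_jostSol hρ) h.maj.integrableQ hs x y
  have hWy : ∀ y, W y = (Complex.exp (Complex.I * ρ * y) * Complex.exp (Complex.I * ρ * y)) •
      (star (jostG Q B σ y) * jostF B ρ y - star (jostF B σ y) * jostG Q B ρ y) := fun y => by
    rw [hW]
    simp only [wr, jostSol, jostSol'_eq, star_smul]
    rw [hσ, star_exp_neg_conj]
    simp only [smul_mul_assoc, mul_smul_comm, smul_smul, smul_sub]
  have hlim : Tendsto (fun y => star (jostG Q B σ y) * jostF B ρ y -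
      star (jostF B σ y) * jostG Q B ρ y) atTop (𝓝 0) := by
    have h1 := ((continuous_star.tendsto _).comp (h.tendsto_jostG hρ')).mul (h.tendsto_jostF hρ)
    have h2 := ((continuous_star.tendsto _).comp (h.tendsto_jostF hρ')).mul (h.tendsto_jostG hρ)
    have h3 := h1.sub h2
    -- For `σ = -ρ̄` the adjoint of `iσ` is `iρ`, so the leading terms cancel; the outer factor
    -- `e^{2iρy}` is bounded for `y ≥ 0`.
    have e : star ((Complex.I * σ) • (1 : E)) * 1 - star (1 : E) * (Complex.I * ρ) • (1 : E) = 0 := by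
      rw [hσ, star_smul, star_one]
      simp
    rwa [e] at h3
  have hz : Tendsto W atTop (𝓝 0) := by
    refine squeeze_zero_norm' ?_ (tendsto_zero_iff_norm_tendsto_zero.1 hlim)
    filter_upwards [eventually_ge_atTop 0] with y hy
    rw [hWy, norm_smul, norm_mul]
    have := norm_exp_I_mul_le hρ hy
    exact mul_le_of_le_one_left (norm_nonneg _) (mul_le_one₀ this (norm_nonneg _) this)
  have : Tendsto W atTop (𝓝 (W x)) := tendsto_const_nhds.congr fun y => (hconst y).symm
  exact tendsto_nhds_unique this hz

lemma isUnit_jostF {ρ : ℂ} (hρ : 0 ≤ ρ.im) {x : ℝ} (hx : kernelMass p C x < 1) :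
    IsUnit (jostF B ρ x) := by
  have h1 : ‖1 - jostF B ρ x‖ < 1 := by
    rw [norm_sub_rev]; exact (h.norm_jostF_sub_one_le hρ x).trans_lt hx
  simpa using isUnit_one_sub_of_norm_lt_one h1

lemma isUnit_jostSol {ρ : ℂ} (hρ : 0 ≤ ρ.im) {x : ℝ} (hx : kernelMass p C x < 1) :
    IsUnit (jostSol B ρ x) := by
  have : jostSol B ρ x = algebraMap ℂ E (Complex.exp (Complex.I * ρ * x)) * jostF B ρ x := by
    rw [jostSol, Algebra.smul_def]
  rw [this]
  exact ((IsUnit.mk0 _ (Complex.exp_ne_zero _)).map (algebraMap ℂ E)).mul (h.isUnit_jostF hρ hx)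

lemma exists_kernelMass_lt {ε : ℝ} (hε : 0 < ε) : ∃ X, ∀ x, X ≤ x → kernelMass p C x < ε :=
  eventually_atTop.1 (h.tendsto_kernelMass.eventually (gt_mem_nhds hε))

/-- A solution with vanishing Wronskian against the adjoint Jost solution is a multiple of the
Jost solution. -/
lemma eq_mul_of_wr_eq_zero (hs : ∀ᵐ x, IsSelfAdjoint (Q x)) {ρ : ℂ} (hρ : 0 ≤ ρ.im)
    {Y Y' : ℝ → E} (hY : Sol Q (ρ ^ 2) Y Y') {x₀ : ℝ}
    (hw : wr (jostSol B (-(starRingEnd ℂ ρ))) (jostSol' Q B (-(starRingEnd ℂ ρ))) Y Y' x₀ = 0) :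
    ∃ a, ∀ x, Y x = jostSol B ρ x * a := by
  have hQ := h.maj.integrableQ
  have hρ' : 0 ≤ (-(starRingEnd ℂ ρ)).im := by rwa [neg_conj_im]
  obtain ⟨X, hX⟩ := h.exists_kernelMass_lt one_pos
  -- Far to the right both Jost solutions are invertible; `u⁻¹ Y(X)` is the only multiple that
  -- matches `Y` at `X`.
  obtain ⟨u, hu⟩ := h.isUnit_jostSol hρ (hX X le_rfl)
  obtain ⟨v, hv⟩ := h.isUnit_jostSol hρ' (hX X le_rfl)
  have hF := (h.sol_jostSol hρ).mul_const hQ (↑u⁻¹ * Y X)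
  have hZ := hY.sub hF hQ
  have hwX := (h.sol_neg_conj hρ).wr_const hY hQ hs x₀ X
  have hwF := h.wr_self hs hρ X
  rw [hw] at hwX
  have hZ0 : (Y - fun x => jostSol B ρ x * (↑u⁻¹ * Y X)) X = 0 := by
    simp [← hu]
  -- The value of the difference vanishes at `X`, so its zero Wronskian is minus an invertible
  -- factor times its derivative there.
  have hZ0' : (Y' - fun x => jostSol' Q B ρ x * (↑u⁻¹ * Y X)) X = 0 := by
    have h1 : wr (jostSol B (-(starRingEnd ℂ ρ))) (jostSol' Q B (-(starRingEnd ℂ ρ)))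
        (Y - fun x => jostSol B ρ x * (↑u⁻¹ * Y X))
        (Y' - fun x => jostSol' Q B ρ x * (↑u⁻¹ * Y X)) X = 0 := by
      simp only [wr, Pi.sub_apply, mul_sub, ← mul_assoc] at hwX hwF ⊢
      have : ∀ a b c d : E, a - b - (c - d) = a - c - (b - d) := fun a b c d => by abel
      rw [this, hwX, ← sub_mul, ← sub_mul, hwF]
      simp
    rw [wr, hZ0, mul_zero, zero_sub, neg_eq_zero, ← hv, ← Units.coe_star, Units.mul_right_eq_zero] at h1
    exact h1
  refine ⟨↑u⁻¹ * Y X, fun x => ?_⟩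
  have := hZ.eq_zero hQ hZ0 hZ0' x
  simpa [sub_eq_zero] using this

/-- The Wronskian against the adjoint Jost solution vanishes for solutions that are small in mean
at infinity. -/
lemma wr_eq_zero_of_tendsto (hs : ∀ᵐ x, IsSelfAdjoint (Q x)) {ρ : ℂ} (hρ : 0 ≤ ρ.im)
    {Y Y' : ℝ → E} (hY : Sol Q (ρ ^ 2) Y Y')
    (hsmall : Tendsto (fun X : ℝ => ∫ t in X..(X + 1), ‖Y t‖) atTop (𝓝 0)) (x : ℝ) :
    wr (jostSol B (-(starRingEnd ℂ ρ))) (jostSol' Q B (-(starRingEnd ℂ ρ))) Y Y' x = 0 := by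
  have hQ := h.maj.integrableQ
  have hρ' : 0 ≤ (-(starRingEnd ℂ ρ)).im := by rwa [neg_conj_im]
  have hZ := h.sol_neg_conj hρ
  have hconst := hZ.wr_const hY hQ hs x
  set σ := -(starRingEnd ℂ ρ) with hσ
  set Z := jostSol B σ
  set Z' := jostSol' Q B σ
  set c := wr Z Z' Y Y' x with hc
  have hZc : Continuous fun t => star (Z t) := continuous_star.comp hZ.continuous
  have hZc' : Continuous fun t => star (Z' t) := continuous_star.comp (hZ.continuous_deriv hQ)
  have hYc := hY.continuous
  have hYc' := hY.continuous_deriv hQ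
  -- The constant Wronskian is averaged against the bump `(t - X)(X + 1 - t)`, whose integral is
  -- 1/6. Adding the total derivative of bump times `Z^* Y`, which integrates to zero, eliminates
  -- `Y'`, for which no bound is available.
  have hid : ∀ X : ℝ, (1 / 6 : ℝ) • c = ∫ t in X..(X + 1),
      ((2 * ((t - X) * (X + 1 - t))) • star (Z' t) + (2 * X + 1 - 2 * t) • star (Z t)) * Y t := by
    intro X
    have hφ : ∀ t : ℝ, HasDerivAt (fun t : ℝ => (t - X) * (X + 1 - t)) (2 * X + 1 - 2 * t) t := by
      intro t
      refine (((hasDerivAt_id t).sub_const X).mul ((hasDerivAt_id t).const_sub (X + 1))).congr_deriv ?_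
      simp only [id]; ring
    have hprod : ∀ t : ℝ, HasDerivAt (fun t : ℝ => ((t - X) * (X + 1 - t)) • (star (Z t) * Y t))
        (((t - X) * (X + 1 - t)) • (star (Z' t) * Y t + star (Z t) * Y' t) +
          (2 * X + 1 - 2 * t) • (star (Z t) * Y t)) t := fun t =>
      (hφ t).smul ((hZ.hasDerivAt t).star.mul (hY.hasDerivAt t))
    have hz := intervalIntegral.integral_eq_sub_of_hasDerivAt (fun t _ => hprod t)
      (Continuous.intervalIntegrable (by fun_prop) X (X + 1))
    simp only [sub_self, zero_mul, zero_smul, mul_zero] at hz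
    have h6 : ∫ t in X..(X + 1), (t - X) * (X + 1 - t) = 1 / 6 := by
      have hp : ∀ t : ℝ, HasDerivAt (fun t : ℝ => (t - X) ^ 2 / 2 - (t - X) ^ 3 / 3)
          ((t - X) * (X + 1 - t)) t := fun t => by
        have hd := (hasDerivAt_id t).sub_const X
        refine (((hd.pow 2).div_const 2).sub ((hd.pow 3).div_const 3)).congr_deriv ?_
        simp only [id]; push_cast; ring
      rw [intervalIntegral.integral_eq_sub_of_hasDerivAt (fun t _ => hp t)
        (Continuous.intervalIntegrable (by fun_prop) _ _)]
      ring
    have hcint : ∫ t in X..(X + 1), ((t - X) * (X + 1 - t)) • wr Z Z' Y Y' t = (1 / 6 : ℝ) • c := by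
      simp only [hconst]
      rw [intervalIntegral.integral_smul_const, h6]
    have hwc : Continuous (wr Z Z' Y Y') := (hZc'.mul hYc).sub (hZc.mul hYc')
    rw [← hcint, ← add_zero (∫ t in X..(X + 1), ((t - X) * (X + 1 - t)) • wr Z Z' Y Y' t), ← hz,
      ← intervalIntegral.integral_add (Continuous.intervalIntegrable (by fun_prop) _ _)
        (Continuous.intervalIntegrable (by fun_prop) _ _)]
    refine intervalIntegral.integral_congr fun t _ => ?_
    simp only [wr, add_mul, smul_mul_assoc]
    module
  set M := ‖(1 : E)‖ + kernelMass p C 0 with hM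
  have hZb : ∀ t, 0 ≤ t → ‖Z t‖ ≤ M := fun t ht => by
    simp only [Z, jostSol, norm_smul]
    refine (mul_le_of_le_one_left (norm_nonneg _) (norm_exp_I_mul_le hρ' ht)).trans
      ((h.norm_jostF_le hρ' t).trans ?_)
    have := h.kernelMass_antitone ht
    simp only [M]; linarith
  obtain ⟨M', hM'⟩ : ∃ M', ∀ᶠ t in atTop, ‖Z' t‖ ≤ M' := by
    refine ⟨‖(Complex.I * σ) • (1 : E)‖ + 1, ?_⟩
    filter_upwards [(h.tendsto_jostG hρ').norm.eventually (gt_mem_nhds (lt_add_one _)),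
      eventually_ge_atTop 0] with t ht ht0
    simp only [Z', jostSol'_eq, norm_smul]
    exact (mul_le_of_le_one_left (norm_nonneg _) (norm_exp_I_mul_le hρ' ht0)).trans
      (by simpa [norm_smul] using ht.le)
  obtain ⟨T, hT⟩ := eventually_atTop.1 (hM'.and (eventually_ge_atTop 0))
  have hbound : ∀ᶠ X in atTop, ‖(1 / 6 : ℝ) • c‖ ≤ (2 * M' + M) * ∫ t in X..(X + 1), ‖Y t‖ := by
    filter_upwards [eventually_ge_atTop T] with X hX
    rw [hid X, ← intervalIntegral.integral_const_mul]
    refine intervalIntegral.norm_integral_le_of_norm_le (by linarith) (ae_of_all _ fun t ht => ?_)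
      (Continuous.intervalIntegrable (by fun_prop) _ _)
    obtain ⟨h1, h2⟩ := hT t (hX.trans ht.1.le)
    have h3 := hZb t h2
    refine (norm_mul_le _ _).trans (mul_le_mul_of_nonneg_right ((norm_add_le _ _).trans ?_)
      (norm_nonneg _))
    rw [norm_smul, norm_smul, norm_star, norm_star]
    have a1 : ‖2 * ((t - X) * (X + 1 - t))‖ ≤ 2 := by
      rw [Real.norm_eq_abs, abs_le]
      constructor <;> nlinarith [ht.1, ht.2]
    have a2 : ‖2 * X + 1 - 2 * t‖ ≤ 1 := by
      rw [Real.norm_eq_abs, abs_le]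
      constructor <;> linarith [ht.1, ht.2]
    exact add_le_add (mul_le_mul a1 h1 (norm_nonneg _) zero_le_two)
      ((mul_le_mul a2 h3 (norm_nonneg _) zero_le_one).trans (one_mul M).le)
  have hlim := ge_of_tendsto (hsmall.const_mul (2 * M' + M)) hbound
  rw [mul_zero] at hlim
  have := norm_le_zero_iff.1 hlim
  simpa using this

/-- Solutions that are small in mean at infinity are multiples of the Jost solution. -/
lemma eq_mul_of_tendsto (hs : ∀ᵐ x, IsSelfAdjoint (Q x)) {ρ : ℂ} (hρ : 0 ≤ ρ.im)
    {Y Y' : ℝ → E} (hY : Sol Q (ρ ^ 2) Y Y')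
    (hsmall : Tendsto (fun X : ℝ => ∫ t in X..(X + 1), ‖Y t‖) atTop (𝓝 0)) :
    ∃ a, ∀ x, Y x = jostSol B ρ x * a :=
  h.eq_mul_of_wr_eq_zero hs hρ hY (h.wr_eq_zero_of_tendsto hs hρ hY hsmall 0)

omit h in
lemma tendsto_integral_norm_of_tendsto {Y : ℝ → E} (hYc : Continuous Y)
    (hY : Tendsto Y atTop (𝓝 0)) :
    Tendsto (fun X : ℝ => ∫ t in X..(X + 1), ‖Y t‖) atTop (𝓝 0) := by
  rw [Metric.tendsto_atTop]
  intro ε hε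
  obtain ⟨T, hT⟩ := eventually_atTop.1 ((tendsto_zero_iff_norm_tendsto_zero.1 hY).eventually
    (gt_mem_nhds (half_pos hε)))
  refine ⟨T, fun X hX => ?_⟩
  have h0 : 0 ≤ ∫ t in X..(X + 1), ‖Y t‖ :=
    intervalIntegral.integral_nonneg (by linarith) fun t _ => norm_nonneg _
  have h1 : ∫ t in X..(X + 1), ‖Y t‖ ≤ ∫ t in X..(X + 1), ε / 2 :=
    intervalIntegral.integral_mono_on (by linarith) (hYc.norm.intervalIntegrable _ _)
      intervalIntegrable_const fun t ht => (hT t (hX.trans ht.1)).le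
  rw [Real.dist_eq, sub_zero, abs_of_nonneg h0]
  simp at h1
  linarith

/-- Uniqueness of the Jost solution. -/
lemma eq_zero_of_tendsto (hs : ∀ᵐ x, IsSelfAdjoint (Q x)) {ρ : ℂ} (hρ : 0 ≤ ρ.im)
    {Y Y' : ℝ → E} (hY : Sol Q (ρ ^ 2) Y Y')
    (hlim : Tendsto (fun x : ℝ => Complex.exp (-(Complex.I * ρ * x)) • Y x) atTop (𝓝 0)) (x : ℝ) :
    Y x = 0 := by
  have hY0 : Tendsto Y atTop (𝓝 0) := by
    refine squeeze_zero_norm' ?_ (tendsto_zero_iff_norm_tendsto_zero.1 hlim)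
    filter_upwards [eventually_ge_atTop 0] with t ht
    have h1 : Y t = Complex.exp (Complex.I * ρ * t) •
        (Complex.exp (-(Complex.I * ρ * t)) • Y t) := by
      rw [smul_smul, ← Complex.exp_add, add_neg_cancel, Complex.exp_zero, one_smul]
    conv_lhs => rw [h1, norm_smul]
    exact mul_le_of_le_one_left (norm_nonneg _) (norm_exp_I_mul_le hρ ht)
  obtain ⟨a, ha⟩ := h.eq_mul_of_tendsto hs hρ hY (tendsto_integral_norm_of_tendsto hY.continuous hY0)
  have h1 : Tendsto (fun x => jostF B ρ x * a) atTop (𝓝 0) := by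
    refine hlim.congr fun t => ?_
    rw [ha, jostSol, smul_mul_assoc, smul_smul, ← Complex.exp_add, neg_add_cancel,
      Complex.exp_zero, one_smul]
  have h2 := (h.tendsto_jostF hρ).mul_const a
  have : a = 0 := by simpa using (tendsto_nhds_unique h1 h2).symm
  rw [ha, this, mul_zero]

end IsJostKernel

end Kernel

end

/-! ### Passage from the abstract algebra to matrix and vector solutions -/

section

variable {m : ℕ}

/-- The `j`-th column of a matrix, as a continuous linear map. -/
def colL (j : Fin m) : Mat m →L[ℂ] (Fin m → ℂ) :=
  LinearMap.toContinuousLinearMap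
    { toFun := fun M i => M i j
      map_add' := fun _ _ => rfl
      map_smul' := fun _ _ => rfl }

lemma colL_mul (j : Fin m) (M N : Mat m) : colL j (M * N) = M *ᵥ colL j N := rfl

lemma colL_smul (j : Fin m) (c : ℂ) (M : Mat m) : colL j (c • M) = c • colL j M := rfl

lemma ext_colL {M N : Mat m} (h : ∀ j, colL j M = colL j N) : M = N := by
  ext i j
  exact congrFun (h j) i

lemma matrix_eq_sum_smul_single (M : Mat m) :
    M = ∑ i, ∑ j, M i j • Matrix.single i j (1 : ℂ) := by
  conv_lhs => rw [Matrix.matrix_eq_sum_single M]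
  simp

lemma hasDerivAt_of_colL {F : ℝ → Mat m} {F' : Mat m} {x : ℝ}
    (h : ∀ j, HasDerivAt (fun x => colL j (F x)) (colL j F') x) : HasDerivAt F F' x := by
  have h1 : ∀ i j, HasDerivAt (fun x => F x i j) (F' i j) x := fun i j =>
    (hasDerivAt_pi.1 (h j)) i
  rw [matrix_eq_sum_smul_single F', show F = fun x => ∑ i, ∑ j, F x i j • Matrix.single i j (1 : ℂ)
    from funext fun x => matrix_eq_sum_smul_single (F x)]
  exact HasDerivAt.fun_sum fun i _ => HasDerivAt.fun_sum fun j _ => (h1 i j).smul_const _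

lemma hasDerivAt_colL {F : ℝ → Mat m} {F' : Mat m} {x : ℝ} (j : Fin m) (h : HasDerivAt F F' x) :
    HasDerivAt (fun x => colL j (F x)) (colL j F') x :=
  ((colL j).restrictScalars ℝ).hasFDerivAt.comp_hasDerivAt x h

lemma Sol.isMatrixSolution {Q : ℝ → Mat m} (hQ : Integrable Q) {lam : ℂ} {F F' : ℝ → Mat m}
    (h : Sol Q lam F F') : IsMatrixSolution Q lam F := by
  intro j
  have hd : ∀ x, HasDerivAt (fun x => colL j (F x)) (colL j (F' x)) x := fun x =>
    hasDerivAt_colL j (h.hasDerivAt x)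
  refine ⟨fun x => (hd x).differentiableAt, fun a b => ?_⟩
  change deriv (fun x => colL j (F x)) b - deriv (fun x => colL j (F x)) a = _
  rw [(hd b).deriv, (hd a).deriv, ← map_sub, h.sub_eq,
    ← ContinuousLinearMap.intervalIntegral_comp_comm _ (h.intervalIntegrable hQ a b)]
  simp only [map_sub, colL_mul, colL_smul]
  rfl

/-- The derivative is assembled from the derivatives of the columns; this brings the columnwise
definition of a solution into the ring-valued setting of `Sol`. -/
lemma IsMatrixSolution.exists_sol {Q : ℝ → Mat m} (hQ : Integrable Q) {lam : ℂ} {F : ℝ → Mat m}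
    (h : IsMatrixSolution Q lam F) : ∃ F', Sol Q lam F F' := by
  have hd : ∀ x, HasDerivAt F (Matrix.of fun i j => deriv (fun x i => F x i j) x i) x := fun x =>
    hasDerivAt_of_colL fun j => ((h j).1 x).hasDerivAt
  have hF : Continuous F := continuous_iff_continuousAt.2 fun x => (hd x).continuousAt
  refine ⟨_, hd, fun a b => ext_colL fun j => ?_⟩
  have hi : IntervalIntegrable (fun t => Q t * F t - lam • F t) volume a b :=
    (hQ.intervalIntegrable.mul_continuousOn hF.continuousOn).sub
      ((hF.const_smul lam).intervalIntegrable _ _)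
  rw [← ContinuousLinearMap.intervalIntegral_comp_comm _ hi]
  simp only [map_sub, colL_mul, colL_smul]
  exact (h j).2 a b

/-- A vector as a matrix with equal columns. -/
def spread (v : Fin m → ℂ) : Mat m := Matrix.of fun i _ => v i

/-- Repeating a vector solution in every column lets the matrix theory apply to eigenfunctions. -/
lemma IsSolution.spread {Q : ℝ → Mat m} {lam : ℂ} {y : ℝ → Fin m → ℂ} (h : IsSolution Q lam y) :
    IsMatrixSolution Q lam fun x => spread (y x) := fun _ => h

/-- The potential reflected at the origin. -/
abbrev reflect {E : Type*} (Q : ℝ → E) : ℝ → E := fun x => Q (-x)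

lemma reflect_reflect {E : Type*} (Q : ℝ → E) : reflect (reflect Q) = Q := by
  funext x; simp [reflect]

/-- The standing assumptions on the potential. -/
structure Pot (Q : ℝ → Mat m) : Prop where
  herm : ∀ᵐ x, (Q x).IsHermitian
  int : Integrable fun x : ℝ => (1 + |x|) • Q x

variable {Q : ℝ → Mat m}

lemma ae_comp_neg {P : ℝ → Prop} (h : ∀ᵐ x, P x) : ∀ᵐ x : ℝ, P (-x) :=
  (Measure.measurePreserving_neg (volume : Measure ℝ)).quasiMeasurePreserving.ae h

namespace Pot

lemma refl (h : Pot Q) : Pot (reflect Q) :=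
  ⟨ae_comp_neg h.herm, by simpa using h.int.comp_neg⟩

lemma isSelfAdjoint (h : Pot Q) : ∀ᵐ x, IsSelfAdjoint (Q x) := h.herm

lemma integrable (h : Pot Q) : Integrable Q := by
  obtain ⟨p, hp⟩ := exists_majorant h.int
  exact hp.integrableQ

/-- The difference of two candidates is a solution that tends to zero after multiplication by
`e^{-iρx}`, and such a solution vanishes. -/
lemma existsUnique_isJostPlus (h : Pot Q) {p : ℝ → ℝ} {B : ℝ × ℝ → Mat m} {C : ℝ}
    (hB : IsJostKernel Q p B C) {ρ : ℂ} (hρ : 0 ≤ ρ.im) :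
    IsJostPlus Q ρ (jostSol B ρ) ∧ ∀ F, IsJostPlus Q ρ F → F = jostSol B ρ := by
  have h1 : Tendsto (fun x : ℝ => Complex.exp (-(Complex.I * ρ * x)) • jostSol B ρ x) atTop
      (𝓝 1) := by
    refine (hB.tendsto_jostF hρ).congr fun x => ?_
    rw [jostSol, smul_smul, ← Complex.exp_add, neg_add_cancel, Complex.exp_zero, one_smul]
  refine ⟨⟨(hB.sol_jostSol hρ).isMatrixSolution h.integrable, h1⟩, fun F hF => ?_⟩
  obtain ⟨F', hF'⟩ := hF.1.exists_sol h.integrable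
  have h2 := hF'.sub (hB.sol_jostSol hρ) h.integrable
  funext x
  refine sub_eq_zero.1 (hB.eq_zero_of_tendsto h.isSelfAdjoint hρ h2 ?_ x)
  have := hF.2.sub h1
  simp only [sub_self, ← smul_sub] at this
  exact this

/-- The Jost solutions at `+∞` are given by a single kernel. -/
lemma exists_jost (h : Pot Q) : ∃ (p : ℝ → ℝ) (B : ℝ × ℝ → Mat m) (C : ℝ),
    IsJostKernel Q p B C ∧ ∀ ρ : ℂ, 0 ≤ ρ.im → jostPlus Q ρ = jostSol B ρ := by
  obtain ⟨p, hp⟩ := exists_majorant h.int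
  obtain ⟨B, C, hC, hB, hb, he⟩ := hp.exists_kernel
  have hk : IsJostKernel Q p B C := ⟨hp, hC, hB, hb, he⟩
  refine ⟨p, B, C, hk, fun ρ hρ => (h.existsUnique_isJostPlus hk hρ).2 _ ?_⟩
  exact Classical.epsilon_spec (p := IsJostPlus Q ρ) ⟨_, (h.existsUnique_isJostPlus hk hρ).1⟩

lemma existsUnique_jostPlus (h : Pot Q) {ρ : ℂ} (hρ : 0 ≤ ρ.im) : ∃! F, IsJostPlus Q ρ F := by
  obtain ⟨p, B, C, hB, -⟩ := h.exists_jost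
  exact ⟨_, (h.existsUnique_isJostPlus hB hρ).1, (h.existsUnique_isJostPlus hB hρ).2⟩

end Pot

lemma IsMatrixSolution.comp_neg (hQ : Integrable Q) {lam : ℂ} {F : ℝ → Mat m}
    (h : IsMatrixSolution Q lam F) :
    IsMatrixSolution (reflect Q) lam fun x => F (-x) := by
  obtain ⟨F', hF'⟩ := h.exists_sol hQ
  exact hF'.comp_neg.isMatrixSolution hQ.comp_neg

/-- The basis of the reflection principle: every later statement about the left end is the right-end
statement for the reflected potential. -/
lemma isJostMinus_iff (hQ : Integrable Q) (ρ : ℂ) (F : ℝ → Mat m) :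
    IsJostMinus Q ρ F ↔ IsJostPlus (reflect Q) ρ fun x => F (-x) := by
  have e : ∀ x : ℝ, Complex.exp (-(Complex.I * ρ * x)) • F (-x) =
      (fun x : ℝ => Complex.exp (Complex.I * ρ * x) • F x) (-x) := fun x => by simp
  constructor
  · intro hF
    refine ⟨hF.1.comp_neg hQ, ?_⟩
    simp only [e]
    exact hF.2.comp tendsto_neg_atTop_atBot
  · intro hF
    have h1 := IsMatrixSolution.comp_neg (Q := reflect Q) hQ.comp_neg hF.1
    rw [reflect_reflect] at h1
    refine ⟨by simpa using h1, ?_⟩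
    have := hF.2.comp tendsto_neg_atBot_atTop
    simpa [Function.comp_def] using this

namespace Pot

lemma existsUnique_jostMinus (h : Pot Q) {ρ : ℂ} (hρ : 0 ≤ ρ.im) : ∃! F, IsJostMinus Q ρ F := by
  obtain ⟨F, hF, hu⟩ := h.refl.existsUnique_jostPlus hρ
  refine ⟨fun x => F (-x), (isJostMinus_iff h.integrable _ _).2 (by simpa using hF),
    fun G hG => ?_⟩
  rw [← hu _ ((isJostMinus_iff h.integrable _ _).1 hG)]
  simp

lemma jostMinus_eq (h : Pot Q) {ρ : ℂ} (hρ : 0 ≤ ρ.im) (x : ℝ) :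
    jostMinus Q ρ x = jostPlus (reflect Q) ρ (-x) := by
  have h1 : IsJostMinus Q ρ (jostMinus Q ρ) :=
    Classical.epsilon_spec (h.existsUnique_jostMinus hρ).exists
  have h2 : IsJostPlus (reflect Q) ρ (jostPlus (reflect Q) ρ) :=
    Classical.epsilon_spec (h.refl.existsUnique_jostPlus hρ).exists
  have h3 := (h.refl.existsUnique_jostPlus hρ).unique h2 ((isJostMinus_iff h.integrable _ _).1 h1)
  rw [h3]
  simp

/-- The substitution `z = (t - x)/2` is undone, with Jacobian 1/2. The bound on `K x`, valid for all
`t`, is what later makes the kernel square integrable. -/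
lemma exists_isKernelPlus (h : Pot Q) : ∃ K, IsKernelPlus Q K ∧
    Continuous (fun q : ℝ × ℝ => K q.1 q.2) ∧ (∀ x, ∃ c, ∀ t, ‖K x t‖ ≤ c) := by
  obtain ⟨p, B, C, hB, hJ⟩ := h.exists_jost
  have hBc := hB.cont
  have hsc : ∀ x (φ : ℝ → Mat m),
      ∫ t in Ioi x, (2⁻¹ : ℝ) • φ ((t - x) / 2) = ∫ z in Ioi (0 : ℝ), φ z := fun x φ => by
    rw [← integral_Ioi_zero_comp_add]
    have := integral_comp_mul_left_Ioi φ 0 (show (0:ℝ) < 2⁻¹ by norm_num)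
    simp only [add_sub_cancel_left, integral_smul, div_eq_inv_mul]
    rw [this]
    simp [smul_smul]
  refine ⟨fun x t => (2⁻¹ : ℝ) • B (x, (t - x) / 2), ⟨?_, fun x => ?_, fun ρ hρ x => ?_⟩, ?_,
    fun x => ⟨(2⁻¹ : ℝ) * (C * (tail p x * expWeight p x)), fun t => ?_⟩⟩
  · exact Continuous.continuousOn (by fun_prop)
  · refine Integrable.smul (2⁻¹ : ℝ) (f := fun t => B (x, (t - x) / 2)) ?_
    have h1 := (integrableOn_Ioi_comp_mul_left_iff (fun z => B (x, z)) 0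
      (show (0:ℝ) < 2⁻¹ by norm_num)).2 (by simpa using hB.integrableOn x)
    have h2 := ((measurePreserving_sub_right volume x).integrableOn_comp_preimage
      (MeasurableEquiv.subRight x).measurableEmbedding).2 h1
    simp only [preimage_sub_const_Ioi, zero_add, Function.comp_def] at h2
    simp only [div_eq_inv_mul]
    exact h2
  · rw [hJ ρ hρ, jostSol, jostF, smul_add, ← integral_smul, ← hsc x]
    congr 1
    refine integral_congr_ae (ae_of_all _ fun t => ?_)
    simp only [smul_comm (2⁻¹ : ℝ)]
    rw [smul_smul, ← Complex.exp_add]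
    congr 2
    push_cast; ring_nf
  · fun_prop
  · rw [norm_smul]
    refine mul_le_mul ?_ (hB.norm_le x _) (norm_nonneg _) (by norm_num)
    norm_num

end Pot

end

/-! ### Wronskians, scattering coefficients and unitarity -/

section

section Generic

variable {E : Type*} [CStarAlgebra E]

/-- In the order of the C*-algebra `a^*a ≤ 1`, and the norm is monotone on nonnegative elements. -/
lemma norm_le_one_of_star_mul_add {a b : E} (h : star a * a + star b * b = 1) : ‖a‖ ≤ 1 := by
  nontriviality E
  let _ := CStarAlgebra.spectralOrder E
  have _ := CStarAlgebra.spectralOrderedRing E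
  have h1 : star a * a ≤ 1 := by rw [← h]; exact le_add_of_nonneg_right (star_mul_self_nonneg b)
  have h2 := CStarAlgebra.norm_le_norm_of_nonneg_of_le (star_mul_self_nonneg a) h1
  rw [CStarRing.norm_star_mul_self, CStarRing.norm_one] at h2
  nlinarith [norm_nonneg a]

/-- Isolates the leading term of a Wronskian whose entries are perturbations of `1` and of scalars;
used for the behaviour of the coefficients for large `ρ`. -/
lemma norm_wr_sub_le {s t : ℂ} {α β a b : E} :
    ‖((s • 1 + α) * (1 + b) - (1 + a) * (t • 1 + β)) - (s - t) • 1‖ ≤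
      ‖s‖ * ‖b‖ + ‖α‖ + ‖α‖ * ‖b‖ + ‖t‖ * ‖a‖ + ‖β‖ + ‖a‖ * ‖β‖ := by
  have e : ((s • 1 + α) * (1 + b) - (1 + a) * (t • 1 + β)) - (s - t) • 1 =
      s • b + α + α * b - t • a - β - a * β := by
    simp only [add_mul, mul_add, smul_mul_assoc, mul_smul_comm, one_mul, mul_one, sub_smul,
      smul_add]
    abel
  rw [e]
  have h1 := norm_sub_le (s • b + α + α * b - t • a - β) (a * β)
  have h2 := norm_sub_le (s • b + α + α * b - t • a) β
  have h3 := norm_sub_le (s • b + α + α * b) (t • a)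
  have h4 := norm_add_le (s • b + α) (α * b)
  have h5 := norm_add_le (s • b) α
  rw [norm_smul] at h3 h5
  have h6 := norm_mul_le α b
  have h7 := norm_mul_le a β
  linarith

end Generic

variable {m : ℕ} {Q : ℝ → Mat m}

/-- The derivative of the Jost solution `F₊`. -/
def jostPlus' (Q : ℝ → Mat m) (ρ : ℂ) : ℝ → Mat m := deriv (jostPlus Q ρ)

/-- The derivative of the Jost solution `F₋`. -/
def jostMinus' (Q : ℝ → Mat m) (ρ : ℂ) : ℝ → Mat m := deriv (jostMinus Q ρ)

/-- The Wronskian of `F₊` with parameter `-ρ̄` against a solution. -/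
def wrPlus (Q : ℝ → Mat m) (ρ : ℂ) (Y Y' : ℝ → Mat m) (x : ℝ) : Mat m :=
  wr (jostPlus Q (-(starRingEnd ℂ ρ))) (jostPlus' Q (-(starRingEnd ℂ ρ))) Y Y' x

/-- The Wronskian whose zeros are the eigenvalues. -/
def jostWr (Q : ℝ → Mat m) (ρ : ℂ) : Mat m := wrPlus Q ρ (jostMinus Q ρ) (jostMinus' Q ρ) 0

namespace Pot

variable (h : Pot Q)
include h

lemma sol_jostPlus {ρ : ℂ} (hρ : 0 ≤ ρ.im) : Sol Q (ρ ^ 2) (jostPlus Q ρ) (jostPlus' Q ρ) := by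
  obtain ⟨p, B, C, hB, hJ⟩ := h.exists_jost
  rw [jostPlus', hJ ρ hρ, (hB.sol_jostSol hρ).deriv_eq]
  exact hB.sol_jostSol hρ

lemma jostMinus_eq' {ρ : ℂ} (hρ : 0 ≤ ρ.im) (x : ℝ) :
    jostMinus' Q ρ x = -jostPlus' (reflect Q) ρ (-x) := by
  have e : jostMinus Q ρ = fun x => jostPlus (reflect Q) ρ (-x) := funext (h.jostMinus_eq hρ)
  rw [jostMinus', e, (h.refl.sol_jostPlus hρ).comp_neg.deriv_eq]

lemma sol_jostMinus {ρ : ℂ} (hρ : 0 ≤ ρ.im) : Sol Q (ρ ^ 2) (jostMinus Q ρ) (jostMinus' Q ρ) := by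
  have e : jostMinus Q ρ = fun x => jostPlus (reflect Q) ρ (-x) := funext (h.jostMinus_eq hρ)
  have e' : jostMinus' Q ρ = fun x => -jostPlus' (reflect Q) ρ (-x) := funext (h.jostMinus_eq' hρ)
  rw [e, e']
  have := Sol.comp_neg (h.refl.sol_jostPlus hρ)
  change Sol (reflect (reflect Q)) _ _ _ at this
  rwa [reflect_reflect] at this

lemma jostPlus_reflect {ρ : ℂ} (hρ : 0 ≤ ρ.im) (x : ℝ) :
    jostPlus Q ρ x = jostMinus (reflect Q) ρ (-x) := by
  rw [h.refl.jostMinus_eq hρ, reflect_reflect, neg_neg]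

lemma jostPlus_reflect' {ρ : ℂ} (hρ : 0 ≤ ρ.im) (x : ℝ) :
    jostPlus' Q ρ x = -jostMinus' (reflect Q) ρ (-x) := by
  rw [h.refl.jostMinus_eq' hρ, reflect_reflect, neg_neg, neg_neg]

lemma sol_conj {ρ : ℂ} (hρ : 0 ≤ ρ.im) : Sol Q (starRingEnd ℂ (ρ ^ 2))
    (jostPlus Q (-(starRingEnd ℂ ρ))) (jostPlus' Q (-(starRingEnd ℂ ρ))) := by
  rw [← neg_conj_sq]
  exact h.sol_jostPlus (by rwa [neg_conj_im])

lemma wrPlus_const {ρ : ℂ} (hρ : 0 ≤ ρ.im) {Y Y' : ℝ → Mat m} (hY : Sol Q (ρ ^ 2) Y Y') (a b : ℝ) :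
    wrPlus Q ρ Y Y' b = wrPlus Q ρ Y Y' a :=
  (h.sol_conj hρ).wr_const hY h.integrable h.isSelfAdjoint a b

lemma wrPlus_self {ρ : ℂ} (hρ : 0 ≤ ρ.im) (x : ℝ) :
    wrPlus Q ρ (jostPlus Q ρ) (jostPlus' Q ρ) x = 0 := by
  obtain ⟨p, B, C, hB, hJ⟩ := h.exists_jost
  have hρ' : 0 ≤ (-(starRingEnd ℂ ρ)).im := by rwa [neg_conj_im]
  rw [wrPlus, jostPlus', jostPlus', hJ ρ hρ, hJ _ hρ', (hB.sol_jostSol hρ).deriv_eq,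
    (hB.sol_jostSol hρ').deriv_eq]
  exact hB.wr_self h.isSelfAdjoint hρ x

lemma eq_jostPlus_mul {ρ : ℂ} (hρ : 0 ≤ ρ.im) {Y Y' : ℝ → Mat m} (hY : Sol Q (ρ ^ 2) Y Y')
    {x₀ : ℝ} (hw : wrPlus Q ρ Y Y' x₀ = 0) : ∃ a, ∀ x, Y x = jostPlus Q ρ x * a := by
  obtain ⟨p, B, C, hB, hJ⟩ := h.exists_jost
  have hρ' : 0 ≤ (-(starRingEnd ℂ ρ)).im := by rwa [neg_conj_im]
  rw [wrPlus, jostPlus', hJ _ hρ', (hB.sol_jostSol hρ').deriv_eq] at hw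
  rw [hJ ρ hρ]
  exact hB.eq_mul_of_wr_eq_zero h.isSelfAdjoint hρ hY hw

lemma eq_jostPlus_mul_of_tendsto {ρ : ℂ} (hρ : 0 ≤ ρ.im) {Y Y' : ℝ → Mat m}
    (hY : Sol Q (ρ ^ 2) Y Y')
    (hsmall : Tendsto (fun X : ℝ => ∫ t in X..(X + 1), ‖Y t‖) atTop (𝓝 0)) :
    ∃ a, ∀ x, Y x = jostPlus Q ρ x * a := by
  obtain ⟨p, B, C, hB, hJ⟩ := h.exists_jost
  rw [hJ ρ hρ]
  exact hB.eq_mul_of_tendsto h.isSelfAdjoint hρ hY hsmall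

lemma tendsto_jostPlus {ρ : ℂ} (hρ : 0 ≤ ρ.im) :
    Tendsto (fun x : ℝ => Complex.exp (-(Complex.I * ρ * x)) • jostPlus Q ρ x) atTop (𝓝 1) :=
  (Classical.epsilon_spec (p := IsJostPlus Q ρ) (h.existsUnique_jostPlus hρ).exists).2

lemma jostPlus_mul_cancel {ρ : ℂ} (hρ : 0 ≤ ρ.im) {a b : Mat m}
    (hab : ∀ x, jostPlus Q ρ x * a = jostPlus Q ρ x * b) : a = b := by
  have h1 := (h.tendsto_jostPlus hρ).mul_const a
  have h2 := (h.tendsto_jostPlus hρ).mul_const b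
  simp only [smul_mul_assoc, hab, one_mul] at h1 h2
  exact tendsto_nhds_unique h1 h2

lemma tendsto_jostPlus' {ρ : ℂ} (hρ : 0 ≤ ρ.im) :
    Tendsto (fun x : ℝ => Complex.exp (-(Complex.I * ρ * x)) • jostPlus' Q ρ x) atTop
      (𝓝 ((Complex.I * ρ) • 1)) := by
  obtain ⟨p, B, C, hB, hJ⟩ := h.exists_jost
  rw [jostPlus', hJ _ hρ, (hB.sol_jostSol hρ).deriv_eq]
  refine (hB.tendsto_jostG hρ).congr fun x => ?_
  rw [jostSol'_eq, smul_smul, ← Complex.exp_add, neg_add_cancel, Complex.exp_zero, one_smul]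

/-- The Wronskian of the Jost solution with its adjoint on the real line. -/
lemma wr_real (r : ℝ) (x : ℝ) : wr (jostPlus Q r) (jostPlus' Q r) (jostPlus Q r) (jostPlus' Q r) x =
    (-(2 * Complex.I * r)) • 1 := by
  have hr : 0 ≤ (r : ℂ).im := by simp
  have hs := h.sol_jostPlus hr
  have hs' : Sol Q (starRingEnd ℂ ((r : ℂ) ^ 2)) (jostPlus Q r) (jostPlus' Q r) := by simpa using hs
  have h1 := h.tendsto_jostPlus hr
  have h2 := h.tendsto_jostPlus' hr
  have h3 := (((continuous_star.tendsto _).comp h2).mul h1).sub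
    (((continuous_star.tendsto _).comp h1).mul h2)
  have e1 : star ((Complex.I * r) • (1 : Mat m)) * 1 - star (1 : Mat m) * ((Complex.I * r) • 1) =
      (-(2 * Complex.I * r)) • 1 := by
    rw [star_smul, star_one, mul_one, one_mul, ← sub_smul]
    congr 1
    simp
    ring
  rw [e1] at h3
  refine tendsto_nhds_unique (tendsto_const_nhds.congr fun y => ?_) h3
  rw [← hs'.wr_const hs h.integrable h.isSelfAdjoint x y]
  simp only [wr, Function.comp_apply, star_smul, smul_mul_assoc, mul_smul_comm, smul_smul]
  have : star (Complex.exp (-(Complex.I * r * y))) * Complex.exp (-(Complex.I * r * y)) = 1 := by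
    rw [Complex.star_def, ← Complex.exp_conj, ← Complex.exp_add, Complex.exp_eq_one_iff]
    exact ⟨0, by simp⟩
  rw [mul_comm] at this
  rw [this, one_smul, one_smul]

lemma wr_jostMinus_real (r : ℝ) (x : ℝ) :
    wr (jostMinus Q r) (jostMinus' Q r) (jostMinus Q r) (jostMinus' Q r) x =
      (2 * Complex.I * r) • 1 := by
  have hr : 0 ≤ (r : ℂ).im := by simp
  have := h.refl.wr_real r (-x)
  simp only [wr, h.jostMinus_eq hr, h.jostMinus_eq' hr, star_neg, neg_mul, mul_neg] at this ⊢
  rw [sub_neg_eq_add, neg_add_eq_sub, ← neg_sub, this, neg_smul, neg_neg]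

/-- `D(ρ)` is the adjoint of a Wronskian taken at `-ρ̄`. The adjoint interchanges the two factors,
and the conjugation of the scalar restores the parameter `ρ`. -/
lemma contD_eq {ρ : ℂ} (hρ : 0 ≤ ρ.im) : contD Q ρ = (1 / (2 * Complex.I * ρ)) • jostWr Q ρ := by
  have hρ' : 0 ≤ (-(starRingEnd ℂ ρ)).im := by rwa [neg_conj_im]
  have hb : deriv (barJostMinus Q (-(starRingEnd ℂ ρ))) 0 = star (jostMinus' Q ρ 0) := by
    have := ((h.sol_jostMinus hρ).hasDerivAt 0).star.deriv
    rw [← this]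
    congr 1
    funext x
    simp [barJostMinus, Matrix.star_eq_conjTranspose]
  rw [contD, contA, wronskian, hb]
  simp only [barJostMinus, jostWr, wrPlus, ← Matrix.star_eq_conjTranspose, star_smul]
  change _ • star (star (jostMinus' Q ρ 0) * _ - _ * jostPlus' Q (-(starRingEnd ℂ ρ)) 0) = _
  have e : star (-(1 / (2 * Complex.I * -(starRingEnd ℂ ρ)))) = -(1 / (2 * Complex.I * ρ)) := by
    simp
  rw [e]
  simp only [wr, star_sub, star_mul, star_star, map_neg, Complex.conj_conj, neg_neg]
  rw [neg_smul, ← smul_neg, neg_sub]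

/-- Reflection exchanges the Jost solutions and changes the sign of derivatives, so no separate
study of `A` is required. -/
lemma contA_eq {ρ : ℂ} (hρ : 0 ≤ ρ.im) : contA Q ρ = contD (reflect Q) ρ := by
  have hρ' : 0 ≤ (-(starRingEnd ℂ ρ)).im := by rwa [neg_conj_im]
  rw [h.refl.contD_eq hρ]
  have hb : deriv (barJostMinus Q ρ) 0 = star (jostMinus' Q (-(starRingEnd ℂ ρ)) 0) :=
    ((h.sol_jostMinus hρ').hasDerivAt 0).star.deriv
  rw [contA, wronskian, hb]
  simp only [barJostMinus, ← Matrix.star_eq_conjTranspose, jostWr, wrPlus, wr]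
  change _ • (_ - _ * jostPlus' Q ρ 0) = _
  rw [h.jostPlus_reflect hρ, h.jostPlus_reflect' hρ, h.jostMinus_eq hρ', h.jostMinus_eq' hρ', neg_zero]
  rw [neg_smul, ← smul_neg]
  simp only [star_neg, neg_mul, mul_neg, sub_neg_eq_add]
  congr 1; abel

/-- With these coefficients `F₋ - F₊ C - F₊(·,-r) D` has zero Wronskian with `F₊(·,-r)`, so it is
`F₊ a`. Its Wronskian with `F₊(·,r)` vanishes as well, while that of `F₊` with itself is a nonzero
scalar for `r ≠ 0`; hence `a = 0`. -/
lemma isCoeffCD {r : ℝ} (hr : r ≠ 0) : IsCoeffCD Q r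
    ((-(1 / (2 * Complex.I * r))) • wr (jostPlus Q r) (jostPlus' Q r) (jostMinus Q r) (jostMinus' Q r) 0,
      (1 / (2 * Complex.I * r)) • jostWr Q r) := by
  have h1 : 0 ≤ (r : ℂ).im := by simp
  have h1' : 0 ≤ (-(r : ℂ)).im := by simp
  set c : Mat m :=
    (-(1 / (2 * Complex.I * r))) • wr (jostPlus Q r) (jostPlus' Q r) (jostMinus Q r) (jostMinus' Q r) 0
    with hc
  set d : Mat m := (1 / (2 * Complex.I * r)) • jostWr Q r with hd
  have hne : (2 * Complex.I * (r : ℂ)) ≠ 0 := by simp [hr]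
  have s1 := (h.sol_jostPlus h1).mul_const h.integrable c
  have s2' : Sol Q ((r : ℂ) ^ 2) (jostPlus Q (-r)) (jostPlus' Q (-r)) := by
    simpa using h.sol_jostPlus h1'
  have s2 := s2'.mul_const h.integrable d
  have s3 := ((h.sol_jostMinus h1).sub s1 h.integrable).sub s2 h.integrable
  have hn := h.wr_real (-r) 0
  have hp := h.wr_real r 0
  have z1 := h.wrPlus_self h1 0
  have z2 := h.wrPlus_self h1' 0
  simp only [wrPlus, Complex.conj_ofReal, map_neg, neg_neg, Complex.ofReal_neg] at z1 z2 hn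
  have k1 : jostWr Q r = (2 * Complex.I * (r : ℂ)) • d := by
    rw [hd, smul_smul, mul_one_div_cancel hne, one_smul]
  have k2 : wr (jostPlus Q r) (jostPlus' Q r) (jostMinus Q r) (jostMinus' Q r) 0 =
      (-(2 * Complex.I * (r : ℂ))) • c := by
    rw [hc, smul_smul, neg_mul_neg, mul_one_div_cancel hne, one_smul]
  have e : ∀ (Z Z' Y Y' U U' V V' : ℝ → Mat m), wr Z Z' (Y - (fun x => U x * c) - fun x => V x * d)
      (Y' - (fun x => U' x * c) - fun x => V' x * d) 0 =
      wr Z Z' Y Y' 0 - wr Z Z' U U' 0 * c - wr Z Z' V V' 0 * d := by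
    intro Z Z' Y Y' U U' V V'
    simp only [wr, Pi.sub_apply, mul_sub, sub_mul, mul_assoc]
    abel
  have w1 : wrPlus Q r (jostMinus Q r - (fun x => jostPlus Q r x * c) - fun x => jostPlus Q (-r) x * d)
      (jostMinus' Q r - (fun x => jostPlus' Q r x * c) - fun x => jostPlus' Q (-r) x * d) 0 = 0 := by
    simp only [wrPlus, Complex.conj_ofReal]
    rw [e, z1, hn]
    simp only [jostWr, wrPlus, Complex.conj_ofReal] at k1
    rw [k1]
    simp
  obtain ⟨a, ha⟩ := h.eq_jostPlus_mul h1 s3 w1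
  have w2 : wr (jostPlus Q r) (jostPlus' Q r)
      (jostMinus Q r - (fun x => jostPlus Q r x * c) - fun x => jostPlus Q (-r) x * d)
      (jostMinus' Q r - (fun x => jostPlus' Q r x * c) - fun x => jostPlus' Q (-r) x * d) 0 = 0 := by
    rw [e, z2, hp, k2]
    simp
  have ha' : (jostMinus' Q r - (fun x => jostPlus' Q r x * c) - fun x => jostPlus' Q (-r) x * d) =
      fun x => jostPlus' Q r x * a := by
    rw [← s3.deriv_eq, ← ((h.sol_jostPlus h1).mul_const h.integrable a).deriv_eq]
    exact congrArg deriv (funext ha)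
  rw [ha', funext ha] at w2
  have w3 : wr (jostPlus Q r) (jostPlus' Q r) (jostPlus Q r) (jostPlus' Q r) 0 * a = 0 := by
    rw [← w2]; simp only [wr, sub_mul, mul_assoc]
  rw [hp, smul_mul_assoc, one_mul, smul_eq_zero, neg_eq_zero] at w3
  have a0 : a = 0 := w3.resolve_left hne
  intro x
  have := ha x
  rw [a0, mul_zero] at this
  simp only [Pi.sub_apply] at this
  rw [sub_sub, sub_eq_zero] at this
  exact this

/-- The Wronskian with `F₊(·,r)` annihilates the term with `D`, the one with `F₊(·,-r)` the term
with `C`; each therefore reads off one coefficient. -/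
lemma isCoeffCD_unique {r : ℝ} (hr : r ≠ 0) {P : Mat m × Mat m} (hP : IsCoeffCD Q r P) :
    P = ((-(1 / (2 * Complex.I * r))) •
      wr (jostPlus Q r) (jostPlus' Q r) (jostMinus Q r) (jostMinus' Q r) 0,
      (1 / (2 * Complex.I * r)) • jostWr Q r) := by
  have h1 : 0 ≤ (r : ℂ).im := by simp
  have h1' : 0 ≤ (-(r : ℂ)).im := by simp
  have hne : (2 * Complex.I * (r : ℂ)) ≠ 0 := by simp [hr]
  have hn := h.wr_real (-r) 0
  have hp := h.wr_real r 0
  have z1 := h.wrPlus_self h1 0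
  have z2 := h.wrPlus_self h1' 0
  simp only [wrPlus, Complex.conj_ofReal, map_neg, neg_neg, Complex.ofReal_neg] at z1 z2 hn
  have hd : jostMinus' Q r 0 = jostPlus' Q r 0 * P.1 + jostPlus' Q (-r) 0 * P.2 := by
    rw [jostMinus', funext hP]
    exact (((h.sol_jostPlus h1).hasDerivAt 0).mul_const P.1 |>.add
      (((h.sol_jostPlus h1').hasDerivAt 0).mul_const P.2)).deriv
  have e : ∀ Z Z' : ℝ → Mat m, wr Z Z' (jostMinus Q r) (jostMinus' Q r) 0 =
      wr Z Z' (jostPlus Q r) (jostPlus' Q r) 0 * P.1 +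
      wr Z Z' (jostPlus Q (-r)) (jostPlus' Q (-r)) 0 * P.2 := by
    intro Z Z'
    rw [wr, hd, hP 0]
    simp only [wr, mul_add, sub_mul, mul_assoc]
    abel
  refine Prod.ext ?_ ?_
  · simp only
    rw [e, hp, z2, zero_mul, add_zero, smul_mul_assoc, one_mul, smul_smul, neg_mul_neg,
      one_div_mul_cancel hne, one_smul]
  · simp only [jostWr, wrPlus, Complex.conj_ofReal]
    have e3 : -(2 * Complex.I * -(r : ℂ)) = 2 * Complex.I * r := by ring
    rw [e, z1, hn, e3, zero_mul, zero_add, smul_mul_assoc, one_mul, smul_smul,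
     
      one_div_mul_cancel hne, one_smul]

lemma existsUnique_isCoeffCD {r : ℝ} (hr : r ≠ 0) : ∃! P, IsCoeffCD Q r P :=
  ⟨_, h.isCoeffCD hr, fun _ hP => h.isCoeffCD_unique hr hP⟩

lemma isCoeffCD_coeffCD {r : ℝ} (hr : r ≠ 0) : IsCoeffCD Q r (coeffCD Q r) :=
  Classical.epsilon_spec (h.existsUnique_isCoeffCD hr).exists

lemma coeffCD_eq {r : ℝ} (hr : r ≠ 0) : coeffCD Q r = ((-(1 / (2 * Complex.I * r))) •
      wr (jostPlus Q r) (jostPlus' Q r) (jostMinus Q r) (jostMinus' Q r) 0,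
      (1 / (2 * Complex.I * r)) • jostWr Q r) :=
  h.isCoeffCD_unique hr (h.isCoeffCD_coeffCD hr)

lemma contD_real {r : ℝ} (hr : r ≠ 0) : contD Q r = (coeffCD Q r).2 := by
  rw [h.contD_eq (by simp), h.coeffCD_eq hr]

lemma isCoeffAB_iff {r : ℝ} (P : Mat m × Mat m) :
    IsCoeffAB Q r P ↔ IsCoeffCD (reflect Q) r P.swap := by
  have h1 : 0 ≤ (r : ℂ).im := by simp
  have h1' : 0 ≤ (-(r : ℂ)).im := by simp
  simp only [IsCoeffAB, IsCoeffCD, h.jostPlus_reflect h1, h.jostMinus_eq h1, h.jostMinus_eq h1',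
    Prod.fst_swap, Prod.snd_swap]
  constructor
  · intro H x
    have := H (-x)
    rw [neg_neg] at this
    rw [this, add_comm]
  · intro H x
    rw [H (-x), add_comm]

lemma existsUnique_isCoeffAB {r : ℝ} (hr : r ≠ 0) : ∃! P, IsCoeffAB Q r P := by
  obtain ⟨P, hP, hu⟩ := h.refl.existsUnique_isCoeffCD hr
  refine ⟨P.swap, (h.isCoeffAB_iff _).2 (by simpa using hP), fun P' hP' => ?_⟩
  rw [← hu _ ((h.isCoeffAB_iff _).1 hP'), Prod.swap_swap]

lemma coeffAB_eq {r : ℝ} (hr : r ≠ 0) : coeffAB Q r = (coeffCD (reflect Q) r).swap := by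
  have h1 : IsCoeffAB Q r (coeffAB Q r) :=
    Classical.epsilon_spec (h.existsUnique_isCoeffAB hr).exists
  refine (h.existsUnique_isCoeffAB hr).unique h1 ((h.isCoeffAB_iff _).2 ?_)
  simpa using h.refl.isCoeffCD_coeffCD hr

lemma contA_real {r : ℝ} (hr : r ≠ 0) : contA Q r = (coeffAB Q r).1 := by
  rw [h.contA_eq (by simp), h.coeffAB_eq hr, h.refl.contD_real hr, Prod.fst_swap]

/-- Unitarity relation between `C` and `D`. -/
lemma star_D_mul_D {r : ℝ} (hr : r ≠ 0) : star (coeffCD Q r).2 * (coeffCD Q r).2 =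
    1 + star (coeffCD Q r).1 * (coeffCD Q r).1 := by
  have h1 : 0 ≤ (r : ℂ).im := by simp
  have h1' : 0 ≤ (-(r : ℂ)).im := by simp
  have hne : (2 * Complex.I * (r : ℂ)) ≠ 0 := by simp [hr]
  have hP := h.isCoeffCD_coeffCD hr
  set P := coeffCD Q r
  have hn := h.wr_real (-r) 0
  have hp := h.wr_real r 0
  have z1 := h.wrPlus_self h1 0
  have z2 := h.wrPlus_self h1' 0
  have hm := h.wr_jostMinus_real r 0
  simp only [wrPlus, Complex.conj_ofReal, map_neg, neg_neg, Complex.ofReal_neg] at z1 z2 hn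
  have hd : jostMinus' Q r 0 = jostPlus' Q r 0 * P.1 + jostPlus' Q (-r) 0 * P.2 := by
    rw [jostMinus', funext hP]
    exact (((h.sol_jostPlus h1).hasDerivAt 0).mul_const P.1 |>.add
      (((h.sol_jostPlus h1').hasDerivAt 0).mul_const P.2)).deriv
  -- The expansion of `F₋` is inserted on both sides of its self-Wronskian; the cross terms pair
  -- `F₊(·,r)` with `F₊(·,-r)` and drop out.
  have e : wr (jostMinus Q r) (jostMinus' Q r) (jostMinus Q r) (jostMinus' Q r) 0 =
      star P.1 * (wr (jostPlus Q r) (jostPlus' Q r) (jostPlus Q r) (jostPlus' Q r) 0 * P.1) +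
      star P.1 * (wr (jostPlus Q r) (jostPlus' Q r) (jostPlus Q (-r)) (jostPlus' Q (-r)) 0 * P.2) +
      star P.2 * (wr (jostPlus Q (-r)) (jostPlus' Q (-r)) (jostPlus Q r) (jostPlus' Q r) 0 * P.1) +
      star P.2 * (wr (jostPlus Q (-r)) (jostPlus' Q (-r)) (jostPlus Q (-r)) (jostPlus' Q (-r)) 0
        * P.2) := by
    rw [wr, hd, hP 0]
    simp only [wr, star_add, star_mul, mul_add, add_mul, mul_sub, sub_mul, mul_assoc]
    abel
  rw [hm, hp, hn, z1, z2] at e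
  have e2 : (2 * Complex.I * (r : ℂ)) • (1 : Mat m) =
      (2 * Complex.I * (r : ℂ)) • (star P.2 * P.2 - star P.1 * P.1) := by
    rw [e]
    simp only [smul_mul_assoc, mul_smul_comm, one_mul, zero_mul, mul_zero, add_zero, smul_sub]
    module
  have e3 := smul_right_injective (Mat m) hne e2
  rw [e3]
  abel

/-- `D^*D = 1 + C^*C ≥ 1` is invertible, hence so is the square matrix `D`. -/
lemma isUnit_D {r : ℝ} (hr : r ≠ 0) : IsUnit (coeffCD Q r).2 := by
  have hD := h.star_D_mul_D hr
  set P := coeffCD Q r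
  let _ := CStarAlgebra.spectralOrder (Mat m)
  have _ := CStarAlgebra.spectralOrderedRing (Mat m)
  have h1 : (1 : Mat m) ≤ star P.2 * P.2 := by
    rw [hD]; exact le_add_of_nonneg_right (star_mul_self_nonneg _)
  have h2 : IsUnit (star P.2 * P.2) := CStarAlgebra.isUnit_of_le 1 h1
  rw [Matrix.isUnit_iff_isUnit_det, Matrix.det_mul] at h2
  exact (Matrix.isUnit_iff_isUnit_det _).2 (isUnit_of_mul_isUnit_right h2)

lemma isUnit_A {r : ℝ} (hr : r ≠ 0) : IsUnit (coeffAB Q r).1 := by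
  rw [h.coeffAB_eq hr]
  exact h.refl.isUnit_D hr

/-- The identity `D^*D = 1 + C^*C` multiplied by `D⁻¹` on the right and its adjoint on the left. It
makes `S₊` and `D⁻¹` contractions at every real `r ≠ 0`. -/
lemma star_scat_mul_add {r : ℝ} (hr : r ≠ 0) :
    star (scatPlus Q r) * scatPlus Q r + star (coeffCD Q r).2⁻¹ * (coeffCD Q r).2⁻¹ = 1 := by
  have h1 := h.star_D_mul_D hr
  have hu := (Matrix.isUnit_iff_isUnit_det _).1 (h.isUnit_D hr)
  set P := coeffCD Q r with hP
  have h2 : P.2 * P.2⁻¹ = 1 := Matrix.mul_nonsing_inv _ hu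
  have h3 : star P.2⁻¹ * star P.2 = 1 := by rw [← star_mul, h2, star_one]
  calc star (scatPlus Q r) * scatPlus Q r + star P.2⁻¹ * P.2⁻¹
      = star P.2⁻¹ * (1 + star P.1 * P.1) * P.2⁻¹ := by
        rw [scatPlus, ← hP, star_mul, mul_add, add_mul, mul_one, add_comm]
        simp only [mul_assoc]
    _ = (star P.2⁻¹ * star P.2) * (P.2 * P.2⁻¹) := by rw [← h1]; simp only [mul_assoc]
    _ = 1 := by rw [h2, h3, one_mul]

lemma norm_scatPlus_le {r : ℝ} (hr : r ≠ 0) : ‖scatPlus Q r‖ ≤ 1 :=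
  norm_le_one_of_star_mul_add (h.star_scat_mul_add hr)

lemma norm_inv_D_le {r : ℝ} (hr : r ≠ 0) : ‖(coeffCD Q r).2⁻¹‖ ≤ 1 :=
  norm_le_one_of_star_mul_add ((add_comm _ _).trans (h.star_scat_mul_add hr))

end Pot

end

/-! ### Holomorphy and asymptotics of the coefficients; square integrability of the scattering
matrix -/

section

variable {m : ℕ} {Q : ℝ → Mat m}

/-- The modulated Jost solution `exp (-iρx) F₊(x, ρ)`. -/
def modPlus (Q : ℝ → Mat m) (x : ℝ) (ρ : ℂ) : Mat m :=
  Complex.exp (-(Complex.I * ρ * x)) • jostPlus Q ρ x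

/-- The modulated derivative `exp (-iρx) F₊'(x, ρ)`. -/
def modPlus' (Q : ℝ → Mat m) (x : ℝ) (ρ : ℂ) : Mat m :=
  Complex.exp (-(Complex.I * ρ * x)) • jostPlus' Q ρ x

lemma modPlus_zero (ρ : ℂ) : modPlus Q 0 ρ = jostPlus Q ρ 0 := by simp [modPlus]

lemma modPlus'_zero (ρ : ℂ) : modPlus' Q 0 ρ = jostPlus' Q ρ 0 := by simp [modPlus']

lemma jostPlus_eq_smul_modPlus (ρ : ℂ) (x : ℝ) :
    jostPlus Q ρ x = Complex.exp (Complex.I * ρ * x) • modPlus Q x ρ := by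
  rw [modPlus, smul_smul, ← Complex.exp_add, add_neg_cancel, Complex.exp_zero, one_smul]

lemma continuousOn_star_neg_conj {E : Type*} [NormedAddCommGroup E] [StarAddMonoid E]
    [ContinuousStar E] {f : ℂ → E} (hf : ContinuousOn f {ρ : ℂ | 0 ≤ ρ.im}) :
    ContinuousOn (fun ρ => star (f (-(starRingEnd ℂ ρ)))) {ρ : ℂ | 0 ≤ ρ.im} :=
  continuous_star.comp_continuousOn (hf.comp
    (Complex.continuous_conj.neg).continuousOn fun ρ hρ => by
      simpa [neg_conj_im] using hρ)

/-- The adjoint and `ρ ↦ -ρ̄` are both antiholomorphic, so their combination is holomorphic; the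
second preserves the upper half-plane. -/
lemma differentiableOn_star_neg_conj {E : Type*} [CStarAlgebra E] {f : ℂ → E}
    (hf : DifferentiableOn ℂ f {ρ : ℂ | 0 < ρ.im}) :
    DifferentiableOn ℂ (fun ρ => star (f (-(starRingEnd ℂ ρ)))) {ρ : ℂ | 0 < ρ.im} := by
  intro ρ hρ
  have h1 : DifferentiableAt ℂ f (-(starRingEnd ℂ ρ)) :=
    hf.differentiableAt (isOpen_upper.mem_nhds (by simpa using hρ))
  have h2 : DifferentiableAt ℂ (fun z => f (-z)) (starRingEnd ℂ ρ) :=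
    DifferentiableAt.comp (starRingEnd ℂ ρ) (g := f) (f := fun z => -z) h1 differentiableAt_id.neg
  have h3 := h2.star_conj
  rw [Complex.conj_conj] at h3
  exact h3.differentiableWithinAt

lemma continuousOn_matrix_inv {α : Type*} [TopologicalSpace α] {f : α → Mat m} {s : Set α}
    (hf : ContinuousOn f s) (hu : ∀ x ∈ s, IsUnit (f x)) : ContinuousOn (fun x => (f x)⁻¹) s := by
  intro x hx
  obtain ⟨u, hu'⟩ := hu x hx
  have h1 : ContinuousAt Ring.inverse (f x) := hu' ▸ NormedRing.inverse_continuousAt u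
  simp only [Matrix.nonsing_inv_eq_ringInverse]
  exact h1.comp_continuousWithinAt (hf x hx)

lemma differentiableOn_matrix_inv {f : ℂ → Mat m} {s : Set ℂ}
    (hf : DifferentiableOn ℂ f s) (hu : ∀ x ∈ s, IsUnit (f x)) :
    DifferentiableOn ℂ (fun x => (f x)⁻¹) s := by
  intro x hx
  obtain ⟨u, hu'⟩ := hu x hx
  have h1 : DifferentiableAt ℂ Ring.inverse (f x) := hu' ▸ differentiableAt_inverse u.isUnit
  simp only [Matrix.nonsing_inv_eq_ringInverse]
  exact h1.comp_differentiableWithinAt x (hf x hx)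

namespace Pot

variable (h : Pot Q)
include h

/-- For fixed `x`, the modulated Jost solution is continuous in the closed and holomorphic in the
open upper half-plane, with the asymptotics of a plane wave. -/
lemma modPlus_spec (x : ℝ) :
    ContinuousOn (modPlus Q x) {ρ : ℂ | 0 ≤ ρ.im} ∧ DifferentiableOn ℂ (modPlus Q x) {ρ : ℂ | 0 < ρ.im} ∧
    ContinuousOn (modPlus' Q x) {ρ : ℂ | 0 ≤ ρ.im} ∧
    DifferentiableOn ℂ (modPlus' Q x) {ρ : ℂ | 0 < ρ.im} ∧
    ∃ c, 0 ≤ c ∧ ∀ ρ : ℂ, 0 ≤ ρ.im →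
      ‖ρ‖ * ‖modPlus Q x ρ - 1‖ ≤ c ∧ ‖modPlus' Q x ρ - (Complex.I * ρ) • 1‖ ≤ c ∧
      ‖modPlus Q x ρ‖ ≤ c := by
  obtain ⟨p, B, C, hB, hJ⟩ := h.exists_jost
  have e1 : ∀ ρ : ℂ, 0 ≤ ρ.im → modPlus Q x ρ = jostF B ρ x := fun ρ hρ => by
    rw [modPlus, hJ ρ hρ, jostSol, smul_smul, ← Complex.exp_add, neg_add_cancel, Complex.exp_zero,
      one_smul]
  have e2 : ∀ ρ : ℂ, 0 ≤ ρ.im → modPlus' Q x ρ = jostG Q B ρ x := fun ρ hρ => by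
    rw [modPlus', jostPlus', hJ ρ hρ, (hB.sol_jostSol hρ).deriv_eq, jostSol'_eq, smul_smul,
      ← Complex.exp_add, neg_add_cancel, Complex.exp_zero, one_smul]
  have c1 := hB.continuousOn_jostF_param x
  have c2 := hB.differentiableOn_jostF_param x
  have c3 := hB.continuousOn_jostH_param x
  have c4 := hB.differentiableOn_jostH_param x
  have c5 : ContinuousOn (fun ρ => jostG Q B ρ x) {ρ : ℂ | 0 ≤ ρ.im} := by
    unfold jostG; fun_prop
  have c6 : DifferentiableOn ℂ (fun ρ => jostG Q B ρ x) {ρ : ℂ | 0 < ρ.im} := by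
    unfold jostG; fun_prop
  have t0 := hB.tailMass_nonneg x
  have k0 := hB.kernelMass_nonneg x
  refine ⟨c1.congr fun ρ hρ => e1 ρ hρ, c2.congr fun ρ hρ => e1 ρ (le_of_lt hρ),
    c5.congr fun ρ hρ => e2 ρ hρ, c6.congr fun ρ hρ => e2 ρ (le_of_lt hρ),
    3 * tailMass p ‖(1 : Mat m)‖ C x + (‖(1 : Mat m)‖ + kernelMass p C x), by positivity,
    fun ρ hρ => ?_⟩
  have b1 := hB.norm_jostF_sub_one_le_div hρ x
  have b2 := hB.norm_jostH_le hρ x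
  have b3 := hB.norm_jostF_le hρ x
  have n1 := norm_nonneg (1 : Mat m)
  rw [e1 ρ hρ, e2 ρ hρ]
  refine ⟨by linarith, ?_, by linarith⟩
  have e3 : jostG Q B ρ x - (Complex.I * ρ) • 1 =
      -((Complex.I * ρ) • (jostF B ρ x - 1)) - jostH Q B ρ x := by
    unfold jostG; module
  rw [e3]
  refine (norm_sub_le _ _).trans ?_
  rw [norm_neg, norm_smul, norm_mul, Complex.norm_I, one_mul]
  change _ ≤ tailMass p ‖(1 : Mat m)‖ C x at b2
  linarith

lemma jostMinus_eq_smul_modPlus {ρ : ℂ} (hρ : 0 ≤ ρ.im) (x : ℝ) :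
    jostMinus Q ρ x = Complex.exp (-(Complex.I * ρ * x)) • modPlus (reflect Q) (-x) ρ := by
  rw [h.jostMinus_eq hρ, jostPlus_eq_smul_modPlus]
  congr 2
  push_cast; ring

/-- The plus sign comes from `F₋'(0)` being minus the derivative at `0` of the reflected solution.
-/
lemma jostWr_eq {ρ : ℂ} (hρ : 0 ≤ ρ.im) : jostWr Q ρ =
    star (modPlus' Q 0 (-(starRingEnd ℂ ρ))) * modPlus (reflect Q) 0 ρ +
    star (modPlus Q 0 (-(starRingEnd ℂ ρ))) * modPlus' (reflect Q) 0 ρ := by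
  simp only [jostWr, wrPlus, wr, h.jostMinus_eq hρ, h.jostMinus_eq' hρ, modPlus_zero, modPlus'_zero,
    neg_zero, mul_neg, sub_neg_eq_add]

lemma continuousOn_jostWr : ContinuousOn (jostWr Q) {ρ : ℂ | 0 ≤ ρ.im} := by
  obtain ⟨a1, -, a3, -⟩ := h.modPlus_spec 0
  obtain ⟨b1, -, b3, -⟩ := h.refl.modPlus_spec 0
  exact (((continuousOn_star_neg_conj a3).mul b1).add
    ((continuousOn_star_neg_conj a1).mul b3)).congr fun ρ hρ => h.jostWr_eq hρ

lemma differentiableOn_jostWr : DifferentiableOn ℂ (jostWr Q) {ρ : ℂ | 0 < ρ.im} := by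
  obtain ⟨-, a1, -, a3, -⟩ := h.modPlus_spec 0
  obtain ⟨-, b1, -, b3, -⟩ := h.refl.modPlus_spec 0
  exact (((differentiableOn_star_neg_conj a3).mul b1).add
    ((differentiableOn_star_neg_conj a1).mul b3)).congr fun ρ hρ => h.jostWr_eq (le_of_lt hρ)

lemma continuousOn_contD : ContinuousOn (contD Q) {ρ : ℂ | 0 ≤ ρ.im ∧ ρ ≠ 0} := by
  refine ContinuousOn.congr (f := fun ρ => (1 / (2 * Complex.I * ρ)) • jostWr Q ρ) ?_
    fun ρ hρ => h.contD_eq hρ.1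
  have h1 : ContinuousOn (fun ρ : ℂ => 1 / (2 * Complex.I * ρ)) {ρ : ℂ | 0 ≤ ρ.im ∧ ρ ≠ 0} :=
    ContinuousOn.div continuousOn_const (by fun_prop) fun ρ hρ => by simpa using hρ.2
  exact h1.smul (h.continuousOn_jostWr.mono fun _ hρ => hρ.1)

lemma differentiableOn_contD : DifferentiableOn ℂ (contD Q) {ρ : ℂ | 0 < ρ.im} := by
  refine DifferentiableOn.congr (f := fun ρ => (1 / (2 * Complex.I * ρ)) • jostWr Q ρ) ?_
    fun ρ hρ => h.contD_eq (le_of_lt hρ)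
  have h1 : DifferentiableOn ℂ (fun ρ : ℂ => 1 / (2 * Complex.I * ρ)) {ρ : ℂ | 0 < ρ.im} :=
    DifferentiableOn.div (by fun_prop) (by fun_prop) fun ρ hρ => by
      have : ρ ≠ 0 := by rintro rfl; simp at hρ
      simpa using this
  exact h1.smul h.differentiableOn_jostWr

lemma continuousOn_contA : ContinuousOn (contA Q) {ρ : ℂ | 0 ≤ ρ.im ∧ ρ ≠ 0} :=
  h.refl.continuousOn_contD.congr fun _ hρ => h.contA_eq hρ.1

lemma differentiableOn_contA : DifferentiableOn ℂ (contA Q) {ρ : ℂ | 0 < ρ.im} :=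
  h.refl.differentiableOn_contD.congr fun _ hρ => h.contA_eq (le_of_lt hρ)

/-- Common bound for the Wronskians of Jost solutions at the origin. -/
lemma exists_wr_bound : ∃ c, 0 ≤ c ∧ (∀ ρ : ℂ, 0 ≤ ρ.im → 1 ≤ ‖ρ‖ →
      ‖jostWr Q ρ - (2 * Complex.I * ρ) • 1‖ ≤ c) ∧
    ∀ r : ℝ, 1 ≤ |r| →
      ‖wr (jostPlus Q r) (jostPlus' Q r) (jostMinus Q r) (jostMinus' Q r) 0‖ ≤ c := by
  obtain ⟨-, -, -, -, c₁, hc₁, h1⟩ := h.modPlus_spec 0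
  obtain ⟨-, -, -, -, c₂, hc₂, h2⟩ := h.refl.modPlus_spec 0
  simp only [modPlus_zero, modPlus'_zero] at h1 h2
  -- Two choices of `σ` are used: `σ = -ρ̄` gives `W(ρ)` with leading term `2iρ`, and `σ = ρ` real
  -- gives the numerator of `C`, whose leading term cancels.
  have key : ∀ (ρ σ : ℂ), 0 ≤ ρ.im → 0 ≤ σ.im → ‖σ‖ = ‖ρ‖ → 1 ≤ ‖ρ‖ →
      ‖wr (jostPlus Q σ) (jostPlus' Q σ) (jostMinus Q ρ) (jostMinus' Q ρ) 0 -
        (star (Complex.I * σ) + Complex.I * ρ) • 1‖ ≤ 2 * (c₁ + c₂) + 2 * (c₁ * c₂) := by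
    intro ρ σ hρ hσ hn h1ρ
    obtain ⟨p1, p2, -⟩ := h1 σ hσ
    obtain ⟨q1, q2, -⟩ := h2 ρ hρ
    have := norm_wr_sub_le (s := star (Complex.I * σ)) (t := -(Complex.I * ρ))
      (α := star (jostPlus' Q σ 0 - (Complex.I * σ) • 1)) (a := star (jostPlus Q σ 0 - 1))
      (b := jostPlus (reflect Q) ρ 0 - 1)
      (β := -(jostPlus' (reflect Q) ρ 0 - (Complex.I * ρ) • 1))
    rw [norm_neg, norm_neg, norm_star, norm_star, norm_star, norm_mul, norm_mul, Complex.norm_I,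
      one_mul, one_mul] at this
    have e : wr (jostPlus Q σ) (jostPlus' Q σ) (jostMinus Q ρ) (jostMinus' Q ρ) 0 -
        (star (Complex.I * σ) + Complex.I * ρ) • 1 =
        (star (Complex.I * σ) • 1 + star (jostPlus' Q σ 0 - (Complex.I * σ) • 1)) *
          (1 + (jostPlus (reflect Q) ρ 0 - 1)) - (1 + star (jostPlus Q σ 0 - 1)) *
          ((-(Complex.I * ρ)) • 1 + -(jostPlus' (reflect Q) ρ 0 - (Complex.I * ρ) • 1)) -
          (star (Complex.I * σ) - -(Complex.I * ρ)) • 1 := by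
      simp only [wr, h.jostMinus_eq hρ, h.jostMinus_eq' hρ, neg_zero, star_sub, star_smul, star_one,
        sub_neg_eq_add, add_sub_cancel, neg_smul, neg_sub]
      congr 3
      abel
    rw [e]
    have a0 := norm_nonneg (jostPlus Q σ 0 - 1)
    have b0 := norm_nonneg (jostPlus (reflect Q) ρ 0 - 1)
    have p1' : ‖jostPlus Q σ 0 - 1‖ ≤ c₁ := le_trans (by rw [hn]; nlinarith) p1
    have q1' : ‖jostPlus (reflect Q) ρ 0 - 1‖ ≤ c₂ := le_trans (by nlinarith) q1
    have m1 := mul_le_mul p2 q1' b0 hc₁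
    have m2 := mul_le_mul p1' q2 (norm_nonneg _) hc₁
    rw [hn] at p1 this
    linarith
  refine ⟨2 * (c₁ + c₂) + 2 * (c₁ * c₂), by positivity, fun ρ hρ h1ρ => ?_, fun r hr => ?_⟩
  · have := key ρ (-(starRingEnd ℂ ρ)) hρ (by rwa [neg_conj_im]) (by simp) h1ρ
    have e : star (Complex.I * -(starRingEnd ℂ ρ)) + Complex.I * ρ = 2 * Complex.I * ρ := by
      simp; ring
    rw [e] at this
    exact this
  · have := key r r (by simp) (by simp) rfl (by simpa using hr)
    have e : star (Complex.I * (r : ℂ)) + Complex.I * r = 0 := by simp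
    rw [e, zero_smul, sub_zero] at this
    exact this

lemma exists_contD_bound : ∃ c, 0 ≤ c ∧ ∀ ρ : ℂ, 0 ≤ ρ.im → 1 ≤ ‖ρ‖ →
    ‖ρ‖ * ‖contD Q ρ - 1‖ ≤ c := by
  obtain ⟨c, hc, h1, -⟩ := h.exists_wr_bound
  refine ⟨c, hc, fun ρ hρ hn => ?_⟩
  have hne : ρ ≠ 0 := by rintro rfl; simp at hn; linarith
  have hne' : 2 * Complex.I * ρ ≠ 0 := by simpa using hne
  have e : contD Q ρ - 1 = (1 / (2 * Complex.I * ρ)) • (jostWr Q ρ - (2 * Complex.I * ρ) • 1) := by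
    rw [h.contD_eq hρ, smul_sub, smul_smul, one_div_mul_cancel hne', one_smul]
  have hp : 0 < ‖ρ‖ := norm_pos_iff.2 hne
  rw [e, norm_smul]
  have : ‖(1 / (2 * Complex.I * ρ) : ℂ)‖ = 1 / (2 * ‖ρ‖) := by simp
  rw [this, ← mul_assoc]
  have e2 : ‖ρ‖ * (1 / (2 * ‖ρ‖)) = 1 / 2 := by field_simp
  rw [e2]
  have := h1 ρ hρ hn
  have := norm_nonneg (jostWr Q ρ - (2 * Complex.I * ρ) • 1)
  linarith

lemma continuousOn_scatPlus : ContinuousOn (scatPlus Q) {r : ℝ | r ≠ 0} := by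
  obtain ⟨a1, -, a3, -⟩ := h.modPlus_spec 0
  obtain ⟨b1, -, b3, -⟩ := h.refl.modPlus_spec 0
  have hof : ∀ {f : ℂ → Mat m}, ContinuousOn f {ρ : ℂ | 0 ≤ ρ.im} → Continuous fun r : ℝ => f r :=
    fun hf => hf.comp_continuous Complex.continuous_ofReal fun r => by simp
  have hw : Continuous fun r : ℝ =>
      wr (jostPlus Q r) (jostPlus' Q r) (jostMinus Q r) (jostMinus' Q r) 0 := by
    have := ((continuous_star.comp (hof a3)).mul (hof b1)).add
      ((continuous_star.comp (hof a1)).mul (hof b3))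
    refine this.congr fun r => ?_
    simp only [wr, h.jostMinus_eq (ρ := r) (by simp), h.jostMinus_eq' (ρ := r) (by simp),
      modPlus_zero, modPlus'_zero, neg_zero, mul_neg, sub_neg_eq_add]
    rfl
  have hinv : ContinuousOn (fun r : ℝ => (1 / (2 * Complex.I * r) : ℂ)) {r : ℝ | r ≠ 0} :=
    ContinuousOn.div continuousOn_const (Continuous.continuousOn (by fun_prop))
      fun r hr => by simpa using hr
  have hC : ContinuousOn (fun r => (coeffCD Q r).1) {r : ℝ | r ≠ 0} :=
    (hinv.neg.smul hw.continuousOn).congr fun r hr => by rw [h.coeffCD_eq hr]; rfl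
  have hD : ContinuousOn (fun r => (coeffCD Q r).2) {r : ℝ | r ≠ 0} :=
    (hinv.smul (hof h.continuousOn_jostWr).continuousOn).congr fun r hr => by rw [h.coeffCD_eq hr]; rfl
  exact hC.mul (continuousOn_matrix_inv hD fun r hr => h.isUnit_D hr)

/-- For `|r| < 1` it suffices that `‖S₊‖ ≤ 1`. For `|r| ≥ 1` one has `S₊ = C D⁻¹` with `‖D⁻¹‖ ≤ 1`
and `C = O(1/r)`. -/
lemma exists_scatPlus_bound : ∃ c, 0 ≤ c ∧ ∀ r : ℝ, r ≠ 0 → ‖scatPlus Q r‖ ^ 2 ≤ c * (1 + r ^ 2)⁻¹ := by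
  obtain ⟨c, hc, -, h2⟩ := h.exists_wr_bound
  refine ⟨2 + 2 * c ^ 2, by positivity, fun r hr => ?_⟩
  have h0 := h.norm_scatPlus_le hr
  have n0 := norm_nonneg (scatPlus Q r)
  have hpos : 0 < 1 + r ^ 2 := by positivity
  rw [← div_eq_mul_inv, le_div_iff₀ hpos]
  rcases le_or_gt 1 |r| with h1 | h1
  · have hC : |r| * ‖scatPlus Q r‖ ≤ c := by
      have h3 := h.norm_inv_D_le hr
      have h4 : ‖scatPlus Q r‖ ≤ ‖(coeffCD Q r).1‖ := by
        rw [scatPlus]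
        exact (norm_mul_le _ _).trans (mul_le_of_le_one_right (norm_nonneg _) h3)
      have h5 : |r| * ‖(coeffCD Q r).1‖ ≤ c := by
        rw [h.coeffCD_eq hr]
        simp only [norm_smul, norm_neg]
        have : ‖(1 / (2 * Complex.I * r) : ℂ)‖ = 1 / (2 * |r|) := by simp
        rw [this, ← mul_assoc]
        have hp : 0 < |r| := abs_pos.2 hr
        have e2 : |r| * (1 / (2 * |r|)) = 1 / 2 := by field_simp
        rw [e2]
        have := h2 r h1
        linarith
      exact (mul_le_mul_of_nonneg_left h4 (abs_nonneg r)).trans h5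
    have h6 : (|r| * ‖scatPlus Q r‖) ^ 2 ≤ c ^ 2 := by gcongr
    rw [mul_pow, sq_abs] at h6
    nlinarith
  · have : r ^ 2 < 1 := by rw [← sq_abs]; nlinarith [abs_nonneg r]
    nlinarith [sq_nonneg c]

lemma aestronglyMeasurable_scatPlus : AEStronglyMeasurable (scatPlus Q) := by
  have h1 := h.continuousOn_scatPlus.aestronglyMeasurable (μ := volume) (measurableSet_singleton (0:ℝ)).compl
  rwa [Measure.restrict_eq_self_of_ae_mem (by
    rw [ae_iff]; simp)] at h1

lemma memLp_scatPlus : MemLp (scatPlus Q) 2 := by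
  obtain ⟨c, hc, hb⟩ := h.exists_scatPlus_bound
  rw [memLp_two_iff_integrable_sq_norm h.aestronglyMeasurable_scatPlus]
  refine (integrable_inv_one_add_sq.const_mul c).mono'
    (h.aestronglyMeasurable_scatPlus.norm.pow 2) ?_
  have : ∀ᵐ r : ℝ, r ≠ 0 := by rw [ae_iff]; simp
  filter_upwards [this] with r hr
  rw [Real.norm_of_nonneg (by positivity)]
  exact hb r hr

end Pot

end

/-! ### Flux estimate for the Wronskian off the imaginary axis -/

section

variable {m : ℕ} {Q : ℝ → Mat m}

/-- The Euclidean space on which the matrices act. -/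
abbrev Vec (m : ℕ) : Type := EuclideanSpace ℂ (Fin m)

/-- The operator defined by a matrix. -/
abbrev opr (A : Mat m) : Vec m →L[ℂ] Vec m := Matrix.toEuclideanCLM (n := Fin m) (𝕜 := ℂ) A

lemma opr_mul_apply (A B : Mat m) (v : Vec m) : opr (A * B) v = opr A (opr B v) := by
  simp [opr]

lemma opr_star_mul (A B : Mat m) (v w : Vec m) :
    inner ℂ v (opr (star A * B) w) = inner ℂ (opr A v) (opr B w) := by
  rw [opr_mul_apply, opr, map_star, ContinuousLinearMap.star_eq_adjoint,
    ContinuousLinearMap.adjoint_inner_right]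

lemma norm_opr_apply_le (A : Mat m) (v : Vec m) : ‖opr A v‖ ≤ ‖A‖ * ‖v‖ :=
  (opr A).le_opNorm v

lemma opr_smul_apply (c : ℂ) (A : Mat m) (v : Vec m) : opr (c • A) v = c • opr A v := by
  simp [opr]

lemma norm_le_of_opr {A : Mat m} {c : ℝ} (hc : 0 ≤ c) (h : ∀ v, ‖opr A v‖ ≤ c * ‖v‖) : ‖A‖ ≤ c :=
  ContinuousLinearMap.opNorm_le_bound (opr A) hc h

/-- The quadratic form `⟪v, A v⟫` as a function of `A`. -/
def formL (v : Vec m) : Mat m →L[ℂ] ℂ :=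
  LinearMap.toContinuousLinearMap
    { toFun := fun A => inner ℂ v (opr A v)
      map_add' := fun A B => by simp [opr]
      map_smul' := fun c A => by simp [opr] }

@[simp] lemma formL_apply (v : Vec m) (A : Mat m) : formL v A = inner ℂ v (opr A v) := rfl

lemma half_norm_le_opr {A : Mat m} (hA : ‖A - 1‖ ≤ 1 / 2) (v : Vec m) : 1 / 2 * ‖v‖ ≤ ‖opr A v‖ := by
  have h1 : v = opr A v - opr (A - 1) v := by simp [opr]
  have h2 := norm_sub_le (opr A v) (opr (A - 1) v)
  rw [← h1] at h2
  have h3 := (norm_opr_apply_le (A - 1) v).trans (mul_le_mul_of_nonneg_right hA (norm_nonneg v))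
  linarith

lemma continuous_opr_apply {Y : ℝ → Mat m} (hY : Continuous Y) (v : Vec m) :
    Continuous fun t => opr (Y t) v := by
  have : Continuous fun A : Mat m => opr A v := by
    refine LinearMap.continuous_of_finiteDimensional
      (f := (⟨⟨fun A : Mat m => opr A v, fun A B => ?_⟩, fun c A => ?_⟩ : Mat m →ₗ[ℂ] Vec m))
    · simp [opr]
    · simp [opr]
  exact this.comp hY

/-- The flux of the solution `Y v`. -/
def flux (Y Y' : ℝ → Mat m) (v : Vec m) (x : ℝ) : ℝ := (formL v (wr Y Y' Y Y' x)).im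

/-- Green's identity for a solution paired with itself, where `λ - λ̄ = 2i Im λ`; the flux is
therefore monotone with a known rate. -/
lemma Sol.flux_sub {lam : ℂ} {Y Y' : ℝ → Mat m} (hY : Sol Q lam Y Y') (h : Pot Q) (v : Vec m) (a b : ℝ) :
    flux Y Y' v b - flux Y Y' v a = 2 * lam.im * ∫ t in a..b, ‖opr (Y t) v‖ ^ 2 := by
  have h1 := hY.green hY h.integrable h.isSelfAdjoint a b
  have hc := hY.continuous
  have hi : IntervalIntegrable (fun t => star (Y t) * Y t) volume a b :=
    ((continuous_star.comp hc).mul hc).intervalIntegrable a b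
  have h2 : (formL v) (∫ t in a..b, star (Y t) * Y t) = ((∫ t in a..b, ‖opr (Y t) v‖ ^ 2 : ℝ) : ℂ) := by
    rw [← ContinuousLinearMap.intervalIntegral_comp_comm _ hi, ← intervalIntegral.integral_ofReal]
    refine intervalIntegral.integral_congr fun t _ => ?_
    simp only [formL_apply]
    rw [opr_star_mul, inner_self_eq_norm_sq_to_K]
    norm_cast
  rw [flux, flux, ← Complex.sub_im, ← map_sub, h1, map_smul, h2, smul_eq_mul, Complex.sub_conj]
  simp only [Complex.im_mul_ofReal]
  simp

lemma sq_im (ρ : ℂ) : (ρ ^ 2).im = 2 * ρ.re * ρ.im := by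
  rw [sq, Complex.mul_im]; ring

lemma norm_exp_I_mul (ρ : ℂ) (x : ℝ) : ‖Complex.exp (Complex.I * ρ * x)‖ = Real.exp (-(ρ.im * x)) := by
  rw [Complex.norm_exp]; simp

lemma norm_exp_neg_I_mul (ρ : ℂ) (x : ℝ) : ‖Complex.exp (-(Complex.I * ρ * x))‖ = Real.exp (ρ.im * x) := by
  rw [Complex.norm_exp]; simp

namespace Pot

lemma exists_modPlus_close (h : Pot Q) {ε : ℝ} (hε : 0 < ε) : ∃ X, ∀ x, X ≤ x → ∀ ρ : ℂ,
    0 ≤ ρ.im → ‖modPlus Q x ρ - 1‖ ≤ ε := by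
  obtain ⟨p, B, C, hB, hJ⟩ := h.exists_jost
  obtain ⟨X, hX⟩ := hB.exists_kernelMass_lt hε
  refine ⟨X, fun x hx ρ hρ => ?_⟩
  have e1 : modPlus Q x ρ = jostF B ρ x := by
    rw [modPlus, hJ ρ hρ, jostSol, smul_smul, ← Complex.exp_add, neg_add_cancel, Complex.exp_zero,
      one_smul]
  rw [e1]
  exact (hB.norm_jostF_sub_one_le hρ x).trans (hX x hx).le

lemma isUnit_jostPlus {x : ℝ} {ρ : ℂ} (hx : ‖modPlus Q x ρ - 1‖ ≤ 1 / 2) : IsUnit (jostPlus Q ρ x) := by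
  have h1 : ‖1 - modPlus Q x ρ‖ < 1 := by rw [norm_sub_rev]; linarith
  have h2 : IsUnit (modPlus Q x ρ) := by simpa using isUnit_one_sub_of_norm_lt_one h1
  rw [jostPlus_eq_smul_modPlus, Algebra.smul_def]
  exact ((IsUnit.mk0 _ (Complex.exp_ne_zero _)).map (algebraMap ℂ (Mat m))).mul h2

variable (h : Pot Q)
include h

lemma tendsto_flux {ρ : ℂ} (hρ : 0 < ρ.im) (v : Vec m) :
    Tendsto (flux (jostPlus Q ρ) (jostPlus' Q ρ) v) atTop (𝓝 0) := by
  have hz : Tendsto (fun x : ℝ => Complex.exp (Complex.I * ρ * x)) atTop (𝓝 0) := by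
    rw [tendsto_zero_iff_norm_tendsto_zero]
    simp only [norm_exp_I_mul]
    exact Real.tendsto_exp_neg_atTop_nhds_zero.comp (tendsto_id.const_mul_atTop hρ)
  have h1 : Tendsto (jostPlus Q ρ) atTop (𝓝 0) := by
    have := hz.smul (h.tendsto_jostPlus hρ.le)
    simp only [smul_smul, ← Complex.exp_add, add_neg_cancel, Complex.exp_zero, one_smul, zero_smul] at this
    exact this
  have h2 : Tendsto (jostPlus' Q ρ) atTop (𝓝 0) := by
    have := hz.smul (h.tendsto_jostPlus' hρ.le)
    rw [zero_smul] at this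
    simp only [smul_smul, ← Complex.exp_add, add_neg_cancel, Complex.exp_zero, one_smul] at this
    exact this
  have h3 := (((continuous_star.tendsto _).comp h2).mul h1).sub
    (((continuous_star.tendsto _).comp h1).mul h2)
  have h4 := (Complex.continuous_im.tendsto _).comp (((formL v).continuous.tendsto _).comp h3)
  simp only [star_zero, mul_zero, sub_zero, map_zero, Complex.zero_im] at h4
  exact h4

/-- The flux of the Jost solution towards infinity. -/
lemma le_flux {X : ℝ} (hX : ∀ x, X ≤ x → ∀ ρ : ℂ, 0 ≤ ρ.im → ‖modPlus Q x ρ - 1‖ ≤ 1 / 2)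
    {ρ : ℂ} (hρ : 0 < ρ.im) (v : Vec m) :
    1 / 2 * ρ.re ^ 2 * Real.exp (-(2 * ρ.im * X)) * ‖v‖ ^ 2 ≤
      -(ρ.re * flux (jostPlus Q ρ) (jostPlus' Q ρ) v X) := by
  set f := flux (jostPlus Q ρ) (jostPlus' Q ρ) v
  have hs := h.sol_jostPlus hρ.le
  -- Beyond `X` one has `‖F v‖² ≥ ¼ e^{-2t Im ρ} ‖v‖²`. The factor `Im ρ` from `Im ρ² = 2 Re ρ Im ρ`
  -- cancels the `1/(2 Im ρ)` from integrating the exponential, so the bound does not degenerate at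
  -- the real axis.
  have hl : ∀ L, X ≤ L → 1 / 2 * ρ.re ^ 2 * (Real.exp (-(2 * ρ.im * X)) - Real.exp (-(2 * ρ.im * L))) *
      ‖v‖ ^ 2 + ρ.re * f X ≤ ρ.re * f L := by
    intro L hL
    have h1 := hs.flux_sub h v X L
    rw [sq_im] at h1
    have h2 : ∫ t in X..L, 1 / 4 * ‖v‖ ^ 2 * Real.exp (-(2 * ρ.im * t)) ≤
        ∫ t in X..L, ‖opr (jostPlus Q ρ t) v‖ ^ 2 := by
      refine intervalIntegral.integral_mono_on hL (Continuous.intervalIntegrable (by fun_prop) _ _)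
        (((continuous_opr_apply hs.continuous v).norm.pow 2).intervalIntegrable _ _) fun t ht => ?_
      have h3 := half_norm_le_opr (hX t ht.1 ρ hρ.le) v
      rw [jostPlus_eq_smul_modPlus, opr_smul_apply, norm_smul, norm_exp_I_mul, mul_pow]
      have e : Real.exp (-(ρ.im * t)) ^ 2 = Real.exp (-(2 * ρ.im * t)) := by
        rw [sq, ← Real.exp_add]; congr 1; ring
      rw [e, mul_comm]
      refine mul_le_mul_of_nonneg_left ?_ (Real.exp_pos _).le
      have := norm_nonneg v
      nlinarith
    have h4 : ∫ t in X..L, 1 / 4 * ‖v‖ ^ 2 * Real.exp (-(2 * ρ.im * t)) = 1 / 4 * ‖v‖ ^ 2 *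
        ((Real.exp (-(2 * ρ.im * X)) - Real.exp (-(2 * ρ.im * L))) / (2 * ρ.im)) := by
      rw [intervalIntegral.integral_const_mul]
      congr 1
      have hd : ∀ t : ℝ, HasDerivAt (fun t : ℝ => -(Real.exp (-(2 * ρ.im * t)) / (2 * ρ.im)))
          (Real.exp (-(2 * ρ.im * t))) t := fun t => by
        have := ((((hasDerivAt_id t).const_mul (2 * ρ.im)).neg.exp).div_const (2 * ρ.im)).neg
        refine this.congr_deriv ?_
        have : ρ.im ≠ 0 := hρ.ne'
        simp only [id]
        field_simp
        rfl
      rw [intervalIntegral.integral_eq_sub_of_hasDerivAt (fun t _ => hd t)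
        (Continuous.intervalIntegrable (by fun_prop) _ _)]
      ring
    rw [h4] at h2
    have h5 := mul_le_mul_of_nonneg_left h2
      (show 0 ≤ 4 * ρ.re ^ 2 * ρ.im by positivity)
    have h6 : 4 * ρ.re ^ 2 * ρ.im * (1 / 4 * ‖v‖ ^ 2 *
        ((Real.exp (-(2 * ρ.im * X)) - Real.exp (-(2 * ρ.im * L))) / (2 * ρ.im))) =
        1 / 2 * ρ.re ^ 2 * (Real.exp (-(2 * ρ.im * X)) - Real.exp (-(2 * ρ.im * L))) * ‖v‖ ^ 2 := by
      have : ρ.im ≠ 0 := hρ.ne'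
      field_simp
    have h7 : 4 * ρ.re ^ 2 * ρ.im * ∫ t in X..L, ‖opr (jostPlus Q ρ t) v‖ ^ 2 =
        ρ.re * (f L - f X) := by
      rw [h1]; ring
    rw [h6, h7] at h5
    linarith
  have hexp : Tendsto (fun L : ℝ => Real.exp (-(2 * ρ.im * L))) atTop (𝓝 0) :=
    Real.tendsto_exp_neg_atTop_nhds_zero.comp (tendsto_id.const_mul_atTop (by linarith))
  have l1 := (((hexp.const_sub (Real.exp (-(2 * ρ.im * X)))).const_mul (1 / 2 * ρ.re ^ 2)).mul_const
    (‖v‖ ^ 2)).add_const (ρ.re * f X)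
  have l2 := (h.tendsto_flux hρ v).const_mul ρ.re
  have := le_of_tendsto_of_tendsto l1 l2 (eventually_atTop.2 ⟨X, hl⟩)
  rw [sub_zero, mul_zero] at this
  linarith

/-- Lower bound for the Wronskian of the Jost solutions away from the imaginary axis. -/
lemma exists_jostWr_lower (r : ℝ) : ∃ K, 0 ≤ K ∧ ∀ ρ : ℂ, 0 < ρ.im → ‖ρ‖ ≤ r → ∀ v : Vec m,
    |ρ.re| * ‖v‖ ≤ K * ‖opr (jostWr Q ρ) v‖ := by
  obtain ⟨X₁, hX₁⟩ := h.exists_modPlus_close (ε := 1 / 2) (by norm_num)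
  obtain ⟨X₂, hX₂⟩ := h.refl.exists_modPlus_close (ε := 1 / 2) (by norm_num)
  obtain ⟨X, h0, h1, h2⟩ : ∃ X : ℝ, 0 ≤ X ∧ X₁ ≤ X ∧ X₂ ≤ X :=
    ⟨max 0 (max X₁ X₂), le_max_left _ _, (le_max_left _ _).trans (le_max_right _ _),
      (le_max_right _ _).trans (le_max_right _ _)⟩
  obtain ⟨-, -, -, -, c, hc, hb⟩ := h.refl.modPlus_spec (-X)
  refine ⟨8 * c * Real.exp (4 * |r| * X), by positivity, fun ρ hρ hr v => ?_⟩
  have hρ' : 0 < (-(starRingEnd ℂ ρ)).im := by rwa [neg_conj_im]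
  have hη : ρ.im ≤ |r| := (Complex.im_le_norm ρ).trans (hr.trans (le_abs_self r))
  set G := jostMinus Q ρ with hG
  set G' := jostMinus' Q ρ with hG'
  set F := jostPlus Q ρ with hF
  set F' := jostPlus' Q ρ with hF'
  have sG : Sol Q (ρ ^ 2) G G' := h.sol_jostMinus hρ.le
  have sF : Sol Q (ρ ^ 2) F F' := h.sol_jostPlus hρ.le
  have nF := hX₁ X h1
  obtain ⟨u, hu⟩ := isUnit_jostPlus (nF ρ hρ.le)
  -- The multiple `F a` agrees with `G` in value at `X`; the mismatch of derivatives, `δ` below,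
  -- measures how far `G` is from being a multiple of `F`.
  set a : Mat m := ↑u⁻¹ * G X with ha
  have hFa : F X * a = G X := by rw [ha, ← mul_assoc, hF, ← hu, Units.mul_inv, one_mul]
  set δ : Mat m := G' X - F' X * a with hδ
  -- the flux of `G` from the left
  have f1 : 1 / 2 * ρ.re ^ 2 * Real.exp (-(2 * ρ.im * X)) * ‖v‖ ^ 2 ≤ ρ.re * flux G G' v X := by
    have k1 := h.refl.le_flux (fun x hx => hX₂ x (h2.trans hx)) hρ v
    have k2 : flux G G' v (-X) = -flux (jostPlus (reflect Q) ρ) (jostPlus' (reflect Q) ρ) v X := by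
      simp only [flux, wr, hG, hG', h.jostMinus_eq hρ.le, h.jostMinus_eq' hρ.le, neg_neg, star_neg,
        neg_mul, mul_neg]
      rw [← Complex.neg_im, ← map_neg]
      congr 2
      abel
    have k3 := sG.flux_sub h v (-X) X
    have k4 : 0 ≤ ∫ t in (-X)..X, ‖opr (G t) v‖ ^ 2 :=
      intervalIntegral.integral_nonneg (by linarith) fun t _ => by positivity
    rw [sq_im] at k3
    have k5 : ρ.re * (flux G G' v X - flux G G' v (-X)) =
        4 * ρ.re ^ 2 * ρ.im * ∫ t in (-X)..X, ‖opr (G t) v‖ ^ 2 := by rw [k3]; ring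
    have k6 : 0 ≤ 4 * ρ.re ^ 2 * ρ.im * ∫ t in (-X)..X, ‖opr (G t) v‖ ^ 2 := by positivity
    rw [k2] at k5
    linarith
  -- the flux of the matched multiple of `F` to the right
  have f2 : 0 ≤ -(ρ.re * flux F F' (opr a v) X) := by
    refine le_trans (by positivity) (h.le_flux (fun x hx => hX₁ x (h1.trans hx)) hρ (opr a v))
  have f3 : flux G G' v X - flux F F' (opr a v) X =
      (inner ℂ (opr δ v) (opr (G X) v) - inner ℂ (opr (G X) v) (opr δ v)).im := by
    simp only [flux, wr, map_sub, formL_apply, opr_star_mul, ← Complex.sub_im]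
    congr 1
    have e1 : opr (F X) (opr a v) = opr (G X) v := by rw [← opr_mul_apply, hFa]
    have e2 : opr δ v = opr (G' X) v - opr (F' X) (opr a v) := by
      rw [hδ, ← opr_mul_apply]; simp [opr]
    rw [e1, e2, inner_sub_left, inner_sub_right]
    ring
  have f4 : |flux G G' v X - flux F F' (opr a v) X| ≤ 2 * (‖opr δ v‖ * ‖opr (G X) v‖) := by
    rw [f3]
    refine (Complex.abs_im_le_norm _).trans ((norm_sub_le _ _).trans ?_)
    have := norm_inner_le_norm (𝕜 := ℂ) (opr δ v) (opr (G X) v)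
    have := norm_inner_le_norm (𝕜 := ℂ) (opr (G X) v) (opr δ v)
    linarith
  -- Multiplied by `Re ρ`, the two fluxes have opposite signs, so their difference dominates the
  -- flux of `G` alone.
  have f5 : 1 / 2 * ρ.re ^ 2 * Real.exp (-(2 * ρ.im * X)) * ‖v‖ ^ 2 ≤
      |ρ.re| * (2 * (‖opr δ v‖ * ‖opr (G X) v‖)) := by
    have e := mul_le_mul_of_nonneg_left f4 (abs_nonneg ρ.re)
    rw [← abs_mul] at e
    have := le_abs_self (ρ.re * (flux G G' v X - flux F F' (opr a v) X))
    linarith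
  -- the defect is controlled by the Wronskian
  have f6 : jostWr Q ρ = -(star (jostPlus Q (-(starRingEnd ℂ ρ)) X) * δ) := by
    have k1 : jostWr Q ρ = wrPlus Q ρ G G' X := h.wrPlus_const hρ.le sG X 0
    have k2 := congrArg (· * a) (h.wrPlus_self hρ.le X)
    simp only [zero_mul] at k2
    rw [k1, hδ, ← sub_zero (wrPlus Q ρ G G' X), ← k2]
    simp only [wrPlus, wr, sub_mul, mul_sub, mul_assoc]
    change _ - (_ * (F X * a) - _) = _
    rw [hFa]
    abel
  have f7 : 1 / 2 * Real.exp (-(ρ.im * X)) * ‖opr δ v‖ ≤ ‖opr (jostWr Q ρ) v‖ := by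
    have e : opr (jostWr Q ρ) v = -(opr (star (jostPlus Q (-(starRingEnd ℂ ρ)) X)) (opr δ v)) := by
      rw [f6, ← opr_mul_apply]; simp [opr]
    rw [e, norm_neg, jostPlus_eq_smul_modPlus, star_smul, opr_smul_apply, norm_smul, norm_star,
      norm_exp_I_mul, neg_conj_im]
    have := half_norm_le_opr (A := star (modPlus Q X (-(starRingEnd ℂ ρ))))
      (by rw [← star_one, ← star_sub, norm_star]; exact nF _ hρ'.le) (opr δ v)
    have := mul_le_mul_of_nonneg_left this (Real.exp_pos (-(ρ.im * X))).le
    linarith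
  have f8 : ‖opr (G X) v‖ ≤ Real.exp (ρ.im * X) * c * ‖v‖ := by
    refine (norm_opr_apply_le _ _).trans (mul_le_mul_of_nonneg_right ?_ (norm_nonneg v))
    rw [hG, h.jostMinus_eq_smul_modPlus hρ.le, norm_smul, norm_exp_neg_I_mul]
    exact mul_le_mul_of_nonneg_left (hb ρ hρ.le).2.2 (Real.exp_pos _).le
  rcases eq_or_ne v 0 with rfl | hv
  · simp
  rcases eq_or_ne ρ.re 0 with h00 | h00
  · rw [h00, abs_zero, zero_mul]; positivity
  have hv' : 0 < ‖v‖ := norm_pos_iff.2 hv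
  have hre : 0 < |ρ.re| := abs_pos.2 h00
  have f9 : ‖opr δ v‖ ≤ 2 * Real.exp (ρ.im * X) * ‖opr (jostWr Q ρ) v‖ := by
    have := mul_le_mul_of_nonneg_left f7 (show 0 ≤ 2 * Real.exp (ρ.im * X) by positivity)
    have e : 2 * Real.exp (ρ.im * X) * (1 / 2 * Real.exp (-(ρ.im * X)) * ‖opr δ v‖) = ‖opr δ v‖ := by
      rw [Real.exp_neg]
      have := (Real.exp_pos (ρ.im * X)).ne'
      field_simp
    rwa [e] at this
  have f10 : |ρ.re| * ‖v‖ * (|ρ.re| * ‖v‖) ≤ 8 * c * Real.exp (4 * ρ.im * X) *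
      ‖opr (jostWr Q ρ) v‖ * (|ρ.re| * ‖v‖) := by
    have k1 : ‖opr δ v‖ * ‖opr (G X) v‖ ≤ (2 * Real.exp (ρ.im * X) * ‖opr (jostWr Q ρ) v‖) *
        (Real.exp (ρ.im * X) * c * ‖v‖) := mul_le_mul f9 f8 (norm_nonneg _) (by positivity)
    have k2 := f5.trans (mul_le_mul_of_nonneg_left (mul_le_mul_of_nonneg_left k1 zero_le_two)
      (abs_nonneg ρ.re))
    have k3 := mul_le_mul_of_nonneg_left k2 (show 0 ≤ 2 * Real.exp (2 * ρ.im * X) by positivity)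
    have e1 : 2 * Real.exp (2 * ρ.im * X) * (1 / 2 * ρ.re ^ 2 * Real.exp (-(2 * ρ.im * X)) * ‖v‖ ^ 2) =
        |ρ.re| * ‖v‖ * (|ρ.re| * ‖v‖) := by
      rw [Real.exp_neg, ← sq_abs ρ.re]
      have := (Real.exp_pos (2 * ρ.im * X)).ne'
      field_simp
    have e2 : Real.exp (4 * ρ.im * X) =
        Real.exp (2 * ρ.im * X) * (Real.exp (ρ.im * X) * Real.exp (ρ.im * X)) := by
      rw [← Real.exp_add, ← Real.exp_add]; congr 1; ring
    rw [e1] at k3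
    refine k3.trans (le_of_eq ?_)
    rw [e2]; ring
  have f11 := le_of_mul_le_mul_right f10 (mul_pos hre hv')
  refine f11.trans (mul_le_mul_of_nonneg_right (mul_le_mul_of_nonneg_left ?_ (by positivity))
    (norm_nonneg _))
  rw [Real.exp_le_exp]
  exact mul_le_mul_of_nonneg_right (by linarith) h0

end Pot

end

/-! ### Eigenvalues as singular points of the Wronskian -/

section

variable {m : ℕ} {Q : ℝ → Mat m}

/-- Square integrable continuous functions are small in mean at infinity. -/
lemma tendsto_integral_norm_of_memLp {E : Type*} [NormedAddCommGroup E] {Y : ℝ → E}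
    (hYc : Continuous Y) (hY : MemLp Y 2) :
    Tendsto (fun X : ℝ => ∫ t in X..(X + 1), ‖Y t‖) atTop (𝓝 0) := by
  have hi : Integrable fun t => ‖Y t‖ ^ 2 :=
    (memLp_two_iff_integrable_sq_norm hYc.aestronglyMeasurable).1 hY
  have h1 := intervalIntegral_tendsto_integral_Ioi 0 hi.integrableOn tendsto_id
  have h2 := intervalIntegral_tendsto_integral_Ioi 0 hi.integrableOn
    (tendsto_atTop_add_const_right atTop (1 : ℝ) tendsto_id)
  have h3 := h2.sub h1
  rw [sub_self] at h3
  have h4 : ∀ X : ℝ, (∫ t in (0 : ℝ)..(id X + 1), ‖Y t‖ ^ 2) - ∫ t in (0 : ℝ)..id X, ‖Y t‖ ^ 2 =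
      ∫ t in X..(X + 1), ‖Y t‖ ^ 2 := fun X =>
    intervalIntegral.integral_interval_sub_left hi.intervalIntegrable hi.intervalIntegrable
  simp only [h4] at h3
  rw [Metric.tendsto_atTop]
  intro ε hε
  obtain ⟨T, hT⟩ := eventually_atTop.1 (h3.eventually (gt_mem_nhds (show 0 < ε ^ 2 by positivity)))
  refine ⟨T, fun X hX => ?_⟩
  have h0 : 0 ≤ ∫ t in X..(X + 1), ‖Y t‖ :=
    intervalIntegral.integral_nonneg (by linarith) fun t _ => norm_nonneg _
  rw [Real.dist_eq, sub_zero, abs_of_nonneg h0]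
  -- Young's inequality `‖Y‖ ≤ ε/2 + ‖Y‖²/(2ε)` replaces the Cauchy-Schwarz inequality on the unit
  -- interval.
  have h5 : ∫ t in X..(X + 1), ‖Y t‖ ≤ ∫ t in X..(X + 1), (ε / 2 + 1 / (2 * ε) * ‖Y t‖ ^ 2) := by
    refine intervalIntegral.integral_mono_on (by linarith)
      (hYc.norm.intervalIntegrable _ _) (Continuous.intervalIntegrable (by fun_prop) _ _)
      fun t _ => ?_
    have : ε / 2 + 1 / (2 * ε) * ‖Y t‖ ^ 2 - ‖Y t‖ = (ε - ‖Y t‖) ^ 2 / (2 * ε) := by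
      field_simp; ring
    have h6 : 0 ≤ (ε - ‖Y t‖) ^ 2 / (2 * ε) := by positivity
    linarith
  rw [intervalIntegral.integral_add intervalIntegrable_const
    (Continuous.intervalIntegrable (by fun_prop) _ _), intervalIntegral.integral_const_mul] at h5
  have h6 := mul_lt_mul_of_pos_left (hT X hX) (show 0 < 1 / (2 * ε) by positivity)
  have h7 : 1 / (2 * ε) * ε ^ 2 = ε / 2 := by field_simp
  simp at h5
  simp at h6 h7
  linarith

/-- `spread` as a continuous linear map. -/
def spreadL : (Fin m → ℂ) →L[ℂ] Mat m :=
  LinearMap.toContinuousLinearMap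
    { toFun := spread
      map_add' := fun _ _ => rfl
      map_smul' := fun _ _ => rfl }

lemma mul_spread (A : Mat m) (v : Fin m → ℂ) : A * spread v = spread (A *ᵥ v) := rfl

lemma spread_zero : (spread 0 : Mat m) = 0 := rfl

lemma tendsto_exp_I_mul_atTop {ρ : ℂ} (hρ : 0 < ρ.im) :
    Tendsto (fun x : ℝ => Complex.exp (Complex.I * ρ * x)) atTop (𝓝 0) := by
  rw [tendsto_zero_iff_norm_tendsto_zero]
  simp only [norm_exp_I_mul]
  exact Real.tendsto_exp_neg_atTop_nhds_zero.comp (tendsto_id.const_mul_atTop hρ)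

namespace Pot

variable (h : Pot Q)
include h

lemma tendsto_jostPlus_zero {ρ : ℂ} (hρ : 0 < ρ.im) : Tendsto (jostPlus Q ρ) atTop (𝓝 0) := by
  have := (tendsto_exp_I_mul_atTop hρ).smul (h.tendsto_jostPlus hρ.le)
  rw [zero_smul] at this
  simp only [smul_smul, ← Complex.exp_add, add_neg_cancel, Complex.exp_zero, one_smul] at this
  exact this

lemma tendsto_jostPlus'_zero {ρ : ℂ} (hρ : 0 < ρ.im) : Tendsto (jostPlus' Q ρ) atTop (𝓝 0) := by
  have := (tendsto_exp_I_mul_atTop hρ).smul (h.tendsto_jostPlus' hρ.le)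
  rw [zero_smul] at this
  simp only [smul_smul, ← Complex.exp_add, add_neg_cancel, Complex.exp_zero, one_smul] at this
  exact this

lemma tendsto_jostMinus_zero {ρ : ℂ} (hρ : 0 < ρ.im) : Tendsto (jostMinus Q ρ) atBot (𝓝 0) := by
  rw [show jostMinus Q ρ = fun x => jostPlus (reflect Q) ρ (-x) from funext (h.jostMinus_eq hρ.le)]
  exact (h.refl.tendsto_jostPlus_zero hρ).comp tendsto_neg_atBot_atTop

lemma tendsto_jostMinus'_zero {ρ : ℂ} (hρ : 0 < ρ.im) : Tendsto (jostMinus' Q ρ) atBot (𝓝 0) := by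
  rw [show jostMinus' Q ρ = fun x => -jostPlus' (reflect Q) ρ (-x) from
    funext (h.jostMinus_eq' hρ.le)]
  simpa using ((h.refl.tendsto_jostPlus'_zero hρ).comp tendsto_neg_atBot_atTop).neg

lemma jostMinus_mul_cancel {ρ : ℂ} (hρ : 0 ≤ ρ.im) {a b : Mat m}
    (hab : ∀ x, jostMinus Q ρ x * a = jostMinus Q ρ x * b) : a = b := by
  refine h.refl.jostPlus_mul_cancel hρ fun x => ?_
  have := hab (-x)
  rwa [h.jostMinus_eq hρ, neg_neg] at this

lemma eq_jostMinus_mul_of_memLp {ρ : ℂ} (hρ : 0 ≤ ρ.im) {Y Y' : ℝ → Mat m}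
    (hY : Sol Q (ρ ^ 2) Y Y') (hm : MemLp Y 2) : ∃ a, ∀ x, Y x = jostMinus Q ρ x * a := by
  have hm' : MemLp (fun x => Y (-x)) 2 :=
    hm.comp_measurePreserving (Measure.measurePreserving_neg (volume : Measure ℝ))
  obtain ⟨a, ha⟩ := h.refl.eq_jostPlus_mul_of_tendsto hρ hY.comp_neg
    (tendsto_integral_norm_of_memLp hY.comp_neg.continuous hm')
  refine ⟨a, fun x => ?_⟩
  rw [h.jostMinus_eq hρ, ← ha, neg_neg]

lemma wrPlus_jostMinus_mul {ρ : ℂ} (a : Mat m) :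
    wrPlus Q ρ (fun x => jostMinus Q ρ x * a) (fun x => jostMinus' Q ρ x * a) 0 = jostWr Q ρ * a := by
  simp only [jostWr, wrPlus, wr, sub_mul, mul_assoc]

/-- On the right the representation by `F₊` decays like `e^{-x Im ρ}`, on the left the one by `F₋`
like `e^{x Im ρ}`, and the middle is compact. -/
lemma memLp_of_eq {ρ : ℂ} (hρ : 0 < ρ.im) {a b : Mat m}
    (hab : ∀ x, jostMinus Q ρ x * b = jostPlus Q ρ x * a) :
    MemLp (fun x => jostPlus Q ρ x * a) 2 := by
  have hc : Continuous fun x => jostPlus Q ρ x * a :=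
    (h.sol_jostPlus hρ.le).continuous.mul continuous_const
  obtain ⟨T, hT⟩ := eventually_atTop.1 ((h.tendsto_jostPlus hρ.le).norm.eventually
    (gt_mem_nhds (lt_add_one _)))
  have hbot : Tendsto (fun x : ℝ => Complex.exp (Complex.I * ρ * x) • jostMinus Q ρ x) atBot (𝓝 1) :=
    (Classical.epsilon_spec (p := IsJostMinus Q ρ) (h.existsUnique_jostMinus hρ.le).exists).2
  obtain ⟨S, hS⟩ := eventually_atBot.1 (hbot.norm.eventually (gt_mem_nhds (lt_add_one _)))
  set k := ‖(1 : Mat m)‖ + 1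
  have hk : 0 ≤ k := by positivity
  have hexp : IntegrableOn (fun x : ℝ => Real.exp (-(2 * ρ.im) * x)) (Ioi T) :=
    integrableOn_exp_mul_Ioi (by linarith) T
  have hexp' : IntegrableOn (fun x : ℝ => Real.exp ((2 * ρ.im) * x)) (Iio S) :=
    (integrableOn_exp_mul_Iic (by linarith) S).mono_set Iio_subset_Iic_self
  rw [memLp_two_iff_integrable_sq_norm hc.aestronglyMeasurable]
  have hu : (univ : Set ℝ) = Iio S ∪ (Icc S T ∪ Ioi T) := by
    ext x
    simp only [mem_univ, mem_union, mem_Iio, mem_Icc, mem_Ioi, true_iff]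
    rcases lt_or_ge x S with h1 | h1
    · exact Or.inl h1
    · rcases le_or_gt x T with h2 | h2
      · exact Or.inr (Or.inl ⟨h1, h2⟩)
      · exact Or.inr (Or.inr h2)
  rw [← integrableOn_univ, hu]
  refine IntegrableOn.union ?_ (IntegrableOn.union ((hc.norm.pow 2).integrableOn_Icc) ?_)
  · refine (hexp'.const_mul ((k * ‖b‖) ^ 2)).mono' (hc.norm.pow 2).aestronglyMeasurable ?_
    filter_upwards [ae_restrict_mem measurableSet_Iio] with x hx
    rw [Real.norm_of_nonneg (by positivity), ← hab]
    have h1 := (hS x (le_of_lt hx)).le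
    rw [norm_smul, norm_exp_I_mul] at h1
    have h2 : ‖jostMinus Q ρ x‖ ≤ k * Real.exp (ρ.im * x) := by
      have := mul_le_mul_of_nonneg_right h1 (Real.exp_pos (ρ.im * x)).le
      rwa [mul_right_comm, ← Real.exp_add, neg_add_cancel, Real.exp_zero, one_mul] at this
    calc ‖jostMinus Q ρ x * b‖ ^ 2 ≤ (k * Real.exp (ρ.im * x) * ‖b‖) ^ 2 := by
          gcongr
          exact (norm_mul_le _ _).trans (mul_le_mul_of_nonneg_right h2 (norm_nonneg _))
      _ = (k * ‖b‖) ^ 2 * Real.exp (2 * ρ.im * x) := by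
          rw [show 2 * ρ.im * x = ρ.im * x + ρ.im * x by ring, Real.exp_add]; ring
  · refine (hexp.const_mul ((k * ‖a‖) ^ 2)).mono' (hc.norm.pow 2).aestronglyMeasurable ?_
    filter_upwards [ae_restrict_mem measurableSet_Ioi] with x hx
    rw [Real.norm_of_nonneg (by positivity)]
    have h1 := (hT x (le_of_lt hx)).le
    rw [norm_smul, norm_exp_neg_I_mul] at h1
    have h2 : ‖jostPlus Q ρ x‖ ≤ k * Real.exp (-(ρ.im * x)) := by
      have := mul_le_mul_of_nonneg_right h1 (Real.exp_pos (-(ρ.im * x))).le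
      rwa [mul_right_comm, ← Real.exp_add, add_neg_cancel, Real.exp_zero, one_mul] at this
    calc ‖jostPlus Q ρ x * a‖ ^ 2 ≤ (k * Real.exp (-(ρ.im * x)) * ‖a‖) ^ 2 := by
          gcongr
          exact (norm_mul_le _ _).trans (mul_le_mul_of_nonneg_right h2 (norm_nonneg _))
      _ = (k * ‖a‖) ^ 2 * Real.exp (-(2 * ρ.im) * x) := by
          rw [show -(2 * ρ.im) * x = -(ρ.im * x) + -(ρ.im * x) by ring, Real.exp_add]; ring

/-- Singularity of the Wronskian yields a common decaying solution. -/
lemma exists_eq_of_mul_eq_zero {ρ : ℂ} (hρ : 0 ≤ ρ.im) {b : Mat m} (hb : jostWr Q ρ * b = 0) :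
    ∃ a, ∀ x, jostMinus Q ρ x * b = jostPlus Q ρ x * a :=
  h.eq_jostPlus_mul hρ ((h.sol_jostMinus hρ).mul_const h.integrable b)
    (by rw [h.wrPlus_jostMinus_mul, hb])

omit h in
lemma exists_mulVec_eq_zero {W : Mat m} (hW : ¬IsUnit W) : ∃ v : Fin m → ℂ, v ≠ 0 ∧ W *ᵥ v = 0 := by
  refine Matrix.exists_mulVec_eq_zero_iff.2 ?_
  by_contra hd
  exact hW ((Matrix.isUnit_iff_isUnit_det _).2 (isUnit_iff_ne_zero.2 hd))

/-- A null vector `v` of `W(ρ)` makes `F₋ v` a multiple of `F₊`, decaying at both ends. It is not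
zero because `F₋` times a nonzero constant cannot vanish identically. -/
lemma isEigenvalue_of_not_isUnit {ρ : ℂ} (hρ : 0 < ρ.im) (hW : ¬IsUnit (jostWr Q ρ)) :
    IsEigenvalue Q (ρ ^ 2) := by
  obtain ⟨v, hv, hWv⟩ := exists_mulVec_eq_zero hW
  obtain ⟨j, hj⟩ := Function.ne_iff.1 hv
  have hb : jostWr Q ρ * spread v = 0 := by rw [mul_spread, hWv, spread_zero]
  obtain ⟨a, ha⟩ := h.exists_eq_of_mul_eq_zero hρ.le hb
  have hs := (h.sol_jostPlus hρ.le).mul_const h.integrable a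
  refine ⟨_, hs.isMatrixSolution h.integrable j, fun h0 => ?_, ?_⟩
  · have h1 : spread v = 0 := h.jostMinus_mul_cancel hρ.le fun x => by
      rw [mul_spread, mul_zero]
      have h2 := congrArg (colL j) (ha x)
      have h3 := congrFun h0 x
      change colL j (jostPlus Q ρ x * a) = 0 at h3
      rw [h3] at h2
      have h4 : jostMinus Q ρ x *ᵥ v = 0 := h2
      rw [h4, spread_zero]
    exact hj (congrFun (congrFun h1 j) j)
  · exact (colL j).comp_memLp' (h.memLp_of_eq hρ ha)

lemma exists_of_isSolution_memLp {ρ : ℂ} (hρ : 0 ≤ ρ.im) {y : ℝ → Fin m → ℂ}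
    (hy : IsSolution Q (ρ ^ 2) y) (hm : MemLp y 2) :
    ∃ Y', Sol Q (ρ ^ 2) (fun x => spread (y x)) Y' ∧ MemLp (fun x => spread (y x)) 2 ∧
      ∃ a, ∀ x, spread (y x) = jostPlus Q ρ x * a := by
  obtain ⟨Y', hY'⟩ := hy.spread.exists_sol h.integrable
  have hm' : MemLp (fun x => spread (y x)) 2 := spreadL.comp_memLp' hm
  exact ⟨Y', hY', hm', h.eq_jostPlus_mul_of_tendsto hρ hY'
    (tendsto_integral_norm_of_memLp hY'.continuous hm')⟩

omit h in
lemma eq_zero_of_spread {y : ℝ → Fin m → ℂ} (h0 : ∀ x, spread (y x) = 0) : y = 0 := by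
  funext x i
  exact congrFun (congrFun (h0 x) i) i

/-- A square-integrable solution is both `F₊ a` and `F₋ b`. For real `ρ` its norm tends to `‖a‖`,
which excludes `a ≠ 0`. For `Im ρ > 0` the Wronskian `W b` equals the vanishing self-Wronskian of
`F₊` times `a`, so `W` invertible would force `b = 0`. -/
lemma not_isUnit_of_isEigenvalue {ρ : ℂ} (hρ : 0 ≤ ρ.im) (he : IsEigenvalue Q (ρ ^ 2)) :
    0 < ρ.im ∧ ¬IsUnit (jostWr Q ρ) := by
  obtain ⟨y, hy, hy0, hm⟩ := he
  obtain ⟨Y', hY, hm', a, ha⟩ := h.exists_of_isSolution_memLp hρ hy hm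
  obtain ⟨b, hb⟩ := h.eq_jostMinus_mul_of_memLp hρ hY hm'
  constructor
  · refine lt_of_le_of_ne hρ fun h0 => hy0 (eq_zero_of_spread fun x => ?_)
    have hn : Tendsto (fun x => ‖spread (y x)‖) atTop (𝓝 ‖a‖) := by
      have h1 := ((h.tendsto_jostPlus hρ).mul_const a).norm
      rw [one_mul] at h1
      refine h1.congr fun t => ?_
      rw [smul_mul_assoc, norm_smul, norm_exp_neg_I_mul, ← h0, zero_mul, Real.exp_zero, one_mul, ha]
    have h2 := tendsto_integral_norm_of_memLp hY.continuous hm'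
    have h3 : ‖a‖ ≤ 0 := by
      by_contra hpos
      push Not at hpos
      obtain ⟨T, hT⟩ := eventually_atTop.1
        ((hn.eventually (lt_mem_nhds (half_lt_self hpos))).and
          (h2.eventually (gt_mem_nhds (half_pos hpos))))
      have h4 : ∫ t in T..(T + 1), ‖a‖ / 2 ≤ ∫ t in T..(T + 1), ‖spread (y t)‖ :=
        intervalIntegral.integral_mono_on (by linarith) intervalIntegrable_const
          (hY.continuous.norm.intervalIntegrable _ _) fun t ht => (hT t ht.1).1.le
      simp at h4
      have := (hT T le_rfl).2
      linarith
    rw [ha, norm_le_zero_iff.1 h3, mul_zero]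
  · intro hu
    have h1 : jostWr Q ρ * b = 0 := by
      have h2 : wrPlus Q ρ (fun x => jostMinus Q ρ x * b) (fun x => jostMinus' Q ρ x * b) 0 =
          wrPlus Q ρ (fun x => jostPlus Q ρ x * a) (fun x => jostPlus' Q ρ x * a) 0 := by
        have e1 : (fun x => jostMinus Q ρ x * b) = fun x => jostPlus Q ρ x * a :=
          funext fun x => by rw [← ha, ← hb]
        have e2 : (fun x => jostMinus' Q ρ x * b) = fun x => jostPlus' Q ρ x * a := by
          rw [← ((h.sol_jostMinus hρ).mul_const h.integrable b).deriv_eq, e1,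
            ((h.sol_jostPlus hρ).mul_const h.integrable a).deriv_eq]
        rw [e1, e2]
      rw [← h.wrPlus_jostMinus_mul, h2]
      have h3 := congrArg (· * a) (h.wrPlus_self hρ 0)
      simpa only [wrPlus, wr, sub_mul, mul_assoc, zero_mul] using h3
    obtain ⟨u, hu⟩ := hu
    rw [← hu, Units.mul_right_eq_zero] at h1
    exact hy0 (eq_zero_of_spread fun x => by rw [hb, h1, mul_zero])

lemma isUnit_jostWr_of_re {ρ : ℂ} (hρ : 0 < ρ.im) (hre : ρ.re ≠ 0) : IsUnit (jostWr Q ρ) := by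
  by_contra hW
  obtain ⟨v, hv, hWv⟩ := exists_mulVec_eq_zero hW
  obtain ⟨K, hK, hl⟩ := h.exists_jostWr_lower ‖ρ‖
  have h1 := hl ρ hρ le_rfl (WithLp.toLp 2 v)
  have h2 : opr (jostWr Q ρ) (WithLp.toLp 2 v) = 0 := by
    rw [opr, Matrix.toEuclideanCLM_toLp, hWv]; rfl
  rw [h2, norm_zero, mul_zero] at h1
  have h3 : 0 < ‖(WithLp.toLp 2 v : Vec m)‖ := norm_pos_iff.2 fun h0 => hv (by
    simpa using congrArg WithLp.ofLp h0)
  have := mul_pos (abs_pos.2 hre) h3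
  linarith

/-- The eigenvalues are the squares of the points where the Wronskian is singular. -/
lemma setOf_isEigenvalue : {lam : ℂ | IsEigenvalue Q lam} =
    (fun τ : ℝ => (Complex.I * (τ : ℂ)) ^ 2) '' {τ | 0 < τ ∧ ¬IsUnit (jostWr Q (Complex.I * τ))} := by
  ext lam
  constructor
  · intro hl
    obtain ⟨ρ, hρ, rfl⟩ : ∃ ρ : ℂ, 0 ≤ ρ.im ∧ ρ ^ 2 = lam := by
      obtain ⟨z, hz⟩ := IsAlgClosed.exists_pow_nat_eq lam zero_lt_two
      rcases le_total 0 z.im with h1 | h1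
      · exact ⟨z, h1, hz⟩
      · exact ⟨-z, by simpa using h1, by rw [neg_sq, hz]⟩
    obtain ⟨h1, h2⟩ := h.not_isUnit_of_isEigenvalue hρ hl
    have h3 : ρ.re = 0 := by
      by_contra h3
      exact h2 (h.isUnit_jostWr_of_re h1 h3)
    have h4 : Complex.I * (ρ.im : ℂ) = ρ := by
      apply Complex.ext <;> simp [h3]
    exact ⟨ρ.im, ⟨h1, by rwa [h4]⟩, by simp only [h4]⟩
  · rintro ⟨τ, ⟨h1, h2⟩, rfl⟩
    exact h.isEigenvalue_of_not_isUnit (by simpa using h1) h2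

end Pot

end

/-! ### Orthogonality of eigenfunctions and absence of accumulation at zero -/

section

variable {m : ℕ} {Q : ℝ → Mat m}

lemma re_inner_ge {a₁ a₂ u₁ u₂ : Vec m} {κ : ℝ} (h₁ : ‖u₁ - a₁‖ ≤ κ) (h₂ : ‖u₂ - a₂‖ ≤ κ)
    (ha₁ : ‖a₁‖ ≤ 1) (ha₂ : ‖a₂‖ ≤ 1) :
    (inner ℂ a₁ a₂).re - (2 * κ + κ ^ 2) ≤ (inner ℂ u₁ u₂).re := by
  have e : inner ℂ u₁ u₂ = inner ℂ a₁ a₂ + (inner ℂ a₁ (u₂ - a₂) + inner ℂ (u₁ - a₁) a₂ +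
      inner ℂ (u₁ - a₁) (u₂ - a₂)) := by
    simp only [inner_sub_left, inner_sub_right]; ring
  have hκ : 0 ≤ κ := (norm_nonneg _).trans h₁
  have k1 : ‖inner ℂ a₁ (u₂ - a₂)‖ ≤ 1 * κ := (norm_inner_le_norm _ _).trans
    (mul_le_mul ha₁ h₂ (norm_nonneg _) zero_le_one)
  have k2 : ‖inner ℂ (u₁ - a₁) a₂‖ ≤ κ * 1 := (norm_inner_le_norm _ _).trans
    (mul_le_mul h₁ ha₂ (norm_nonneg _) hκ)
  have k3 : ‖inner ℂ (u₁ - a₁) (u₂ - a₂)‖ ≤ κ * κ := (norm_inner_le_norm _ _).trans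
    (mul_le_mul h₁ h₂ (norm_nonneg _) hκ)
  have k4 := norm_add₃_le (a := inner ℂ a₁ (u₂ - a₂)) (b := inner ℂ (u₁ - a₁) a₂)
    (c := inner ℂ (u₁ - a₁) (u₂ - a₂))
  have k5 := (abs_le.1 (Complex.abs_re_le_norm (inner ℂ a₁ (u₂ - a₂) + inner ℂ (u₁ - a₁) a₂ +
      inner ℂ (u₁ - a₁) (u₂ - a₂)))).1
  rw [e, Complex.add_re]
  nlinarith

lemma re_intervalIntegral {f : ℝ → ℂ} (hf : Continuous f) (a b : ℝ) :
    (∫ t in a..b, f t).re = ∫ t in a..b, (f t).re :=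
  (Complex.reCLM.intervalIntegral_comp_comm (hf.intervalIntegrable a b)).symm

namespace Pot

lemma exists_modPlus_bound (h : Pot Q) (X : ℝ) : ∃ M, 0 ≤ M ∧ ∀ x, X ≤ x → ∀ ρ : ℂ, 0 ≤ ρ.im →
    ‖modPlus Q x ρ‖ ≤ M := by
  obtain ⟨p, B, C, hB, hJ⟩ := h.exists_jost
  have := hB.kernelMass_nonneg X
  refine ⟨‖(1 : Mat m)‖ + kernelMass p C X, by positivity, fun x hx ρ hρ => ?_⟩
  have e1 : modPlus Q x ρ = jostF B ρ x := by
    rw [modPlus, hJ ρ hρ, jostSol, smul_smul, ← Complex.exp_add, neg_add_cancel, Complex.exp_zero,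
      one_smul]
  rw [e1]
  exact (hB.norm_jostF_le hρ x).trans (add_le_add le_rfl (hB.kernelMass_antitone hx))

variable (h : Pot Q)
include h

lemma continuous_opr_jostPlus {ρ : ℂ} (hρ : 0 ≤ ρ.im) (a : Vec m) :
    Continuous fun x => opr (jostPlus Q ρ x) a :=
  continuous_opr_apply (h.sol_jostPlus hρ).continuous a

/-- Beyond `X` the function `F₊(t,iτ) a` is `e^{-τt}` times a vector within `κ = 1/16` of `a`; the
loss in the inner product is `2κ + κ² = 33/256`. -/
lemma re_integral_inner_ge {X : ℝ}
    (hX : ∀ x, X ≤ x → ∀ ρ : ℂ, 0 ≤ ρ.im → ‖modPlus Q x ρ - 1‖ ≤ 1 / 16) {τ₁ τ₂ : ℝ} (h₁ : 0 < τ₁)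
    (h₂ : 0 < τ₂) {a₁ a₂ : Vec m} (ha₁ : ‖a₁‖ ≤ 1) (ha₂ : ‖a₂‖ ≤ 1) {L : ℝ} (hL : X ≤ L) :
    ((inner ℂ a₁ a₂).re - 33 / 256) * ∫ t in X..L, Real.exp (-((τ₁ + τ₂) * t)) ≤
      ∫ t in X..L, (inner ℂ (opr (jostPlus Q (Complex.I * τ₁) t) a₁)
        (opr (jostPlus Q (Complex.I * τ₂) t) a₂)).re := by
  have i₁ : 0 ≤ (Complex.I * (τ₁ : ℂ)).im := by simpa using h₁.le
  have i₂ : 0 ≤ (Complex.I * (τ₂ : ℂ)).im := by simpa using h₂.le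
  have c1 := h.continuous_opr_jostPlus i₁ a₁
  have c2 := h.continuous_opr_jostPlus i₂ a₂
  rw [← intervalIntegral.integral_const_mul]
  refine intervalIntegral.integral_mono_on hL (Continuous.intervalIntegrable (by fun_prop) _ _)
    ((Complex.continuous_re.comp (c1.inner c2)).intervalIntegrable _ _) fun t ht => ?_
  have key : ∀ (τ : ℝ) (a : Vec m), 0 < τ → ‖a‖ ≤ 1 →
      ‖opr (modPlus Q t (Complex.I * τ)) a - a‖ ≤ 1 / 16 := fun τ a hτ ha => by
    have e : opr (modPlus Q t (Complex.I * τ)) a - a = opr (modPlus Q t (Complex.I * τ) - 1) a := by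
      simp [opr]
    rw [e]
    refine (norm_opr_apply_le _ _).trans ?_
    have := hX t ht.1 (Complex.I * τ) (by simpa using hτ.le)
    nlinarith [norm_nonneg a, norm_nonneg (modPlus Q t (Complex.I * τ) - 1)]
  have k := re_inner_ge (key τ₁ a₁ h₁ ha₁) (key τ₂ a₂ h₂ ha₂) ha₁ ha₂
  have e : ∀ τ : ℝ, Complex.exp (Complex.I * (Complex.I * τ) * t) = ((Real.exp (-(τ * t)) : ℝ) : ℂ) := by
    intro τ
    rw [← mul_assoc, Complex.I_mul_I]
    push_cast; ring_nf
  rw [jostPlus_eq_smul_modPlus, jostPlus_eq_smul_modPlus, opr_smul_apply, opr_smul_apply, e, e,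
    inner_smul_left, inner_smul_right, Complex.conj_ofReal, ← mul_assoc, ← Complex.ofReal_mul,
    ← Real.exp_add, Complex.re_ofReal_mul, ← neg_add, ← add_mul, mul_comm]
  refine mul_le_mul_of_nonneg_left ?_ (Real.exp_pos _).le
  linarith

/-- Eigenfunctions to different eigenvalues are orthogonal. -/
lemma tendsto_integral_inner {τ₁ τ₂ : ℝ} (h₁ : 0 < τ₁) (h₂ : 0 < τ₂) (hne : τ₁ ≠ τ₂)
    {A₁ B₁ A₂ B₂ : Mat m}
    (e₁ : ∀ x, jostMinus Q (Complex.I * τ₁) x * B₁ = jostPlus Q (Complex.I * τ₁) x * A₁)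
    (e₂ : ∀ x, jostMinus Q (Complex.I * τ₂) x * B₂ = jostPlus Q (Complex.I * τ₂) x * A₂) (v : Vec m) :
    Tendsto (fun L : ℝ => ∫ t in (-L)..L, inner ℂ (opr (jostPlus Q (Complex.I * τ₁) t * A₁) v)
      (opr (jostPlus Q (Complex.I * τ₂) t * A₂) v)) atTop (𝓝 0) := by
  have i₁ : 0 < (Complex.I * (τ₁ : ℂ)).im := by simpa using h₁
  have i₂ : 0 < (Complex.I * (τ₂ : ℂ)).im := by simpa using h₂
  have s₁ := (h.sol_jostPlus i₁.le).mul_const h.integrable A₁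
  have s₂ := (h.sol_jostPlus i₂.le).mul_const h.integrable A₂
  have d : ∀ {τ : ℝ} (i : 0 < (Complex.I * (τ : ℂ)).im) {A B : Mat m},
      (∀ x, jostMinus Q (Complex.I * τ) x * B = jostPlus Q (Complex.I * τ) x * A) →
      ∀ x, jostMinus' Q (Complex.I * τ) x * B = jostPlus' Q (Complex.I * τ) x * A := by
    intro τ i A B e x
    have a1 := ((h.sol_jostMinus i.le).mul_const h.integrable B).deriv_eq
    have a2 := ((h.sol_jostPlus i.le).mul_const h.integrable A).deriv_eq
    rw [funext e, a2] at a1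
    exact (congrFun a1 x).symm
  have lt : Tendsto (wr (fun x => jostPlus Q (Complex.I * τ₁) x * A₁)
      (fun x => jostPlus' Q (Complex.I * τ₁) x * A₁) (fun x => jostPlus Q (Complex.I * τ₂) x * A₂)
      (fun x => jostPlus' Q (Complex.I * τ₂) x * A₂)) atTop (𝓝 0) := by
    have k1 := (h.tendsto_jostPlus_zero i₁).mul_const A₁
    have k2 := (h.tendsto_jostPlus'_zero i₁).mul_const A₁
    have k3 := (h.tendsto_jostPlus_zero i₂).mul_const A₂
    have k4 := (h.tendsto_jostPlus'_zero i₂).mul_const A₂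
    have := (k2.star.mul k3).sub (k1.star.mul k4)
    simp only [zero_mul, mul_zero, sub_zero, star_zero] at this
    exact this
  have lb : Tendsto (wr (fun x => jostPlus Q (Complex.I * τ₁) x * A₁)
      (fun x => jostPlus' Q (Complex.I * τ₁) x * A₁) (fun x => jostPlus Q (Complex.I * τ₂) x * A₂)
      (fun x => jostPlus' Q (Complex.I * τ₂) x * A₂)) atBot (𝓝 0) := by
    simp only [← e₁, ← e₂, ← d i₁ e₁, ← d i₂ e₂]
    have k1 := (h.tendsto_jostMinus_zero i₁).mul_const B₁
    have k2 := (h.tendsto_jostMinus'_zero i₁).mul_const B₁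
    have k3 := (h.tendsto_jostMinus_zero i₂).mul_const B₂
    have k4 := (h.tendsto_jostMinus'_zero i₂).mul_const B₂
    have := (k2.star.mul k3).sub (k1.star.mul k4)
    simp only [zero_mul, mul_zero, sub_zero, star_zero] at this
    exact this
  have hlam : (Complex.I * (τ₂ : ℂ)) ^ 2 - starRingEnd ℂ ((Complex.I * (τ₁ : ℂ)) ^ 2) ≠ 0 := by
    have e : (Complex.I * (τ₂ : ℂ)) ^ 2 - starRingEnd ℂ ((Complex.I * (τ₁ : ℂ)) ^ 2) =
        ((τ₁ ^ 2 - τ₂ ^ 2 : ℝ) : ℂ) := by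
      simp [mul_pow]
      ring
    rw [e, Ne, Complex.ofReal_eq_zero, sub_eq_zero, sq_eq_sq₀ h₁.le h₂.le]
    exact hne
  have hl := ((formL v).continuous.tendsto _).comp (lt.sub (lb.comp tendsto_neg_atTop_atBot))
  have hl2 := hl.const_mul ((Complex.I * (τ₂ : ℂ)) ^ 2 - starRingEnd ℂ ((Complex.I * (τ₁ : ℂ)) ^ 2))⁻¹
  rw [sub_zero, map_zero, mul_zero] at hl2
  refine hl2.congr fun L => ?_
  have hi : IntervalIntegrable (fun t => star (jostPlus Q (Complex.I * τ₁) t * A₁) *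
      (jostPlus Q (Complex.I * τ₂) t * A₂)) volume (-L) L :=
    ((continuous_star.comp s₁.continuous).mul s₂.continuous).intervalIntegrable _ _
  simp only [Function.comp_apply]
  rw [s₁.green s₂ h.integrable h.isSelfAdjoint, map_smul, smul_eq_mul, inv_mul_cancel_left₀ hlam,
    ← ContinuousLinearMap.intervalIntegral_comp_comm _ hi]
  simp only [formL_apply, opr_star_mul]

/-- The amplitudes of an eigenfunction at the two ends are scaled onto the unit sphere so that
compactness can be applied. Matrices act through one vector `v`, on which `spread w` returns `w`. -/
lemma exists_normalized {τ : ℝ} (hτ : 0 < τ) (hW : ¬IsUnit (jostWr Q (Complex.I * τ))) {v : Vec m}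
    (hv : ∀ w : Fin m → ℂ, opr (spread w) v = WithLp.toLp 2 w) : ∃ A B : Mat m,
    (∀ x, jostMinus Q (Complex.I * τ) x * B = jostPlus Q (Complex.I * τ) x * A) ∧
    ‖(opr A v, opr B v)‖ = 1 := by
  obtain ⟨w, hw, hWw⟩ := exists_mulVec_eq_zero hW
  have i : 0 ≤ (Complex.I * (τ : ℂ)).im := by simpa using hτ.le
  have hb : jostWr Q (Complex.I * τ) * spread w = 0 := by rw [mul_spread, hWw, spread_zero]
  obtain ⟨A, hA⟩ := h.exists_eq_of_mul_eq_zero i hb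
  have hne : (opr A v, opr (spread w) v) ≠ 0 := by
    intro h0
    have h1 := congrArg Prod.snd h0
    rw [hv] at h1
    exact hw (by simpa using congrArg WithLp.ofLp h1)
  set c : ℂ := ((‖(opr A v, opr (spread w) v)‖⁻¹ : ℝ) : ℂ) with hc
  refine ⟨c • A, c • spread w, fun x => ?_, ?_⟩
  · rw [mul_smul_comm, mul_smul_comm, hA]
  · rw [opr_smul_apply, opr_smul_apply, ← Prod.smul_mk, norm_smul, hc, Complex.norm_real,
      Real.norm_of_nonneg (by positivity), inv_mul_cancel₀ (norm_ne_zero_iff.2 hne)]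

set_option maxHeartbeats 1000000 in
/-- The eigenvalues do not accumulate at the origin. -/
lemma exists_isUnit_near_zero : ∃ ε, 0 < ε ∧ ∀ τ : ℝ, 0 < τ → τ < ε → IsUnit (jostWr Q (Complex.I * τ)) := by
  by_contra hcon
  push Not at hcon
  -- A basis vector is taken for `v`. That an index exists, that is `m ≠ 0`, is learnt from a
  -- singular point.
  obtain ⟨v, hv⟩ : ∃ v : Vec m, ∀ w : Fin m → ℂ, opr (spread w) v = WithLp.toLp 2 w := by
    obtain ⟨τ, -, -, hτ⟩ := hcon 1 one_pos
    obtain ⟨w, hw, -⟩ := exists_mulVec_eq_zero hτ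
    obtain ⟨j, -⟩ := Function.ne_iff.1 hw
    refine ⟨WithLp.toLp 2 (Pi.single j 1), fun w => ?_⟩
    rw [opr, Matrix.toEuclideanCLM_toLp]
    congr 1
    ext i
    simp [spread]
  obtain ⟨X₁, hX₁⟩ := h.exists_modPlus_close (ε := 1 / 16) (by norm_num)
  obtain ⟨X₂, hX₂⟩ := h.refl.exists_modPlus_close (ε := 1 / 16) (by norm_num)
  obtain ⟨X, h0, h1, h2⟩ : ∃ X : ℝ, 0 ≤ X ∧ X₁ ≤ X ∧ X₂ ≤ X :=
    ⟨max 0 (max X₁ X₂), le_max_left _ _, (le_max_left _ _).trans (le_max_right _ _),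
      (le_max_right _ _).trans (le_max_right _ _)⟩
  replace hX₁ := fun x hx => hX₁ x (h1.trans hx)
  replace hX₂ := fun x hx => hX₂ x (h2.trans hx)
  obtain ⟨M₀, hM₀, hb⟩ := h.exists_modPlus_bound (-X)
  set M := Real.exp X * M₀ with hM
  set S : Set ℝ := {τ | 0 < τ ∧ ¬IsUnit (jostWr Q (Complex.I * τ))} with hS
  have hdata : ∀ τ ∈ S, ∃ P : Mat m × Mat m,
      (∀ x, jostMinus Q (Complex.I * τ) x * P.2 = jostPlus Q (Complex.I * τ) x * P.1) ∧
      ‖(opr P.1 v, opr P.2 v)‖ = 1 := fun τ hτ => by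
    obtain ⟨A, B, k1, k2⟩ := h.exists_normalized hτ.1 hτ.2 hv
    exact ⟨(A, B), k1, k2⟩
  choose! P hP hPn using hdata
  set l := 𝓝[>] (0 : ℝ) ⊓ 𝓟 S with hl
  have hlne : l.NeBot := by
    rw [hl, ← frequently_mem_iff_neBot, frequently_iff]
    intro U hU
    obtain ⟨u, hu, hsub⟩ := mem_nhdsGT_iff_exists_Ioo_subset.1 hU
    obtain ⟨τ, k1, k2, k3⟩ := hcon u hu
    exact ⟨τ, hsub ⟨k1, k2⟩, k1, k3⟩
  -- A cluster point of the amplitude pairs as `τ → 0` provides two distinct small singular points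
  -- with nearly equal amplitudes, whose eigenfunctions can hardly be orthogonal.
  obtain ⟨c, -, hc⟩ := (isCompact_sphere (0 : Vec m × Vec m) 1).exists_mapClusterPt (f := l)
    (u := fun τ => (opr (P τ).1 v, opr (P τ).2 v)) (by
      rw [le_principal_iff, mem_map]
      refine mem_inf_of_right (mem_principal.2 fun τ hτ => ?_)
      rw [mem_preimage, mem_sphere_zero_iff_norm]
      exact hPn τ hτ)
  have hfreq : ∀ ε, 0 < ε → ∃ τ ∈ S, τ < ε ∧
      dist (opr (P τ).1 v, opr (P τ).2 v) c < 1 / 32 := by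
    intro ε hε
    have k1 := mapClusterPt_iff_frequently.1 hc (Metric.ball c (1 / 32))
      (Metric.ball_mem_nhds _ (by norm_num))
    have k2 : ∀ᶠ τ in l, τ ∈ S ∧ τ < ε := by
      refine Eventually.and (mem_inf_of_right (mem_principal_self S)) (mem_inf_of_left ?_)
      exact mem_nhdsWithin_of_mem_nhds (gt_mem_nhds hε)
    obtain ⟨τ, a1, a2, a3⟩ := (k1.and_eventually k2).exists
    exact ⟨τ, a2, a3, a1⟩
  -- With `s = τ₁ + τ₂ < 2ε`, orthogonality will give `e^{-sX} ≤ 4 X M² s`; this `ε` makes `s (16 X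
  -- M² + 16) < e^{-X}`, a contradiction since `s ≤ 1`.
  set ε : ℝ := min (1 / 2) (Real.exp (-X) / (4 * (8 * X * M ^ 2 + 8))) with hε
  have hεpos : 0 < ε := lt_min (by norm_num) (by positivity)
  obtain ⟨τ₁, hS₁, hlt₁, hd₁⟩ := hfreq ε hεpos
  obtain ⟨τ₂, hS₂, hlt₂, hd₂⟩ := hfreq τ₁ hS₁.1
  have hτ₁ := hS₁.1
  have hτ₂ := hS₂.1
  have n₁ := hPn τ₁ hS₁
  have n₂ := hPn τ₂ hS₂
  have q₁ := hP τ₁ hS₁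
  have q₂ := hP τ₂ hS₂
  set A₁ := (P τ₁).1
  set B₁ := (P τ₁).2
  set A₂ := (P τ₂).1
  set B₂ := (P τ₂).2
  set a₁ := opr A₁ v
  set b₁ := opr B₁ v
  set a₂ := opr A₂ v
  set b₂ := opr B₂ v
  have na₁ : ‖a₁‖ ≤ 1 := (norm_fst_le (a₁, b₁)).trans n₁.le
  have nb₁ : ‖b₁‖ ≤ 1 := (norm_snd_le (a₁, b₁)).trans n₁.le
  have na₂ : ‖a₂‖ ≤ 1 := (norm_fst_le (a₂, b₂)).trans n₂.le
  have nb₂ : ‖b₂‖ ≤ 1 := (norm_snd_le (a₂, b₂)).trans n₂.le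
  have hd : ‖(a₂ - a₁, b₂ - b₁)‖ ≤ 1 / 16 := by
    have := dist_triangle_right (a₂, b₂) (a₁, b₁) c
    rw [dist_eq_norm, Prod.mk_sub_mk] at this
    linarith
  -- The product carries the maximum norm, so one amplitude has norm 1 and the squares sum to at
  -- least 1; from this `2/16` and `66/256` are lost.
  have hinner : 1 / 2 ≤ ((inner ℂ a₁ a₂).re - 33 / 256) + ((inner ℂ b₁ b₂).re - 33 / 256) := by
    have k : ∀ u w : Vec m, ‖u‖ ≤ 1 → ‖w - u‖ ≤ 1 / 16 → ‖u‖ ^ 2 - 1 / 16 ≤ (inner ℂ u w).re := by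
      intro u w hu hw
      have e : inner ℂ u w = inner ℂ u u + inner ℂ u (w - u) := by rw [inner_sub_right]; ring
      have e1 : (inner ℂ u u).re = ‖u‖ ^ 2 := inner_self_eq_norm_sq (𝕜 := ℂ) u
      have e2 := (abs_le.1 ((Complex.abs_re_le_norm _).trans
        (norm_inner_le_norm (𝕜 := ℂ) u (w - u)))).1
      rw [e, Complex.add_re, e1]
      nlinarith [norm_nonneg u, norm_nonneg (w - u)]
    have k1 := k a₁ a₂ na₁ ((norm_fst_le (a₂ - a₁, b₂ - b₁)).trans hd)
    have k2 := k b₁ b₂ nb₁ ((norm_snd_le (a₂ - a₁, b₂ - b₁)).trans hd)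
    have k3 : 1 ≤ ‖a₁‖ ^ 2 + ‖b₁‖ ^ 2 := by
      rw [Prod.norm_mk] at n₁
      rcases max_choice ‖a₁‖ ‖b₁‖ with h5 | h5 <;> rw [h5] at n₁ <;> rw [n₁] <;> nlinarith [sq_nonneg ‖a₁‖, sq_nonneg ‖b₁‖]
    linarith
  have i₁ : 0 ≤ (Complex.I * (τ₁ : ℂ)).im := by simpa using hτ₁.le
  have i₂ : 0 ≤ (Complex.I * (τ₂ : ℂ)).im := by simpa using hτ₂.le
  have c₁ := h.continuous_opr_jostPlus i₁ a₁
  have c₂ := h.continuous_opr_jostPlus i₂ a₂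
  set s := τ₁ + τ₂ with hs
  have hspos : 0 < s := add_pos hτ₁ hτ₂
  set g : ℝ → ℝ := fun t => (inner ℂ (opr (jostPlus Q (Complex.I * τ₁) t) a₁)
        (opr (jostPlus Q (Complex.I * τ₂) t) a₂)).re with hg
  have hgc : Continuous g := Complex.continuous_re.comp (c₁.inner c₂)
  have hlim : Tendsto (fun L : ℝ => ∫ t in (-L)..L, g t) atTop (𝓝 0) := by
    have k := (Complex.continuous_re.tendsto _).comp
      (h.tendsto_integral_inner hτ₁ hτ₂ hlt₂.ne' q₁ q₂ v)
    rw [Complex.zero_re] at k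
    refine k.congr fun L => ?_
    simp only [opr_mul_apply, Function.comp_apply]
    exact re_intervalIntegral (c₁.inner c₂) _ _
  -- Together the two tails contribute at least half of `∫ e^{-st}`, of order `1/s`, while the
  -- middle part is at least `-2 X M²`.
  have hlower : ∀ L, X ≤ L → 1 / 2 * ((Real.exp (-(s * X)) - Real.exp (-(s * L))) / s) - 2 * X * M ^ 2 ≤
      ∫ t in (-L)..L, g t := by
    intro L hL
    have k1 := h.re_integral_inner_ge hX₁ hτ₁ hτ₂ na₁ na₂ hL
    have k2 := h.refl.re_integral_inner_ge hX₂ hτ₁ hτ₂ nb₁ nb₂ hL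
    have e2 : ∫ t in X..L, (inner ℂ (opr (jostPlus (reflect Q) (Complex.I * τ₁) t) b₁)
        (opr (jostPlus (reflect Q) (Complex.I * τ₂) t) b₂)).re = ∫ t in (-L)..(-X), g t := by
      rw [← intervalIntegral.integral_comp_neg]
      refine intervalIntegral.integral_congr fun t _ => ?_
      have r₁ := q₁ (-t)
      have r₂ := q₂ (-t)
      rw [h.jostMinus_eq i₁, neg_neg] at r₁
      rw [h.jostMinus_eq i₂, neg_neg] at r₂
      simp only [g, a₁, a₂, b₁, b₂, ← opr_mul_apply, r₁, r₂]
    rw [e2] at k2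
    have e3 : ∫ t in X..L, Real.exp (-((τ₁ + τ₂) * t)) =
        (Real.exp (-(s * X)) - Real.exp (-(s * L))) / s := by
      have hdv : ∀ t : ℝ, HasDerivAt (fun t : ℝ => -(Real.exp (-(s * t)) / s))
          (Real.exp (-(s * t))) t := fun t => by
        have := ((((hasDerivAt_id t).const_mul s).neg.exp).div_const s).neg
        refine this.congr_deriv ?_
        have := hspos.ne'
        simp only [id]
        field_simp
        rfl
      rw [intervalIntegral.integral_eq_sub_of_hasDerivAt (fun t _ => hdv t)
        (Continuous.intervalIntegrable (by fun_prop) _ _)]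
      ring
    have e4 : 0 ≤ ∫ t in X..L, Real.exp (-((τ₁ + τ₂) * t)) :=
      intervalIntegral.integral_nonneg hL fun t _ => (Real.exp_pos _).le
    have e5 := mul_le_mul_of_nonneg_right hinner e4
    have k3 : -(2 * X * M ^ 2) ≤ ∫ t in (-X)..X, g t := by
      have hbd : ∀ (τ : ℝ) (a : Vec m), 0 < τ → τ < 1 → ‖a‖ ≤ 1 → ∀ t, -X ≤ t →
          ‖opr (jostPlus Q (Complex.I * τ) t) a‖ ≤ M := by
        intro τ a hτ hτ1 ha t ht
        have hm := hb t ht (Complex.I * τ) (by simpa using hτ.le)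
        rw [jostPlus_eq_smul_modPlus, opr_smul_apply, norm_smul, norm_exp_I_mul]
        have e6 : Real.exp (-((Complex.I * (τ : ℂ)).im * t)) ≤ Real.exp X := by
          rw [Real.exp_le_exp]
          simp
          nlinarith
        have e7 := (norm_opr_apply_le (modPlus Q t (Complex.I * τ)) a).trans
          (mul_le_mul hm ha (norm_nonneg _) hM₀)
        rw [mul_one] at e7
        exact mul_le_mul e6 e7 (norm_nonneg _) (Real.exp_pos _).le
      have hτ₁1 : τ₁ < 1 := by
        have := hlt₁.trans_le (min_le_left _ _); linarith
      have := intervalIntegral.norm_integral_le_of_norm_le_const (a := -X) (b := X) (f := g)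
        (C := M ^ 2) fun t ht => by
          rw [uIoc_of_le (by linarith)] at ht
          refine (Complex.abs_re_le_norm _).trans ((norm_inner_le_norm _ _).trans ?_)
          rw [sq]
          exact mul_le_mul (hbd τ₁ a₁ hτ₁ hτ₁1 na₁ t ht.1.le)
            (hbd τ₂ a₂ hτ₂ (hlt₂.trans hτ₁1) na₂ t ht.1.le) (norm_nonneg _) (by positivity)
      rw [Real.norm_eq_abs, sub_neg_eq_add, abs_of_nonneg (by linarith : (0:ℝ) ≤ X + X)] at this
      have := (abs_le.1 this).1
      linarith
    have hsum : ∫ t in (-L)..L, g t = (∫ t in (-L)..(-X), g t) + (∫ t in (-X)..X, g t) +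
        ∫ t in X..L, g t := by
      rw [intervalIntegral.integral_add_adjacent_intervals (hgc.intervalIntegrable _ _)
        (hgc.intervalIntegrable _ _), intervalIntegral.integral_add_adjacent_intervals
        (hgc.intervalIntegrable _ _) (hgc.intervalIntegrable _ _)]
    rw [hsum]
    rw [add_mul] at e5
    rw [e3] at k1 k2 e5
    linarith
  have hexp : Tendsto (fun L : ℝ => Real.exp (-(s * L))) atTop (𝓝 0) :=
    Real.tendsto_exp_neg_atTop_nhds_zero.comp (tendsto_id.const_mul_atTop hspos)
  have hfin := le_of_tendsto_of_tendsto
    ((((hexp.const_sub (Real.exp (-(s * X)))).div_const s).const_mul (1 / 2)).sub_const (2 * X * M ^ 2))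
    hlim (eventually_atTop.2 ⟨X, hlower⟩)
  rw [sub_zero] at hfin
  have hs1 : s < 2 * ε := by linarith
  have hs2 : s ≤ 1 := by have := min_le_left (1 / 2) (Real.exp (-X) / (4 * (8 * X * M ^ 2 + 8))); linarith
  have hs3 : s * (2 * (8 * X * M ^ 2 + 8)) < Real.exp (-X) := by
    have k1 : ε ≤ Real.exp (-X) / (4 * (8 * X * M ^ 2 + 8)) := min_le_right _ _
    rw [le_div_iff₀ (by positivity)] at k1
    have k2 : 0 < 8 * X * M ^ 2 + 8 := by positivity
    nlinarith
  have hs4 : Real.exp (-X) ≤ Real.exp (-(s * X)) := by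
    rw [Real.exp_le_exp]; nlinarith
  have hs5 : 1 / 2 * (Real.exp (-(s * X)) / s) ≤ 2 * X * M ^ 2 := by linarith
  rw [mul_div_assoc', div_le_iff₀ hspos] at hs5
  have : 0 ≤ s * (X * M ^ 2) := by positivity
  linarith

end Pot

end

/-! ### Simple poles of the inverse coefficient, weight matrices, finiteness of the spectrum -/

section

section Circle

variable {E : Type*} [NormedAddCommGroup E] [NormedSpace ℂ E]

/-- A holomorphic function with a simple singular bound on a diameter of a circle is bounded. -/
lemma norm_le_of_re_mul_norm_le {f : ℂ → E} {c : ℂ} {r M : ℝ} (hr : 0 < r)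
    (hf : DifferentiableOn ℂ f (Metric.closedBall c r))
    (hb : ∀ z ∈ Metric.closedBall c r, |(z - c).re| * ‖f z‖ ≤ M) {z : ℂ}
    (hz : z ∈ Metric.ball c (r / 2)) : ‖f z‖ ≤ 8 * M / (3 * r) := by
  set g : ℂ → E := fun z => ((z - c) ^ 2 + r ^ 2) • f z with hg
  have hgd : DifferentiableOn ℂ g (Metric.closedBall c r) :=
    DifferentiableOn.smul (by fun_prop) hf
  have hgc : DiffContOnCl ℂ g (Metric.ball c r) := hgd.diffContOnCl_ball Subset.rfl
  have hfr : ∀ w ∈ frontier (Metric.ball c r), ‖g w‖ ≤ 2 * r * M := by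
    intro w hw
    rw [frontier_ball c hr.ne'] at hw
    have h1 : ‖w - c‖ = r := mem_sphere_iff_norm.1 hw
    -- On the circle `r² = (w - c)` times its conjugate, so the auxiliary factor equals `2 (w - c)
    -- Re(w - c)` and absorbs the singularity of the bound; the maximum principle then applies
    -- inside.
    have h2 : (w - c) ^ 2 + (r : ℂ) ^ 2 = (w - c) * (2 * ((w - c).re : ℂ)) := by
      rw [← h1, ← Complex.mul_conj', ← Complex.ofReal_ofNat, ← Complex.ofReal_mul,
        ← Complex.add_conj]
      ring
    simp only [hg]
    rw [norm_smul, h2, norm_mul, h1, norm_mul, Complex.norm_real, Real.norm_eq_abs]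
    have := mul_le_mul_of_nonneg_left (hb w (Metric.sphere_subset_closedBall hw))
      (show 0 ≤ 2 * r by positivity)
    simp only [Complex.norm_ofNat]
    linarith
  have hzc : z ∈ closure (Metric.ball c r) :=
    subset_closure (Metric.ball_subset_ball (by linarith) hz)
  have h3 := Complex.norm_le_of_forall_mem_frontier_norm_le Metric.isBounded_ball hgc hfr hzc
  have h4 : 3 * r ^ 2 / 4 ≤ ‖(z - c) ^ 2 + (r : ℂ) ^ 2‖ := by
    have h5 : ‖z - c‖ < r / 2 := mem_ball_iff_norm.1 hz
    have h6 := norm_sub_le ((z - c) ^ 2 + (r : ℂ) ^ 2) ((z - c) ^ 2)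
    rw [add_sub_cancel_left, norm_pow, norm_pow, Complex.norm_real, Real.norm_of_nonneg hr.le] at h6
    nlinarith [norm_nonneg (z - c)]
  simp only [hg, norm_smul] at h3
  rw [le_div_iff₀ (by positivity)]
  have h7 := mul_le_mul_of_nonneg_right h4 (norm_nonneg (f z))
  have h8 : 3 * r ^ 2 / 4 * ‖f z‖ ≤ 2 * r * M := h7.trans h3
  have h9 : r * (‖f z‖ * (3 * r)) ≤ r * (8 * M) := by linarith
  exact le_of_mul_le_mul_left h9 hr

/-- A bound by the inverse distance from a vertical line improves to the inverse distance from a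
point. -/
lemma norm_mul_le_of_re_mul_norm_le {f : ℂ → E} {c ρ : ℂ} {M : ℝ} (hM : 0 ≤ M)
    (hf : (ρ - c).im ≠ 0 → DifferentiableOn ℂ f
      (Metric.closedBall (c + Complex.I * ((ρ - c).im : ℂ)) (|(ρ - c).im| / 2)))
    (hb : ∀ z, z = ρ ∨ z ∈ Metric.closedBall (c + Complex.I * ((ρ - c).im : ℂ)) (|(ρ - c).im| / 2) →
      |(z - c).re| * ‖f z‖ ≤ M) : ‖ρ - c‖ * ‖f ρ‖ ≤ 7 * M := by
  set v := (ρ - c).im with hv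
  have hn : ‖ρ - c‖ ≤ |(ρ - c).re| + |v| := Complex.norm_le_abs_re_add_abs_im _
  -- Far from the vertical line the hypothesis at `ρ` is enough. Close to it, the disc centred on
  -- the line at the height of `ρ`, of radius `|v|/2`, avoids `c` and contains `ρ` in its inner
  -- half.
  rcases le_or_gt (|v| / 4) |(ρ - c).re| with h1 | h1
  · have h2 := hb ρ (Or.inl rfl)
    have h3 := mul_le_mul_of_nonneg_right (hn.trans (show _ ≤ 5 * |(ρ - c).re| by linarith))
      (norm_nonneg (f ρ))
    linarith
  · have hv0 : v ≠ 0 := by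
      intro h0
      rw [h0, abs_zero, zero_div] at h1
      exact absurd h1 (not_lt.2 (abs_nonneg _))
    have hvp : 0 < |v| := abs_pos.2 hv0
    have h2 := norm_le_of_re_mul_norm_le (c := c + Complex.I * (v : ℂ)) (r := |v| / 2) (M := M)
      (by positivity) (hf hv0) (fun z hz => by
        have := hb z (Or.inr hz)
        have e : (z - (c + Complex.I * (v : ℂ))).re = (z - c).re := by simp
        rwa [e]) (z := ρ) (by
        rw [mem_ball_iff_norm]
        have e : ρ - (c + Complex.I * (v : ℂ)) = (((ρ - c).re : ℝ) : ℂ) := by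
          apply Complex.ext <;> simp [hv]
        rw [e, Complex.norm_real, Real.norm_eq_abs]
        linarith)
    have h3 : ‖ρ - c‖ ≤ 5 / 4 * |v| := by linarith
    calc ‖ρ - c‖ * ‖f ρ‖ ≤ (5 / 4 * |v|) * (8 * M / (3 * (|v| / 2))) :=
          mul_le_mul h3 h2 (norm_nonneg _) (by positivity)
      _ = 20 / 3 * M := by field_simp; ring
      _ ≤ 7 * M := by linarith

end Circle

variable {m : ℕ} {Q : ℝ → Mat m}

lemma differentiableOn_det {f : ℂ → Mat m} {s : Set ℂ} (hf : DifferentiableOn ℂ f s) :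
    DifferentiableOn ℂ (fun z => (f z).det) s := by
  have he : ∀ i j, DifferentiableOn ℂ (fun z => f z i j) s := fun i j =>
    ((ContinuousLinearMap.proj (R := ℂ) (φ := fun _ : Fin m => ℂ) i).comp
      (colL j)).differentiable.comp_differentiableOn hf
  simp only [Matrix.det_apply']
  exact DifferentiableOn.fun_sum fun σ _ => (differentiableOn_const _).mul
    (DifferentiableOn.fun_finsetProd fun i _ => he _ _)

namespace Pot

variable (h : Pot Q)
include h

lemma exists_norm_inv_jostWr_le (r : ℝ) : ∃ K, 0 ≤ K ∧ ∀ ρ : ℂ, 0 < ρ.im → ‖ρ‖ ≤ r →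
    |ρ.re| * ‖(jostWr Q ρ)⁻¹‖ ≤ K := by
  obtain ⟨K, hK, hl⟩ := h.exists_jostWr_lower r
  refine ⟨K, hK, fun ρ hρ hr => ?_⟩
  rcases eq_or_ne ρ.re 0 with h0 | h0
  · rw [h0, abs_zero, zero_mul]; exact hK
  have hu := (Matrix.isUnit_iff_isUnit_det _).1 (h.isUnit_jostWr_of_re hρ h0)
  have hp : 0 < |ρ.re| := abs_pos.2 h0
  rw [mul_comm, ← le_div_iff₀ hp]
  refine norm_le_of_opr (by positivity) fun v => ?_
  have h1 := hl ρ hρ hr (opr (jostWr Q ρ)⁻¹ v)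
  rw [← opr_mul_apply, Matrix.mul_nonsing_inv _ hu] at h1
  have h2 : opr (1 : Mat m) v = v := by simp [opr]
  rw [h2] at h1
  rw [div_mul_eq_mul_div, le_div_iff₀ hp]
  linarith

lemma isUnit_contD_iff {ρ : ℂ} (hρ : 0 ≤ ρ.im) (h0 : ρ ≠ 0) :
    IsUnit (contD Q ρ) ↔ IsUnit (jostWr Q ρ) := by
  have hne : (1 / (2 * Complex.I * ρ) : ℂ) ≠ 0 := by simpa using h0
  rw [h.contD_eq hρ]
  exact isUnit_smul_iff (Units.mk0 _ hne) (jostWr Q ρ)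

lemma inv_contD_eq {ρ : ℂ} (hρ : 0 ≤ ρ.im) (h0 : ρ ≠ 0) (hu : IsUnit (jostWr Q ρ)) :
    (contD Q ρ)⁻¹ = (2 * Complex.I * ρ) • (jostWr Q ρ)⁻¹ := by
  have hne : (2 * Complex.I * ρ) ≠ 0 := by simpa using h0
  refine Matrix.inv_eq_left_inv ?_
  rw [h.contD_eq hρ, smul_mul_assoc, mul_smul_comm,
    Matrix.nonsing_inv_mul _ ((Matrix.isUnit_iff_isUnit_det _).1 hu), smul_smul,
    mul_one_div_cancel hne, one_smul]

/-- The points of the upper half-plane where the Wronskian is regular. -/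
lemma differentiableOn_inv_jostWr {s : Set ℂ} (hs : s ⊆ {ρ | 0 < ρ.im})
    (hu : ∀ ρ ∈ s, IsUnit (jostWr Q ρ)) : DifferentiableOn ℂ (fun ρ => (jostWr Q ρ)⁻¹) s :=
  differentiableOn_matrix_inv (h.differentiableOn_jostWr.mono hs) hu

/-- `D⁻¹` is bounded near the origin. -/
lemma exists_bound_near_zero : ∃ ε K, 0 < ε ∧ 0 ≤ K ∧ ∀ ρ : ℂ, 0 < ρ.im → ‖ρ‖ < ε →
    IsUnit (jostWr Q ρ) ∧ ‖(contD Q ρ)⁻¹‖ ≤ K := by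
  obtain ⟨ε, hε, hu⟩ := h.exists_isUnit_near_zero
  obtain ⟨K, hK, hb⟩ := h.exists_norm_inv_jostWr_le (3 * ε)
  have hunit : ∀ ρ : ℂ, 0 < ρ.im → ρ.im < ε → IsUnit (jostWr Q ρ) := by
    intro ρ hρ hlt
    rcases eq_or_ne ρ.re 0 with h0 | h0
    · have e : ρ = Complex.I * (ρ.im : ℂ) := by apply Complex.ext <;> simp [h0]
      rw [e]
      exact hu _ hρ hlt
    · exact h.isUnit_jostWr_of_re hρ h0
  refine ⟨ε / 2, 2 * (7 * K), by positivity, by positivity, fun ρ hρ hlt => ?_⟩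
  have him : ρ.im < ε / 2 := (Complex.im_le_norm ρ).trans_lt hlt
  have h1 : IsUnit (jostWr Q ρ) := hunit ρ hρ (by linarith)
  refine ⟨h1, ?_⟩
  have hne : ρ ≠ 0 := by rintro rfl; simp at hρ
  -- The disc has half the height of its centre as radius, so it remains in the part of the upper
  -- half-plane below height `ε`, where `W` is regular.
  have hball : ∀ z ∈ Metric.closedBall (0 + Complex.I * ((ρ - 0).im : ℂ)) (|(ρ - 0).im| / 2),
      0 < z.im ∧ z.im < ε ∧ ‖z‖ ≤ 3 * ε := by
    intro z hz
    rw [mem_closedBall_iff_norm, sub_zero, zero_add, abs_of_pos hρ] at hz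
    have k1 := (Complex.abs_im_le_norm _).trans hz
    simp only [Complex.sub_im, Complex.mul_im, Complex.I_re, Complex.ofReal_im, mul_zero,
      Complex.I_im, Complex.ofReal_re, one_mul, zero_add] at k1
    have k2 := abs_le.1 k1
    refine ⟨by linarith [k2.1], by linarith [k2.2], ?_⟩
    have k3 := norm_add_le (z - Complex.I * (ρ.im : ℂ)) (Complex.I * (ρ.im : ℂ))
    rw [sub_add_cancel, norm_mul, Complex.norm_I, one_mul, Complex.norm_real,
      Real.norm_of_nonneg hρ.le] at k3
    linarith
  -- This gives `|ρ| ‖W⁻¹‖ ≤ 7K`, and the factor `2iρ` in `D⁻¹ = 2iρ W⁻¹` compensates exactly the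
  -- singularity at the origin.
  have h2 := norm_mul_le_of_re_mul_norm_le (f := fun ρ => (jostWr Q ρ)⁻¹) (c := 0) (ρ := ρ) hK
    (fun _ => h.differentiableOn_inv_jostWr (fun z hz => (hball z hz).1)
      fun z hz => hunit z (hball z hz).1 (hball z hz).2.1) (fun z hz => by
      rw [sub_zero]
      rcases hz with rfl | hz
      · exact hb z hρ (by linarith)
      · exact hb z (hball z hz).1 (hball z hz).2.2)
  rw [h.inv_contD_eq hρ.le hne h1, norm_smul, norm_mul, norm_mul, Complex.norm_I, Complex.norm_ofNat]
  rw [sub_zero] at h2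
  linarith

/-- Behaviour of `D⁻¹` for large parameters. -/
lemma exists_bound_at_infty : ∃ R K, 1 ≤ R ∧ 0 ≤ K ∧ ∀ ρ : ℂ, 0 ≤ ρ.im → R ≤ ‖ρ‖ →
    IsUnit (contD Q ρ) ∧ ‖(contD Q ρ)⁻¹‖ ≤ 2 ∧ ‖ρ‖ * ‖(contD Q ρ)⁻¹ - 1‖ ≤ K := by
  obtain ⟨c, hc, hb⟩ := h.exists_contD_bound
  refine ⟨1 + 2 * c, 2 * c, by linarith, by positivity, fun ρ hρ hR => ?_⟩
  have hb1 := hb ρ hρ (by linarith)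
  have hpos : 0 < ‖ρ‖ := by linarith
  have h1 : ‖contD Q ρ - 1‖ ≤ 1 / 2 := by
    by_contra hcon
    push Not at hcon
    have := mul_lt_mul_of_pos_left hcon hpos
    linarith
  have hu : IsUnit (contD Q ρ) := by
    have h2 : ‖1 - contD Q ρ‖ < 1 := by rw [norm_sub_rev]; linarith
    simpa using isUnit_one_sub_of_norm_lt_one h2
  have hdet := (Matrix.isUnit_iff_isUnit_det _).1 hu
  have h2 : ‖(contD Q ρ)⁻¹‖ ≤ 2 := by
    refine norm_le_of_opr zero_le_two fun v => ?_
    have h3 := half_norm_le_opr h1 (opr (contD Q ρ)⁻¹ v)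
    rw [← opr_mul_apply, Matrix.mul_nonsing_inv _ hdet] at h3
    have h4 : opr (1 : Mat m) v = v := by simp [opr]
    rw [h4] at h3
    linarith
  refine ⟨hu, h2, ?_⟩
  have e : (contD Q ρ)⁻¹ - 1 = -((contD Q ρ)⁻¹ * (contD Q ρ - 1)) := by
    rw [mul_sub, Matrix.nonsing_inv_mul _ hdet, mul_one, neg_sub]
  rw [e, norm_neg]
  have h5 := norm_mul_le (contD Q ρ)⁻¹ (contD Q ρ - 1)
  have h6 := mul_le_mul_of_nonneg_right h2 (norm_nonneg (contD Q ρ - 1))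
  have h7 := mul_le_mul_of_nonneg_left (h5.trans h6) hpos.le
  linarith

/-- The singular points of the Wronskian are isolated. -/
lemma eventually_isUnit_jostWr {ρ₀ : ℂ} (h₀ : 0 < ρ₀.im) : ∀ᶠ ρ in 𝓝[≠] ρ₀, IsUnit (jostWr Q ρ) := by
  have ha : AnalyticAt ℂ (fun ρ => (jostWr Q ρ).det) ρ₀ :=
    (differentiableOn_det h.differentiableOn_jostWr).analyticAt (isOpen_upper.mem_nhds h₀)
  rcases ha.eventually_eq_zero_or_eventually_ne_zero with h1 | h1
  -- The determinant cannot vanish near `ρ₀`, since nearby points on the horizontal line through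
  -- `ρ₀` and off the imaginary axis are regular.
  · exfalso
    have h2 : Tendsto (fun t : ℝ => ρ₀ + t) (𝓝[≠] 0) (𝓝 ρ₀) := by
      have : Continuous fun t : ℝ => ρ₀ + t := by fun_prop
      have h3 := this.tendsto 0
      simp only [Complex.ofReal_zero, add_zero] at h3
      exact h3.mono_left nhdsWithin_le_nhds
    have h3 : ∀ᶠ t : ℝ in 𝓝[≠] 0, (ρ₀ + t).re ≠ 0 := by
      rcases eq_or_ne ρ₀.re 0 with h0 | h0
      · filter_upwards [self_mem_nhdsWithin] with t ht
        simpa [h0] using ht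
      · exact h2.eventually ((isOpen_ne_fun Complex.continuous_re continuous_const).mem_nhds h0)
    obtain ⟨t, k1, k2, k3⟩ := ((h2.eventually h1).and (h3.and
      (h2.eventually (isOpen_upper.mem_nhds h₀)))).exists
    exact ((Matrix.isUnit_iff_isUnit_det _).1 (h.isUnit_jostWr_of_re k3 k2)).ne_zero k1
  · filter_upwards [h1] with ρ hρ
    exact (Matrix.isUnit_iff_isUnit_det _).2 (isUnit_iff_ne_zero.2 hρ)

/-- The poles of `D⁻¹` are at most simple. -/
lemma exists_tendsto_residue {τ : ℝ} (hτ : 0 < τ) : ∃ R : Mat m,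
    Tendsto (fun ρ : ℂ => (ρ - Complex.I * τ) • (contD Q ρ)⁻¹) (𝓝[≠] (Complex.I * τ)) (𝓝 R) := by
  have h₀ : 0 < (Complex.I * (τ : ℂ)).im := by simpa using hτ
  obtain ⟨ε₁, hε₁, hsub⟩ := Metric.mem_nhdsWithin_iff.1 (h.eventually_isUnit_jostWr h₀)
  obtain ⟨ε, hε, hle, hlt⟩ : ∃ ε, 0 < ε ∧ ε ≤ ε₁ ∧ ε ≤ τ := ⟨min ε₁ τ, lt_min hε₁ hτ, min_le_left _ _, min_le_right _ _⟩
  obtain ⟨K, hK, hb⟩ := h.exists_norm_inv_jostWr_le (2 * τ)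
  have hnear : ∀ z ∈ Metric.ball (Complex.I * (τ : ℂ)) ε, 0 < z.im ∧ ‖z‖ ≤ 2 * τ ∧
      (z ≠ Complex.I * τ → IsUnit (jostWr Q z)) := by
    intro z hz
    have h1 := mem_ball_iff_norm.1 hz
    refine ⟨?_, ?_, fun hne => hsub ⟨Metric.ball_subset_ball hle hz, hne⟩⟩
    · have h2 := (abs_lt.1 ((Complex.abs_im_le_norm _).trans_lt h1)).1
      simp at h2
      linarith
    · have h2 := norm_add_le (z - Complex.I * (τ : ℂ)) (Complex.I * τ)
      rw [sub_add_cancel, norm_mul, Complex.norm_I, one_mul, Complex.norm_real,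
        Real.norm_of_nonneg hτ.le] at h2
      linarith
  -- Since `Re(z - iτ) = Re z`, the flux bound is a bound by the distance from the vertical line
  -- through `iτ`; it improves to the distance from `iτ`, which leaves a removable singularity after
  -- multiplication by `ρ - iτ`.
  have hbound : ∀ ρ ∈ Metric.ball (Complex.I * (τ : ℂ)) (ε / 2), ρ ≠ Complex.I * τ →
      ‖ρ - Complex.I * τ‖ * ‖(jostWr Q ρ)⁻¹‖ ≤ 7 * K := by
    intro ρ hρ hne
    have hρ1 := mem_ball_iff_norm.1 hρ
    set v := (ρ - Complex.I * τ).im with hv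
    have hvb : |v| < ε / 2 := (Complex.abs_im_le_norm _).trans_lt hρ1
    have hball : ∀ z ∈ Metric.closedBall (Complex.I * τ + Complex.I * (v : ℂ)) (|v| / 2),
        z ∈ Metric.ball (Complex.I * (τ : ℂ)) ε ∧ (v ≠ 0 → z ≠ Complex.I * τ) := by
      intro z hz
      have k1 := mem_closedBall_iff_norm.1 hz
      constructor
      · rw [mem_ball_iff_norm]
        have k2 := norm_add_le (z - (Complex.I * τ + Complex.I * (v : ℂ))) (Complex.I * (v : ℂ))
        rw [norm_mul, Complex.norm_I, one_mul, Complex.norm_real, Real.norm_eq_abs] at k2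
        have e : z - (Complex.I * τ + Complex.I * (v : ℂ)) + Complex.I * (v : ℂ) = z - Complex.I * τ := by
          ring
        rw [e] at k2
        linarith
      · rintro hv0 rfl
        rw [sub_add_cancel_left, norm_neg, norm_mul, Complex.norm_I, one_mul, Complex.norm_real,
          Real.norm_eq_abs] at k1
        have := abs_pos.2 hv0
        linarith
    refine norm_mul_le_of_re_mul_norm_le (f := fun ρ => (jostWr Q ρ)⁻¹) hK
      (fun hv0 => h.differentiableOn_inv_jostWr (fun z hz => (hnear z (hball z hz).1).1)
        fun z hz => (hnear z (hball z hz).1).2.2 ((hball z hz).2 hv0)) (fun z hz => ?_)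
    have hz' : z ∈ Metric.ball (Complex.I * (τ : ℂ)) ε := by
      rcases hz with rfl | hz
      · exact Metric.ball_subset_ball (by linarith) hρ
      · exact (hball z hz).1
    have e : (z - Complex.I * τ).re = z.re := by simp
    rw [e]
    exact hb z (hnear z hz').1 (hnear z hz').2.1
  have hmem : ∀ᶠ ρ in 𝓝[≠] (Complex.I * (τ : ℂ)),
      ρ ∈ Metric.ball (Complex.I * (τ : ℂ)) (ε / 2) ∧ ρ ≠ Complex.I * τ :=
    Eventually.and (mem_nhdsWithin_of_mem_nhds (Metric.ball_mem_nhds _ (by positivity)))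
      self_mem_nhdsWithin
  set f : ℂ → Mat m := fun ρ => (ρ - Complex.I * τ) • (jostWr Q ρ)⁻¹ with hf
  have hlim := Complex.tendsto_limUnder_of_differentiable_on_punctured_nhds_of_bounded_under
    (f := f) (c := Complex.I * τ) (by
      have hop : IsOpen (Metric.ball (Complex.I * (τ : ℂ)) (ε / 2) \ {Complex.I * (τ : ℂ)}) :=
        Metric.isOpen_ball.sdiff isClosed_singleton
      have hdo : DifferentiableOn ℂ f (Metric.ball (Complex.I * (τ : ℂ)) (ε / 2) \ {Complex.I * (τ : ℂ)}) := by
        refine (differentiableOn_id.sub_const (Complex.I * (τ : ℂ))).smul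
          (h.differentiableOn_inv_jostWr ?_ ?_)
        · exact fun z hz => (hnear z (Metric.ball_subset_ball (by linarith) hz.1)).1
        · exact fun z hz => (hnear z (Metric.ball_subset_ball (by linarith) hz.1)).2.2 hz.2
      filter_upwards [hmem] with ρ hρ
      exact hdo.differentiableAt (hop.mem_nhds hρ))
    (by
      refine ⟨7 * K, eventually_map.2 ?_⟩
      filter_upwards [hmem] with ρ hρ
      have e : f (Complex.I * τ) = 0 := by simp [hf]
      rw [e, sub_zero, hf]
      simp only [norm_smul]
      exact hbound ρ hρ.1 hρ.2)
  refine ⟨(2 * Complex.I * (Complex.I * τ)) • limUnder (𝓝[≠] (Complex.I * (τ : ℂ))) f, ?_⟩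
  have hc : Tendsto (fun ρ : ℂ => 2 * Complex.I * ρ) (𝓝[≠] (Complex.I * (τ : ℂ)))
      (𝓝 (2 * Complex.I * (Complex.I * τ))) := by
    have : Continuous fun ρ : ℂ => 2 * Complex.I * ρ := by fun_prop
    exact (this.tendsto _).mono_left nhdsWithin_le_nhds
  refine (hc.smul hlim).congr' ?_
  filter_upwards [hmem] with ρ hρ
  have hρ' := hnear ρ (Metric.ball_subset_ball (by linarith) hρ.1)
  have hne : ρ ≠ 0 := by rintro rfl; simp at hρ'
  rw [h.inv_contD_eq hρ'.1.le hne (hρ'.2.2 hρ.2), hf]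
  simp only [smul_smul]
  congr 1
  ring

/-- `W(ρ)` times `(ρ - iτ) D(ρ)⁻¹` is `2iρ(ρ - iτ)`, which tends to zero. So `W(iτ)` annihilates the
residue, and `F₋` times the residue is a multiple of `F₊`. At a regular point both residue and
weight are zero, so no eigenvalue assumption is made. -/
lemma existsUnique_isWeightPlus {τ : ℝ} (hτ : 0 < τ) : ∃! W, IsWeightPlus Q τ W := by
  have h₀ : 0 < (Complex.I * (τ : ℂ)).im := by simpa using hτ
  obtain ⟨R, hR⟩ := h.exists_tendsto_residue hτ
  have hcont : Tendsto (jostWr Q) (𝓝[≠] (Complex.I * (τ : ℂ))) (𝓝 (jostWr Q (Complex.I * τ))) :=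
    ((h.differentiableOn_jostWr.differentiableAt (isOpen_upper.mem_nhds h₀)).continuousAt.tendsto).mono_left
      nhdsWithin_le_nhds
  have hWR : jostWr Q (Complex.I * τ) * R = 0 := by
    have h1 := hcont.mul hR
    have h2 : Tendsto (fun ρ : ℂ => ((ρ - Complex.I * τ) * (2 * Complex.I * ρ)) • (1 : Mat m))
        (𝓝[≠] (Complex.I * (τ : ℂ))) (𝓝 0) := by
      have : Continuous fun ρ : ℂ => ((ρ - Complex.I * τ) * (2 * Complex.I * ρ)) • (1 : Mat m) := by
        fun_prop
      have h3 := (this.tendsto (Complex.I * τ)).mono_left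
        (nhdsWithin_le_nhds (s := {Complex.I * (τ : ℂ)}ᶜ))
      simpa using h3
    refine tendsto_nhds_unique (h1.congr' ?_) h2
    filter_upwards [h.eventually_isUnit_jostWr h₀,
      mem_nhdsWithin_of_mem_nhds (isOpen_upper.mem_nhds h₀)] with ρ hu hρ
    have hne : ρ ≠ 0 := by rintro rfl; simp at hρ
    rw [h.inv_contD_eq (le_of_lt hρ) hne hu, mul_smul_comm, mul_smul_comm,
      Matrix.mul_nonsing_inv _ ((Matrix.isUnit_iff_isUnit_det _).1 hu), smul_smul]
  obtain ⟨a, ha⟩ := h.exists_eq_of_mul_eq_zero h₀.le hWR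
  refine ⟨(-Complex.I) • a, ⟨R, hR, fun x => ?_⟩, ?_⟩
  · rw [ha, mul_smul_comm, smul_smul]
    simp
  · rintro W ⟨R', hR', hW⟩
    have hRR : R' = R := tendsto_nhds_unique hR' hR
    have h1 : Complex.I • W = a := h.jostPlus_mul_cancel h₀.le fun x => by
      rw [mul_smul_comm, ← hW, hRR, ha]
    rw [← h1, smul_smul]
    simp

lemma isWeightMinus_iff {τ : ℝ} (hτ : 0 < τ) (W : Mat m) :
    IsWeightMinus Q τ W ↔ IsWeightPlus (reflect Q) τ W := by
  have h₀ : 0 < (Complex.I * (τ : ℂ)).im := by simpa using hτ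
  have e : ∀ R : Mat m, Tendsto (fun ρ : ℂ => (ρ - Complex.I * τ) • (contA Q ρ)⁻¹)
      (𝓝[≠] (Complex.I * τ)) (𝓝 R) ↔ Tendsto (fun ρ : ℂ => (ρ - Complex.I * τ) •
      (contD (reflect Q) ρ)⁻¹) (𝓝[≠] (Complex.I * τ)) (𝓝 R) := fun R => by
    refine tendsto_congr' ?_
    filter_upwards [mem_nhdsWithin_of_mem_nhds (isOpen_upper.mem_nhds h₀)] with ρ hρ
    rw [h.contA_eq (le_of_lt hρ)]
  have e2 : ∀ R : Mat m, (∀ x : ℝ, jostPlus Q (Complex.I * τ) x * R =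
      Complex.I • (jostMinus Q (Complex.I * τ) x * W)) ↔ ∀ x : ℝ,
      jostMinus (reflect Q) (Complex.I * τ) x * R =
      Complex.I • (jostPlus (reflect Q) (Complex.I * τ) x * W) := fun R => by
    simp only [h.jostPlus_reflect h₀.le, h.jostMinus_eq h₀.le]
    exact ⟨fun H x => by simpa using H (-x), fun H x => H (-x)⟩
  simp only [IsWeightMinus, IsWeightPlus, e, e2]

lemma existsUnique_isWeightMinus {τ : ℝ} (hτ : 0 < τ) : ∃! W, IsWeightMinus Q τ W := by
  simp only [h.isWeightMinus_iff hτ]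
  exact h.refl.existsUnique_isWeightPlus hτ

lemma weightMinus_eq {τ : ℝ} (hτ : 0 < τ) : weightMinus Q τ = weightPlus (reflect Q) τ := by
  have : IsWeightMinus Q τ = IsWeightPlus (reflect Q) τ :=
    funext fun W => propext (h.isWeightMinus_iff hτ W)
  rw [weightMinus, weightPlus, this]

/-- The singular points stay away from zero and from infinity; an infinite set of them would
accumulate in a compact interval, against their isolation. -/
lemma finite_singular : {τ : ℝ | 0 < τ ∧ ¬IsUnit (jostWr Q (Complex.I * τ))}.Finite := by
  obtain ⟨ε, hε, hu⟩ := h.exists_isUnit_near_zero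
  obtain ⟨R, K, hR, -, hinf⟩ := h.exists_bound_at_infty
  by_contra hcon
  have hsub : {τ : ℝ | 0 < τ ∧ ¬IsUnit (jostWr Q (Complex.I * τ))} ⊆ Icc ε R := by
    rintro τ ⟨h1, h2⟩
    constructor
    · by_contra h3
      exact h2 (hu τ h1 (not_le.1 h3))
    · by_contra h3
      have h4 : 0 ≤ (Complex.I * (τ : ℂ)).im := by simpa using h1.le
      have h5 := (hinf (Complex.I * τ) h4 (by
        rw [norm_mul, Complex.norm_I, one_mul, Complex.norm_real, Real.norm_of_nonneg h1.le]
        exact (not_le.1 h3).le)).1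
      exact h2 ((h.isUnit_contD_iff h4 (by simpa using h1.ne')).1 h5)
  obtain ⟨τ, hτ, hacc⟩ := Set.Infinite.exists_accPt_of_subset_isCompact hcon isCompact_Icc hsub
  have hτ0 : 0 < τ := hε.trans_le hτ.1
  have hev := h.eventually_isUnit_jostWr (ρ₀ := Complex.I * τ) (by simpa using hτ0)
  have ht : Tendsto (fun t : ℝ => Complex.I * (t : ℂ)) (𝓝[≠] τ) (𝓝[≠] (Complex.I * (τ : ℂ))) := by
    refine tendsto_nhdsWithin_iff.2 ⟨?_, ?_⟩
    · have : Continuous fun t : ℝ => Complex.I * (t : ℂ) := by fun_prop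
      exact (this.tendsto τ).mono_left nhdsWithin_le_nhds
    · filter_upwards [self_mem_nhdsWithin] with t ht
      simpa using ht
  have hfr := accPt_iff_frequently_nhdsNE.1 hacc
  obtain ⟨t, h1, h2⟩ := (hfr.and_eventually (ht.eventually hev)).exists
  exact h1.2 h2

lemma exists_isEigenvalueEnumeration : ∃ (N : ℕ) (τ : Fin N → ℝ), IsEigenvalueEnumeration Q τ := by
  have hfin := h.finite_singular
  refine ⟨hfin.toFinset.card, fun k => (hfin.toFinset.equivFin.symm k : ℝ), ?_, fun k => ?_, ?_⟩
  · exact Subtype.val_injective.comp (Equiv.injective _)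
  · have := (hfin.toFinset.equivFin.symm k).2
    rw [hfin.mem_toFinset] at this
    exact this.1
  · rw [h.setOf_isEigenvalue]
    ext lam
    constructor
    · rintro ⟨τ, hτ, rfl⟩
      exact ⟨hfin.toFinset.equivFin ⟨τ, hfin.mem_toFinset.2 hτ⟩, by simp⟩
    · rintro ⟨k, rfl⟩
      have := (hfin.toFinset.equivFin.symm k).2
      rw [hfin.mem_toFinset] at this
      exact ⟨_, this, rfl⟩

/-- The points of an enumeration are exactly the singular points. -/
lemma mem_range_of_enumeration {N : ℕ} {τ : Fin N → ℝ} (hτ : IsEigenvalueEnumeration Q τ) {ρ : ℂ}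
    (hρ : 0 < ρ.im) : IsUnit (jostWr Q ρ) ∨ ∃ k, ρ = Complex.I * τ k := by
  by_contra hcon
  push Not at hcon
  have h1 := h.isEigenvalue_of_not_isUnit hρ hcon.1
  have h2 : ρ ^ 2 ∈ range fun k => (Complex.I * (τ k : ℂ)) ^ 2 := hτ.2.2 ▸ h1
  obtain ⟨k, hk⟩ := h2
  rcases sq_eq_sq_iff_eq_or_eq_neg.1 hk with h3 | h3
  · exact hcon.2 k h3.symm
  · have h4 := congrArg Complex.im h3
    simp at h4
    have := hτ.2.1 k
    linarith

end Pot

end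

/-! ### Fourier inversion in the mean-square sense -/

section

section Plancherel

open scoped FourierTransform SchwartzMap ContDiff

/-- The rescaling `ρ = 2πw` passes from the phase `e^{iρx}` to Mathlib's normalisation `e^{2πiwx}`.
-/
theorem memLp_comp_two_pi_mul {G : Type*} [NormedAddCommGroup G] {S : ℝ → G} :
    MemLp (fun w => S (2 * Real.pi * w)) 2 ↔ MemLp S 2 := by
  have hp : 2 * Real.pi ≠ 0 := by positivity
  have h := (Homeomorph.mulLeft₀ _ hp).toMeasurableEquiv.memLp_map_measure_iff
    (g := S) (p := 2) (μ := volume)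
  have e : Measure.map (Homeomorph.mulLeft₀ _ hp).toMeasurableEquiv (volume : Measure ℝ)
      = ENNReal.ofReal |(2 * Real.pi)⁻¹| • volume := Real.map_volume_mul_left hp
  rw [e] at h
  refine h.symm.trans ⟨fun h' => ?_, fun h' => h'.smul_measure ENNReal.ofReal_ne_top⟩
  have := h'.smul_measure (c := ENNReal.ofReal |2 * Real.pi|) ENNReal.ofReal_ne_top
  rwa [smul_smul, ← ENNReal.ofReal_mul (abs_nonneg _), ← abs_mul, mul_inv_cancel₀ hp, abs_one,
    ENNReal.ofReal_one, one_smul] at this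

section Hilbert

variable {F : Type*} [NormedAddCommGroup F] [InnerProductSpace ℂ F] [CompleteSpace F]

/-- For integrable and square integrable functions the Fourier integral represents the
Fourier transform on `L²`. -/
theorem fourier_toLp_ae_eq {f : ℝ → F} (hf₁ : Integrable f) (hf₂ : MemLp f 2) :
    (𝓕 (hf₂.toLp f) : Lp F 2 (volume : Measure ℝ)) =ᵐ[volume] 𝓕 f := by
  have hc : Continuous (𝓕 f) :=
    VectorFourier.fourierIntegral_continuous Real.continuous_fourierChar continuous_inner hf₁
  -- Both sides are compared on smooth compactly supported test functions: duality of tempered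
  -- distributions handles the `L²` transform, Fubini the Fourier integral.
  refine ae_eq_of_integral_contDiff_smul_eq ?_ hc.locallyIntegrable ?_
  · exact (Lp.memLp (𝓕 (hf₂.toLp f) : Lp F 2 (volume : Measure ℝ))).locallyIntegrable (by norm_num)
  intro g hg hgs
  have hg' : ContDiff ℝ ∞ (fun x => (g x : ℂ)) := Complex.ofRealCLM.contDiff.comp hg
  have hgs' : HasCompactSupport (fun x => (g x : ℂ)) :=
    hgs.comp_left (g := fun x : ℝ => (x : ℂ)) Complex.ofReal_zero
  let G : 𝓢(ℝ, ℂ) := hgs'.toSchwartzMap hg'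
  have hG : ∀ x, G x = (g x : ℂ) := fun x => rfl
  have h1 := congrArg (fun T : 𝓢'(ℝ, F) => T G)
    (Lp.fourier_toTemperedDistribution_eq (hf₂.toLp f))
  simp only [TemperedDistribution.fourier_apply, Lp.toTemperedDistribution_apply] at h1
  have h2 := VectorFourier.integral_fourierIntegral_smul_eq_flip (L := innerₗ ℝ)
    Real.continuous_fourierChar continuous_inner (G.integrable (μ := volume)) hf₁
  calc ∫ x, g x • (𝓕 (hf₂.toLp f) : Lp F 2 (volume : Measure ℝ)) x
      = ∫ x, G x • (𝓕 (hf₂.toLp f) : Lp F 2 (volume : Measure ℝ)) x := by simp [hG]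
    _ = ∫ x, (𝓕 G : 𝓢(ℝ, ℂ)) x • (hf₂.toLp f) x := h1.symm
    _ = ∫ x, (𝓕 G : 𝓢(ℝ, ℂ)) x • f x := by
        refine integral_congr_ae ?_
        filter_upwards [hf₂.coeFn_toLp] with x hx
        rw [hx]
    _ = ∫ x, G x • 𝓕 f x := by
        rw [flip_innerₗ] at h2
        exact h2
    _ = ∫ x, g x • 𝓕 f x := by simp [hG]

theorem fourierInv_toLp_ae_eq {f : ℝ → F} (hf₁ : Integrable f) (hf₂ : MemLp f 2) :
    (𝓕⁻ (hf₂.toLp f) : Lp F 2 (volume : Measure ℝ)) =ᵐ[volume] 𝓕⁻ f := by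
  have hc : Continuous (𝓕⁻ f) := by
    rw [Real.fourierInv_eq_fourier_comp_neg]
    exact VectorFourier.fourierIntegral_continuous Real.continuous_fourierChar continuous_inner
      hf₁.comp_neg
  refine ae_eq_of_integral_contDiff_smul_eq ?_ hc.locallyIntegrable ?_
  · exact (Lp.memLp (𝓕⁻ (hf₂.toLp f) : Lp F 2 (volume : Measure ℝ))).locallyIntegrable (by norm_num)
  intro g hg hgs
  have hg' : ContDiff ℝ ∞ (fun x => (g x : ℂ)) := Complex.ofRealCLM.contDiff.comp hg
  have hgs' : HasCompactSupport (fun x => (g x : ℂ)) :=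
    hgs.comp_left (g := fun x : ℝ => (x : ℂ)) Complex.ofReal_zero
  let G : 𝓢(ℝ, ℂ) := hgs'.toSchwartzMap hg'
  have hG : ∀ x, G x = (g x : ℂ) := fun x => rfl
  have h1 := congrArg (fun T : 𝓢'(ℝ, F) => T G)
    (Lp.fourierInv_toTemperedDistribution_eq (hf₂.toLp f))
  simp only [TemperedDistribution.fourierInv_apply, Lp.toTemperedDistribution_apply] at h1
  have h2 := VectorFourier.integral_fourierIntegral_smul_eq_flip (L := innerₗ ℝ)
    Real.continuous_fourierChar continuous_inner (G.integrable (μ := volume)) hf₁.comp_neg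
  calc ∫ x, g x • (𝓕⁻ (hf₂.toLp f) : Lp F 2 (volume : Measure ℝ)) x
      = ∫ x, G x • (𝓕⁻ (hf₂.toLp f) : Lp F 2 (volume : Measure ℝ)) x := by simp [hG]
    _ = ∫ x, (𝓕⁻ G : 𝓢(ℝ, ℂ)) x • (hf₂.toLp f) x := h1.symm
    _ = ∫ x, (𝓕⁻ G : 𝓢(ℝ, ℂ)) x • f x := by
        refine integral_congr_ae ?_
        filter_upwards [hf₂.coeFn_toLp] with x hx
        rw [hx]
    _ = ∫ x, (𝓕 (G : ℝ → ℂ)) x • f (-x) := by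
        rw [← integral_neg_eq_self]
        refine integral_congr_ae (.of_forall fun x => ?_)
        simp only [SchwartzMap.fourierInv_coe, Real.fourierInv_eq_fourier_neg, neg_neg]
    _ = ∫ x, G x • 𝓕⁻ f x := by
        rw [flip_innerₗ] at h2
        rw [Real.fourierInv_eq_fourier_comp_neg]
        exact h2
    _ = ∫ x, g x • 𝓕⁻ f x := by simp [hG]

theorem tendsto_eLpNorm_sub_indicator {G : Type*} [NormedAddCommGroup G] {g : ℝ → G}
    (hg : MemLp g 2) {J : ℝ → Set ℝ} (hJm : ∀ T, MeasurableSet (J T))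
    (hJ : ∀ x, ∀ᶠ T in atTop, x ∈ J T) :
    Tendsto (fun T => eLpNorm (fun x => g x - (J T).indicator g x) 2 volume) atTop (𝓝 0) := by
  have h : Tendsto (fun T => ∫⁻ x, ‖g x - (J T).indicator g x‖ₑ ^ (2 : ℝ)) atTop
      (𝓝 (∫⁻ _ : ℝ, 0)) := by
    refine tendsto_lintegral_filter_of_dominated_convergence' (fun x => ‖g x‖ₑ ^ (2 : ℝ))
      (.of_forall fun T => ?_) (.of_forall fun T => .of_forall fun x => ?_) ?_
      (.of_forall fun x => ?_)
    · exact ((hg.1.sub (hg.1.indicator (hJm T))).enorm.pow_const _)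
    · refine ENNReal.rpow_le_rpow ?_ (by norm_num)
      by_cases hx : x ∈ J T <;> simp [hx]
    · have := lintegral_rpow_enorm_lt_top_of_eLpNorm_lt_top (by norm_num) (by norm_num) hg.2
      simpa using this.ne
    · refine tendsto_const_nhds.congr' ?_
      filter_upwards [hJ x] with T hT
      simp [hT]
  have h' := (ENNReal.continuous_rpow_const (y := (1 / 2 : ℝ))).tendsto _ |>.comp h
  simp only [lintegral_zero, ENNReal.zero_rpow_of_pos (show (0 : ℝ) < 1 / 2 by norm_num)] at h'
  refine h'.congr fun T => ?_
  rw [eLpNorm_eq_lintegral_rpow_enorm_toReal (by norm_num) (by norm_num)]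
  simp

/-- The truncated inverse Fourier integrals of a square integrable function converge in `L²`. -/
theorem tendsto_truncated_fourierInv {S : ℝ → F} (hS : MemLp (fun w => S (2 * Real.pi * w)) 2) :
    Tendsto (fun T : ℝ => eLpNorm (fun x : ℝ => (𝓕⁻ (hS.toLp _) : Lp F 2 (volume : Measure ℝ)) x -
        (1 / (2 * Real.pi) : ℂ) •
        ∫ ρ in (-T)..T, Complex.exp (Complex.I * ρ * x) • S ρ) 2 volume)
      atTop (𝓝 0) := by
  have hp : 0 < 2 * Real.pi := by positivity
  set g : ℝ → F := fun w => S (2 * Real.pi * w) with hg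
  -- The truncation to `(-T, T)` in the rescaled variable. Truncations converge in `L²`, and the
  -- inverse transform is an isometry.
  set J : ℝ → Set ℝ := fun T => Ioc (-T / (2 * Real.pi)) (T / (2 * Real.pi)) with hJ
  have hJm : ∀ T, MeasurableSet (J T) := fun T => measurableSet_Ioc
  have h2 : ∀ T, MemLp ((J T).indicator g) 2 := fun T => hS.indicator (hJm T)
  have h1 : ∀ T, Integrable ((J T).indicator g) := by
    intro T
    exact (((hS.locallyIntegrable (by norm_num)).integrableOn_isCompact isCompact_Icc).mono_set
      Ioc_subset_Icc_self).integrable_indicator (hJm T)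
  have hJ' : ∀ x, ∀ᶠ T in atTop, x ∈ J T := by
    intro x
    filter_upwards [eventually_gt_atTop (2 * Real.pi * |x|)] with T hT
    have := abs_le.1 (le_refl |x|)
    constructor
    · rw [div_lt_iff₀ hp]; nlinarith
    · rw [le_div_iff₀ hp]; nlinarith
  refine (tendsto_eLpNorm_sub_indicator hS hJm hJ').congr' ?_
  filter_upwards [eventually_gt_atTop 0] with T hT
  have e1 : eLpNorm (fun x => g x - (J T).indicator g x) 2 volume
      = ‖hS.toLp g - (h2 T).toLp _‖ₑ := by
    rw [← MemLp.toLp_sub, Lp.enorm_toLp]; rfl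
  have e2 : ‖hS.toLp g - (h2 T).toLp _‖ₑ
      = ‖(𝓕⁻ (hS.toLp g) : Lp F 2 (volume : Measure ℝ)) - (𝓕⁻ ((h2 T).toLp _) : Lp F 2 (volume : Measure ℝ))‖ₑ := by
    rw [← ofReal_norm, ← ofReal_norm]
    congr 1
    refine ((Lp.fourierTransformₗᵢ ℝ F).symm.norm_map _).symm.trans ?_
    rw [map_sub]
    rfl
  rw [e1, e2, Lp.enorm_def]
  refine eLpNorm_congr_ae ?_
  filter_upwards [Lp.coeFn_sub (𝓕⁻ (hS.toLp g) : Lp F 2 (volume : Measure ℝ)) (𝓕⁻ ((h2 T).toLp _) : Lp F 2 (volume : Measure ℝ)),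
    fourierInv_toLp_ae_eq (h1 T) (h2 T)] with x hx hx'
  rw [hx, Pi.sub_apply, hx']
  congr 1
  rw [Real.fourierInv_eq']
  have e3 : ∀ w : ℝ, Complex.exp ((2 * Real.pi * inner ℝ w x : ℝ) * Complex.I) •
      (J T).indicator g w
      = (J T).indicator (fun w => Complex.exp (Complex.I * (2 * Real.pi * w : ℝ) * x) •
        S (2 * Real.pi * w)) w := by
    intro w
    by_cases hw : w ∈ J T
    · rw [indicator_of_mem hw, indicator_of_mem hw]
      congr 2
      simp only [RCLike.inner_apply, conj_trivial]
      push_cast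
      ring
    · rw [indicator_of_notMem hw, indicator_of_notMem hw, smul_zero]
  simp_rw [e3]
  rw [integral_indicator (hJm T), ← intervalIntegral.integral_of_le (by
    rw [div_le_div_iff_of_pos_right hp]; linarith),
    intervalIntegral.integral_comp_mul_left (fun ρ : ℝ => Complex.exp (Complex.I * ρ * x) • S ρ)
      hp.ne', mul_div_cancel₀ _ hp.ne', mul_div_cancel₀ _ hp.ne']
  rw [← Complex.coe_smul]
  push_cast
  rw [one_div]

theorem fourierInv_toLp_comp_ae_eq {k S : ℝ → F} (hk₁ : Integrable k) (hk₂ : MemLp k 2)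
    (hS : ∀ᵐ ρ : ℝ, S ρ = ∫ t : ℝ, Complex.exp (-(Complex.I * ρ * t)) • k t) :
    ∃ h : MemLp (fun w => S (2 * Real.pi * w)) 2,
      (𝓕⁻ (h.toLp _) : Lp F 2 (volume : Measure ℝ)) =ᵐ[volume] k := by
  have hp : 2 * Real.pi ≠ 0 := by positivity
  have h1 : (𝓕 (hk₂.toLp k) : Lp F 2 (volume : Measure ℝ)) =ᵐ[volume]
      fun w => S (2 * Real.pi * w) := by
    have := (Measure.quasiMeasurePreserving_smul (volume : Measure ℝ) hp).ae hS
    filter_upwards [fourier_toLp_ae_eq hk₁ hk₂, this] with w hw hw'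
    rw [hw]
    refine Eq.trans ?_ hw'.symm
    rw [Real.fourier_eq']
    refine integral_congr_ae (.of_forall fun t => ?_)
    simp only [RCLike.inner_apply, conj_trivial, smul_eq_mul]
    congr 2
    push_cast
    ring
  have h2 : MemLp (fun w => S (2 * Real.pi * w)) 2 := (memLp_congr_ae h1).1 (Lp.memLp _)
  refine ⟨h2, ?_⟩
  have h3 : h2.toLp _ = (𝓕 (hk₂.toLp k) : Lp F 2 (volume : Measure ℝ)) :=
    Lp.ext (h2.coeFn_toLp.trans h1.symm)
  rw [h3, FourierTransform.fourierInv_fourier_eq]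
  exact hk₂.coeFn_toLp

end Hilbert

section FiniteDimensional

variable {E : Type*} [NormedAddCommGroup E] [NormedSpace ℂ E]

/-- `R` is the `L²` limit of the truncated integrals `(2π)⁻¹ ∫_{-T}^T S(ρ) exp(iρx) dρ`. -/
def IsFourierLimit (S R : ℝ → E) : Prop :=
  Tendsto (fun T : ℝ => eLpNorm (fun x : ℝ => R x - (1 / (2 * Real.pi) : ℂ) •
    ∫ ρ in (-T)..T, Complex.exp (Complex.I * ρ * x) • S ρ) 2 volume) atTop (𝓝 0)

theorem IsFourierLimit.clm_comp {G : Type*} [NormedAddCommGroup G] [NormedSpace ℂ G]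
    {S R : ℝ → G} (h : IsFourierLimit S R) (e : G ≃L[ℂ] E) :
    IsFourierLimit (fun ρ => e (S ρ)) (fun x => e (R x)) := by
  have h' := ENNReal.Tendsto.const_mul h (.inr (ENNReal.ofReal_ne_top (r := ‖(e : G →L[ℂ] E)‖)))
  rw [mul_zero] at h'
  refine tendsto_of_tendsto_of_tendsto_of_le_of_le tendsto_const_nhds h' (fun _ => bot_le)
    fun T => ?_
  refine eLpNorm_le_mul_eLpNorm_of_ae_le_mul (.of_forall fun x => ?_) 2
  have : ∫ ρ in (-T)..T, Complex.exp (Complex.I * ρ * x) • e (S ρ)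
      = e (∫ ρ in (-T)..T, Complex.exp (Complex.I * ρ * x) • S ρ) := by
    simp only [intervalIntegral, map_sub, ← ContinuousLinearEquiv.integral_comp_comm, map_smul]
  rw [this, ← map_smul, ← map_sub]
  exact (e : G →L[ℂ] E).le_opNorm _

theorem memLp_equiv_comp {G : Type*} [NormedAddCommGroup G] [NormedSpace ℂ G] {S : ℝ → G}
    (h : MemLp S 2) (e : G ≃L[ℂ] E) : MemLp (fun x => e (S x)) 2 :=
  (e : G →L[ℂ] E).comp_memLp' h

variable [FiniteDimensional ℂ E]

/-- Plancherel requires a Hilbert space as target, and matrices with the operator norm do not form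
one. The result is transported along a linear isomorphism with a Euclidean space, under which `L²`
convergence is preserved. -/
theorem exists_isFourierLimit {S : ℝ → E} (hS : MemLp S 2) :
    ∃ R, MemLp R 2 ∧ IsFourierLimit S R := by
  let e : E ≃L[ℂ] EuclideanSpace ℂ (Fin (Module.finrank ℂ E)) :=
    ContinuousLinearEquiv.ofFinrankEq (by simp)
  have h1 := tendsto_truncated_fourierInv (memLp_comp_two_pi_mul.2 (memLp_equiv_comp hS e))
  refine ⟨_, memLp_equiv_comp (Lp.memLp (𝓕⁻ ((memLp_comp_two_pi_mul.2
    (memLp_equiv_comp hS e)).toLp _) : Lp _ 2 (volume : Measure ℝ))) e.symm, ?_⟩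
  simpa using IsFourierLimit.clm_comp h1 e.symm

/-- Fourier inversion for functions in `L¹ ∩ L²`; through it the kernel itself is recovered from its
Fourier integral in the Marchenko equation. -/
theorem isFourierLimit_of_integral {k S : ℝ → E} (hk₁ : Integrable k) (hk₂ : MemLp k 2)
    (hS : ∀ᵐ ρ : ℝ, S ρ = ∫ t : ℝ, Complex.exp (-(Complex.I * ρ * t)) • k t) :
    MemLp S 2 ∧ IsFourierLimit S k := by
  let e : E ≃L[ℂ] EuclideanSpace ℂ (Fin (Module.finrank ℂ E)) :=
    ContinuousLinearEquiv.ofFinrankEq (by simp)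
  have hek : Integrable (fun t => e (k t)) :=
    ContinuousLinearMap.integrable_comp (e : E →L[ℂ] EuclideanSpace ℂ (Fin (Module.finrank ℂ E))) hk₁
  obtain ⟨h1, h2⟩ := fourierInv_toLp_comp_ae_eq (k := fun t => e (k t)) (S := fun ρ => e (S ρ))
    hek (memLp_equiv_comp hk₂ e) (by
      filter_upwards [hS] with ρ hρ
      rw [hρ, ← ContinuousLinearEquiv.integral_comp_comm]
      simp only [map_smul])
  have h3 : IsFourierLimit (fun ρ => e (S ρ)) (fun x => e (k x)) := by
    refine (tendsto_truncated_fourierInv (S := fun ρ => e (S ρ)) h1).congr fun T => eLpNorm_congr_ae ?_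
    filter_upwards [h2] with x hx
    rw [hx]
  refine ⟨?_, by simpa using h3.clm_comp e.symm⟩
  simpa using memLp_equiv_comp (memLp_comp_two_pi_mul (S := fun ρ => e (S ρ)) |>.1 h1) e.symm

end FiniteDimensional

end Plancherel

end

/-! ### Removable singularities and Jordan's lemma -/

section

section Contour

variable {E : Type*} [NormedAddCommGroup E] [NormedSpace ℂ E] [CompleteSpace E]

/-- Riemann's theorem fills in one point at a time; in the inductive step the new point is first
removed from the open set. Values off `S` are never changed, so boundary values are unaffected. -/
theorem exists_differentiableOn_of_removable (S : Finset ℂ) (f : ℂ → E) {U : Set ℂ}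
    (hU : IsOpen U) (hSU : ∀ s ∈ S, s ∈ U) (hf : DifferentiableOn ℂ f (U \ S))
    (hS : ∀ s ∈ S, Tendsto (fun ρ => (ρ - s) • f ρ) (𝓝[≠] s) (𝓝 0)) :
    ∃ g : ℂ → E, DifferentiableOn ℂ g U ∧ ∀ ρ, ρ ∉ S → g ρ = f ρ := by
  classical
  induction S using Finset.induction_on generalizing U with
  | empty => exact ⟨f, by simpa using hf, fun _ _ => rfl⟩
  | insert a S ha ih =>
    obtain ⟨g, hg, hgf⟩ := ih (U := U \ {a}) (hU.sdiff isClosed_singleton)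
      (fun s hs => ⟨hSU s (Finset.mem_insert_of_mem hs), fun h => ha (h ▸ hs)⟩)
      (hf.mono fun z hz => ⟨hz.1.1, by
        simp only [Finset.coe_insert, mem_insert_iff, not_or]
        exact ⟨hz.1.2, hz.2⟩⟩)
      (fun s hs => hS s (Finset.mem_insert_of_mem hs))
    have haU := hSU a (Finset.mem_insert_self _ _)
    have hn' : (S : Set ℂ)ᶜ ∈ 𝓝 a :=
      S.finite_toSet.isClosed.isOpen_compl.mem_nhds (by simpa using ha)
    have hn : ∀ᶠ z in 𝓝[≠] a, z ∉ S := mem_nhdsWithin_of_mem_nhds hn'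
    have h0 : Tendsto (fun ρ => (ρ - a) • g ρ) (𝓝[≠] a) (𝓝 0) := by
      refine (hS a (Finset.mem_insert_self _ _)).congr' ?_
      filter_upwards [hn] with z hz
      rw [hgf z hz]
    have ho : (fun z => g z - g a) =o[𝓝[≠] a] fun z => (z - a)⁻¹ := by
      have h1 : Tendsto (fun ρ => (ρ - a) • (g ρ - g a)) (𝓝[≠] a) (𝓝 0) := by
        have h2 : Tendsto (fun ρ : ℂ => (ρ - a) • g a) (𝓝[≠] a) (𝓝 0) := by
          have : Continuous fun ρ : ℂ => (ρ - a) • g a := by fun_prop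
          have := this.tendsto a
          rw [sub_self, zero_smul] at this
          exact this.mono_left nhdsWithin_le_nhds
        simpa [smul_sub] using h0.sub h2
      rw [Asymptotics.isLittleO_iff]
      intro c hc
      filter_upwards [h1.norm.eventually_le_const (by simpa using hc), self_mem_nhdsWithin]
        with z hz hz'
      have hz0 : 0 < ‖z - a‖ := norm_pos_iff.2 (sub_ne_zero.2 hz')
      rw [norm_inv, ← div_eq_mul_inv, le_div_iff₀ hz0, mul_comm, ← norm_smul]
      exact hz
    refine ⟨_, Complex.differentiableOn_update_limUnder_of_isLittleO (hU.mem_nhds haU) hg ho, ?_⟩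
    intro ρ hρ
    rw [Finset.mem_insert, not_or] at hρ
    rw [Function.update_of_ne hρ.1, hgf ρ hρ.2]

/-- Cauchy's theorem on the rectangle with corners `-T + iη` and `T + iT`. On the other three sides
`‖Φ‖ ≤ K/T`; the vertical sides integrate `e^{-ys}` and the top carries `e^{-Ts}`. The resulting
bound is independent of `η`. -/
theorem norm_integral_rect_le {Φ : ℂ → E} (hd : DifferentiableOn ℂ Φ {ρ | 0 < ρ.im})
    {R K : ℝ} (hR : 0 < R) (hK : 0 ≤ K)
    (hb : ∀ ρ : ℂ, 0 ≤ ρ.im → R ≤ ‖ρ‖ → ‖ρ‖ * ‖Φ ρ‖ ≤ K) {s : ℝ} (hs : 0 < s) {T η : ℝ}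
    (hT : R ≤ T) (hη : 0 < η) (hηT : η < T) :
    ‖∫ x in (-T)..T, Complex.exp (Complex.I * (x + η * Complex.I) * s) •
      Φ (x + η * Complex.I)‖ ≤ 2 * K * Real.exp (-(T * s)) + 2 * (K / (T * s)) := by
  have hT0 : 0 < T := hR.trans_le hT
  set f : ℂ → E := fun ρ => Complex.exp (Complex.I * ρ * s) • Φ ρ with hf
  have hfd : DifferentiableOn ℂ f {ρ | 0 < ρ.im} := by
    refine DifferentiableOn.smul ?_ hd
    fun_prop
  have hfb : ∀ x y : ℝ, 0 ≤ y → (T ≤ |x| ∨ T ≤ y) →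
      ‖f (x + y * Complex.I)‖ ≤ Real.exp (-(y * s)) * (K / T) := by
    intro x y hy hxy
    have hn : T ≤ ‖(x + y * Complex.I : ℂ)‖ := by
      rcases hxy with h | h
      · exact h.trans (by simpa using Complex.abs_re_le_norm (x + y * Complex.I : ℂ))
      · exact h.trans ((le_abs_self y).trans
          (by simpa using Complex.abs_im_le_norm (x + y * Complex.I : ℂ)))
    rw [hf]
    simp only [norm_smul]
    rw [norm_exp_I_mul]
    have := hb (x + y * Complex.I) (by simpa using hy) (hT.trans hn)
    have h1 : ‖Φ (x + y * Complex.I)‖ ≤ K / T := by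
      rw [le_div_iff₀ hT0]
      nlinarith [norm_nonneg (Φ (x + y * Complex.I))]
    simpa using mul_le_mul_of_nonneg_left h1 (Real.exp_pos _).le
  have hrect := Complex.integral_boundary_rect_eq_zero_of_differentiableOn f
    (-T + η * Complex.I) (T + T * Complex.I) (hfd.mono ?_)
  · simp only [Complex.add_re, Complex.neg_re, Complex.ofReal_re, Complex.mul_re, Complex.I_re,
      mul_zero, Complex.ofReal_im, Complex.I_im, mul_one, sub_self, add_zero, Complex.add_im,
      Complex.neg_im, neg_zero, Complex.mul_im, zero_add] at hrect
    have hside : ∀ x : ℝ, T ≤ |x| → ‖∫ y in η..T, f (x + y * Complex.I)‖ ≤ K / (T * s) := by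
      intro x hx
      have h1 : ∀ y ∈ uIcc η T, HasDerivAt (fun y : ℝ => -(Real.exp (-(y * s)) / s) * (K / T))
          (Real.exp (-(y * s)) * (K / T)) y := by
        intro y _
        have := (((hasDerivAt_id y).mul_const s).neg.exp.div_const s).neg.mul_const (K / T)
        refine this.congr_deriv ?_
        simp only [id, one_mul, Pi.neg_apply]
        field_simp
      have h2 : IntervalIntegrable (fun y : ℝ => Real.exp (-(y * s)) * (K / T)) volume η T := by
        apply Continuous.intervalIntegrable
        fun_prop
      refine (intervalIntegral.norm_integral_le_of_norm_le hηT.le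
        (.of_forall fun y hy => hfb x y (hη.le.trans hy.1.le) (.inl hx)) h2).trans ?_
      rw [intervalIntegral.integral_eq_sub_of_hasDerivAt h1 h2]
      have h3 : Real.exp (-(η * s)) ≤ 1 := Real.exp_le_one_iff.2 (by nlinarith)
      have h4 := Real.exp_pos (-(T * s))
      have h5 : -(Real.exp (-(T * s)) / s) * (K / T) - -(Real.exp (-(η * s)) / s) * (K / T)
          = (Real.exp (-(η * s)) - Real.exp (-(T * s))) * (K / (T * s)) := by
        field_simp
        ring
      rw [h5]
      exact mul_le_of_le_one_left (by positivity) (by linarith)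
    have htop : ‖∫ x in (-T)..T, f (x + T * Complex.I)‖ ≤ 2 * K * Real.exp (-(T * s)) := by
      refine (intervalIntegral.norm_integral_le_of_norm_le_const
        (C := Real.exp (-(T * s)) * (K / T)) fun x _ => hfb x T hT0.le (.inr le_rfl)).trans ?_
      rw [abs_of_pos (by linarith)]
      apply le_of_eq
      field_simp
      ring
    have h1 := hside T (le_abs_self T)
    have h2 := hside (-T) (by rw [abs_neg]; exact le_abs_self T)
    push_cast at h2 hrect
    have e : ∫ x in (-T)..T, f (x + η * Complex.I) = (∫ x in (-T)..T, f (x + T * Complex.I))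
        - Complex.I • (∫ y in η..T, f (T + y * Complex.I))
        + Complex.I • ∫ y in η..T, f (-T + y * Complex.I) := by
      rw [← sub_eq_zero, ← hrect]; abel
    change ‖∫ x in (-T)..T, f (x + η * Complex.I)‖ ≤ _
    rw [e]
    refine (norm_add_le _ _).trans ?_
    have := norm_sub_le (∫ x in (-T)..T, f (x + T * Complex.I))
      (Complex.I • (∫ y in η..T, f (T + y * Complex.I)))
    rw [norm_smul, Complex.norm_I, one_mul] at this ⊢
    linarith
  · intro z hz
    have := hz.2
    simp only [Complex.add_im, Complex.neg_im, Complex.ofReal_im, Complex.mul_im,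
      Complex.ofReal_re, Complex.I_im, Complex.I_re, mul_one, mul_zero, neg_zero, zero_add,
      add_zero, mem_preimage] at this
    rw [uIcc_of_le hηT.le] at this
    exact hη.trans_le this.1

/-- Jordan's lemma: closing the contour in the upper half-plane. -/
theorem tendsto_integral_exp_smul_of_upper {Φ : ℂ → E}
    (hc : ContinuousOn Φ {ρ | 0 ≤ ρ.im ∧ ρ ≠ 0}) (hd : DifferentiableOn ℂ Φ {ρ | 0 < ρ.im})
    {ε R K : ℝ} (hε : 0 < ε) (hR : 0 < R) (hK : 0 ≤ K)
    (h0 : ∀ ρ : ℂ, 0 < ρ.im → ‖ρ‖ < ε → ‖Φ ρ‖ ≤ K)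
    (hb : ∀ ρ : ℂ, 0 ≤ ρ.im → R ≤ ‖ρ‖ → ‖ρ‖ * ‖Φ ρ‖ ≤ K) {s : ℝ} (hs : 0 < s) :
    Tendsto (fun T : ℝ => ∫ ρ in (-T)..T, Complex.exp (Complex.I * ρ * s) • Φ ρ)
      atTop (𝓝 0) := by
  have hB : Tendsto (fun T : ℝ => 2 * K * Real.exp (-(T * s)) + 2 * (K / (T * s))) atTop
      (𝓝 0) := by
    have h1 : Tendsto (fun T : ℝ => T * s) atTop atTop := tendsto_id.atTop_mul_const hs
    have h2 := (Real.tendsto_exp_neg_atTop_nhds_zero.comp h1).const_mul (2 * K)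
    have h3 := (h1.const_div_atTop K).const_mul 2
    simpa using h2.add h3
  refine squeeze_zero_norm' ?_ hB
  filter_upwards [eventually_ge_atTop R] with T hT
  have hT0 : 0 < T := hR.trans_le hT
  -- Away from the origin compactness bounds `Φ` on the strip, near the origin `h0` does; together
  -- they dominate the integrands as `η` decreases to zero.
  have hcpt : IsCompact ((Icc (-T) T ×ℂ Icc 0 1) ∩ {ρ : ℂ | ε ≤ ‖ρ‖}) :=
    (isCompact_Icc.reProdIm isCompact_Icc).inter_right
      (isClosed_le continuous_const continuous_norm)
  obtain ⟨C, hC⟩ := hcpt.exists_bound_of_continuousOn (hc.mono fun ρ hρ => ⟨hρ.1.2.1, fun h => by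
    have : ε ≤ ‖ρ‖ := hρ.2
    rw [h, norm_zero] at this
    exact this.not_gt hε⟩)
  have hlim : Tendsto (fun η : ℝ => ∫ x in (-T)..T,
      Complex.exp (Complex.I * (x + η * Complex.I) * s) • Φ (x + η * Complex.I)) (𝓝[>] 0)
      (𝓝 (∫ x in (-T)..T, Complex.exp (Complex.I * x * s) • Φ x)) := by
    refine intervalIntegral.tendsto_integral_filter_of_dominated_convergence
      (fun _ => max K C) ?_ ?_ intervalIntegrable_const ?_
    · filter_upwards [self_mem_nhdsWithin] with η hη
      have : ContinuousOn (fun ρ : ℂ => Complex.exp (Complex.I * ρ * s) • Φ ρ)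
          {ρ | 0 < ρ.im} := by
        refine ContinuousOn.smul ?_ hd.continuousOn
        fun_prop
      refine (this.comp_continuous (f := fun x : ℝ => (x + η * Complex.I : ℂ)) (by fun_prop)
        fun x => ?_).aestronglyMeasurable
      simpa using hη
    · have : Ioo (0 : ℝ) 1 ∈ 𝓝[>] (0 : ℝ) := Ioo_mem_nhdsGT one_pos
      filter_upwards [this] with η hη
      refine .of_forall fun x hx => ?_
      rw [uIoc_of_le (by linarith)] at hx
      rw [norm_smul, norm_exp_I_mul]
      have h1 : Real.exp (-((x + η * Complex.I : ℂ).im * s)) ≤ 1 := by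
        rw [Real.exp_le_one_iff]
        have : 0 < η * s := mul_pos hη.1 hs
        simpa using this.le
      have h2 : ‖Φ (x + η * Complex.I)‖ ≤ max K C := by
        rcases lt_or_ge ‖(x + η * Complex.I : ℂ)‖ ε with h | h
        · exact (h0 _ (by simpa using hη.1) h).trans (le_max_left _ _)
        · refine (hC _ ⟨⟨?_, ?_⟩, h⟩).trans (le_max_right _ _)
          · simpa using ⟨hx.1.le, hx.2⟩
          · simpa using ⟨hη.1.le, hη.2.le⟩
      exact (mul_le_of_le_one_left (norm_nonneg _) h1).trans h2
    · have hne : ∀ᵐ x : ℝ, x ≠ 0 := Measure.ae_ne volume 0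
      filter_upwards [hne] with x hx _
      have hcw : ContinuousOn (fun ρ : ℂ => Complex.exp (Complex.I * ρ * s) • Φ ρ)
          {ρ | 0 ≤ ρ.im ∧ ρ ≠ 0} := by
        refine ContinuousOn.smul ?_ hc
        fun_prop
      have h1 := hcw x ⟨by simp, by simpa using hx⟩
      have h2 : Tendsto (fun η : ℝ => (x + η * Complex.I : ℂ)) (𝓝[>] 0)
          (𝓝[{ρ | 0 ≤ ρ.im ∧ ρ ≠ 0}] (x : ℂ)) := by
        refine tendsto_nhdsWithin_iff.2 ⟨?_, ?_⟩
        · have : Continuous fun η : ℝ => (x + η * Complex.I : ℂ) := by fun_prop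
          have := this.tendsto 0
          simp only [Complex.ofReal_zero, zero_mul, add_zero] at this
          exact this.mono_left nhdsWithin_le_nhds
        · filter_upwards [self_mem_nhdsWithin] with η hη
          have hη' : (0 : ℝ) < η := hη
          refine ⟨by simpa using hη'.le, fun h => ?_⟩
          have := congrArg Complex.im h
          simp at this
          exact hη'.ne' this
      exact h1.tendsto.comp h2
  refine le_of_tendsto hlim.norm ?_
  filter_upwards [Ioo_mem_nhdsGT hT0] with η hη
  exact norm_integral_rect_le hd hR hK hb hs hT hη.1 hη.2

end Contour

end

/-! ### Truncated Fourier integrals and convolution -/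

section

section FourierLimit

variable {E : Type*} [NormedAddCommGroup E] [NormedSpace ℂ E]

/-- The truncated inverse Fourier integral. -/
def truncFourier (S : ℝ → E) (T x : ℝ) : E :=
  (1 / (2 * Real.pi) : ℂ) • ∫ ρ in (-T)..T, Complex.exp (Complex.I * ρ * x) • S ρ

theorem isFourierLimit_iff {S R : ℝ → E} : IsFourierLimit S R ↔
    Tendsto (fun T => eLpNorm (fun x => R x - truncFourier S T x) 2 volume) atTop (𝓝 0) := Iff.rfl

theorem norm_exp_I_mul_mul (r x : ℝ) : ‖Complex.exp (Complex.I * r * x)‖ = 1 := by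
  rw [norm_exp_I_mul]; simp

theorem truncFourier_congr {S S' : ℝ → E} (h : ∀ᵐ ρ, S ρ = S' ρ) (T x : ℝ) :
    truncFourier S T x = truncFourier S' T x := by
  unfold truncFourier
  congr 1
  refine intervalIntegral.integral_congr_ae ?_
  filter_upwards [h] with ρ hρ _
  rw [hρ]

theorem intervalIntegrable_of_memLp {S : ℝ → E} (hS : MemLp S 2) (a b : ℝ) :
    IntervalIntegrable S volume a b :=
  ((hS.locallyIntegrable (by norm_num)).integrableOn_isCompact
    isCompact_uIcc).intervalIntegrable

theorem continuous_truncFourier {S : ℝ → E} {T : ℝ} (hS : IntervalIntegrable S volume (-T) T) :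
    Continuous (truncFourier S T) := by
  refine Continuous.const_smul ?_ _
  refine intervalIntegral.continuous_of_dominated_interval (bound := fun ρ => ‖S ρ‖)
    (fun x => ?_) (fun x => .of_forall fun ρ _ => ?_) hS.norm (.of_forall fun ρ _ => ?_)
  · have : Continuous fun ρ : ℝ => Complex.exp (Complex.I * ρ * x) := by fun_prop
    exact this.aestronglyMeasurable.smul hS.aestronglyMeasurable_restrict_uIoc
  · rw [norm_smul, norm_exp_I_mul_mul, one_mul]
  · fun_prop

theorem exists_norm_truncFourier_le (S : ℝ → E) (T : ℝ) : ∃ C, ∀ x, ‖truncFourier S T x‖ ≤ C := by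
  refine ⟨‖(1 / (2 * Real.pi) : ℂ)‖ * |∫ ρ in (-T)..T, ‖S ρ‖|, fun x => ?_⟩
  rw [truncFourier, norm_smul]
  gcongr
  refine intervalIntegral.norm_integral_le_abs_integral_norm.trans (le_of_eq ?_)
  simp only [norm_smul, norm_exp_I_mul_mul, one_mul]

theorem IsFourierLimit.congr {S S' R R' : ℝ → E} (h : IsFourierLimit S R)
    (hS : ∀ᵐ ρ, S ρ = S' ρ) (hR : ∀ᵐ x, R x = R' x) : IsFourierLimit S' R' := by
  refine (isFourierLimit_iff.1 h).congr fun T => eLpNorm_congr_ae ?_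
  filter_upwards [hR] with x hx
  rw [truncFourier_congr hS, hx]
  rfl

/-- Along a subsequence, the truncated Fourier integrals converge almost everywhere. -/
theorem exists_seq_tendsto_ae_of_isFourierLimit {S R : ℝ → E} (hS : MemLp S 2) (hR : MemLp R 2)
    (h : IsFourierLimit S R) (u : ℕ → ℝ) (hu : Tendsto u atTop atTop) :
    ∃ n : ℕ → ℕ, StrictMono n ∧ ∀ᵐ x, Tendsto (fun i => truncFourier S (u (n i)) x) atTop
      (𝓝 (R x)) := by
  have hm : ∀ i, AEStronglyMeasurable (truncFourier S (u i)) volume := fun i =>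
    (continuous_truncFourier (intervalIntegrable_of_memLp hS _ _)).aestronglyMeasurable
  have h1 : Tendsto (fun i => eLpNorm (truncFourier S (u i) - R) 2 volume) atTop (𝓝 0) := by
    refine ((isFourierLimit_iff.1 h).comp hu).congr fun i => ?_
    rw [eLpNorm_sub_comm]
    rfl
  exact (tendstoInMeasure_of_tendsto_eLpNorm two_ne_zero hm hR.1 h1).exists_seq_tendsto_ae

theorem IsFourierLimit.ae_eq {S R R' : ℝ → E} (hS : MemLp S 2) (hR : MemLp R 2)
    (hR' : MemLp R' 2) (h : IsFourierLimit S R) (h' : IsFourierLimit S R') : R =ᵐ[volume] R' := by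
  obtain ⟨n, hn, h1⟩ := exists_seq_tendsto_ae_of_isFourierLimit hS hR h _
    tendsto_natCast_atTop_atTop
  obtain ⟨n', hn', h2⟩ := exists_seq_tendsto_ae_of_isFourierLimit hS hR' h' _
    (tendsto_natCast_atTop_atTop.comp hn.tendsto_atTop)
  filter_upwards [h1, h2] with x hx hx'
  exact tendsto_nhds_unique (hx.comp hn'.tendsto_atTop) hx'

/-- By continuity the functions `g x` agree on overlapping half-lines, so near each point the glued
function `z ↦ g (z - 1) z` coincides with a single continuous one. -/
theorem exists_continuous_of_ae_eq_on_Ioi {R : ℝ → E} {g : ℝ → ℝ → E}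
    (hg : ∀ x, ContinuousOn (g x) (Ioi x)) (h : ∀ x, ∀ᵐ z, x < z → R z = g x z) :
    ∃ R' : ℝ → E, Continuous R' ∧ R =ᵐ[volume] R' := by
  have key : ∀ x x' z, x < z → x' < z → g x z = g x' z := by
    intro x x' z hx hx'
    have : EqOn (g x) (g x') (Ioi (max x x')) := by
      refine Measure.eqOn_open_of_ae_eq (μ := volume) ?_ isOpen_Ioi
        ((hg x).mono (Ioi_subset_Ioi (le_max_left _ _)))
        ((hg x').mono (Ioi_subset_Ioi (le_max_right _ _)))
      rw [Filter.EventuallyEq, ae_restrict_iff' measurableSet_Ioi]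
      filter_upwards [h x, h x'] with z h1 h2 hz
      rw [← h1 ((le_max_left _ _).trans_lt hz), ← h2 ((le_max_right _ _).trans_lt hz)]
    exact this (max_lt hx hx')
  refine ⟨fun z => g (z - 1) z, ?_, ?_⟩
  · rw [continuous_iff_continuousAt]
    intro z
    refine ((hg (z - 1)).continuousAt (Ioi_mem_nhds (by linarith))).congr ?_
    filter_upwards [Ioi_mem_nhds (show z - 1 < z by linarith)] with w hw
    exact key _ _ _ hw (by linarith)
  · have := ae_all_iff.2 fun n : ℕ => h (-n)
    filter_upwards [this] with z hz
    obtain ⟨n, hn⟩ := exists_nat_gt (-z)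
    rw [hz n (by linarith)]
    exact key _ _ _ (by linarith) (by linarith)

end FourierLimit

section Convolution

variable {A : Type*} [NormedRing A] [NormedAlgebra ℂ A] [CompleteSpace A]

theorem continuous_fourier_kernel {k : ℝ → A} (hk : Integrable k) :
    Continuous fun ρ : ℝ => ∫ t : ℝ, Complex.exp (Complex.I * ρ * t) • k t := by
  refine continuous_of_dominated (bound := fun t => ‖k t‖) (fun ρ => ?_)
    (fun ρ => .of_forall fun t => ?_) hk.norm (.of_forall fun t => by fun_prop)
  · have : Continuous fun t : ℝ => Complex.exp (Complex.I * ρ * t) := by fun_prop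
    exact this.aestronglyMeasurable.smul hk.1
  · rw [norm_smul, norm_exp_I_mul_mul, one_mul]

theorem intervalIntegrable_fourier_kernel_mul {k S : ℝ → A} (hk : Integrable k) {a b : ℝ}
    (hS : IntervalIntegrable S volume a b) :
    IntervalIntegrable (fun ρ : ℝ => (∫ t : ℝ, Complex.exp (Complex.I * ρ * t) • k t) * S ρ)
      volume a b := by
  have h := (continuous_fourier_kernel hk).aestronglyMeasurable (μ := volume)
  have hb : ∀ ρ : ℝ, ‖∫ t : ℝ, Complex.exp (Complex.I * ρ * t) • k t‖ ≤ ∫ t, ‖k t‖ := by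
    intro ρ
    refine (norm_integral_le_integral_norm _).trans (le_of_eq ?_)
    simp only [norm_smul, norm_exp_I_mul_mul, one_mul]
  exact ⟨hS.1.bdd_mul h.restrict (.of_forall hb), hS.2.bdd_mul h.restrict (.of_forall hb)⟩

/-- Multiplication by the transform of `k` becomes correlation with `k`; Fubini is legitimate
because the frequency interval is bounded. -/
theorem truncFourier_kernel_mul {k S : ℝ → A} (hk : Integrable k) {T : ℝ} (hT : 0 ≤ T)
    (hS : IntervalIntegrable S volume (-T) T) (y : ℝ) :
    truncFourier (fun ρ : ℝ => (∫ t : ℝ, Complex.exp (Complex.I * ρ * t) • k t) * S ρ) T y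
      = ∫ t, k t * truncFourier S T (t + y) := by
  have hle : -T ≤ T := by linarith
  have hST : Integrable S (volume.restrict (Ioc (-T) T)) := hS.1
  have hprod : Integrable (fun p : ℝ × ℝ => Complex.exp (Complex.I * p.1 * (p.2 + y)) •
      (k p.2 * S p.1)) ((volume.restrict (Ioc (-T) T)).prod volume) := by
    have h1 : Integrable (fun p : ℝ × ℝ => k p.2 * S p.1)
        ((volume.restrict (Ioc (-T) T)).prod volume) := (hk.mul_prod hST).swap
    have h2 : Continuous fun p : ℝ × ℝ => Complex.exp (Complex.I * p.1 * (p.2 + y)) := by fun_prop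
    refine h1.mono (h2.aestronglyMeasurable.smul h1.1) (.of_forall fun p => ?_)
    have := norm_exp_I_mul_mul p.1 (p.2 + y)
    push_cast at this
    rw [norm_smul, this, one_mul]
  have e1 : ∀ ρ : ℝ, Complex.exp (Complex.I * ρ * y) •
      ((∫ t : ℝ, Complex.exp (Complex.I * ρ * t) • k t) * S ρ)
      = ∫ t : ℝ, Complex.exp (Complex.I * ρ * (t + y)) • (k t * S ρ) := by
    intro ρ
    have hi : Integrable fun t : ℝ => Complex.exp (Complex.I * ρ * t) • k t := by
      have h2 : Continuous fun t : ℝ => Complex.exp (Complex.I * ρ * t) := by fun_prop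
      refine hk.mono (h2.aestronglyMeasurable.smul hk.1) (.of_forall fun t => ?_)
      rw [norm_smul, norm_exp_I_mul_mul, one_mul]
    rw [← integral_mul_const_of_integrable hi, ← integral_smul]
    refine integral_congr_ae (.of_forall fun t => ?_)
    simp only
    rw [smul_mul_assoc, smul_smul, ← Complex.exp_add]
    congr 2
    ring
  have e2 : ∀ t : ℝ, ∫ ρ in Ioc (-T) T, Complex.exp (Complex.I * ρ * (t + y)) • (k t * S ρ)
      = k t * ∫ ρ in Ioc (-T) T, Complex.exp (Complex.I * ρ * (t + y)) • S ρ := by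
    intro t
    have hi : Integrable (fun ρ : ℝ => Complex.exp (Complex.I * ρ * (t + y)) • S ρ)
        (volume.restrict (Ioc (-T) T)) := by
      have h2 : Continuous fun ρ : ℝ => Complex.exp (Complex.I * ρ * (t + y)) := by fun_prop
      refine hST.mono (h2.aestronglyMeasurable.smul hST.1) (.of_forall fun ρ => ?_)
      have := norm_exp_I_mul_mul ρ (t + y)
      push_cast at this
      rw [norm_smul, this, one_mul]
    rw [← integral_const_mul_of_integrable hi]
    refine integral_congr_ae (.of_forall fun ρ => ?_)
    simp only [mul_smul_comm]
  unfold truncFourier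
  simp only [intervalIntegral.integral_of_le hle, e1]
  rw [integral_integral_swap hprod, ← integral_smul]
  refine integral_congr_ae (.of_forall fun t => ?_)
  simp only [e2, mul_smul_comm, Complex.ofReal_add]

theorem memLp_comp_add {E : Type*} [NormedAddCommGroup E] {R : ℝ → E} (hR : MemLp R 2)
    (y : ℝ) : MemLp (fun t => R (t + y)) 2 :=
  hR.comp_measurePreserving (measurePreserving_add_right volume y)

theorem integrable_mul_comp_add {k R : ℝ → A} (hk : MemLp k 2) (hR : MemLp R 2) (y : ℝ) :
    Integrable fun t => k t * R (t + y) :=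
  hk.integrable_mul (memLp_comp_add hR y)

/-- Cauchy-Schwarz and translation invariance; the bound does not depend on `y`, which makes the
convergence below uniform. -/
theorem enorm_integral_mul_sub_le {k R : ℝ → A} (hk : Integrable k) (hk₂ : MemLp k 2)
    (hR : MemLp R 2) {f : ℝ → A} (hf : Continuous f) {C : ℝ} (hfC : ∀ x, ‖f x‖ ≤ C) (y : ℝ) :
    ‖(∫ t, k t * R (t + y)) - ∫ t, k t * f (t + y)‖ₑ ≤
      eLpNorm k 2 volume * eLpNorm (fun x => R x - f x) 2 volume := by
  have hfy : Continuous fun t => f (t + y) := by fun_prop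
  have h1 : Integrable fun t => k t * f (t + y) :=
    hk.mul_bdd hfy.aestronglyMeasurable (.of_forall fun t => hfC _)
  rw [← integral_sub (integrable_mul_comp_add hk₂ hR y) h1]
  refine (enorm_integral_le_lintegral_enorm _).trans ?_
  rw [← eLpNorm_one_eq_lintegral_enorm]
  have h2 : eLpNorm (fun t => R (t + y) - f (t + y)) 2 volume
      = eLpNorm (fun x => R x - f x) 2 volume :=
    eLpNorm_comp_measurePreserving (g := fun x => R x - f x)
      (hR.1.sub hf.aestronglyMeasurable) (measurePreserving_add_right volume y)
  rw [← h2]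
  have h4 : AEStronglyMeasurable (fun t => R (t + y) - f (t + y)) volume :=
    (memLp_comp_add hR y).1.sub hfy.aestronglyMeasurable
  have h3 := eLpNorm_le_eLpNorm_mul_eLpNorm'_of_norm (p := 2) (q := 2) (r := 1) hk.1 h4 (fun a b : A => a * b) 1
    (.of_forall fun t => by simpa using norm_mul_le _ _)
  simpa [mul_sub] using h3

/-- The truncated Fourier integrals of a product converge uniformly to the convolution. -/
theorem tendstoUniformly_truncFourier_kernel_mul {k S R : ℝ → A} (hk : Integrable k)
    (hk₂ : MemLp k 2) (hS : MemLp S 2) (hR : MemLp R 2) (h : IsFourierLimit S R) :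
    TendstoUniformly (fun T => truncFourier
      (fun ρ : ℝ => (∫ t : ℝ, Complex.exp (Complex.I * ρ * t) • k t) * S ρ) T)
      (fun y => ∫ t, k t * R (t + y)) atTop := by
  rw [EMetric.tendstoUniformly_iff]
  intro ε hε
  have h1 := ENNReal.Tendsto.const_mul (isFourierLimit_iff.1 h) (.inr hk₂.2.ne)
  rw [mul_zero] at h1
  filter_upwards [h1.eventually_lt_const hε, eventually_ge_atTop 0] with T hT hT0 y
  have hST := intervalIntegrable_of_memLp hS (-T) T
  obtain ⟨C, hC⟩ := exists_norm_truncFourier_le S T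
  rw [truncFourier_kernel_mul hk hT0 hST, edist_eq_enorm_sub]
  exact (enorm_integral_mul_sub_le hk hk₂ hR (continuous_truncFourier hST) hC y).trans_lt hT

/-- A uniform limit of continuous functions. No continuity of `R` enters, which later allows
continuity of `R` to be deduced from the equation. -/
theorem continuous_integral_mul_comp_add {k S R : ℝ → A} (hk : Integrable k)
    (hk₂ : MemLp k 2) (hS : MemLp S 2) (hR : MemLp R 2) (h : IsFourierLimit S R) :
    Continuous (fun y => ∫ t, k t * R (t + y)) :=
  (tendstoUniformly_truncFourier_kernel_mul hk hk₂ hS hR h).continuous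
    (Eventually.frequently (.of_forall fun _ => continuous_truncFourier
      (intervalIntegrable_fourier_kernel_mul hk (intervalIntegrable_of_memLp hS _ _))))

end Convolution

end

/-! ### Subtracting the poles and closing the contour -/

section

section PolePart

variable {m N : ℕ} {Q : ℝ → Mat m} {τ : Fin N → ℝ}

/-- The singular part `∑ₖ (ρ - iτₖ)⁻¹ Pₖ`. -/
def polePart (τ : Fin N → ℝ) (P : Fin N → Mat m) (ρ : ℂ) : Mat m :=
  ∑ k, (ρ - Complex.I * τ k)⁻¹ • P k

theorem norm_I_mul_of_pos {t : ℝ} (ht : 0 < t) : ‖Complex.I * (t : ℂ)‖ = t := by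
  simp [abs_of_pos ht]

/-- Below `τₖ/2` the distance from `ρ` to the pole is at least `τₖ/2`, and beyond `2τₖ` it is at
least `‖ρ‖/2`. -/
theorem exists_polePart_bound (hτ : ∀ k, 0 < τ k) (P : Fin N → Mat m) :
    ∃ ε R K : ℝ, 0 < ε ∧ 0 < R ∧ 0 ≤ K ∧
      (∀ ρ : ℂ, ‖ρ‖ < ε → (∀ k, ρ ≠ Complex.I * τ k) ∧ ‖polePart τ P ρ‖ ≤ K) ∧
      ∀ ρ : ℂ, R ≤ ‖ρ‖ → (∀ k, ρ ≠ Complex.I * τ k) ∧ ‖ρ‖ * ‖polePart τ P ρ‖ ≤ K := by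
  have hε : ∀ᶠ ε : ℝ in 𝓝[>] 0, ∀ k, ε < τ k / 2 := eventually_all.2 fun k =>
    (eventually_lt_nhds (half_pos (hτ k))).filter_mono nhdsWithin_le_nhds
  obtain ⟨ε, hε, hε0⟩ := (hε.and self_mem_nhdsWithin).exists
  have hR : ∀ᶠ R : ℝ in atTop, ∀ k, 2 * τ k < R := eventually_all.2 fun k =>
    eventually_gt_atTop _
  obtain ⟨R, hR, hR0⟩ := (hR.and (eventually_gt_atTop 0)).exists
  refine ⟨ε, R, (∑ k, 2 / τ k * ‖P k‖) + ∑ k, 2 * ‖P k‖, hε0, hR0, ?_, fun ρ hρ => ⟨?_, ?_⟩,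
    fun ρ hρ => ⟨?_, ?_⟩⟩
  · have := fun k => (hτ k).le
    exact add_nonneg (Finset.sum_nonneg fun k _ => mul_nonneg (div_nonneg zero_le_two (this k))
      (norm_nonneg _)) (Finset.sum_nonneg fun k _ => by positivity)
  · rintro k rfl
    rw [norm_I_mul_of_pos (hτ k)] at hρ
    linarith [hε k, hτ k]
  · refine le_add_of_le_of_nonneg ((norm_sum_le _ _).trans (Finset.sum_le_sum fun k _ => ?_))
      (Finset.sum_nonneg fun k _ => by positivity)
    rw [norm_smul, norm_inv]
    gcongr
    have h1 := norm_sub_norm_le (Complex.I * (τ k : ℂ)) ρ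
    rw [norm_I_mul_of_pos (hτ k), norm_sub_rev] at h1
    have h2 : τ k / 2 ≤ ‖ρ - Complex.I * τ k‖ := by linarith [hε k]
    have h3 := inv_anti₀ (half_pos (hτ k)) h2
    rwa [inv_div] at h3
  · rintro k rfl
    rw [norm_I_mul_of_pos (hτ k)] at hρ
    linarith [hR k, hτ k]
  · refine le_add_of_nonneg_of_le (Finset.sum_nonneg fun k _ => mul_nonneg
      (div_nonneg zero_le_two (hτ k).le) (norm_nonneg _)) ?_
    refine (mul_le_mul_of_nonneg_left (norm_sum_le _ _) (norm_nonneg _)).trans ?_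
    rw [Finset.mul_sum]
    refine Finset.sum_le_sum fun k _ => ?_
    rw [norm_smul, norm_inv, ← mul_assoc]
    gcongr
    have h1 := norm_sub_norm_le ρ (Complex.I * (τ k : ℂ))
    rw [norm_I_mul_of_pos (hτ k)] at h1
    have h2 : ‖ρ‖ / 2 ≤ ‖ρ - Complex.I * τ k‖ := by linarith [hR k]
    have h0 : 0 < ‖ρ‖ := hR0.trans_le hρ
    rw [← div_eq_mul_inv, div_le_iff₀ (by linarith)]
    linarith

theorem differentiableAt_polePart (P : Fin N → Mat m) {ρ : ℂ}
    (h : ∀ k, ρ ≠ Complex.I * τ k) : DifferentiableAt ℂ (polePart τ P) ρ := by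
  unfold polePart
  refine DifferentiableAt.fun_sum fun k _ => DifferentiableAt.smul_const ?_ _
  exact (differentiableAt_id.sub_const _).inv (sub_ne_zero.2 (h k))

theorem tendsto_smul_polePart (hτ : Function.Injective τ) (P : Fin N → Mat m) (k : Fin N) :
    Tendsto (fun ρ => (ρ - Complex.I * τ k) • polePart τ P ρ) (𝓝[≠] (Complex.I * τ k))
      (𝓝 (P k)) := by
  classical
  have h0 : ∀ j, j ≠ k → Complex.I * (τ k : ℂ) ≠ Complex.I * τ j := by
    intro j hj h
    have := mul_left_cancel₀ Complex.I_ne_zero h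
    exact hj (hτ (Complex.ofReal_injective this)).symm
  have h1 : ∀ ρ, ρ ≠ Complex.I * τ k → (ρ - Complex.I * τ k) • polePart τ P ρ
      = P k + ∑ j ∈ Finset.univ.erase k,
        ((ρ - Complex.I * τ k) * (ρ - Complex.I * τ j)⁻¹) • P j := by
    intro ρ hρ
    rw [polePart, Finset.smul_sum, ← Finset.add_sum_erase _ _ (Finset.mem_univ k)]
    congr 1
    · rw [smul_smul, mul_inv_cancel₀ (sub_ne_zero.2 hρ), one_smul]
    · exact Finset.sum_congr rfl fun j _ => smul_smul _ _ _
  have h2 : Tendsto (fun ρ => P k + ∑ j ∈ Finset.univ.erase k,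
      ((ρ - Complex.I * τ k) * (ρ - Complex.I * τ j)⁻¹) • P j) (𝓝 (Complex.I * τ k))
      (𝓝 (P k)) := by
    have : ContinuousAt (fun ρ => P k + ∑ j ∈ Finset.univ.erase k,
        ((ρ - Complex.I * τ k) * (ρ - Complex.I * τ j)⁻¹) • P j) (Complex.I * τ k) := by
      refine continuousAt_const.add (tendsto_finsetSum _ fun j hj => ?_)
      have h3 : ContinuousAt (fun ρ : ℂ => (ρ - Complex.I * τ k) * (ρ - Complex.I * τ j)⁻¹)
          (Complex.I * τ k) :=
        ContinuousAt.mul (by fun_prop) (ContinuousAt.inv₀ (by fun_prop)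
          (sub_ne_zero.2 (h0 j (Finset.ne_of_mem_erase hj))))
      exact h3.smul continuousAt_const
    have := this.tendsto
    simpa using this
  refine (h2.mono_left nhdsWithin_le_nhds).congr' ?_
  filter_upwards [self_mem_nhdsWithin] with ρ hρ
  exact (h1 ρ hρ).symm

namespace Pot

/-- `exp(iρx) F₋(x,ρ) D(ρ)⁻¹ - I` without its poles. -/
def regPart (Q : ℝ → Mat m) (τ : Fin N → ℝ) (P : Fin N → Mat m) (x : ℝ) (ρ : ℂ) : Mat m :=
  modPlus (reflect Q) (-x) ρ * (contD Q ρ)⁻¹ - 1 - polePart τ P ρ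

theorem isUnit_contD_of_ne (h : Pot Q) (hτ : IsEigenvalueEnumeration Q τ) {ρ : ℂ}
    (hρ : 0 ≤ ρ.im) (h0 : ρ ≠ 0) (hne : ∀ k, ρ ≠ Complex.I * τ k) : IsUnit (contD Q ρ) := by
  rcases hρ.eq_or_lt with h1 | h1
  · obtain ⟨r, rfl⟩ : ∃ r : ℝ, ρ = r := ⟨ρ.re, Complex.ext rfl (by simp [← h1])⟩
    have hr : r ≠ 0 := fun h' => h0 (by simp [h'])
    rw [h.contD_real hr]
    exact h.isUnit_D hr
  · rw [h.isUnit_contD_iff hρ h0]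
    rcases h.mem_range_of_enumeration hτ h1 with h2 | ⟨k, h2⟩
    · exact h2
    · exact absurd h2 (hne k)

/-- `P k` is the residue of `e^{iρx} F₋ D⁻¹` at `iτₖ`, so after subtraction all singularities are
removable. The bounds near zero and infinity hold for each ingredient separately, and Jordan's lemma
applies because `s > 0`. -/
theorem tendsto_integral_regPart (h : Pot Q) (hτ : IsEigenvalueEnumeration Q τ)
    {P Res : Fin N → Mat m} {x : ℝ}
    (hRes : ∀ k, Tendsto (fun ρ : ℂ => (ρ - Complex.I * τ k) • (contD Q ρ)⁻¹)
      (𝓝[≠] (Complex.I * τ k)) (𝓝 (Res k)))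
    (hP : ∀ k, P k = modPlus (reflect Q) (-x) (Complex.I * τ k) * Res k) {s : ℝ} (hs : 0 < s) :
    Tendsto (fun T : ℝ => ∫ ρ in (-T)..T,
      Complex.exp (Complex.I * ρ * s) • regPart Q τ P x ρ) atTop (𝓝 0) := by
  classical
  obtain ⟨hWc, hWd, -, -, c, hc0, hc⟩ := h.refl.modPlus_spec (-x)
  obtain ⟨ε₁, K₁, hε₁, hK₁, h0D⟩ := h.exists_bound_near_zero
  obtain ⟨R₁, K₂, hR₁, hK₂, hinfD⟩ := h.exists_bound_at_infty
  obtain ⟨ε₂, R₂, K₃, hε₂, hR₂, hK₃, h0P, hinfP⟩ := exists_polePart_bound hτ.2.1 P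
  set S : Finset ℂ := Finset.univ.image fun k => Complex.I * (τ k : ℂ) with hS
  have hmem : ∀ ρ, ρ ∉ S ↔ ∀ k, ρ ≠ Complex.I * τ k := by
    intro ρ
    simp [hS, eq_comm]
  have hcont : ContinuousOn (regPart Q τ P x) {ρ | (0 ≤ ρ.im ∧ ρ ≠ 0) ∧ ρ ∉ S} := by
    refine (((hWc.mono fun ρ hρ => hρ.1.1).mul (continuousOn_matrix_inv
      (h.continuousOn_contD.mono fun ρ hρ => hρ.1) fun ρ hρ =>
        h.isUnit_contD_of_ne hτ hρ.1.1 hρ.1.2 ((hmem ρ).1 hρ.2))).sub continuousOn_const).sub ?_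
    exact fun ρ hρ => (differentiableAt_polePart P
      ((hmem ρ).1 hρ.2)).continuousAt.continuousWithinAt
  have hdiff : DifferentiableOn ℂ (regPart Q τ P x) ({ρ | 0 < ρ.im} \ S) := by
    refine (((hWd.mono sdiff_subset).mul (differentiableOn_matrix_inv
      (h.differentiableOn_contD.mono sdiff_subset) fun ρ hρ =>
        h.isUnit_contD_of_ne hτ (le_of_lt hρ.1) ?_ ((hmem ρ).1 hρ.2))).sub_const _).sub ?_
    · rintro rfl
      simpa using hρ.1
    · exact fun ρ hρ => (differentiableAt_polePart P
        ((hmem ρ).1 hρ.2)).differentiableWithinAt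
  obtain ⟨Φ, hΦd, hΦ⟩ := exists_differentiableOn_of_removable S (regPart Q τ P x) isOpen_upper
    (by
      intro s hs
      obtain ⟨k, -, rfl⟩ := Finset.mem_image.1 hs
      simpa using hτ.2.1 k) hdiff
    (by
      intro s hs
      obtain ⟨k, -, rfl⟩ := Finset.mem_image.1 hs
      have hk : 0 < (Complex.I * (τ k : ℂ)).im := by simpa using hτ.2.1 k
      have hW : Tendsto (modPlus (reflect Q) (-x)) (𝓝[≠] (Complex.I * (τ k : ℂ)))
          (𝓝 (modPlus (reflect Q) (-x) (Complex.I * τ k))) :=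
        (hWd.differentiableAt (isOpen_upper.mem_nhds hk)).continuousAt.tendsto.mono_left
          nhdsWithin_le_nhds
      have h1 : Tendsto (fun ρ : ℂ => (ρ - Complex.I * τ k) • (1 : Mat m))
          (𝓝[≠] (Complex.I * (τ k : ℂ))) (𝓝 0) := by
        have : Continuous fun ρ : ℂ => (ρ - Complex.I * τ k) • (1 : Mat m) := by fun_prop
        have := this.tendsto (Complex.I * (τ k : ℂ))
        rw [sub_self, zero_smul] at this
        exact this.mono_left nhdsWithin_le_nhds
      have h2 := ((hW.mul (hRes k)).sub h1).sub (tendsto_smul_polePart hτ.1 P k)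
      rw [← hP k, sub_zero, sub_self] at h2
      refine h2.congr fun ρ => ?_
      rw [regPart, smul_sub, smul_sub, mul_smul_comm])
  have hΦc : ContinuousOn Φ {ρ | 0 ≤ ρ.im ∧ ρ ≠ 0} := by
    rintro ρ ⟨hρ, hρ0⟩
    rcases hρ.eq_or_lt with h1 | h1
    · have hρS : ρ ∉ S := by
        rw [hmem]
        rintro k rfl
        have := hτ.2.1 k
        simp at h1
        exact this.ne h1
      have hn : (S : Set ℂ)ᶜ ∈ 𝓝 ρ :=
        S.finite_toSet.isClosed.isOpen_compl.mem_nhds (by simpa using hρS)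
      have h2 := (hcont.congr fun z hz => hΦ z hz.2) ρ ⟨⟨hρ, hρ0⟩, hρS⟩
      exact (continuousWithinAt_inter hn).1 h2
    · exact (hΦd.differentiableAt (isOpen_upper.mem_nhds h1)).continuousAt.continuousWithinAt
  have hlim := tendsto_integral_exp_smul_of_upper (K := c * K₁ + ‖(1 : Mat m)‖ + K₃ + 2 * c + K₂)
    hΦc hΦd
    (lt_min hε₁ hε₂) (lt_max_of_lt_left (by linarith : 0 < R₁) : 0 < max R₁ R₂) (by positivity)
    (by
      intro ρ hρ hn
      have h1 := (h0P ρ (hn.trans_le (min_le_right _ _)))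
      rw [hΦ ρ ((hmem ρ).2 h1.1)]
      have h2 := (h0D ρ hρ (hn.trans_le (min_le_left _ _))).2
      have h3 := (hc ρ hρ.le).2.2
      have h4 := norm_sub_le (modPlus (reflect Q) (-x) ρ * (contD Q ρ)⁻¹ - 1) (polePart τ P ρ)
      have h5 := norm_sub_le (modPlus (reflect Q) (-x) ρ * (contD Q ρ)⁻¹) 1
      have h6 : ‖modPlus (reflect Q) (-x) ρ * (contD Q ρ)⁻¹‖ ≤ c * K₁ :=
        (norm_mul_le _ _).trans (mul_le_mul h3 h2 (norm_nonneg _) hc0)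
      rw [regPart]
      linarith [h1.2])
    (by
      intro ρ hρ hn
      have h1 := (hinfP ρ ((le_max_right _ _).trans hn))
      rw [hΦ ρ ((hmem ρ).2 h1.1)]
      obtain ⟨-, h2, h3⟩ := hinfD ρ hρ ((le_max_left _ _).trans hn)
      have h4 := (hc ρ hρ).1
      -- In this decomposition every summand is `O(1/‖ρ‖)`.
      have e : regPart Q τ P x ρ = (modPlus (reflect Q) (-x) ρ - 1) * (contD Q ρ)⁻¹ +
          ((contD Q ρ)⁻¹ - 1) - polePart τ P ρ := by
        rw [regPart, sub_mul, one_mul]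
        abel
      have h5 : ‖(modPlus (reflect Q) (-x) ρ - 1) * (contD Q ρ)⁻¹‖ ≤
          ‖modPlus (reflect Q) (-x) ρ - 1‖ * 2 :=
        (norm_mul_le _ _).trans (mul_le_mul_of_nonneg_left h2 (norm_nonneg _))
      have h6 := norm_sub_le ((modPlus (reflect Q) (-x) ρ - 1) * (contD Q ρ)⁻¹ +
          ((contD Q ρ)⁻¹ - 1)) (polePart τ P ρ)
      have h7 := norm_add_le ((modPlus (reflect Q) (-x) ρ - 1) * (contD Q ρ)⁻¹)
          ((contD Q ρ)⁻¹ - 1)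
      have h8 := mul_le_mul_of_nonneg_left (h6.trans (add_le_add_left (h7.trans
        (add_le_add_left h5 _)) _)) (norm_nonneg ρ)
      have h9 := norm_nonneg (1 : Mat m)
      have h10 : 0 ≤ c * K₁ := mul_nonneg hc0 hK₁
      rw [e]
      linarith [h1.2]) hs
  refine hlim.congr fun T => ?_
  refine intervalIntegral.integral_congr fun ρ _ => ?_
  congr 1
  refine hΦ _ ((hmem _).2 ?_)
  intro k hk
  have := congrArg Complex.im hk
  simp at this
  exact (hτ.2.1 k).ne this

end Pot

end PolePart

end

/-! ### The Marchenko equation almost everywhere -/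

section

section PoleKernel

variable {m N : ℕ} {Q : ℝ → Mat m} {τ : Fin N → ℝ}

theorem memLp_two_of_integrable_of_bound {E : Type*} [NormedAddCommGroup E] {k : ℝ → E}
    (hk : Integrable k) {c : ℝ} (hc : ∀ t, ‖k t‖ ≤ c) : MemLp k 2 := by
  rw [memLp_two_iff_integrable_sq_norm hk.1]
  refine (hk.norm.const_mul c).mono (hk.1.norm.pow 2) (.of_forall fun t => ?_)
  have hc0 : 0 ≤ c := (norm_nonneg _).trans (hc t)
  rw [Real.norm_of_nonneg (by positivity), Real.norm_of_nonneg (by positivity), sq]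
  exact mul_le_mul_of_nonneg_right (hc t) (norm_nonneg _)

theorem intervalIntegrable_exp_smul {E : Type*} [NormedAddCommGroup E] [NormedSpace ℂ E]
    {S : ℝ → E} {a b : ℝ} (hS : IntervalIntegrable S volume a b) (y : ℝ) :
    IntervalIntegrable (fun ρ : ℝ => Complex.exp (Complex.I * ρ * y) • S ρ) volume a b := by
  have h2 : Continuous fun ρ : ℝ => Complex.exp (Complex.I * ρ * y) := by fun_prop
  refine hS.mono_fun (h2.aestronglyMeasurable.smul hS.aestronglyMeasurable_restrict_uIoc)
    (.of_forall fun ρ => ?_)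
  simp only
  rw [norm_smul, norm_exp_I_mul_mul, one_mul]

/-- The function on `(x, ∞)` whose Fourier transform is `exp(-iρx)` times the polar part. -/
def poleKer (τ : Fin N → ℝ) (P : Fin N → Mat m) (x t : ℝ) : Mat m :=
  ∑ k, (Complex.I * Complex.exp (-(τ k * (t - x)))) • P k

theorem norm_poleKer_le (hτ : ∀ k, 0 < τ k) (P : Fin N → Mat m) {x t : ℝ} (h : x ≤ t) :
    ‖poleKer τ P x t‖ ≤ ∑ k, ‖P k‖ := by
  refine (norm_sum_le _ _).trans (Finset.sum_le_sum fun k _ => ?_)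
  rw [norm_smul, norm_mul, Complex.norm_I, one_mul, Complex.norm_exp]
  refine mul_le_of_le_one_left (norm_nonneg _) (Real.exp_le_one_iff.2 ?_)
  have := mul_nonneg (hτ k).le (sub_nonneg.2 h)
  simpa using this

theorem integrableOn_exp_poleKer_term {t₀ : ℝ} (ht : 0 < t₀) (P : Mat m) (x r : ℝ) :
    IntegrableOn (fun t : ℝ => Complex.exp (-(Complex.I * r * t)) •
      (Complex.I * Complex.exp (-(t₀ * (t - x)))) • P) (Ioi x) ∧
    ∫ t in Ioi x, Complex.exp (-(Complex.I * r * t)) •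
      (Complex.I * Complex.exp (-(t₀ * (t - x)))) • P =
    Complex.exp (-(Complex.I * r * x)) • (r - Complex.I * t₀ : ℂ)⁻¹ • P := by
  have hre : (-(t₀ + Complex.I * r) : ℂ).re < 0 := by simpa using ht
  have e : ∀ t : ℝ, Complex.exp (-(Complex.I * r * t)) •
      (Complex.I * Complex.exp (-(t₀ * (t - x)))) • P =
      Complex.exp (-(t₀ + Complex.I * r) * t) • ((Complex.I * Complex.exp (t₀ * x)) • P) := by
    intro t
    rw [smul_smul, smul_smul]
    congr 1
    have : Complex.exp (-(t₀ * (t - x))) * Complex.exp (-(Complex.I * r * t))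
        = Complex.exp (-(t₀ + Complex.I * r) * t) * Complex.exp (t₀ * x) := by
      rw [← Complex.exp_add, ← Complex.exp_add]
      congr 1
      ring
    linear_combination Complex.I * this
  simp only [e]
  refine ⟨(integrableOn_exp_mul_complex_Ioi hre x).smul_const _, ?_⟩
  rw [integral_smul_const, integral_exp_mul_complex_Ioi hre, smul_smul, smul_smul]
  congr 1
  have h1 : (-(t₀ + Complex.I * r) : ℂ) ≠ 0 := fun h => by rw [h] at hre; simp at hre
  -- This identity explains the factor `i` in the kernel: `i/(t₀ + ir) = 1/(r - it₀)`.
  have h2 : (r - Complex.I * t₀ : ℂ) = -Complex.I * (t₀ + Complex.I * r) := by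
    linear_combination (r : ℂ) * Complex.I_sq
  have h3 : Complex.exp (-(t₀ + Complex.I * r) * x) * Complex.exp (t₀ * x)
      = Complex.exp (-(Complex.I * r * x)) := by
    rw [← Complex.exp_add]
    congr 1
    ring
  rw [h2, ← h3, mul_inv, neg_div_neg_eq, inv_neg, Complex.inv_I, neg_neg]
  ring

theorem integral_poleKer (hτ : ∀ k, 0 < τ k) (P : Fin N → Mat m) (x r : ℝ) :
    IntegrableOn (fun t : ℝ => Complex.exp (-(Complex.I * r * t)) • poleKer τ P x t) (Ioi x) ∧
    ∫ t in Ioi x, Complex.exp (-(Complex.I * r * t)) • poleKer τ P x t =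
      Complex.exp (-(Complex.I * r * x)) • polePart τ P r := by
  simp only [poleKer, polePart, Finset.smul_sum]
  refine ⟨integrable_finsetSum _ fun k _ => (integrableOn_exp_poleKer_term (hτ k) (P k) x r).1, ?_⟩
  rw [integral_finsetSum _ fun k _ => (integrableOn_exp_poleKer_term (hτ k) (P k) x r).1]
  exact Finset.sum_congr rfl fun k _ => (integrableOn_exp_poleKer_term (hτ k) (P k) x r).2

theorem integrableOn_poleKer (hτ : ∀ k, 0 < τ k) (P : Fin N → Mat m) (x : ℝ) :
    IntegrableOn (poleKer τ P x) (Ioi x) := by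
  simpa using (integral_poleKer hτ P x 0).1

/-- The kernel `K(x, ·)` with the polar part removed, extended by zero. -/
def regKer (K : ℝ → ℝ → Mat m) (τ : Fin N → ℝ) (P : Fin N → Mat m) (x : ℝ) : ℝ → Mat m :=
  (Ioi x).indicator fun t => K x t - poleKer τ P x t

theorem integrable_regKer (hτ : ∀ k, 0 < τ k) (P : Fin N → Mat m) {K : ℝ → ℝ → Mat m} {x : ℝ}
    (hK : IntegrableOn (K x) (Ioi x)) : Integrable (regKer K τ P x) :=
  (integrable_indicator_iff measurableSet_Ioi).2 (Integrable.sub hK (integrableOn_poleKer hτ P x))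

theorem memLp_regKer (hτ : ∀ k, 0 < τ k) (P : Fin N → Mat m) {K : ℝ → ℝ → Mat m} {x c : ℝ}
    (hK : IntegrableOn (K x) (Ioi x)) (hc : ∀ t, ‖K x t‖ ≤ c) : MemLp (regKer K τ P x) 2 := by
  have hc0 : 0 ≤ c := (norm_nonneg _).trans (hc 0)
  refine memLp_two_of_integrable_of_bound (integrable_regKer hτ P hK) (c := c + ∑ k, ‖P k‖)
    fun t => ?_
  by_cases ht : t ∈ Ioi x
  · rw [regKer, indicator_of_mem ht]
    exact (norm_sub_le _ _).trans (add_le_add (hc t) (norm_poleKer_le hτ P (le_of_lt ht)))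
  · rw [regKer, indicator_of_notMem ht, norm_zero]
    positivity

theorem integral_exp_smul_indicator (f : ℝ → Mat m) (g : ℝ → ℂ) (x : ℝ) :
    ∫ t, g t • (Ioi x).indicator f t = ∫ t in Ioi x, g t • f t := by
  rw [← integral_indicator measurableSet_Ioi]
  congr 1
  ext1 t
  rw [indicator_smul_apply]

theorem integrableOn_exp_smul {f : ℝ → Mat m} {s : Set ℝ} (hf : IntegrableOn f s) (r : ℝ) :
    IntegrableOn (fun t : ℝ => Complex.exp (-(Complex.I * r * t)) • f t) s := by
  have h2 : Continuous fun t : ℝ => Complex.exp (-(Complex.I * r * t)) := by fun_prop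
  refine Integrable.mono hf (h2.aestronglyMeasurable.smul hf.1) (.of_forall fun t => ?_)
  have := norm_exp_I_mul_mul (-r) t
  rw [Complex.ofReal_neg, mul_neg, neg_mul] at this
  rw [norm_smul, this, one_mul]

namespace Pot

/-- The scattering relation gives `F₋ D⁻¹ = F₊ S₊ + F₊(·,-r)`, and `F₊(x,-r)` is `e^{-irx}` plus the
Fourier integral of `K x`. The exponential cancels the subtracted identity, and the polar part is
itself a Fourier integral over `(x, ∞)`. -/
theorem exp_smul_regPart_eq (h : Pot Q) (hτ : ∀ k, 0 < τ k) (P : Fin N → Mat m)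
    {K : ℝ → ℝ → Mat m} (hK : IsKernelPlus Q K) (x : ℝ) {r : ℝ} (hr : r ≠ 0) :
    Complex.exp (-(Complex.I * r * x)) • regPart Q τ P x r =
      jostPlus Q r x * scatPlus Q r +
        ∫ t : ℝ, Complex.exp (-(Complex.I * r * t)) • regKer K τ P x t := by
  have hu := (Matrix.isUnit_iff_isUnit_det _).1 (h.isUnit_D hr)
  have h1 : Complex.exp (-(Complex.I * r * x)) •
      (modPlus (reflect Q) (-x) r * (contD Q r)⁻¹) =
      jostPlus Q r x * scatPlus Q r + jostPlus Q (-r) x := by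
    rw [← smul_mul_assoc, ← h.jostMinus_eq_smul_modPlus (by simp), h.contD_real hr,
      h.isCoeffCD_coeffCD hr x, add_mul, mul_assoc, mul_assoc, Matrix.mul_nonsing_inv _ hu,
      mul_one]
    rfl
  have h2 := hK.2.2 (-r) (by simp) x
  have e : ∀ t : ℝ, Complex.exp (Complex.I * (-r) * t) = Complex.exp (-(Complex.I * r * t)) := by
    intro t
    congr 1
    ring
  simp only [e] at h2
  have h3 := integral_poleKer hτ P x r
  rw [regPart, smul_sub, smul_sub, h1, h2, ← h3.2]
  simp only [regKer]
  rw [integral_exp_smul_indicator]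
  simp only [smul_sub]
  rw [integral_sub (integrableOn_exp_smul (hK.2.1 x) r) h3.1]
  abel

/-- The inverse Fourier transform of `exp_smul_regPart_eq` at `y`. The left side then carries the
phase `e^{ir(y-x)}` and vanishes in the limit for `y > x`; the right side yields `R(x+y)`, the
correlation of `K x` with `R`, and the regularised kernel. As `R` is merely an `L²` limit, only
almost every `y` is reached. -/
theorem ae_glm (h : Pot Q) (hτ : IsEigenvalueEnumeration Q τ) {K : ℝ → ℝ → Mat m}
    (hK : IsKernelPlus Q K) {x c : ℝ} (hc : ∀ t, ‖K x t‖ ≤ c) {W : Fin N → Mat m}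
    (hW : ∀ k, IsWeightPlus Q (τ k) (W k)) {R : ℝ → Mat m} (hR : MemLp R 2)
    (hF : IsFourierLimit (scatPlus Q) R) :
    ∀ᵐ y, x < y → R (x + y) + K x y + (∫ t, (Ioi x).indicator (K x) t * R (t + y)) +
      ∑ k, Complex.exp (-(τ k * y)) • (jostPlus Q (Complex.I * τ k) x * W k) = 0 := by
  choose Res hRes hWx using hW
  set P : Fin N → Mat m := fun k => modPlus (reflect Q) (-x) (Complex.I * τ k) * Res k with hP
  set kx := (Ioi x).indicator (K x) with hkx
  have hkx₁ : Integrable kx := (integrable_indicator_iff measurableSet_Ioi).2 (hK.2.1 x)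
  have hkx₂ : MemLp kx 2 := memLp_two_of_integrable_of_bound hkx₁ fun t =>
    (norm_indicator_le_norm_self _ _).trans (hc t)
  set V : ℝ → Mat m := fun r => ∫ t : ℝ, Complex.exp (-(Complex.I * r * t)) • regKer K τ P x t
    with hV
  obtain ⟨hV₂, hVF⟩ := isFourierLimit_of_integral (integrable_regKer hτ.2.1 P (hK.2.1 x))
    (memLp_regKer hτ.2.1 P (hK.2.1 x) hc) (S := V) (.of_forall fun ρ => rfl)
  have hS := h.memLp_scatPlus
  obtain ⟨n₁, hn₁, hc₁⟩ := exists_seq_tendsto_ae_of_isFourierLimit hS hR hF _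
    tendsto_natCast_atTop_atTop
  -- The second subsequence is extracted from the first, so both `L²` limits are attained pointwise
  -- along a common sequence.
  obtain ⟨n₂, hn₂, hc₂⟩ := exists_seq_tendsto_ae_of_isFourierLimit hV₂
    (memLp_regKer hτ.2.1 P (hK.2.1 x) hc) hVF _
    (tendsto_natCast_atTop_atTop.comp hn₁.tendsto_atTop)
  have hc₁' := (measurePreserving_add_left volume x).quasiMeasurePreserving.ae hc₁
  filter_upwards [hc₁', hc₂] with y hy₁ hy₂ hxy
  set u : ℕ → ℝ := fun i => (n₁ (n₂ i) : ℝ) with hu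
  have hu' : Tendsto u atTop atTop :=
    tendsto_natCast_atTop_atTop.comp (hn₁.tendsto_atTop.comp hn₂.tendsto_atTop)
  have l₁ : Tendsto (fun i => truncFourier (scatPlus Q) (u i) (x + y)) atTop (𝓝 (R (x + y))) :=
    hy₁.comp hn₂.tendsto_atTop
  have l₂ : Tendsto (fun i => truncFourier V (u i) y) atTop (𝓝 (regKer K τ P x y)) := hy₂
  have l₃ := ((tendstoUniformly_truncFourier_kernel_mul hkx₁ hkx₂ hS hR hF).tendsto_at y).comp hu'
  have l₀ := ((h.tendsto_integral_regPart hτ hRes (P := P) (fun k => rfl)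
    (sub_pos.2 hxy)).const_smul (1 / (2 * Real.pi) : ℂ)).comp hu'
  rw [smul_zero] at l₀
  have key : ∀ T : ℝ, (1 / (2 * Real.pi) : ℂ) • (∫ ρ in (-T)..T,
      Complex.exp (Complex.I * ρ * (y - x : ℝ)) • regPart Q τ P x ρ) =
      truncFourier (scatPlus Q) T (x + y) + truncFourier (fun ρ : ℝ =>
        (∫ t : ℝ, Complex.exp (Complex.I * ρ * t) • kx t) * scatPlus Q ρ) T y +
        truncFourier V T y := by
    intro T
    have hST := intervalIntegrable_of_memLp hS (-T) T
    have i₁ := intervalIntegrable_exp_smul hST (x + y)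
    have i₂ := intervalIntegrable_exp_smul (intervalIntegrable_fourier_kernel_mul hkx₁ hST) y
    have i₃ := intervalIntegrable_exp_smul (intervalIntegrable_of_memLp hV₂ (-T) T) y
    rw [truncFourier, truncFourier, truncFourier, ← smul_add, ← smul_add,
      ← intervalIntegral.integral_add i₁ i₂, ← intervalIntegral.integral_add (i₁.add i₂) i₃]
    congr 1
    refine intervalIntegral.integral_congr_ae ?_
    filter_upwards [Measure.ae_ne volume (0 : ℝ)] with ρ hρ _
    have e₁ := h.exp_smul_regPart_eq hτ.2.1 P hK x hρ
    have e₂ := hK.2.2 ρ (by simp) x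
    rw [← integral_exp_smul_indicator] at e₂
    have e₃ : Complex.exp (Complex.I * ρ * (y - x : ℝ)) =
        Complex.exp (Complex.I * ρ * y) * Complex.exp (-(Complex.I * ρ * x)) := by
      rw [← Complex.exp_add]
      push_cast
      congr 1
      ring
    have e₄ : Complex.exp (Complex.I * ρ * (x + y : ℝ)) =
        Complex.exp (Complex.I * ρ * y) * Complex.exp (Complex.I * ρ * x) := by
      rw [← Complex.exp_add]
      push_cast
      congr 1
      ring
    rw [e₃, e₄, mul_smul, e₁, e₂, add_mul, smul_mul_assoc, one_mul, mul_smul, ← smul_add,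
      ← smul_add]
  have hlim := tendsto_nhds_unique l₀ (((l₁.add l₃).add l₂).congr fun i => (key (u i)).symm)
  -- By `F₋ Res = i F₊ W` the factor `i` occurs twice, and the resulting sign turns the subtracted
  -- polar kernel into the added sum over the weights.
  have hker : regKer K τ P x y = K x y +
      ∑ k, Complex.exp (-(τ k * y)) • (jostPlus Q (Complex.I * τ k) x * W k) := by
    rw [regKer, indicator_of_mem (mem_Ioi.2 hxy), sub_eq_add_neg, poleKer, ← Finset.sum_neg_distrib]
    congr 1
    refine Finset.sum_congr rfl fun k _ => ?_
    have e₁ := hWx k x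
    rw [h.jostMinus_eq_smul_modPlus (by simpa using (hτ.2.1 k).le), smul_mul_assoc] at e₁
    have e₂ : Complex.exp (-(Complex.I * (Complex.I * τ k) * x)) = Complex.exp (τ k * x) := by
      congr 1
      linear_combination (-(τ k : ℂ) * x) * Complex.I_sq
    have e₃ : Complex.exp (-(τ k * (y - x))) =
        Complex.exp (-(τ k * y)) * Complex.exp (τ k * x) := by
      rw [← Complex.exp_add]
      congr 1
      ring
    rw [e₂] at e₁
    rw [e₃, ← mul_assoc, mul_smul, e₁, smul_smul, ← neg_smul]
    congr 1
    linear_combination (-Complex.exp (-(τ k * y))) * Complex.I_sq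
  rw [hlim, hker]
  abel

end Pot

end PoleKernel

end

/-! ### Continuous representative and the equation for every argument -/

section

section Marchenko

variable {m N : ℕ} {Q : ℝ → Mat m} {τ : Fin N → ℝ}

theorem isL2Fourier_one_iff {S R : ℝ → Mat m} :
    IsL2Fourier 1 S R ↔ MemLp S 2 ∧ MemLp R 2 ∧ IsFourierLimit S R := by
  simp [IsL2Fourier, IsFourierLimit]

/-- The kernel of the transformation operator is determined by the Jost solution. -/
theorem IsKernelPlus.eq_of_lt {K K' : ℝ → ℝ → Mat m} (hK : IsKernelPlus Q K)
    (hK' : IsKernelPlus Q K') {x t : ℝ} (ht : x < t) : K x t = K' x t := by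
  set d := (Ioi x).indicator fun t => K x t - K' x t with hd
  have hdi : Integrable d := (integrable_indicator_iff measurableSet_Ioi).2
    (Integrable.sub (hK.2.1 x) (hK'.2.1 x))
  have hsub : ∀ {K : ℝ → ℝ → Mat m}, IsKernelPlus Q K → ContinuousOn (K x) (Ioi x) := by
    intro K hK
    exact hK.1.comp (f := fun t : ℝ => (x, t)) (by fun_prop) fun t ht => (mem_Ioi.1 ht).le
  -- Both kernels represent the same `F₊` for real `ρ`, so the Fourier transform of their difference
  -- is zero; inversion at a point of continuity concludes.
  have hzero : FourierTransform.fourier d = 0 := by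
    ext1 w
    have e : ∀ t : ℝ, Complex.exp ((-2 * Real.pi * inner ℝ t w : ℝ) * Complex.I) =
        Complex.exp (Complex.I * ((-2 * Real.pi * w : ℝ) : ℂ) * t) := by
      intro t
      congr 1
      simp only [RCLike.inner_apply, conj_trivial]
      push_cast
      ring
    have hi : ∀ {K : ℝ → ℝ → Mat m}, IsKernelPlus Q K → IntegrableOn (fun t : ℝ =>
        Complex.exp (Complex.I * ((-2 * Real.pi * w : ℝ) : ℂ) * t) • K x t) (Ioi x) := by
      intro K hK
      have := integrableOn_exp_smul (hK.2.1 x) (2 * Real.pi * w)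
      refine this.congr_fun (fun t _ => ?_) measurableSet_Ioi
      simp only
      congr 2
      push_cast
      ring
    have h1 := (hK.2.2 ((-2 * Real.pi * w : ℝ) : ℂ) (by simp) x).symm.trans
      (hK'.2.2 ((-2 * Real.pi * w : ℝ) : ℂ) (by simp) x)
    rw [Real.fourier_eq']
    simp only [e]
    rw [hd, integral_exp_smul_indicator]
    simp only [smul_sub]
    rw [integral_sub (hi hK) (hi hK'), add_left_cancel h1, sub_self]
    rfl
  have hcont : ContinuousAt d t := by
    refine (((hsub hK).sub (hsub hK')).continuousAt (Ioi_mem_nhds ht)).congr ?_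
    filter_upwards [Ioi_mem_nhds ht] with s hs
    rw [hd, indicator_of_mem hs]
    rfl
  have h1 := hdi.fourierInv_fourier_eq (by rw [hzero]; exact integrable_zero _ _ _) hcont
  have h2 : d t = 0 := by
    rw [← h1, hzero, Real.fourierInv_eq']
    simp
  rw [hd, indicator_of_mem (mem_Ioi.2 ht)] at h2
  exact sub_eq_zero.1 h2

namespace Pot

theorem isWeightPlus_weightPlus (h : Pot Q) {t : ℝ} (ht : 0 < t) :
    IsWeightPlus Q t (weightPlus Q t) :=
  Classical.epsilon_spec (h.existsUnique_isWeightPlus ht).exists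

/-- The part of the Marchenko equation complementary to `R(x + y)`. -/
def glmRest (Q : ℝ → Mat m) (τ : Fin N → ℝ) (K : ℝ → ℝ → Mat m) (R : ℝ → Mat m) (x y : ℝ) :
    Mat m :=
  K x y + (∫ t, (Ioi x).indicator (K x) t * R (t + y)) +
    ∑ k, Complex.exp (-(τ k * y)) • (jostPlus Q (Complex.I * τ k) x * weightPlus Q (τ k))

/-- The only term that involves `R` is a correlation, which is continuous for square-integrable `R`.
-/
theorem continuousOn_glmRest (h : Pot Q) {K : ℝ → ℝ → Mat m} (hK : IsKernelPlus Q K) {x c : ℝ}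
    (hc : ∀ t, ‖K x t‖ ≤ c) {R : ℝ → Mat m} (hR : MemLp R 2)
    (hF : IsFourierLimit (scatPlus Q) R) : ContinuousOn (glmRest Q τ K R x) (Ioi x) := by
  have hkx₁ : Integrable ((Ioi x).indicator (K x)) :=
    (integrable_indicator_iff measurableSet_Ioi).2 (hK.2.1 x)
  have hkx₂ : MemLp ((Ioi x).indicator (K x)) 2 :=
    memLp_two_of_integrable_of_bound hkx₁ fun t => (norm_indicator_le_norm_self _ _).trans (hc t)
  refine ContinuousOn.add (ContinuousOn.add ?_ ?_) ?_
  · exact hK.1.comp (f := fun t : ℝ => (x, t)) (by fun_prop) fun t ht => (mem_Ioi.1 ht).le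
  · exact (continuous_integral_mul_comp_add hkx₁ hkx₂ h.memLp_scatPlus hR hF).continuousOn
  · exact Continuous.continuousOn (by fun_prop)

theorem ae_eq_neg_glmRest (h : Pot Q) (hτ : IsEigenvalueEnumeration Q τ) {K : ℝ → ℝ → Mat m}
    (hK : IsKernelPlus Q K) {x c : ℝ} (hc : ∀ t, ‖K x t‖ ≤ c) {R : ℝ → Mat m} (hR : MemLp R 2)
    (hF : IsFourierLimit (scatPlus Q) R) :
    ∀ᵐ y, x < y → R (x + y) = -glmRest Q τ K R x y := by
  filter_upwards [h.ae_glm hτ hK hc (fun k => h.isWeightPlus_weightPlus (hτ.2.1 k)) hR hF]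
    with y hy hxy
  have := hy hxy
  rw [eq_neg_iff_add_eq_zero, glmRest, ← this]
  abel

/-- The equation expresses `R(x+y)` almost everywhere on `y > x` through a continuous function of
`y`. With `x = w/2` and `y = z - w/2` the condition becomes `z > w`, and since `w` is arbitrary the
whole line is covered. -/
theorem existsUnique_isRPlus (h : Pot Q) : ∃! R, IsRPlus Q R := by
  obtain ⟨N, τ, hτ⟩ := h.exists_isEigenvalueEnumeration
  obtain ⟨K, hK, -, hc⟩ := h.exists_isKernelPlus
  choose c hc using hc
  have hS := h.memLp_scatPlus
  obtain ⟨R, hR, hF⟩ := exists_isFourierLimit hS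
  obtain ⟨R', hR'c, hRR'⟩ := exists_continuous_of_ae_eq_on_Ioi (R := R)
    (g := fun w z => -glmRest Q τ K R (w / 2) (z - w / 2))
    (fun w => ((h.continuousOn_glmRest hK (hc (w / 2)) hR hF).comp (f := fun z => z - w / 2)
      (by fun_prop) fun z hz => by
        have : w < z := hz
        simp only [mem_Ioi]
        linarith).neg)
    (fun w => by
      have := (measurePreserving_sub_right volume (w / 2)).quasiMeasurePreserving.ae
        (h.ae_eq_neg_glmRest hτ hK (hc (w / 2)) hR hF)
      filter_upwards [this] with z hz hwz
      rw [← hz (by linarith)]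
      congr 1
      ring)
  have hR' : MemLp R' 2 := (memLp_congr_ae hRR').1 hR
  refine ⟨R', ⟨hR'c, isL2Fourier_one_iff.2 ⟨hS, hR', hF.congr (.of_forall fun _ => rfl) hRR'⟩⟩, ?_⟩
  rintro R'' ⟨hc'', hF''⟩
  obtain ⟨-, hR'', hF''⟩ := isL2Fourier_one_iff.1 hF''
  exact (Continuous.ae_eq_iff_eq volume hc'' hR'c).1
    ((hF''.ae_eq hS hR'' hR hF).trans hRR')

theorem isRPlus_RPlus (h : Pot Q) : IsRPlus Q (RPlus Q) :=
  Classical.epsilon_spec h.existsUnique_isRPlus.exists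

/-- Both sides are continuous on `y > x`, so almost everywhere becomes everywhere. -/
theorem RPlus_add_glmRest (h : Pot Q) (hτ : IsEigenvalueEnumeration Q τ) {K : ℝ → ℝ → Mat m}
    (hK : IsKernelPlus Q K) {x c : ℝ} (hc : ∀ t, ‖K x t‖ ≤ c) {y : ℝ} (hxy : x < y) :
    RPlus Q (x + y) + glmRest Q τ K (RPlus Q) x y = 0 := by
  obtain ⟨hRc, hF⟩ := h.isRPlus_RPlus
  obtain ⟨-, hR, hF⟩ := isL2Fourier_one_iff.1 hF
  have : EqOn (fun y => RPlus Q (x + y)) (fun y => -glmRest Q τ K (RPlus Q) x y) (Ioi x) := by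
    refine Measure.eqOn_open_of_ae_eq (μ := volume) ?_ isOpen_Ioi
      (Continuous.continuousOn (by fun_prop)) (h.continuousOn_glmRest hK hc hR hF).neg
    rw [Filter.EventuallyEq, ae_restrict_iff' measurableSet_Ioi]
    exact h.ae_eq_neg_glmRest hτ hK hc hR hF
  rw [show RPlus Q (x + y) = -glmRest Q τ K (RPlus Q) x y from this hxy, neg_add_cancel]

theorem integrableOn_exp_neg_smul {f : ℝ → Mat m} {x : ℝ} (hf : IntegrableOn f (Ioi x)) {t₀ : ℝ}
    (ht : 0 < t₀) : IntegrableOn (fun t : ℝ => Complex.exp (-(t₀ * t)) • f t) (Ioi x) := by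
  have h2 : Continuous fun t : ℝ => Complex.exp (-(t₀ * t)) := by fun_prop
  refine Integrable.mono (Integrable.const_mul (Integrable.norm hf) (Real.exp (-(t₀ * x))))
    (h2.aestronglyMeasurable.smul hf.1) ?_
  rw [ae_restrict_iff' measurableSet_Ioi]
  refine .of_forall fun t hxt => ?_
  have : x < t := hxt
  rw [norm_smul, Real.norm_of_nonneg (by positivity), Complex.norm_exp]
  refine mul_le_mul_of_nonneg_right (Real.exp_le_exp.2 ?_) (norm_nonneg _)
  have := mul_le_mul_of_nonneg_left this.le ht.le
  simpa using this

theorem MPlus_eq (z : ℝ) : MPlus Q τ z = RPlus Q z +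
    ∑ k, Complex.exp (-(τ k * z)) • weightPlus Q (τ k) := by
  rw [MPlus]
  congr 1
  refine Finset.sum_congr rfl fun k _ => ?_
  rw [← Complex.coe_smul]
  push_cast
  rfl

theorem mul_MPlus_eq (A : Mat m) (t y : ℝ) : A * MPlus Q τ (t + y) = A * RPlus Q (t + y) +
    ∑ k, Complex.exp (-(τ k * y)) • ((Complex.exp (-(τ k * t)) • A) * weightPlus Q (τ k)) := by
  rw [MPlus_eq, mul_add, Finset.mul_sum]
  congr 1
  refine Finset.sum_congr rfl fun k _ => ?_
  rw [mul_smul_comm, smul_mul_assoc, smul_smul, ← Complex.exp_add]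
  congr 2
  push_cast
  ring

/-- Expanding `F₊(x,iτ)` by its kernel splits each weight term into the exponential part of
`M₊(x+y)` and the exponential part of `M₊(t+y)` under the integral. -/
theorem exp_smul_jostPlus_mul {K : ℝ → ℝ → Mat m} (hK : IsKernelPlus Q K) {t₀ : ℝ} (ht : 0 < t₀)
    (x y : ℝ) (W : Mat m) :
    Complex.exp (-(t₀ * y)) • (jostPlus Q (Complex.I * t₀) x * W) =
      Complex.exp (-(t₀ * (x + y : ℝ))) • W +
      Complex.exp (-(t₀ * y)) • ((∫ t : ℝ in Ioi x, Complex.exp (-(t₀ * t)) • K x t) * W) := by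
  have e : ∀ t : ℝ, Complex.exp (Complex.I * (Complex.I * t₀) * t) = Complex.exp (-(t₀ * t)) := by
    intro t
    congr 1
    linear_combination (t₀ : ℂ) * t * Complex.I_sq
  have hj := hK.2.2 (Complex.I * t₀) (by simpa using ht.le) x
  simp only [e] at hj
  rw [hj, add_mul, smul_add, smul_mul_assoc, one_mul, smul_smul, ← Complex.exp_add]
  congr 3
  push_cast
  ring

theorem integral_mul_MPlus (hτ : ∀ k, 0 < τ k) {f : ℝ → Mat m} {x y : ℝ}
    (hf : IntegrableOn f (Ioi x)) (hfR : IntegrableOn (fun t => f t * RPlus Q (t + y)) (Ioi x)) :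
    IntegrableOn (fun t => f t * MPlus Q τ (t + y)) (Ioi x) ∧
    ∫ t in Ioi x, f t * MPlus Q τ (t + y) = (∫ t in Ioi x, f t * RPlus Q (t + y)) +
      ∑ k, Complex.exp (-(τ k * y)) • ((∫ t : ℝ in Ioi x, Complex.exp (-(τ k * t)) • f t) *
        weightPlus Q (τ k)) := by
  have hi₃ : ∀ k, IntegrableOn (fun t : ℝ => Complex.exp (-(τ k * y)) •
      ((Complex.exp (-(τ k * t)) • f t) * weightPlus Q (τ k))) (Ioi x) := fun k =>
    ((integrableOn_exp_neg_smul hf (hτ k)).mul_const _).fun_smul _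
  have hi₄ : IntegrableOn (fun t : ℝ => ∑ k, Complex.exp (-(τ k * y)) •
      ((Complex.exp (-(τ k * t)) • f t) * weightPlus Q (τ k))) (Ioi x) :=
    integrable_finsetSum _ fun k _ => hi₃ k
  simp only [mul_MPlus_eq]
  refine ⟨hfR.add hi₄, ?_⟩
  rw [integral_add hfR hi₄, integral_finsetSum _ fun k _ => hi₃ k]
  congr 1
  refine Finset.sum_congr rfl fun k _ => ?_
  rw [integral_smul, integral_mul_const_of_integrable (integrableOn_exp_neg_smul hf (hτ k))]

/-- A bounded integrable kernel is square integrable, so its product with a translate of `R₊` is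
integrable and the integral splits. -/
theorem glm_of_bounded (h : Pot Q) (hτ : IsEigenvalueEnumeration Q τ) {K : ℝ → ℝ → Mat m}
    (hK : IsKernelPlus Q K) {x c : ℝ} (hc : ∀ t, ‖K x t‖ ≤ c) {y : ℝ} (hxy : x < y) :
    IntegrableOn (fun t => K x t * MPlus Q τ (t + y)) (Ioi x) ∧
      MPlus Q τ (x + y) + K x y + ∫ t in Ioi x, K x t * MPlus Q τ (t + y) = 0 := by
  obtain ⟨-, hF⟩ := h.isRPlus_RPlus
  obtain ⟨-, hR, -⟩ := isL2Fourier_one_iff.1 hF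
  have hglm := h.RPlus_add_glmRest hτ hK hc hxy
  have hkx₁ : Integrable ((Ioi x).indicator (K x)) :=
    (integrable_indicator_iff measurableSet_Ioi).2 (hK.2.1 x)
  have hkx₂ : MemLp ((Ioi x).indicator (K x)) 2 :=
    memLp_two_of_integrable_of_bound hkx₁ fun t => (norm_indicator_le_norm_self _ _).trans (hc t)
  have e : ∀ t, (Ioi x).indicator (K x) t * RPlus Q (t + y) =
      (Ioi x).indicator (fun t => K x t * RPlus Q (t + y)) t := fun t => by
    by_cases ht : t ∈ Ioi x <;> simp [ht]
  have hi₁ : IntegrableOn (fun t => K x t * RPlus Q (t + y)) (Ioi x) :=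
    (integrable_indicator_iff measurableSet_Ioi).1
      ((integrable_mul_comp_add hkx₂ hR y).congr (.of_forall e))
  obtain ⟨h₁, h₂⟩ := integral_mul_MPlus (τ := τ) hτ.2.1 (hK.2.1 x) hi₁
  refine ⟨h₁, ?_⟩
  simp only [glmRest, e, exp_smul_jostPlus_mul hK (hτ.2.1 _), Finset.sum_add_distrib] at hglm
  rw [integral_indicator measurableSet_Ioi] at hglm
  rw [h₂, MPlus_eq, ← hglm]
  abel

/-- An arbitrary kernel agrees for `t > x` with the constructed bounded one, and the equation uses
only these values. -/
theorem glm_plus (h : Pot Q) (hτ : IsEigenvalueEnumeration Q τ) {K : ℝ → ℝ → Mat m}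
    (hK : IsKernelPlus Q K) {x y : ℝ} (hxy : x < y) :
    IntegrableOn (fun t => K x t * MPlus Q τ (t + y)) (Ioi x) ∧
      MPlus Q τ (x + y) + K x y + ∫ t in Ioi x, K x t * MPlus Q τ (t + y) = 0 := by
  obtain ⟨K', hK', -, hc⟩ := h.exists_isKernelPlus
  obtain ⟨c, hc⟩ := hc x
  have e : EqOn (fun t => K x t * MPlus Q τ (t + y)) (fun t => K' x t * MPlus Q τ (t + y))
      (Ioi x) := fun t ht => by
    simp only [hK.eq_of_lt hK' ht]
  rw [integrableOn_congr_fun e measurableSet_Ioi, setIntegral_congr_fun measurableSet_Ioi e,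
    hK.eq_of_lt hK' hxy]
  exact h.glm_of_bounded hτ hK' hc hxy

end Pot

end Marchenko

end

/-! ### Reflection: the equation at the left end -/

section

section Reflection

variable {m N : ℕ} {Q : ℝ → Mat m} {τ : Fin N → ℝ}

theorem integrableOn_Iio_iff {E : Type*} [NormedAddCommGroup E] {f : ℝ → E} {x : ℝ} :
    IntegrableOn f (Iio x) ↔ IntegrableOn (fun t => f (-t)) (Ioi (-x)) := by
  have h := (Measure.measurePreserving_neg (volume : Measure ℝ)).integrableOn_comp_preimage
    (MeasurableEquiv.neg ℝ).measurableEmbedding (f := f) (s := Iio x)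
  rw [← h]
  simp [Function.comp_def]

theorem integral_Iio_eq {E : Type*} [NormedAddCommGroup E] [NormedSpace ℝ E] (f : ℝ → E) (x : ℝ) :
    ∫ t in Iio x, f t = ∫ t in Ioi (-x), f (-t) := by
  rw [integral_comp_neg_Ioi, neg_neg, integral_Iic_eq_integral_Iio]

theorem IsSolution.comp_neg {lam : ℂ} {y : ℝ → Fin m → ℂ} (h : IsSolution Q lam y) :
    IsSolution (reflect Q) lam (fun x => y (-x)) := by
  refine ⟨h.1.comp differentiable_neg, fun a b => ?_⟩
  rw [deriv_comp_neg, deriv_comp_neg]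
  have h1 := intervalIntegral.integral_comp_neg (a := a) (b := b)
    (fun t => Q t *ᵥ y t - lam • y t)
  rw [← h.2] at h1
  rw [h1]
  abel

theorem IsEigenvalue.reflect {lam : ℂ} (h : IsEigenvalue Q lam) :
    IsEigenvalue (reflect Q) lam := by
  obtain ⟨y, hy, hy0, hy2⟩ := h
  refine ⟨_, hy.comp_neg, fun h0 => hy0 ?_,
    hy2.comp_measurePreserving (Measure.measurePreserving_neg volume)⟩
  ext1 x
  simpa using congrFun h0 (-x)

theorem IsEigenvalueEnumeration.reflect (h : IsEigenvalueEnumeration Q τ) :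
    IsEigenvalueEnumeration (reflect Q) τ := by
  refine ⟨h.1, h.2.1, ?_⟩
  rw [← h.2.2]
  ext lam
  exact ⟨fun h' => by simpa [reflect_reflect] using h'.reflect, fun h' => h'.reflect⟩

theorem isKernelMinus_iff (h : Pot Q) {K : ℝ → ℝ → Mat m} :
    IsKernelMinus Q K ↔ IsKernelPlus (reflect Q) (fun x t => K (-x) (-t)) := by
  refine and_congr ?_ (and_congr ?_ ?_)
  · constructor
    · intro h'
      exact h'.comp (f := fun p : ℝ × ℝ => (-p.1, -p.2)) (by fun_prop) fun p hp =>
        neg_le_neg (show p.1 ≤ p.2 from hp)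
    · intro h'
      have := h'.comp (f := fun p : ℝ × ℝ => (-p.1, -p.2)) (s := {p : ℝ × ℝ | p.2 ≤ p.1})
        (by fun_prop) fun p hp => neg_le_neg (show p.2 ≤ p.1 from hp)
      simpa [Function.comp_def] using this
  · simp only [integrableOn_Iio_iff]
    exact neg_surjective.forall.trans (by simp)
  · refine forall_congr' fun ρ => forall_congr' fun hρ => ?_
    rw [neg_surjective.forall]
    refine forall_congr' fun x => ?_
    rw [h.jostMinus_eq hρ, neg_neg, integral_Iio_eq]
    simp

theorem eLpNorm_comp_neg {E : Type*} [NormedAddCommGroup E] (f : ℝ → E) :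
    eLpNorm (fun x => f (-x)) 2 volume = eLpNorm f 2 volume := by
  have h := (MeasurableEquiv.neg ℝ).measurableEmbedding.eLpNorm_map_measure
    (g := f) (p := 2) (μ := volume)
  have e : Measure.map (MeasurableEquiv.neg ℝ) (volume : Measure ℝ) = volume :=
    (Measure.measurePreserving_neg volume).map_eq
  rw [e] at h
  exact h.symm

theorem memLp_comp_neg {E : Type*} [NormedAddCommGroup E] {f : ℝ → E} (hf : MemLp f 2) :
    MemLp (fun x => f (-x)) 2 :=
  hf.comp_measurePreserving (Measure.measurePreserving_neg volume)

theorem isL2Fourier_neg_one_iff {S R : ℝ → Mat m} :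
    IsL2Fourier (-1) S R ↔ IsL2Fourier 1 S (fun x => R (-x)) := by
  refine and_congr Iff.rfl (and_congr
    ⟨memLp_comp_neg, fun h => by simpa using memLp_comp_neg h⟩ ?_)
  refine iff_of_eq (congrArg (fun f => Tendsto f atTop (𝓝 0)) (funext fun T => ?_))
  rw [← eLpNorm_comp_neg]
  simp

theorem IsL2Fourier.congr {σ : ℝ} {S S' R : ℝ → Mat m} (h : IsL2Fourier σ S R)
    (hS : S =ᵐ[volume] S') : IsL2Fourier σ S' R := by
  refine ⟨(memLp_congr_ae hS).1 h.1, h.2.1, h.2.2.congr fun T => ?_⟩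
  congr 1
  ext1 x
  congr 2
  refine intervalIntegral.integral_congr_ae ?_
  filter_upwards [hS] with ρ hρ _
  rw [hρ]

theorem isRMinus_iff (h : Pot Q) {R : ℝ → Mat m} :
    IsRMinus Q R ↔ IsRPlus (reflect Q) (fun x => R (-x)) := by
  -- At `r = 0` the coefficients are not determined by their defining relations, so the scattering
  -- matrices are compared only off the origin; a null set does not affect the Fourier transform.
  have hS : ∀ r : ℝ, r ≠ 0 → scatMinus Q r = scatPlus (reflect Q) r := by
    intro r hr
    rw [scatMinus, scatPlus, h.coeffAB_eq hr]
    rfl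
  have hS' : scatMinus Q =ᵐ[volume] scatPlus (reflect Q) := by
    filter_upwards [Measure.ae_ne volume (0 : ℝ)] with r hr
    exact hS r hr
  refine and_congr ⟨fun hc => hc.comp continuous_neg, fun hc => ?_⟩ ?_
  · simpa [Function.comp_def] using hc.comp continuous_neg
  · rw [isL2Fourier_neg_one_iff]
    exact ⟨fun h' => h'.congr hS', fun h' => h'.congr hS'.symm⟩

theorem Pot.existsUnique_isRMinus (h : Pot Q) : ∃! R, IsRMinus Q R := by
  obtain ⟨R, hR, hu⟩ := h.refl.existsUnique_isRPlus
  refine ⟨fun x => R (-x), (isRMinus_iff h).2 (by simpa using hR), fun R' hR' => ?_⟩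
  rw [← hu _ ((isRMinus_iff h).1 hR')]
  simp

theorem Pot.RMinus_eq (h : Pot Q) (x : ℝ) : RMinus Q x = RPlus (reflect Q) (-x) := by
  have h0 : IsRMinus Q (RMinus Q) := Classical.epsilon_spec h.existsUnique_isRMinus.exists
  have h1 := (isRMinus_iff h).1 h0
  have := congrFun (h.refl.existsUnique_isRPlus.unique h1 h.refl.isRPlus_RPlus) (-x)
  simpa using this

theorem Pot.MMinus_eq (h : Pot Q) (hτ : ∀ k, 0 < τ k) (x : ℝ) :
    MMinus Q τ x = MPlus (reflect Q) τ (-x) := by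
  rw [MMinus, MPlus, h.RMinus_eq]
  congr 1
  refine Finset.sum_congr rfl fun k _ => ?_
  rw [h.weightMinus_eq (hτ k), mul_neg, neg_neg]

theorem Pot.glm_minus (h : Pot Q) (hτ : IsEigenvalueEnumeration Q τ) {K : ℝ → ℝ → Mat m}
    (hK : IsKernelMinus Q K) {x y : ℝ} (hxy : y < x) :
    IntegrableOn (fun t => K x t * MMinus Q τ (t + y)) (Iio x) ∧
      MMinus Q τ (x + y) + K x y + ∫ t in Iio x, K x t * MMinus Q τ (t + y) = 0 := by
  have := h.refl.glm_plus hτ.reflect ((isKernelMinus_iff h).1 hK) (neg_lt_neg hxy)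
  simp only [neg_neg, ← neg_add] at this
  simpa only [h.MMinus_eq hτ.2.1, integrableOn_Iio_iff, integral_Iio_eq, neg_add, neg_neg]
    using this

end Reflection

end

end

end MatrixScattering

theorem mainTheorem3 {m : ℕ} (Q : ℝ → MatrixScattering.Mat m)
    (hQ_herm : ∀ᵐ x, (Q x).IsHermitian)
    (hQ_int : Integrable (fun x : ℝ => (1 + |x|) • Q x)) :
    -- the Jost solutions are well defined
    (∀ ρ : ℂ, 0 ≤ ρ.im →
      (∃! F, MatrixScattering.IsJostPlus Q ρ F) ∧ (∃! F, MatrixScattering.IsJostMinus Q ρ F)) ∧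
    -- the coefficients are well defined, `A` and `D` are invertible and are continued to the
    -- upper half-plane
    (∀ ρ : ℝ, ρ ≠ 0 →
      (∃! P, MatrixScattering.IsCoeffAB Q ρ P) ∧ (∃! P, MatrixScattering.IsCoeffCD Q ρ P) ∧
      IsUnit (MatrixScattering.coeffAB Q ρ).1 ∧ IsUnit (MatrixScattering.coeffCD Q ρ).2 ∧
      MatrixScattering.contA Q ρ = (MatrixScattering.coeffAB Q ρ).1 ∧
      MatrixScattering.contD Q ρ = (MatrixScattering.coeffCD Q ρ).2) ∧
    (ContinuousOn (MatrixScattering.contA Q) {ρ : ℂ | 0 ≤ ρ.im ∧ ρ ≠ 0} ∧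
      DifferentiableOn ℂ (MatrixScattering.contA Q) {ρ : ℂ | 0 < ρ.im} ∧
      ContinuousOn (MatrixScattering.contD Q) {ρ : ℂ | 0 ≤ ρ.im ∧ ρ ≠ 0} ∧
      DifferentiableOn ℂ (MatrixScattering.contD Q) {ρ : ℂ | 0 < ρ.im}) ∧
    -- there are finitely many eigenvalues, all negative, and the weight matrices are well defined
    (∃ (N : ℕ) (τ : Fin N → ℝ), MatrixScattering.IsEigenvalueEnumeration Q τ) ∧
    (∀ τ : ℝ, 0 < τ → MatrixScattering.IsEigenvalue Q ((Complex.I * τ) ^ 2) →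
      (∃! W, MatrixScattering.IsWeightPlus Q τ W) ∧
      (∃! W, MatrixScattering.IsWeightMinus Q τ W)) ∧
    -- the Fourier transforms of the scattering matrices are well defined
    (∃! R, MatrixScattering.IsRPlus Q R) ∧ (∃! R, MatrixScattering.IsRMinus Q R) ∧
    -- the kernels of the transformation operators exist
    (∃ K, MatrixScattering.IsKernelPlus Q K) ∧ (∃ K, MatrixScattering.IsKernelMinus Q K) ∧
    -- the Gelfand-Levitan-Marchenko equations
    ∀ (N : ℕ) (τ : Fin N → ℝ), MatrixScattering.IsEigenvalueEnumeration Q τ →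
      (∀ K, MatrixScattering.IsKernelPlus Q K → ∀ x y : ℝ, x < y →
        IntegrableOn (fun t => K x t * MatrixScattering.MPlus Q τ (t + y)) (Ioi x) ∧
        MatrixScattering.MPlus Q τ (x + y) + K x y +
          ∫ t in Ioi x, K x t * MatrixScattering.MPlus Q τ (t + y) = 0) ∧
      (∀ K, MatrixScattering.IsKernelMinus Q K → ∀ x y : ℝ, y < x →
        IntegrableOn (fun t => K x t * MatrixScattering.MMinus Q τ (t + y)) (Iio x) ∧
        MatrixScattering.MMinus Q τ (x + y) + K x y +
          ∫ t in Iio x, K x t * MatrixScattering.MMinus Q τ (t + y) = 0) := by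
  have h : MatrixScattering.Pot Q := ⟨hQ_herm, hQ_int⟩
  have hK := h.exists_isKernelPlus
  have hK' := h.refl.exists_isKernelPlus
  refine ⟨fun ρ hρ => ⟨h.existsUnique_jostPlus hρ, h.existsUnique_jostMinus hρ⟩,
    fun ρ hρ => ⟨h.existsUnique_isCoeffAB hρ, h.existsUnique_isCoeffCD hρ, h.isUnit_A hρ,
      h.isUnit_D hρ, h.contA_real hρ, h.contD_real hρ⟩,
    ⟨h.continuousOn_contA, h.differentiableOn_contA, h.continuousOn_contD,
      h.differentiableOn_contD⟩,
    h.exists_isEigenvalueEnumeration,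
    fun τ hτ _ => ⟨h.existsUnique_isWeightPlus hτ, h.existsUnique_isWeightMinus hτ⟩,
    h.existsUnique_isRPlus, h.existsUnique_isRMinus, hK.imp fun _ hK => hK.1, ?_,
    fun N τ hτ => ⟨fun K hK x y hxy => h.glm_plus hτ hK hxy,
      fun K hK x y hxy => h.glm_minus hτ hK hxy⟩⟩
  -- The kernel at the left end is the reflection in both variables of the kernel for the reflected
  -- potential.
  obtain ⟨K, hK, -⟩ := hK'
  exact ⟨fun x t => K (-x) (-t), (MatrixScattering.isKernelMinus_iff h).2 (by simpa using hK)⟩
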